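/- Let $\Omega\subset\mathbb R^2$ be a bounded domain with polygonal boundary which is the interior of its closure, and let $\sigma>0$. There is a constant $C$, depending only on $\Omega$ and $\sigma$, such that the following holds. Let $\mathcal T_h$ be a conforming triangulation of $\overline\Omega$ into triangles, each of which has at least one vertex in $\Omega$ and contains a disc of radius $\sigma h$, where $h$ is the largest diameter of a triangle. Let $\mathcal N_0$ and $\partial\mathcal N$ be the sets of vertices in $\Omega$ and on $\partial\Omega$, and let $\varphi_i$ be the piecewise linear nodal basis function of the vertex $i$. Put $S_h=\{v\in H^1_0(\Omega): v|_T\in\mathcal P_1(T)\ \forall T\in\mathcal T_h\}$; let $B_h\subset H_0^1(\Omega)$ be the space of functions that are on each triangle $T$ a multiple of the cubic bubble function (the product of the three barycentric coordinates of $T$); put $W_h=S_h\oplus B_h$ and $\mathbf V_h=[S_h]^2$. For $j\in\partial\mathcal N$ and $i\in\mathcal N_0$ sharing an edge let $A_{j,i}\ge 0$ be coefficients such that, for each $j\in\partial\mathcal N$, the sum of $A_{j,i}$ over all $i\in\mathcal N_0$ sharing an edge with $j$ is $1$. Let $M^1_h$ be the span of the functions $\phi_i=\varphi_i+\sum_{j}A_{j,i}\varphi_j$,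 $i\in\mathcal N_0$, where $j$ runs over the vertices in $\partial\mathcal N$ sharing an edge with $i$. Put $\mathbf M^1_h=[M_h^1]^2$ and $$b(\psi,v;\eta)=\int_\Omega(\psi-\nabla v)\cdot\eta\,dx .$$ Then there exist a bounded linear projector $\mathbf Q_h$ of $[H^1_0(\Omega)]^2$ onto $\mathbf V_h$ and a bounded linear projector $R_h$ of $H^1_0(\Omega)$ onto $W_h$, both with operator norm at most $C$ in the $H^1$ norm, such that $$b(\mathbf Q_h\psi,R_hv;\eta_h)=b(\psi,v;\eta_h)\qquad\text{for all }\psi\in[H_0^1(\Omega)]^2,\ v\in H^1_0(\Omega),\ \eta_h\in\mathbf M^1_h .$$ Here $\mathbf Q_h$ is the $M^1_h$-orthogonal projection: $\int_\Omega(\psi_k-(\mathbf Q_h\psi)_k)\,\eta\,dx=0$ for all $\eta\in M^1_h$ and $k=1,2$. Moreover, let $P_h$ be the $L^2(\Omega)$-orthogonal projection onto $S_h$, and let $Z_h:H_0^1(\Omega)\to B_h$ be the map with $\int_T(v-Z_hv)\,dx=0$ for all $T\in\mathcal T_h$. Both are bounded linear operators on $H^1_0(\Omega)$, and the (in general not idempotent)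 linear operator $\tilde R_h=P_h+Z_h(I-P_h)$ maps $H^1_0(\Omega)$ into $W_h$, satisfies $\|\tilde R_hv\|_{H^1(\Omega)}\le C\|v\|_{H^1(\Omega)}$, and satisfies $b(\mathbf Q_h\psi,\tilde R_hv;\eta_h)=b(\psi,v;\eta_h)$ for all $\psi$, $v$, $\eta_h$ as above. -/

import Mathlib

open MeasureTheory Set
open scoped ContDiff

noncomputable section

namespace PlateFEM

/-- The Euclidean plane. -/
abbrev Plane : Type := EuclideanSpace ℝ (Fin 2)

/-- A bounded region with polygonal boundary: a bounded domain (nonempty, open, connected) that is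
the interior of its closure (no slits or punctures) and whose boundary is a finite union of line
segments. -/
structure IsPolygonalDomain (Ω : Set Plane) : Prop where
  isOpen : IsOpen Ω
  isConnected : IsConnected Ω
  isBounded : Bornology.IsBounded Ω
  interior_closure : interior (closure Ω) = Ω
  polygonal : ∃ F : Finset (Plane × Plane), frontier Ω = ⋃ e ∈ F, segment ℝ e.1 e.2

/-! ### Sobolev spaces -/

/-- `C_c^∞(Ω)`. -/
structure IsTestFunction (Ω : Set Plane) (φ : Plane → ℝ) : Prop where
  smooth : ContDiff ℝ ∞ φ
  compact : HasCompactSupport φ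
  supp : tsupport φ ⊆ Ω

/-- `L²(Ω)`. -/
abbrev L2 (Ω : Set Plane) : Type := Lp ℝ 2 (volume.restrict Ω)

/-- `L²(Ω)²`. -/
abbrev L2Vec (Ω : Set Plane) : Type := Lp Plane 2 (volume.restrict Ω)

/-- `g` is the weak gradient of `u` on `Ω`, with one equation for each direction `e`. -/
def IsWeakGradient (Ω : Set Plane) (u : Plane → ℝ) (g : Plane → Plane) : Prop :=
  ∀ φ : Plane → ℝ, IsTestFunction Ω φ → ∀ e : Plane,
    ∫ x in Ω, u x * fderiv ℝ φ x e = - ∫ x in Ω, inner ℝ e (g x) * φ x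

lemma IsTestFunction.memLp {Ω : Set Plane} {φ : Plane → ℝ} (h : IsTestFunction Ω φ) :
    MemLp φ 2 (volume.restrict Ω) :=
  (h.smooth.continuous.memLp_of_hasCompactSupport h.compact).restrict Ω

lemma IsTestFunction.memLp_fderiv {Ω : Set Plane} {φ : Plane → ℝ} (h : IsTestFunction Ω φ)
    (e : Plane) : MemLp (fun x => fderiv ℝ φ x e) 2 (volume.restrict Ω) := by
  have hc : Continuous (fun x => fderiv ℝ φ x e) :=
    (h.smooth.continuous_fderiv (by simp)).clm_apply continuous_const
  exact (hc.memLp_of_hasCompactSupport (h.compact.fderiv_apply ℝ e)).restrict Ω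

lemma integrable_val {Ω : Set Plane} {φ : Plane → ℝ} (h : IsTestFunction Ω φ) (e : Plane)
    (u : L2 Ω) : Integrable (fun x => u x * fderiv ℝ φ x e) (volume.restrict Ω) :=
  (Lp.memLp u).integrable_mul (h.memLp_fderiv e)

lemma integrable_grad {Ω : Set Plane} {φ : Plane → ℝ} (h : IsTestFunction Ω φ) (e : Plane)
    (g : L2Vec Ω) : Integrable (fun x => inner ℝ e (g x) * φ x) (volume.restrict Ω) :=
  ((Lp.memLp g).const_inner e).integrable_mul h.memLp

/-- `H¹(Ω)`, as the space of pairs `(u, ∇u)` in `L²(Ω) × L²(Ω)²`. The norm it inherits is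
`(‖u‖² + ‖∇u‖²)^{1/2}`, the `H¹` norm. -/
def H1 (Ω : Set Plane) : Submodule ℝ (WithLp 2 (L2 Ω × L2Vec Ω)) where
  carrier := {w | IsWeakGradient Ω w.fst w.snd}
  zero_mem' := by
    intro φ _ e
    have h1 : ∀ᵐ x ∂(volume.restrict Ω), (0 : L2 Ω) x = 0 := Lp.coeFn_zero ℝ 2 _
    have h2 : ∀ᵐ x ∂(volume.restrict Ω), (0 : L2Vec Ω) x = 0 := Lp.coeFn_zero Plane 2 _
    rw [integral_eq_zero_of_ae, integral_eq_zero_of_ae, neg_zero]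
    · filter_upwards [h2] with x hx
      change inner ℝ e ((0 : L2Vec Ω) x) * φ x = 0
      rw [hx, inner_zero_right, zero_mul]
    · filter_upwards [h1] with x hx
      change (0 : L2 Ω) x * fderiv ℝ φ x e = 0
      rw [hx, zero_mul]
  add_mem' := by
    intro v w hv hw φ hφ e
    have h1 := Lp.coeFn_add v.fst w.fst
    have h2 := Lp.coeFn_add v.snd w.snd
    have e1 : ∫ x in Ω, (v + w).fst x * fderiv ℝ φ x e
        = ∫ x in Ω, (v.fst x * fderiv ℝ φ x e + w.fst x * fderiv ℝ φ x e) := by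
      refine integral_congr_ae ?_
      filter_upwards [h1] with x hx
      simp only [WithLp.add_fst, hx, Pi.add_apply, add_mul]
    have e2 : ∫ x in Ω, inner ℝ e ((v + w).snd x) * φ x
        = ∫ x in Ω, (inner ℝ e (v.snd x) * φ x + inner ℝ e (w.snd x) * φ x) := by
      refine integral_congr_ae ?_
      filter_upwards [h2] with x hx
      simp only [WithLp.add_snd, hx, Pi.add_apply, inner_add_right, add_mul]
    rw [e1, e2, integral_add (integrable_val hφ e _) (integrable_val hφ e _),
      integral_add (integrable_grad hφ e _) (integrable_grad hφ e _), hv φ hφ e, hw φ hφ e]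
    ring
  smul_mem' := by
    intro c v hv φ hφ e
    have h1 := Lp.coeFn_smul c v.fst
    have h2 := Lp.coeFn_smul c v.snd
    have e1 : ∫ x in Ω, (c • v).fst x * fderiv ℝ φ x e
        = ∫ x in Ω, c * (v.fst x * fderiv ℝ φ x e) := by
      refine integral_congr_ae ?_
      filter_upwards [h1] with x hx
      simp only [WithLp.smul_fst, hx, Pi.smul_apply, smul_eq_mul, mul_assoc]
    have e2 : ∫ x in Ω, inner ℝ e ((c • v).snd x) * φ x
        = ∫ x in Ω, c * (inner ℝ e (v.snd x) * φ x) := by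
      refine integral_congr_ae ?_
      filter_upwards [h2] with x hx
      simp only [WithLp.smul_snd, hx, Pi.smul_apply, inner_smul_right, mul_assoc]
    rw [e1, e2, integral_const_mul, integral_const_mul, hv φ hφ e]
    ring

/-- The elements of `H¹(Ω)` that are (represented by) test functions. -/
def testSubspace (Ω : Set Plane) : Submodule ℝ (H1 Ω) where
  carrier := {w | ∃ φ, IsTestFunction Ω φ ∧ w.1.fst =ᵐ[volume.restrict Ω] φ}
  zero_mem' := ⟨0, ⟨contDiff_const, HasCompactSupport.zero, by simp [tsupport]⟩,
    Lp.coeFn_zero ℝ 2 _⟩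
  add_mem' := by
    rintro v w ⟨φ, hφ, hv⟩ ⟨χ, hχ, hw⟩
    refine ⟨φ + χ, ⟨hφ.smooth.add hχ.smooth, hφ.compact.add hχ.compact,
      (tsupport_add φ χ).trans (union_subset hφ.supp hχ.supp)⟩, ?_⟩
    exact (Lp.coeFn_add v.1.fst w.1.fst).trans (hv.add hw)
  smul_mem' := by
    rintro c v ⟨φ, hφ, hv⟩
    have hs : tsupport (c • φ) ⊆ tsupport φ := closure_mono (Function.support_const_smul_subset c φ)
    refine ⟨c • φ, ⟨hφ.smooth.const_smul c, hφ.compact.mono' ?_, hs.trans hφ.supp⟩, ?_⟩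
    · exact subset_closure.trans hs
    · exact (Lp.coeFn_smul c v.1.fst).trans (hv.const_smul c)

/-- `H¹₀(Ω)`: the closure of `C_c^∞(Ω)` in `H¹(Ω)`, with the `H¹` norm. -/
def H10 (Ω : Set Plane) : Submodule ℝ (H1 Ω) := (testSubspace Ω).topologicalClosure

/-- `H¹₀(Ω)²` with the norm `(‖ψ₁‖² + ‖ψ₂‖²)^{1/2}`. -/
abbrev H10Vec (Ω : Set Plane) : Type := PiLp 2 (fun _ : Fin 2 => H10 Ω)

/-- The function `u` underlying an element of `H¹(Ω)`, defined almost everywhere on `Ω`. -/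
def H1.val {Ω : Set Plane} (w : H1 Ω) : Plane → ℝ := w.1.fst

/-- The weak gradient of an element of `H¹(Ω)`, defined almost everywhere on `Ω`. -/
def H1.grad {Ω : Set Plane} (w : H1 Ω) : Plane → Plane := w.1.snd

/-- The form `b(ψ, v; η) = ∫_Ω (ψ - ∇v) · η`. -/
def bForm {Ω : Set Plane} (ψ : H10Vec Ω) (v : H10 Ω) (η : Fin 2 → Plane → ℝ) : ℝ :=
  ∫ x in Ω, ∑ k : Fin 2, (H1.val (ψ k : H1 Ω) x - H1.grad (v : H1 Ω) x k) * η k x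

/-! ### Triangulations -/

/-- A (conforming) triangulation of `Ω`. A triangle is given by the set of its three vertices. -/
structure Triangulation (Ω : Set Plane) where
  triangles : Finset (Finset Plane)
  card_eq : ∀ t ∈ triangles, t.card = 3
  indep : ∀ t ∈ triangles, AffineIndependent ℝ ((↑) : t → Plane)
  conforming : ∀ s ∈ triangles, ∀ t ∈ triangles,
    convexHull ℝ (s : Set Plane) ∩ convexHull ℝ (t : Set Plane)
      ⊆ convexHull ℝ ((s : Set Plane) ∩ (t : Set Plane))
  cover : ⋃ t ∈ triangles, convexHull ℝ (t : Set Plane) = closure Ω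

namespace Triangulation

variable {Ω : Set Plane}

/-- Quasi-uniformity with constant `σ`: each triangle contains a disc of radius `σ h`, where the
mesh-size `h` is the largest diameter of a triangle. -/
def QuasiUniform (𝒯 : Triangulation Ω) (σ : ℝ) : Prop :=
  ∀ s ∈ 𝒯.triangles, ∀ t ∈ 𝒯.triangles,
    ∃ c : Plane, Metric.closedBall c (σ * Metric.diam (convexHull ℝ (s : Set Plane)))
      ⊆ convexHull ℝ (t : Set Plane)

open scoped Classical in
/-- The set `𝒩` of all vertices. -/
def vertices (𝒯 : Triangulation Ω) : Finset Plane := 𝒯.triangles.biUnion id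

open scoped Classical in
/-- The set `𝒩₀` of the vertices in `Ω`. -/
def interiorVertices (𝒯 : Triangulation Ω) : Finset Plane := 𝒯.vertices.filter (· ∈ Ω)

open scoped Classical in
/-- The set `∂𝒩` of the vertices on the boundary of `Ω`. -/
def boundaryVertices (𝒯 : Triangulation Ω) : Finset Plane := 𝒯.vertices.filter (· ∈ frontier Ω)

/-- `i` and `j` share a common edge. -/
def Adj (𝒯 : Triangulation Ω) (i j : Plane) : Prop := i ≠ j ∧ ∃ t ∈ 𝒯.triangles, i ∈ t ∧ j ∈ t

/-- Each triangle has at least one interior vertex. -/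
def EachHasInteriorVertex (𝒯 : Triangulation Ω) : Prop := ∀ t ∈ 𝒯.triangles, ∃ i ∈ t, i ∈ Ω

end Triangulation

/-- The barycentric coordinate of the point `x` associated with the vertex `p` of the
(nondegenerate) triangle with vertex set `t`. -/
def bary (t : Finset Plane) (p x : Plane) : ℝ :=
  open scoped Classical in
  if h : (AffineIndependent ℝ ((↑) : t → Plane) ∧
      affineSpan ℝ (range ((↑) : t → Plane)) = ⊤) ∧ p ∈ t then
    (AffineBasis.mk ((↑) : t → Plane) h.1.1 h.1.2).coord ⟨p, h.2⟩ x
  else 0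

namespace Triangulation

variable {Ω : Set Plane}

open scoped Classical in
/-- The standard finite element basis function of the vertex `p`: on each triangle that contains
`p` it is the barycentric coordinate of `p`, and elsewhere it is zero. By conformity the value at
`x` does not depend on the triangle chosen. -/
def hat (𝒯 : Triangulation Ω) (p x : Plane) : ℝ :=
  if h : ∃ t ∈ 𝒯.triangles, p ∈ t ∧ x ∈ convexHull ℝ (t : Set Plane) then bary h.choose p x else 0

/-! ### Finite element spaces -/

/-- `K_h`: the functions in `H¹(Ω)` that are affine on each triangle. -/
def K (𝒯 : Triangulation Ω) : Submodule ℝ (H1 Ω) where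
  carrier := {v | ∀ t ∈ 𝒯.triangles, ∃ a : Plane →ᵃ[ℝ] ℝ,
    ∀ᵐ x ∂(volume.restrict Ω), x ∈ convexHull ℝ (t : Set Plane) → H1.val v x = a x}
  zero_mem' := fun t _ => ⟨0, by
    have h : ∀ᵐ x ∂(volume.restrict Ω), (0 : L2 Ω) x = 0 := Lp.coeFn_zero ℝ 2 _
    filter_upwards [h] with x hx _
    exact hx⟩
  add_mem' := by
    intro v w hv hw t ht
    obtain ⟨a, ha⟩ := hv t ht
    obtain ⟨b, hb⟩ := hw t ht
    refine ⟨a + b, ?_⟩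
    filter_upwards [ha, hb, Lp.coeFn_add v.1.fst w.1.fst] with x h1 h2 h3 hx
    exact h3.trans (congrArg₂ (· + ·) (h1 hx) (h2 hx))
  smul_mem' := by
    intro c v hv t ht
    obtain ⟨a, ha⟩ := hv t ht
    refine ⟨c • a, ?_⟩
    filter_upwards [ha, Lp.coeFn_smul c v.1.fst] with x h1 h3 hx
    exact h3.trans (congrArg (c * ·) (h1 hx))

/-- `S_h = H¹₀(Ω) ∩ K_h`. -/
def S (𝒯 : Triangulation Ω) : Submodule ℝ (H10 Ω) := 𝒯.K.comap (H10 Ω).subtype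

/-- The bubble space `B_h`: on each triangle a multiple of the cubic bubble function, which is the
product of the three barycentric coordinates. -/
def B (𝒯 : Triangulation Ω) : Submodule ℝ (H10 Ω) where
  carrier := {v | ∀ t ∈ 𝒯.triangles, ∃ c : ℝ,
    ∀ᵐ x ∂(volume.restrict Ω), x ∈ convexHull ℝ (t : Set Plane) →
      H1.val (v : H1 Ω) x = c * ∏ p ∈ t, bary t p x}
  zero_mem' := fun t _ => ⟨0, by
    have h : ∀ᵐ x ∂(volume.restrict Ω), (0 : L2 Ω) x = 0 := Lp.coeFn_zero ℝ 2 _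
    filter_upwards [h] with x hx _
    rw [zero_mul]
    exact hx⟩
  add_mem' := by
    intro v w hv hw t ht
    obtain ⟨a, ha⟩ := hv t ht
    obtain ⟨b, hb⟩ := hw t ht
    refine ⟨a + b, ?_⟩
    filter_upwards [ha, hb, Lp.coeFn_add v.1.1.fst w.1.1.fst] with x h1 h2 h3 hx
    rw [add_mul]
    exact h3.trans (congrArg₂ (· + ·) (h1 hx) (h2 hx))
  smul_mem' := by
    intro c v hv t ht
    obtain ⟨a, ha⟩ := hv t ht
    refine ⟨c * a, ?_⟩
    filter_upwards [ha, Lp.coeFn_smul c v.1.1.fst] with x h1 h3 hx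
    rw [mul_assoc]
    exact h3.trans (congrArg (c * ·) (h1 hx))

/-- `V_h = [S_h]²`. -/
def V (𝒯 : Triangulation Ω) : Submodule ℝ (H10Vec Ω) where
  carrier := {ψ | ∀ k, ψ k ∈ 𝒯.S}
  zero_mem' := fun _ => 𝒯.S.zero_mem
  add_mem' := fun hv hw k => 𝒯.S.add_mem (hv k) (hw k)
  smul_mem' := fun c _ hv k => 𝒯.S.smul_mem c (hv k)

/-- `W_h = S_h ⊕ B_h`. -/
def W (𝒯 : Triangulation Ω) : Submodule ℝ (H10 Ω) := 𝒯.S ⊔ 𝒯.B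

open scoped Classical in
/-- Admissible coefficients `A_{j,i}` of the boundary modification, where `j` is a boundary vertex
and `i` an interior vertex that shares an edge with `j`: they are nonnegative, and for each
boundary vertex they add up to one. -/
structure IsAdmissible (𝒯 : Triangulation Ω) (A : Plane → Plane → ℝ) : Prop where
  nonneg : ∀ j ∈ 𝒯.boundaryVertices, ∀ i ∈ 𝒯.interiorVertices, 𝒯.Adj i j → 0 ≤ A j i
  sum_eq_one : ∀ j ∈ 𝒯.boundaryVertices, ∑ i ∈ 𝒯.interiorVertices with 𝒯.Adj i j, A j i = 1

open scoped Classical in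
/-- The basis function of the multiplier space `M¹_h` for the interior vertex `i`. The sum is empty
if `i` has no neighbour on the boundary. -/
def multiplierBasis (𝒯 : Triangulation Ω) (A : Plane → Plane → ℝ) (i : Plane) : Plane → ℝ :=
  fun x => 𝒯.hat i x + ∑ j ∈ 𝒯.boundaryVertices with 𝒯.Adj i j, A j i * 𝒯.hat j x

/-- The multiplier space `M¹_h`, a space of functions on `closure Ω` (extended by zero). -/
def M (𝒯 : Triangulation Ω) (A : Plane → Plane → ℝ) : Submodule ℝ (Plane → ℝ) :=
  Submodule.span ℝ (𝒯.multiplierBasis A '' 𝒯.interiorVertices)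

/-- `P` is the `L²(Ω)`-orthogonal projection onto `S_h` (restricted to `H¹₀(Ω)`). -/
def IsL2Projection (𝒯 : Triangulation Ω) (P : H10 Ω →L[ℝ] H10 Ω) : Prop :=
  ∀ v : H10 Ω, P v ∈ 𝒯.S ∧
    ∀ s ∈ 𝒯.S, ∫ x in Ω, (H1.val (v : H1 Ω) x - H1.val (P v : H1 Ω) x) * H1.val (s : H1 Ω) x = 0

/-- `Z` maps `v` to the bubble function with the same integral over each triangle. -/
def IsBubbleMap (𝒯 : Triangulation Ω) (Z : H10 Ω →L[ℝ] H10 Ω) : Prop :=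
  ∀ v : H10 Ω, Z v ∈ 𝒯.B ∧
    ∀ t ∈ 𝒯.triangles, ∫ x in Ω ∩ convexHull ℝ (t : Set Plane),
      (H1.val (v : H1 Ω) x - H1.val (Z v : H1 Ω) x) = 0

end Triangulation

end PlateFEM

end

/-!
The estimates rest on two kinds of stability.

*Stability in `L²`.* The `M¹_h`-orthogonal projection `Q` onto `S_h` has nodal values given by the
transpose of the mixed mass matrix. That matrix, applied to nodal values `v`, is the ordinary mass
matrix applied to the extension of `v` to the boundary vertices by averages of interior neighbours.
It satisfies a discrete maximum principle (`IsRegular.exists_lt_abs_massSum`): near a maximum of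
`|v|` some row is bounded below by a multiple of `h ^ 2` times the maximum. The argument tolerates
weights that vary slowly on the scale `h`, and weights decaying away from a vertex turn this `ℓ^∞`
fact into the `ℓ²` bound `exists_sum_sq_le_massSum` with a constant that depends on `σ` only. Unlike
the `ℓ^∞` bound, it passes to the transpose (`sum_sq_le_transpose`). The case `A = 0` is the `L²`
projection `P`. For `R` one needs a projection `Π` onto `S_h` that annihilates the bubble functions
(`exists_projection_bubble`); its nodal values are local moments against the functions `dualFun`,
which makes the `L²` bound elementary.

*Stability in `H¹`.* A projection onto `S_h` whose nodal values are stable in `L²` is stable in `H¹`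
and approximates to first order (`exists_projection`): it reproduces a quasi-interpolant, and the
inverse estimate is applied to the error only. The quasi-interpolant (`exists_quasi_interpolant`)
takes as nodal value at an interior vertex `p` the value of the test function at a nearby point of a
segment issuing from `p`, chosen such that the `L²` distance to this value on a disc is controlled
by the gradient (`exists_setIntegral_sub_sq_le`). At a boundary vertex the segment is taken inside
the polygonal boundary (`exists_boundary_segment`), so that the value is zero, as it has to be.

The bubble map `Z` alone is not uniformly bounded in `H¹`: the inverse estimate costs a factor `h⁻¹`
relative to the `L²` norm. It is applied to `v - Π v` or `v - P v` only, whose `L²` norm is of order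
`h` (`norm_add_bubbleMap_le`). The maps `R = Π + Z (1 - Π)` and `P + Z (1 - P)` preserve the integral
over each triangle. The first of them is a projector onto `W_h`, since `Π` is the identity on `S_h`
and zero on `B_h`, and `Z` is the identity on `B_h`.

The commuting property follows (`bForm_eq_bForm`): integration by parts moves the gradient to `η`,
whose gradient is constant on each triangle (`setIntegral_inner_grad_mul_hat`), so that only the
integrals of `v` over the triangles enter.

On the side of the function spaces, the criterion `ofLipschitz_mem_H10` (Lipschitz functions
that vanish outside `Ω` are in `H¹₀(Ω)`) puts hat and bubble functions into `H¹₀(Ω)`, and conversely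
`exists_fe_eq` shows that the piecewise affine functions in `H¹₀(Ω)` are the combinations of hat
functions of interior vertices: continuity across edges and zero boundary values are recovered from
Poincaré inequalities on small discs around each vertex.
-/

open Filter Topology

namespace PlateFEM

/-! ### Elements of `H¹(Ω)` and `H¹₀(Ω)` -/

section Sobolev

variable {Ω : Set Plane}

lemma H1.memLp_val (w : H1 Ω) : MemLp (H1.val w) 2 (volume.restrict Ω) := Lp.memLp w.1.fst

lemma H1.memLp_grad (w : H1 Ω) : MemLp (H1.grad w) 2 (volume.restrict Ω) := Lp.memLp w.1.snd

lemma H1.integrable_val_sq (w : H1 Ω) : Integrable (fun x => H1.val w x ^ 2) (volume.restrict Ω) :=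
  (H1.memLp_val w).integrable_sq

lemma H1.integrable_grad_sq (w : H1 Ω) :
    Integrable (fun x => ‖H1.grad w x‖ ^ 2) (volume.restrict Ω) :=
  (H1.memLp_grad w).norm.integrable_sq

lemma norm_sq_Lp {E : Type*} [NormedAddCommGroup E] [InnerProductSpace ℝ E] {μ : Measure Plane}
    (f : Lp E 2 μ) : ‖f‖ ^ 2 = ∫ x, ‖f x‖ ^ 2 ∂μ := by
  rw [← real_inner_self_eq_norm_sq, L2.inner_def]
  simp only [real_inner_self_eq_norm_sq]

lemma H1.norm_sq (w : H1 Ω) :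
    ‖w‖ ^ 2 = (∫ x in Ω, H1.val w x ^ 2) + ∫ x in Ω, ‖H1.grad w x‖ ^ 2 := by
  have h : ‖w‖ ^ 2 = ‖w.1.fst‖ ^ 2 + ‖w.1.snd‖ ^ 2 := WithLp.prod_norm_sq_eq_of_L2 w.1
  rw [h, norm_sq_Lp, norm_sq_Lp]
  simp only [Real.norm_eq_abs, sq_abs]
  rfl

lemma H1.val_add (v w : H1 Ω) : H1.val (v + w) =ᵐ[volume.restrict Ω] H1.val v + H1.val w :=
  Lp.coeFn_add v.1.fst w.1.fst

lemma H1.val_sub (v w : H1 Ω) : H1.val (v - w) =ᵐ[volume.restrict Ω] H1.val v - H1.val w :=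
  Lp.coeFn_sub v.1.fst w.1.fst

lemma H1.val_smul (c : ℝ) (v : H1 Ω) : H1.val (c • v) =ᵐ[volume.restrict Ω] c • H1.val v :=
  Lp.coeFn_smul c v.1.fst

lemma H1.val_zero : H1.val (0 : H1 Ω) =ᵐ[volume.restrict Ω] 0 := Lp.coeFn_zero ℝ 2 _

lemma H1.grad_add (v w : H1 Ω) : H1.grad (v + w) =ᵐ[volume.restrict Ω] H1.grad v + H1.grad w :=
  Lp.coeFn_add v.1.snd w.1.snd

lemma H1.grad_sub (v w : H1 Ω) : H1.grad (v - w) =ᵐ[volume.restrict Ω] H1.grad v - H1.grad w :=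
  Lp.coeFn_sub v.1.snd w.1.snd

lemma H1.grad_smul (c : ℝ) (v : H1 Ω) : H1.grad (c • v) =ᵐ[volume.restrict Ω] c • H1.grad v :=
  Lp.coeFn_smul c v.1.snd

lemma H1.grad_zero : H1.grad (0 : H1 Ω) =ᵐ[volume.restrict Ω] 0 := Lp.coeFn_zero Plane 2 _

lemma H1.val_sum {ι : Type*} (s : Finset ι) (c : ι → ℝ) (v : ι → H1 Ω) :
    H1.val (∑ i ∈ s, c i • v i) =ᵐ[volume.restrict Ω] fun x => ∑ i ∈ s, c i * H1.val (v i) x := by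
  classical
  induction s using Finset.induction_on with
  | empty => simp only [Finset.sum_empty]; exact H1.val_zero
  | insert a s ha ih =>
    rw [Finset.sum_insert ha]
    filter_upwards [H1.val_add (c a • v a) (∑ i ∈ s, c i • v i), H1.val_smul (c a) (v a), ih]
      with x h1 h2 h3
    rw [Finset.sum_insert ha, h1, Pi.add_apply, h2, h3, Pi.smul_apply, smul_eq_mul]

lemma H1.grad_sum {ι : Type*} (s : Finset ι) (c : ι → ℝ) (v : ι → H1 Ω) :
    H1.grad (∑ i ∈ s, c i • v i) =ᵐ[volume.restrict Ω] fun x => ∑ i ∈ s, c i • H1.grad (v i) x := by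
  classical
  induction s using Finset.induction_on with
  | empty => simp only [Finset.sum_empty]; exact H1.grad_zero
  | insert a s ha ih =>
    rw [Finset.sum_insert ha]
    filter_upwards [H1.grad_add (c a • v a) (∑ i ∈ s, c i • v i), H1.grad_smul (c a) (v a), ih]
      with x h1 h2 h3
    rw [Finset.sum_insert ha, h1, Pi.add_apply, h2, h3, Pi.smul_apply]

/-- The element of `H¹(Ω)` given by a function and its weak gradient. -/
noncomputable def H1.ofFun (f : Plane → ℝ) (g : Plane → Plane) (hf : MemLp f 2 (volume.restrict Ω))
    (hg : MemLp g 2 (volume.restrict Ω)) (h : IsWeakGradient Ω f g) : H1 Ω :=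
  ⟨WithLp.toLp 2 (hf.toLp f, hg.toLp g), by
    intro φ hφ e
    have h1 : ∫ x in Ω, hf.toLp f x * fderiv ℝ φ x e = ∫ x in Ω, f x * fderiv ℝ φ x e := by
      refine integral_congr_ae ?_
      filter_upwards [hf.coeFn_toLp] with x hx
      rw [hx]
    have h2 : ∫ x in Ω, inner ℝ e (hg.toLp g x) * φ x = ∫ x in Ω, inner ℝ e (g x) * φ x := by
      refine integral_congr_ae ?_
      filter_upwards [hg.coeFn_toLp] with x hx
      rw [hx]
    exact (h1.trans (h φ hφ e)).trans (congrArg _ h2.symm)⟩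

lemma H1.val_ofFun {f : Plane → ℝ} {g : Plane → Plane} (hf : MemLp f 2 (volume.restrict Ω))
    (hg : MemLp g 2 (volume.restrict Ω)) (h : IsWeakGradient Ω f g) :
    H1.val (H1.ofFun f g hf hg h) =ᵐ[volume.restrict Ω] f := hf.coeFn_toLp

lemma H1.grad_ofFun {f : Plane → ℝ} {g : Plane → Plane} (hf : MemLp f 2 (volume.restrict Ω))
    (hg : MemLp g 2 (volume.restrict Ω)) (h : IsWeakGradient Ω f g) :
    H1.grad (H1.ofFun f g hf hg h) =ᵐ[volume.restrict Ω] g := hg.coeFn_toLp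

/-- A function in `L²(Ω)²` that is a weak gradient of zero vanishes. -/
lemma ae_eq_zero_of_isWeakGradient_zero (hΩ : IsOpen Ω) {g : Plane → Plane}
    (hg : MemLp g 2 (volume.restrict Ω)) (h : IsWeakGradient Ω 0 g) :
    g =ᵐ[volume.restrict Ω] 0 := by
  have hcomp : ∀ k : Fin 2, ∀ᵐ x ∂(volume.restrict Ω), g x k = 0 := by
    intro k
    have hk : MemLp (fun x => inner ℝ (EuclideanSpace.single k (1 : ℝ)) (g x)) 2
        (volume.restrict Ω) := hg.const_inner _
    have hloc : LocallyIntegrableOn (fun x => inner ℝ (EuclideanSpace.single k (1 : ℝ)) (g x)) Ω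
        volume := by
      rw [locallyIntegrableOn_iff hΩ.isLocallyClosed]
      intro K hK hKc
      have : IsFiniteMeasure (volume.restrict K) := ⟨by simpa using hKc.measure_lt_top⟩
      exact (hk.mono_measure (Measure.restrict_mono hK le_rfl)).integrable one_le_two
    have := hΩ.ae_eq_zero_of_integral_contDiff_smul_eq_zero hloc (by
      intro φ h1 h2 h3
      have h4 := h φ ⟨h1, h2, h3⟩ (EuclideanSpace.single k (1 : ℝ))
      simp only [Pi.zero_apply, zero_mul, integral_zero] at h4
      have h5 : ∫ x in Ω, inner ℝ (EuclideanSpace.single k (1 : ℝ)) (g x) * φ x = 0 := by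
        linarith
      rw [setIntegral_eq_integral_of_forall_compl_eq_zero] at h5
      · rw [← h5]
        congr 1
        ext x
        rw [smul_eq_mul, mul_comm]
      · intro x hx
        rw [image_eq_zero_of_notMem_tsupport (fun hx' => hx (h3 hx')), mul_zero])
    rw [ae_restrict_iff' hΩ.measurableSet]
    filter_upwards [this] with x hx hxΩ
    simpa [EuclideanSpace.inner_single_left] using hx hxΩ
  filter_upwards [hcomp 0, hcomp 1] with x h0 h1
  ext k
  fin_cases k
  · exact h0
  · exact h1

lemma H1.ext_val (hΩ : IsOpen Ω) {v w : H1 Ω} (h : H1.val v =ᵐ[volume.restrict Ω] H1.val w) :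
    v = w := by
  have h0 : H1.val (v - w) =ᵐ[volume.restrict Ω] 0 := by
    filter_upwards [H1.val_sub v w, h] with x h1 h2
    rw [h1, Pi.sub_apply, h2, sub_self, Pi.zero_apply]
  have h1 : IsWeakGradient Ω 0 (H1.grad (v - w)) := by
    intro φ hφ e
    have := (v - w).2 φ hφ e
    have h2 : ∫ x in Ω, (v - w).1.fst x * fderiv ℝ φ x e
        = ∫ x in Ω, (0 : Plane → ℝ) x * fderiv ℝ φ x e := by
      refine integral_congr_ae ?_
      filter_upwards [h0] with x hx
      change (H1.val (v - w)) x * _ = _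
      rw [hx]
    rw [← h2]
    exact this
  have h2 := ae_eq_zero_of_isWeakGradient_zero hΩ (H1.memLp_grad (v - w)) h1
  have h3 : ‖v - w‖ ^ 2 = 0 := by
    have e0 : ∫ x in Ω, H1.val (v - w) x ^ 2 = 0 := by
      refine integral_eq_zero_of_ae ?_
      filter_upwards [h0] with x hx
      rw [hx]; simp
    have e1 : ∫ x in Ω, ‖H1.grad (v - w) x‖ ^ 2 = 0 := by
      refine integral_eq_zero_of_ae ?_
      filter_upwards [h2] with x hx
      rw [hx]; simp
    rw [H1.norm_sq, e0, e1, add_zero]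
  rw [← sub_eq_zero, ← norm_eq_zero]
  exact pow_eq_zero_iff two_ne_zero |>.1 h3

lemma H10.ext_val (hΩ : IsOpen Ω) {v w : H10 Ω}
    (h : H1.val (v : H1 Ω) =ᵐ[volume.restrict Ω] H1.val (w : H1 Ω)) : v = w :=
  Subtype.ext (H1.ext_val hΩ h)

/-! ### Lipschitz functions in `H¹(Ω)` -/

lemma measurable_gradient (f : Plane → ℝ) : Measurable (gradient f) :=
  (LinearIsometryEquiv.continuous _).measurable.comp (measurable_fderiv ℝ f)

lemma norm_gradient (f : Plane → ℝ) (x : Plane) : ‖gradient f x‖ = ‖fderiv ℝ f x‖ := by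
  simp [gradient]

lemma inner_gradient (f : Plane → ℝ) (x e : Plane) :
    inner ℝ e (gradient f x) = fderiv ℝ f x e := by
  rw [real_inner_comm]; simp [gradient]

lemma norm_gradient_le {f : Plane → ℝ} {K : NNReal} (hf : LipschitzWith K f) (x : Plane) :
    ‖gradient f x‖ ≤ K := by
  rw [norm_gradient]; exact norm_fderiv_le_of_lipschitz ℝ hf

lemma isFiniteMeasure_restrict (hb : Bornology.IsBounded Ω) :
    IsFiniteMeasure (volume.restrict Ω) := ⟨by simpa using hb.measure_lt_top⟩

lemma exists_norm_le_of_continuous (hb : Bornology.IsBounded Ω) {f : Plane → ℝ}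
    (hf : Continuous f) : ∃ C, ∀ x ∈ Ω, ‖f x‖ ≤ C := by
  obtain ⟨C, hC⟩ := (hb.isCompact_closure).exists_bound_of_continuousOn hf.continuousOn
  exact ⟨C, fun x hx => hC x (subset_closure hx)⟩

lemma memLp_of_continuous (hΩ : IsOpen Ω) (hb : Bornology.IsBounded Ω) {f : Plane → ℝ}
    (hf : Continuous f) : MemLp f 2 (volume.restrict Ω) := by
  have := isFiniteMeasure_restrict hb
  obtain ⟨C, hC⟩ := exists_norm_le_of_continuous hb hf
  refine MemLp.of_bound hf.aestronglyMeasurable C ?_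
  rw [ae_restrict_iff' hΩ.measurableSet]
  exact Eventually.of_forall hC

lemma memLp_gradient (hb : Bornology.IsBounded Ω) {f : Plane → ℝ}
    {K : NNReal} (hf : LipschitzWith K f) : MemLp (gradient f) 2 (volume.restrict Ω) := by
  have := isFiniteMeasure_restrict hb
  exact MemLp.of_bound (measurable_gradient f).aestronglyMeasurable K
    (Eventually.of_forall (norm_gradient_le hf))

lemma isWeakGradient_gradient {f : Plane → ℝ} {K : NNReal} (hf : LipschitzWith K f) :
    IsWeakGradient Ω f (gradient f) := by
  intro φ hφ e
  obtain ⟨D, hD⟩ := (hφ.smooth.of_le (by simp : (1 : WithTop ℕ∞) ≤ ∞)).lipschitzWith_of_hasCompactSupport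
    hφ.compact (by simp)
  have h := hf.integral_lineDeriv_mul_eq (μ := volume) hD hφ.compact e
  rw [setIntegral_eq_integral_of_forall_compl_eq_zero, setIntegral_eq_integral_of_forall_compl_eq_zero]
  · have h1 : ∫ x, inner ℝ e (gradient f x) * φ x = ∫ x, lineDeriv ℝ f x e * φ x := by
      refine integral_congr_ae ?_
      filter_upwards [hf.ae_differentiableAt] with x hx
      rw [inner_gradient, hx.lineDeriv_eq_fderiv]
    have h2 : ∫ x, f x * fderiv ℝ φ x e = - ∫ x, lineDeriv ℝ φ x (-e) * f x := by
      rw [← integral_neg]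
      congr 1
      ext x
      rw [((hφ.smooth.differentiable (by simp)) x).lineDeriv_eq_fderiv, map_neg]
      ring
    rw [h1, h2, h]
  · intro x hx
    rw [image_eq_zero_of_notMem_tsupport (fun hx' => hx (hφ.supp hx')), mul_zero]
  · intro x hx
    have : fderiv ℝ φ x = 0 := image_eq_zero_of_notMem_tsupport
      (fun hx' => hx (hφ.supp (tsupport_fderiv_subset ℝ hx')))
    rw [this]; simp

/-- The element of `H¹(Ω)` given by a Lipschitz function on the plane. -/
noncomputable def H1.ofLipschitz (hΩ : IsOpen Ω) (hb : Bornology.IsBounded Ω) {f : Plane → ℝ} {K : NNReal}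
    (hf : LipschitzWith K f) : H1 Ω :=
  H1.ofFun f (gradient f) (memLp_of_continuous hΩ hb hf.continuous) (memLp_gradient hb hf)
    (isWeakGradient_gradient hf)

lemma H1.val_ofLipschitz (hΩ : IsOpen Ω) (hb : Bornology.IsBounded Ω) {f : Plane → ℝ}
    {K : NNReal} (hf : LipschitzWith K f) :
    H1.val (H1.ofLipschitz hΩ hb hf) =ᵐ[volume.restrict Ω] f := H1.val_ofFun _ _ _

lemma H1.grad_ofLipschitz (hΩ : IsOpen Ω) (hb : Bornology.IsBounded Ω) {f : Plane → ℝ}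
    {K : NNReal} (hf : LipschitzWith K f) :
    H1.grad (H1.ofLipschitz hΩ hb hf) =ᵐ[volume.restrict Ω] gradient f := H1.grad_ofFun _ _ _

lemma IsTestFunction.lipschitz {φ : Plane → ℝ} (hφ : IsTestFunction Ω φ) :
    ∃ D, LipschitzWith D φ :=
  (hφ.smooth.of_le (by simp : (1 : WithTop ℕ∞) ≤ ∞)).lipschitzWith_of_hasCompactSupport
    hφ.compact (by simp)

lemma ofLipschitz_mem_H10_of_isTestFunction (hΩ : IsOpen Ω) (hb : Bornology.IsBounded Ω)
    {φ : Plane → ℝ} {K : NNReal} (hf : LipschitzWith K φ) (hφ : IsTestFunction Ω φ) :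
    H1.ofLipschitz hΩ hb hf ∈ H10 Ω :=
  Submodule.le_topologicalClosure _ ⟨φ, hφ, H1.val_ofLipschitz hΩ hb hf⟩

lemma H1.grad_of_isTestFunction (hΩ : IsOpen Ω) {u : H1 Ω} {φ : Plane → ℝ}
    (hφ : IsTestFunction Ω φ) (hval : H1.val u =ᵐ[volume.restrict Ω] φ) :
    H1.grad u =ᵐ[volume.restrict Ω] gradient φ := by
  obtain ⟨D, hD⟩ := hφ.lipschitz
  have hwk : IsWeakGradient Ω 0 (H1.grad u - gradient φ) := by
    intro χ hχ e
    have h1 := u.2 χ hχ e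
    have h2 := isWeakGradient_gradient (Ω := Ω) hD χ hχ e
    have h3 : ∫ x in Ω, u.1.fst x * fderiv ℝ χ x e = ∫ x in Ω, φ x * fderiv ℝ χ x e := by
      refine integral_congr_ae ?_
      filter_upwards [hval] with x hx
      change H1.val u x * _ = _
      rw [hx]
    have hi2 : Integrable (fun x => inner ℝ e (gradient φ x) * χ x) (volume.restrict Ω) := by
      have hg : MemLp (gradient φ) 2 (volume.restrict Ω) := by
        have hc : Continuous (gradient φ) := (LinearIsometryEquiv.continuous _).comp
          (hφ.smooth.continuous_fderiv (by simp))
        refine (hc.memLp_of_hasCompactSupport ?_).restrict Ω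
        exact (hφ.compact.fderiv ℝ).comp_left (map_zero _)
      exact (hg.const_inner e).integrable_mul hχ.memLp
    simp only [Pi.zero_apply, zero_mul, integral_zero]
    have h4 : ∫ x in Ω, inner ℝ e ((H1.grad u - gradient φ) x) * χ x
        = (∫ x in Ω, inner ℝ e (u.1.snd x) * χ x)
          - ∫ x in Ω, inner ℝ e (gradient φ x) * χ x := by
      rw [← integral_sub (integrable_grad hχ e _) hi2]
      congr 1
      ext x
      rw [Pi.sub_apply, inner_sub_right, sub_mul]
      rfl
    rw [h4]
    linarith
  have hmem : MemLp (gradient φ) 2 (volume.restrict Ω) := by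
    have hc : Continuous (gradient φ) := (LinearIsometryEquiv.continuous _).comp
      (hφ.smooth.continuous_fderiv (by simp))
    refine (hc.memLp_of_hasCompactSupport ?_).restrict Ω
    exact (hφ.compact.fderiv ℝ).comp_left (map_zero _)
  filter_upwards [ae_eq_zero_of_isWeakGradient_zero hΩ ((H1.memLp_grad u).sub hmem) hwk] with x hx
  exact sub_eq_zero.1 hx

/-- A closed property of `H¹₀(Ω)` functions need only be checked on test functions. -/
lemma H10.induction (hΩ : IsOpen Ω) {p : H10 Ω → Prop} (hp : IsClosed {w | p w})
    (h : ∀ (w : H10 Ω) (φ : Plane → ℝ), IsTestFunction Ω φ →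
      H1.val (w : H1 Ω) =ᵐ[volume.restrict Ω] φ → H1.grad (w : H1 Ω) =ᵐ[volume.restrict Ω] gradient φ →
      p w) (w : H10 Ω) : p w := by
  have hw : (w : H1 Ω) ∈ closure (testSubspace Ω : Set (H1 Ω)) := by
    rw [← Submodule.topologicalClosure_coe]; exact w.2
  obtain ⟨u, hu, hlim⟩ := mem_closure_iff_seq_limit.1 hw
  have hlim' : Tendsto (fun n => (⟨u n, Submodule.le_topologicalClosure _ (hu n)⟩ : H10 Ω)) atTop
      (𝓝 w) := tendsto_subtype_rng.2 hlim
  refine hp.mem_of_tendsto hlim' (Eventually.of_forall fun n => ?_)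
  obtain ⟨φ, hφ, hval⟩ := hu n
  exact h _ φ hφ hval (H1.grad_of_isTestFunction hΩ hφ hval)

end Sobolev

end PlateFEM

namespace PlateFEM

section Approximation

variable {Ω : Set Plane}

/-- Uniform convergence of uniformly Lipschitz functions together with almost everywhere
convergence of their gradients implies convergence in `H¹`. -/
lemma ofLipschitz_mem_H10_of_tendsto (hΩ : IsOpen Ω) (hb : Bornology.IsBounded Ω)
    {f : Plane → ℝ} {F : ℕ → Plane → ℝ} {K : NNReal} (hf : LipschitzWith K f)
    (hF : ∀ n, LipschitzWith K (F n)) (hmem : ∀ n, H1.ofLipschitz hΩ hb (hF n) ∈ H10 Ω)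
    {ε : ℕ → ℝ} (hε : Tendsto ε atTop (𝓝 0)) (hlim : ∀ n x, |F n x - f x| ≤ ε n)
    (hgrad : ∀ᵐ x ∂(volume.restrict Ω),
      Tendsto (fun n => gradient (F n) x) atTop (𝓝 (gradient f x))) :
    H1.ofLipschitz hΩ hb hf ∈ H10 Ω := by
  have := isFiniteMeasure_restrict hb
  have hclosed : IsClosed (H10 Ω : Set (H1 Ω)) := Submodule.isClosed_topologicalClosure _
  refine hclosed.mem_of_tendsto (b := atTop) (f := fun n => H1.ofLipschitz hΩ hb (hF n)) ?_
    (Eventually.of_forall hmem)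
  rw [tendsto_iff_norm_sub_tendsto_zero]
  have key : Tendsto (fun n => ‖H1.ofLipschitz hΩ hb (hF n) - H1.ofLipschitz hΩ hb hf‖ ^ 2) atTop
      (𝓝 0) := by
    have heq : ∀ n, ‖H1.ofLipschitz hΩ hb (hF n) - H1.ofLipschitz hΩ hb hf‖ ^ 2
        = (∫ x in Ω, (F n x - f x) ^ 2)
          + ∫ x in Ω, ‖gradient (F n) x - gradient f x‖ ^ 2 := by
      intro n
      rw [H1.norm_sq]
      congr 1
      · refine integral_congr_ae ?_
        filter_upwards [H1.val_sub (H1.ofLipschitz hΩ hb (hF n)) (H1.ofLipschitz hΩ hb hf),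
          H1.val_ofLipschitz hΩ hb (hF n), H1.val_ofLipschitz hΩ hb hf] with x h1 h2 h3
        rw [h1, Pi.sub_apply, h2, h3]
      · refine integral_congr_ae ?_
        filter_upwards [H1.grad_sub (H1.ofLipschitz hΩ hb (hF n)) (H1.ofLipschitz hΩ hb hf),
          H1.grad_ofLipschitz hΩ hb (hF n), H1.grad_ofLipschitz hΩ hb hf] with x h1 h2 h3
        rw [h1, Pi.sub_apply, h2, h3]
    simp only [heq]
    rw [← add_zero (0 : ℝ)]
    refine Tendsto.add ?_ ?_
    · have hup : Tendsto (fun n => ε n ^ 2 * (volume.restrict Ω).real univ) atTop (𝓝 0) := by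
        have := (hε.pow 2).mul_const ((volume.restrict Ω).real univ)
        simpa using this
      refine squeeze_zero (fun n => integral_nonneg fun x => sq_nonneg _) (fun n => ?_) hup
      have hle : ∫ x in Ω, (F n x - f x) ^ 2 ≤ ∫ x in Ω, ε n ^ 2 := by
        refine integral_mono_of_nonneg (Eventually.of_forall fun x => sq_nonneg _)
          (integrable_const _) (Eventually.of_forall fun x => ?_)
        exact sq_le_sq' (neg_le_of_abs_le (hlim n x)) (le_of_abs_le (hlim n x))
      refine hle.trans_eq ?_
      simp [mul_comm]
    · have h0 : (0 : ℝ) = ∫ x in Ω, (0 : ℝ) := by simp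
      rw [h0]
      refine tendsto_integral_of_dominated_convergence (fun _ => (2 * (K : ℝ)) ^ 2)
        (fun n => ?_) (integrable_const _) (fun n => Eventually.of_forall fun x => ?_) ?_
      · exact (((measurable_gradient (F n)).sub (measurable_gradient f)).norm.pow_const
          2).aestronglyMeasurable
      · rw [Real.norm_eq_abs, abs_of_nonneg (sq_nonneg _)]
        have h1 := norm_sub_le (gradient (F n) x) (gradient f x)
        have h2 := norm_gradient_le (hF n) x
        have h3 := norm_gradient_le hf x
        exact pow_le_pow_left₀ (norm_nonneg _) (by linarith) 2
      · filter_upwards [hgrad] with x hx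
        have := ((hx.sub_const (gradient f x)).norm).pow 2
        simpa using this
  have := key.sqrt
  simpa [Real.sqrt_sq (norm_nonneg _)] using this

open scoped Convolution in
lemma gradient_convolution {f : Plane → ℝ} {K : NNReal} (hf : LipschitzWith K f)
    {ρ : Plane → ℝ} (hρ : Continuous ρ) (hρc : HasCompactSupport ρ) (x : Plane) :
    gradient (ρ ⋆[ContinuousLinearMap.lsmul ℝ ℝ, volume] f) x
      = (ρ ⋆[ContinuousLinearMap.lsmul ℝ ℝ, volume] (gradient f)) x := by
  have hρi : Integrable ρ volume := hρ.integrable_of_hasCompactSupport hρc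
  have hderiv : HasFDerivAt (fun y => ∫ t, ρ t * f (y - t)) (∫ t, ρ t • fderiv ℝ f (x - t)) x := by
    have hm : ∀ y, AEStronglyMeasurable (fun t => ρ t * f (y - t)) volume := fun y =>
      (hρ.mul (hf.continuous.comp (continuous_const.sub continuous_id))).aestronglyMeasurable
    refine (hasFDerivAt_integral_of_dominated_loc_of_lip (s := univ)
      (bound := fun t => |ρ t| * K) univ_mem
      (Eventually.of_forall hm) ?_ ?_ ?_ ?_ ?_).2
    · refine (hρ.mul (hf.continuous.comp
        (continuous_const.sub continuous_id))).integrable_of_hasCompactSupport ?_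
      exact hρc.mul_right
    · exact hρ.aestronglyMeasurable.smul
        ((measurable_fderiv ℝ f).comp (measurable_const.sub measurable_id)).aestronglyMeasurable
    · refine Eventually.of_forall fun t => ?_
      refine LipschitzOnWith.of_dist_le_mul fun y _ z _ => ?_
      have h1 := hf.dist_le_mul (y - t) (z - t)
      rw [dist_sub_right] at h1
      rw [Real.dist_eq, ← mul_sub, abs_mul]
      rw [Real.dist_eq] at h1
      have h2 : ((Real.nnabs (|ρ t| * K) : NNReal) : ℝ) = |ρ t| * K := by
        simp
      rw [h2, mul_assoc]
      exact mul_le_mul_of_nonneg_left h1 (abs_nonneg _)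
    · exact hρi.abs.mul_const _
    · have h1 : ∀ᵐ t : Plane, DifferentiableAt ℝ f (x - t) :=
        (quasiMeasurePreserving_sub_left volume x).ae
          hf.ae_differentiableAt
      filter_upwards [h1] with t ht
      have h2 : HasFDerivAt (fun y => f (y - t)) (fderiv ℝ f (x - t)) x := by
        have := ht.hasFDerivAt.comp x ((hasFDerivAt_id x).sub_const t)
        rwa [ContinuousLinearMap.comp_id] at this
      exact h2.const_mul (ρ t)
  have e1 : (ρ ⋆[ContinuousLinearMap.lsmul ℝ ℝ, volume] f) = fun y => ∫ t, ρ t * f (y - t) := by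
    ext y
    simp [convolution_def]
  rw [e1, gradient, hderiv.fderiv]
  simp only [convolution_def, gradient, ContinuousLinearMap.lsmul_apply]
  have hint : Integrable (fun t => ρ t • gradient f (x - t)) volume := by
    refine (hρi.abs.mul_const (K : ℝ)).mono' ?_ (Eventually.of_forall fun t => ?_)
    · exact hρ.aestronglyMeasurable.smul
        ((measurable_gradient f).comp (measurable_const.sub measurable_id)).aestronglyMeasurable
    · rw [norm_smul, Real.norm_eq_abs]
      exact mul_le_mul_of_nonneg_left (norm_gradient_le hf _) (abs_nonneg _)
  have hint' : Integrable (fun t => ρ t • fderiv ℝ f (x - t)) volume := by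
    refine (hρi.abs.mul_const (K : ℝ)).mono' ?_ (Eventually.of_forall fun t => ?_)
    · exact hρ.aestronglyMeasurable.smul
        ((measurable_fderiv ℝ f).comp (measurable_const.sub measurable_id)).aestronglyMeasurable
    · rw [norm_smul, Real.norm_eq_abs]
      exact mul_le_mul_of_nonneg_left (norm_fderiv_le_of_lipschitz ℝ hf) (abs_nonneg _)
  refine ext_inner_left ℝ fun e => ?_
  have e2 : inner ℝ e (∫ t, ρ t • gradient f (x - t)) = ∫ t, ρ t * fderiv ℝ f (x - t) e := by
    rw [← integral_inner hint]
    simp only [inner_smul_right, inner_gradient]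
  refine Eq.trans ?_ e2.symm
  rw [real_inner_comm, InnerProductSpace.toDual_symm_apply,
    ContinuousLinearMap.integral_apply hint']
  simp

open scoped Convolution in
/-- A Lipschitz function with compact support in `Ω` is in `H¹₀(Ω)`: its mollifications are test
functions and converge in `H¹`. -/
lemma ofLipschitz_mem_H10_of_tsupport_subset (hΩ : IsOpen Ω) (hb : Bornology.IsBounded Ω)
    {f : Plane → ℝ} {K : NNReal} (hf : LipschitzWith K f) (hfΩ : tsupport f ⊆ Ω) :
    H1.ofLipschitz hΩ hb hf ∈ H10 Ω := by
  have hfc : HasCompactSupport f :=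
    Metric.isCompact_of_isClosed_isBounded (isClosed_tsupport f) (hb.subset hfΩ)
  obtain ⟨δ, hδ, hδΩ⟩ := hfc.isCompact.exists_cthickening_subset_open hΩ hfΩ
  set ρ : ℕ → ContDiffBump (0 : Plane) := fun n =>
    ⟨δ / (2 * (n + 1)), δ / (n + 1), by positivity, by
      rw [div_lt_div_iff_of_pos_left hδ (by positivity) (by positivity)]
      have : (0 : ℝ) ≤ n := n.cast_nonneg
      linarith⟩ with hρ
  have hout : Tendsto (fun n => (ρ n).rOut) atTop (𝓝 0) := by
    have := tendsto_one_div_add_atTop_nhds_zero_nat (𝕜 := ℝ) |>.const_mul δ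
    simpa [hρ, div_eq_mul_inv] using this
  set F : ℕ → Plane → ℝ := fun n =>
    (ρ n).normed volume ⋆[ContinuousLinearMap.lsmul ℝ ℝ, volume] f with hFdef
  have hFapp : ∀ n x, F n x = ∫ t, (ρ n).normed volume t * f (x - t) := by
    intro n x
    simp [hFdef, convolution_def]
  have hint : ∀ n x, Integrable (fun t => (ρ n).normed volume t * f (x - t)) volume := by
    intro n x
    refine ((ρ n).continuous_normed.mul (hf.continuous.comp
      (continuous_const.sub continuous_id))).integrable_of_hasCompactSupport ?_
    exact (ρ n).hasCompactSupport_normed.mul_right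
  have hF : ∀ n, LipschitzWith K (F n) := by
    intro n
    refine LipschitzWith.of_dist_le_mul fun x y => ?_
    rw [Real.dist_eq, hFapp, hFapp, ← integral_sub (hint n x) (hint n y), ← Real.norm_eq_abs]
    have hi : Integrable (fun t => (ρ n).normed volume t * (K * dist x y)) volume :=
      ((ρ n).integrable_normed).mul_const _
    refine (norm_integral_le_of_norm_le hi (Eventually.of_forall fun t => ?_)).trans_eq ?_
    · rw [← mul_sub, norm_mul, Real.norm_of_nonneg ((ρ n).nonneg_normed t)]
      refine mul_le_mul_of_nonneg_left ?_ ((ρ n).nonneg_normed t)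
      have := hf.dist_le_mul (x - t) (y - t)
      rwa [dist_sub_right, dist_eq_norm] at this
    · rw [integral_mul_const, (ρ n).integral_normed, one_mul]
  have hclose : ∀ n x, |F n x - f x| ≤ K * (ρ n).rOut := by
    intro n x
    rw [← Real.dist_eq]
    refine ContDiffBump.dist_normed_convolution_le hf.continuous.aestronglyMeasurable fun y hy => ?_
    refine (hf.dist_le_mul y x).trans (mul_le_mul_of_nonneg_left (le_of_lt hy) K.coe_nonneg)
  refine ofLipschitz_mem_H10_of_tendsto hΩ hb hf hF (fun n => ?_)
    (ε := fun n => K * (ρ n).rOut) (by simpa using hout.const_mul (K : ℝ)) hclose ?_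
  · refine ofLipschitz_mem_H10_of_isTestFunction hΩ hb (hF n) ⟨?_, ?_, ?_⟩
    · exact (ρ n).hasCompactSupport_normed.contDiff_convolution_left _ (ρ n).contDiff_normed
        hf.continuous.locallyIntegrable
    · exact (ρ n).hasCompactSupport_normed.convolution _ hfc
    · refine subset_trans ?_ hδΩ
      refine closure_minimal ?_ Metric.isClosed_cthickening
      refine (support_convolution_subset _).trans ?_
      rintro _ ⟨a, ha, b, hb', rfl⟩
      rw [(ρ n).support_normed_eq, mem_ball_zero_iff] at ha
      refine Metric.mem_cthickening_of_dist_le _ b δ _ (subset_tsupport f hb') ?_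
      rw [dist_eq_norm]
      simp only [add_sub_cancel_right]
      refine ha.le.trans ?_
      change δ / ((n : ℝ) + 1) ≤ δ
      exact div_le_self hδ.le (by have : (0 : ℝ) ≤ n := n.cast_nonneg
                                  linarith)
  · refine ae_restrict_of_ae ?_
    have hloc : LocallyIntegrable (gradient f) volume := by
      refine (locallyIntegrable_const (K : ℝ)).mono
        (measurable_gradient f).aestronglyMeasurable (Eventually.of_forall fun x => ?_)
      refine (norm_gradient_le hf x).trans (le_abs_self _)
    have := ContDiffBump.ae_convolution_tendsto_right_of_locallyIntegrable (μ := volume)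
      (φ := ρ) (K := 2) hout (Eventually.of_forall fun n => by
        change δ / ((n : ℝ) + 1) ≤ 2 * (δ / (2 * (n + 1)))
        apply le_of_eq; field_simp) hloc
    filter_upwards [this] with x hx
    refine hx.congr fun n => ?_
    exact (gradient_convolution hf (ρ n).continuous_normed (ρ n).hasCompactSupport_normed x).symm

/-- Soft thresholding at level `δ`. -/
def shrink (δ t : ℝ) : ℝ := max (t - δ) 0 - max (-t - δ) 0

lemma shrink_lipschitz {δ : ℝ} (hδ : 0 ≤ δ) : LipschitzWith 1 (shrink δ) := by
  refine LipschitzWith.of_dist_le_mul fun a b => ?_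
  simp only [Real.dist_eq, shrink, NNReal.coe_one, one_mul]
  rcases max_cases (a - δ) 0 with h1 | h1 <;> rcases max_cases (-a - δ) 0 with h2 | h2 <;>
  rcases max_cases (b - δ) 0 with h3 | h3 <;> rcases max_cases (-b - δ) 0 with h4 | h4 <;>
  rcases abs_cases (a - b) with h5 | h5 <;> rw [abs_le] <;> constructor <;> linarith

lemma abs_shrink_sub_le {δ : ℝ} (hδ : 0 ≤ δ) (t : ℝ) : |shrink δ t - t| ≤ δ := by
  simp only [shrink]
  rcases max_cases (t - δ) 0 with h1 | h1 <;> rcases max_cases (-t - δ) 0 with h2 | h2 <;>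
    rw [abs_le] <;> constructor <;> linarith

lemma shrink_eq_zero {δ t : ℝ} (h : |t| ≤ δ) : shrink δ t = 0 := by
  rw [abs_le] at h
  rw [shrink, max_eq_right (by linarith), max_eq_right (by linarith), sub_zero]

lemma shrink_of_lt {δ t : ℝ} (hδ : 0 ≤ δ) (h : δ < t) : shrink δ t = t - δ := by
  rw [shrink, max_eq_left (by linarith), max_eq_right (by linarith), sub_zero]

lemma shrink_of_lt_neg {δ t : ℝ} (hδ : 0 ≤ δ) (h : t < -δ) : shrink δ t = t + δ := by
  rw [shrink, max_eq_right (by linarith), max_eq_left (by linarith)]; ring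

/-- A Lipschitz function vanishing outside `Ω` is in `H¹₀(Ω)`: its truncations by soft thresholding
have compact support in `Ω`. The hypothesis `hae` makes the convergence of their gradients
obvious. -/
lemma ofLipschitz_mem_H10 (hΩ : IsOpen Ω) (hb : Bornology.IsBounded Ω)
    {f : Plane → ℝ} {K : NNReal} (hf : LipschitzWith K f) (hfΩ : ∀ x ∉ Ω, f x = 0)
    (hae : ∀ᵐ x ∂(volume.restrict Ω), f x ≠ 0 ∨ f =ᶠ[𝓝 x] 0) :
    H1.ofLipschitz hΩ hb hf ∈ H10 Ω := by
  have hpos : ∀ n : ℕ, (0 : ℝ) < 1 / ((n : ℝ) + 1) := fun n => by positivity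
  have hlim := tendsto_one_div_add_atTop_nhds_zero_nat (𝕜 := ℝ)
  have hF : ∀ n : ℕ, LipschitzWith K (fun x => shrink (1 / ((n : ℝ) + 1)) (f x)) := fun n => by
    have := (shrink_lipschitz (hpos n).le).comp hf
    rwa [one_mul] at this
  refine ofLipschitz_mem_H10_of_tendsto hΩ hb hf hF (fun n => ?_)
    (ε := fun n => 1 / ((n : ℝ) + 1)) hlim
    (fun n x => abs_shrink_sub_le (hpos n).le _) ?_
  · refine ofLipschitz_mem_H10_of_tsupport_subset hΩ hb (hF n) ?_
    have hcl : IsClosed {x | 1 / ((n : ℝ) + 1) ≤ |f x|} :=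
      isClosed_le continuous_const hf.continuous.abs
    refine (closure_minimal (fun x hx => ?_) hcl).trans (fun x hx => ?_)
    · by_contra hx'
      exact hx (shrink_eq_zero (not_le.1 hx').le)
    · by_contra hx'
      have h1 : 1 / ((n : ℝ) + 1) ≤ |f x| := hx
      rw [hfΩ x hx', abs_zero] at h1
      exact absurd h1 (not_le.2 (hpos n))
  · filter_upwards [hae] with x hx
    refine tendsto_const_nhds.congr' ?_
    rcases hx with hx | hx
    · have habs : 0 < |f x| := abs_pos.2 hx
      filter_upwards [hlim.eventually (gt_mem_nhds habs)] with n hn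
      rcases lt_or_gt_of_ne hx with h0 | h0
      · have h1 : ∀ᶠ y in 𝓝 x, f y < -(1 / ((n : ℝ) + 1)) :=
          hf.continuous.continuousAt.eventually_lt continuousAt_const
            (by rw [abs_of_neg h0] at hn; linarith)
        have h2 : (fun y => shrink (1 / ((n : ℝ) + 1)) (f y))
            =ᶠ[𝓝 x] fun y => f y + 1 / ((n : ℝ) + 1) := by
          filter_upwards [h1] with y hy
          exact shrink_of_lt_neg (hpos n).le hy
        rw [gradient, gradient, h2.fderiv_eq, fderiv_add_const]
      · have h1 : ∀ᶠ y in 𝓝 x, 1 / ((n : ℝ) + 1) < f y :=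
          continuousAt_const.eventually_lt hf.continuous.continuousAt
            (by rw [abs_of_pos h0] at hn; linarith)
        have h2 : (fun y => shrink (1 / ((n : ℝ) + 1)) (f y))
            =ᶠ[𝓝 x] fun y => f y - 1 / ((n : ℝ) + 1) := by
          filter_upwards [h1] with y hy
          exact shrink_of_lt (hpos n).le hy
        rw [gradient, gradient, h2.fderiv_eq, fderiv_sub_const]
    · refine Eventually.of_forall fun n => ?_
      have h2 : (fun y => shrink (1 / ((n : ℝ) + 1)) (f y)) =ᶠ[𝓝 x] f := by
        filter_upwards [hx] with y hy
        rw [hy]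
        exact shrink_eq_zero (by simpa using (hpos n).le)
      simp only [gradient, h2.fderiv_eq]

end Approximation

end PlateFEM

namespace PlateFEM

/-! ### A Poincaré inequality with point values -/

lemma sq_integral_mul_le {α : Type*} [MeasurableSpace α] {μ : Measure α} {f g : α → ℝ}
    (hf : Integrable (fun x => f x ^ 2) μ) (hg : Integrable (fun x => g x ^ 2) μ)
    (hfg : Integrable (fun x => f x * g x) μ) :
    (∫ x, f x * g x ∂μ) ^ 2 ≤ (∫ x, f x ^ 2 ∂μ) * ∫ x, g x ^ 2 ∂μ := by
  have key : ∀ t : ℝ, 0 ≤ (∫ x, f x ^ 2 ∂μ) * (t * t) + (2 * ∫ x, f x * g x ∂μ) * t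
      + ∫ x, g x ^ 2 ∂μ := by
    intro t
    have h : ∫ x, (t * f x + g x) ^ 2 ∂μ = (∫ x, f x ^ 2 ∂μ) * (t * t)
        + (2 * ∫ x, f x * g x ∂μ) * t + ∫ x, g x ^ 2 ∂μ := by
      have e : ∀ x, (t * f x + g x) ^ 2
          = (t * t) * f x ^ 2 + (2 * t) * (f x * g x) + g x ^ 2 := fun x => by ring
      simp only [e]
      have i1 : Integrable (fun x => (t * t) * f x ^ 2 + (2 * t) * (f x * g x)) μ :=
        (hf.const_mul _).add (hfg.const_mul _)
      rw [integral_add i1 hg, integral_add (hf.const_mul _) (hfg.const_mul _),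
        integral_const_mul, integral_const_mul]
      ring
    rw [← h]
    exact integral_nonneg fun x => sq_nonneg _
  have := discrim_le_zero key
  rw [discrim] at this
  linarith

lemma sq_setIntegral_le {α : Type*} [MeasurableSpace α] {μ : Measure α} {s : Set α} {f : α → ℝ}
    (hs : μ s ≠ ⊤) (hf : IntegrableOn f s μ) (hf2 : IntegrableOn (fun x => f x ^ 2) s μ) :
    (∫ x in s, f x ∂μ) ^ 2 ≤ μ.real s * ∫ x in s, f x ^ 2 ∂μ := by
  have : IsFiniteMeasure (μ.restrict s) := ⟨by simpa using hs.lt_top⟩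
  have h := sq_integral_mul_le (μ := μ.restrict s) (f := fun _ => 1) (g := f)
    (by simp) hf2 (by simpa [IntegrableOn] using hf)
  simpa using h

lemma sq_sub_le_integral_deriv {f f' : ℝ → ℝ} {g : ℝ → ℝ} {L a b : ℝ} (hL : 0 ≤ L)
    (hf : ∀ x, HasDerivAt f (f' x) x)
    (hf' : Continuous f') (hg : Continuous g) (hfg : ∀ x, f' x ^ 2 ≤ g x)
    (ha : a ∈ Icc (-L) L) (hb : b ∈ Icc (-L) L) :
    (f a - f b) ^ 2 ≤ 2 * L * ∫ x in Icc (-L) L, g x := by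
  have h1 : f a - f b = ∫ x in b..a, f' x :=
    (intervalIntegral.integral_eq_sub_of_hasDerivAt (fun x _ => hf x)
      (hf'.intervalIntegrable _ _)).symm
  have hsub : Set.uIoc b a ⊆ Icc (-L) L := by
    intro x hx
    rw [Set.mem_uIoc] at hx
    rcases hx with hx | hx <;> constructor <;> linarith [hx.1, hx.2, ha.1, ha.2, hb.1, hb.2]
  have hi : IntegrableOn (fun x => |f' x|) (Icc (-L) L) := hf'.abs.integrableOn_Icc
  have h2 : |f a - f b| ≤ ∫ x in Icc (-L) L, |f' x| := by
    rw [h1]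
    have h : ‖∫ x in b..a, f' x‖ ≤ ∫ x in Set.uIoc b a, ‖f' x‖ :=
      intervalIntegral.norm_integral_le_integral_norm_uIoc
    refine h.trans ?_
    exact setIntegral_mono_set hi (Eventually.of_forall fun x => abs_nonneg _)
      (Eventually.of_forall hsub)
  have h3 : (∫ x in Icc (-L) L, |f' x|) ^ 2
      ≤ volume.real (Icc (-L) L) * ∫ x in Icc (-L) L, |f' x| ^ 2 :=
    sq_setIntegral_le (by simp) hi (hf'.abs.pow 2).integrableOn_Icc
  have h4 : ∫ x in Icc (-L) L, |f' x| ^ 2 ≤ ∫ x in Icc (-L) L, g x :=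
    setIntegral_mono (hf'.abs.pow 2).integrableOn_Icc hg.integrableOn_Icc
      fun x => by simpa using hfg x
  have h5 : volume.real (Icc (-L) L) = 2 * L := by
    rw [Real.volume_real_Icc_of_le (by linarith)]; ring
  rw [h5] at h3
  calc (f a - f b) ^ 2 = |f a - f b| ^ 2 := (sq_abs _).symm
    _ ≤ (∫ x in Icc (-L) L, |f' x|) ^ 2 := pow_le_pow_left₀ (abs_nonneg _) h2 2
    _ ≤ 2 * L * ∫ x in Icc (-L) L, |f' x| ^ 2 := h3
    _ ≤ _ := by gcongr

/-- A function on a square minus its value at a suitable point of a horizontal segment is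
controlled in `L²` by its gradient. -/
lemma exists_setIntegral_square_le {f f₁ f₂ g : ℝ → ℝ → ℝ} {L ℓ : ℝ} (hℓ : 0 < ℓ) (hℓL : ℓ ≤ L)
    (hfc : Continuous fun z : ℝ × ℝ => f z.1 z.2)
    (hf₁ : ∀ x y, HasDerivAt (fun x => f x y) (f₁ x y) x)
    (hf₂ : ∀ x y, HasDerivAt (fun y => f x y) (f₂ x y) y)
    (hc₁ : ∀ y, Continuous fun x => f₁ x y) (hc₂ : ∀ x, Continuous fun y => f₂ x y)
    (hg : Continuous fun z : ℝ × ℝ => g z.1 z.2)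
    (h₁ : ∀ x y, f₁ x y ^ 2 ≤ g x y) (h₂ : ∀ x y, f₂ x y ^ 2 ≤ g x y) :
    ∃ s ∈ Icc 0 ℓ, ∫ z in Icc (-L) L ×ˢ Icc (-L) L, (f z.1 z.2 - f s 0) ^ 2
      ≤ (8 * L ^ 2 + 16 * L ^ 3 / ℓ) * ∫ z in Icc (-L) L ×ˢ Icc (-L) L, g z.1 z.2 := by
  have hL : 0 < L := hℓ.trans_le hℓL
  set I := Icc (-L) L with hI
  have hvol : volume.real I = 2 * L := by
    rw [hI, Real.volume_real_Icc_of_le (by linarith)]; ring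
  have hcomp : IsCompact (I ×ˢ I) := isCompact_Icc.prod isCompact_Icc
  have hgx : ∀ y, Continuous fun x => g x y := fun y =>
    hg.comp (continuous_id.prodMk continuous_const)
  have hgy : ∀ x, Continuous fun y => g x y := fun x =>
    hg.comp (continuous_const.prodMk continuous_id)
  have hg0 : ∀ x y, 0 ≤ g x y := fun x y => (sq_nonneg _).trans (h₁ x y)
  have hgi : IntegrableOn (fun z : ℝ × ℝ => g z.1 z.2) (I ×ˢ I) :=
    hg.continuousOn.integrableOn_compact hcomp
  set J := ∫ z in I ×ˢ I, g z.1 z.2 with hJ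
  have hV : Continuous fun x => ∫ y in I, g x y :=
    continuous_parametric_integral_of_continuous (by exact hg) isCompact_Icc
  have hH : Continuous fun y => ∫ x in I, g x y :=
    continuous_parametric_integral_of_continuous (f := fun y x => g x y)
      (by exact hg.comp continuous_swap) isCompact_Icc
  have hJV : J = ∫ x in I, ∫ y in I, g x y := by
    rw [hJ, Measure.volume_eq_prod, setIntegral_prod _ hgi]
  have hJH : J = ∫ y in I, ∫ x in I, g x y := by
    rw [hJV]
    refine integral_integral_swap ?_
    rw [Measure.prod_restrict]; exact hgi
  -- some vertical line through the segment carries at most the average energy; a point of the square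
  -- is joined to it horizontally, and then vertically along it to the segment
  obtain ⟨s, hs, hsV⟩ : ∃ s ∈ Icc 0 ℓ, ∫ y in I, g s y ≤ J / ℓ := by
    have hv : volume.real (Icc 0 ℓ) = ℓ := by
      rw [Real.volume_real_Icc_of_le hℓ.le]; ring
    obtain ⟨s, hs, h⟩ := exists_le_setAverage (μ := volume) (s := Icc 0 ℓ)
      (f := fun x => ∫ y in I, g x y) (by simp [hℓ]) (by simp) hV.integrableOn_Icc
    refine ⟨s, hs, h.trans ?_⟩
    rw [setAverage_eq, hv, smul_eq_mul, div_eq_inv_mul]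
    refine mul_le_mul_of_nonneg_left ?_ (by positivity)
    rw [hJV]
    refine setIntegral_mono_set hV.integrableOn_Icc
      (Eventually.of_forall fun x => integral_nonneg fun y => hg0 x y)
      (Eventually.of_forall fun x hx => ?_)
    exact ⟨by linarith [hx.1], hx.2.trans hℓL⟩
  refine ⟨s, hs, ?_⟩
  have hsI : s ∈ I := ⟨by linarith [hs.1], hs.2.trans hℓL⟩
  have h0I : (0 : ℝ) ∈ I := ⟨by linarith, hL.le⟩
  have hpt : ∀ z ∈ I ×ˢ I, (f z.1 z.2 - f s 0) ^ 2
      ≤ 4 * L * (∫ x in I, g x z.2) + 4 * L * ∫ y in I, g s y := by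
    intro z hz
    have e1 := sq_sub_le_integral_deriv hL.le (fun x => hf₁ x z.2) (hc₁ z.2) (hgx z.2)
      (fun x => h₁ x z.2) hz.1 hsI
    have e2 := sq_sub_le_integral_deriv hL.le (fun y => hf₂ s y) (hc₂ s) (hgy s)
      (fun y => h₂ s y) hz.2 h0I
    nlinarith [sq_nonneg ((f z.1 z.2 - f s z.2) - (f s z.2 - f s 0))]
  have hfin : volume (I ×ˢ I) ≠ ⊤ := hcomp.measure_lt_top.ne
  have hint1 : IntegrableOn (fun z : ℝ × ℝ => 4 * L * ∫ x in I, g x z.2) (I ×ˢ I) :=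
    (continuous_const.mul (hH.comp continuous_snd)).continuousOn.integrableOn_compact hcomp
  have hint2 : IntegrableOn (fun _ : ℝ × ℝ => 4 * L * ∫ y in I, g s y) (I ×ˢ I) :=
    integrableOn_const hfin
  have hint0 : IntegrableOn (fun z : ℝ × ℝ => (f z.1 z.2 - f s 0) ^ 2) (I ×ˢ I) :=
    ((hfc.sub continuous_const).pow 2).continuousOn.integrableOn_compact hcomp
  have hmono := setIntegral_mono_on hint0 (hint1.add hint2)
    (measurableSet_Icc.prod measurableSet_Icc) hpt
  refine hmono.trans ?_
  rw [integral_add' hint1 hint2]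
  have i1 : ∫ z in I ×ˢ I, 4 * L * ∫ x in I, g x z.2 = 8 * L ^ 2 * J := by
    have : IntegrableOn (fun z : ℝ × ℝ => 4 * L * ∫ x in I, g x z.2) (I ×ˢ I)
      (volume.prod volume) := hint1
    rw [Measure.volume_eq_prod, setIntegral_prod _ this]
    simp only [integral_const_mul, integral_const, MeasurableSet.univ, measureReal_restrict_apply,
      univ_inter, hvol, smul_eq_mul]
    rw [← hJH]; ring
  have i2 : ∫ _ in I ×ˢ I, 4 * L * ∫ y in I, g s y
      = 16 * L ^ 3 * ∫ y in I, g s y := by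
    have : volume.real (I ×ˢ I) = (2 * L) * (2 * L) := by
      rw [Measure.volume_eq_prod, measureReal_prod_prod, hvol]
    rw [setIntegral_const, this, smul_eq_mul]; ring
  rw [i1, i2]
  have : 16 * L ^ 3 * ∫ y in I, g s y ≤ 16 * L ^ 3 * (J / ℓ) := by gcongr
  calc _ ≤ 8 * L ^ 2 * J + 16 * L ^ 3 * (J / ℓ) := by linarith
    _ = _ := by ring

/-- Orthonormal coordinates on the plane with origin `p` and first axis `e`. -/
lemma exists_coordinates (p e : Plane) (he : ‖e‖ = 1) :
    ∃ (Ψ : ℝ × ℝ ≃ᵐ Plane) (e' : Plane), MeasurePreserving Ψ volume volume ∧ ‖e'‖ = 1 ∧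
      (∀ z, Ψ z = p + z.1 • e + z.2 • e') ∧
      ∀ z : ℝ × ℝ, ‖z.1 • e + z.2 • e'‖ ^ 2 = z.1 ^ 2 + z.2 ^ 2 := by
  have hv : Orthonormal ℝ ((({0} : Set (Fin 2))).domRestrict (fun _ : Fin 2 => e)) := by
    refine ⟨fun i => he, fun i j hij => absurd (Subsingleton.elim i j) hij⟩
  obtain ⟨b, hb⟩ := hv.exists_orthonormalBasis_extension_of_card_eq (by simp)
  have hb0 : b 0 = e := hb 0 rfl
  refine ⟨(MeasurableEquiv.finTwoArrow.symm.trans (MeasurableEquiv.toLp 2 (Fin 2 → ℝ))).trans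
    (b.measurableEquiv.symm.trans (MeasurableEquiv.addLeft p)), b 1, ?_, b.norm_eq_one 1, ?_, ?_⟩
  · have h1 := (volume_preserving_finTwoArrow ℝ).symm
    have h2 : MeasurePreserving (MeasurableEquiv.toLp 2 (Fin 2 → ℝ)) volume volume :=
      PiLp.volume_preserving_toLp (Fin 2)
    have h3 := b.measurePreserving_measurableEquiv.symm
    have h4 := measurePreserving_add_left (volume : Measure Plane) p
    exact (h4.comp h3).comp (h2.comp h1)
  · intro z
    change p + b.repr.symm (WithLp.toLp 2 ![z.1, z.2]) = _
    rw [← b.sum_repr_symm, Fin.sum_univ_two, hb0, add_assoc]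
    simp
  · intro z
    have h01 : inner ℝ e (b 1) = 0 := by
      rw [← hb0]; exact b.orthonormal.2 (by decide)
    rw [norm_add_sq_real, norm_smul, norm_smul, he, b.norm_eq_one, inner_smul_left,
      inner_smul_right, h01]
    simp

/-- The `L²` distance of `φ` on a disc to its value at some point of a given radial segment is
controlled by the gradient on the concentric disc of twice the radius. -/
lemma exists_setIntegral_sub_sq_le {φ : Plane → ℝ} (hφ : ContDiff ℝ 1 φ) (p : Plane) {e : Plane}
    (he : ‖e‖ = 1) {L ℓ : ℝ} (hℓ : 0 < ℓ) (hℓL : ℓ ≤ L) :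
    ∃ s ∈ Icc 0 ℓ, ∫ x in Metric.closedBall p L, (φ x - φ (p + s • e)) ^ 2
      ≤ (8 * L ^ 2 + 16 * L ^ 3 / ℓ) *
        ∫ x in Metric.closedBall p (2 * L), ‖gradient φ x‖ ^ 2 := by
  have hL : 0 < L := hℓ.trans_le hℓL
  obtain ⟨Ψ, e', hΨ, he', hΨeq, hnorm⟩ := exists_coordinates p e he
  have hcΨ : Continuous Ψ := by
    have : (Ψ : ℝ × ℝ → Plane) = fun z => p + z.1 • e + z.2 • e' := funext hΨeq
    rw [this]; fun_prop
  have hgc : Continuous (gradient φ) :=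
    (LinearIsometryEquiv.continuous _).comp (hφ.continuous_fderiv (by simp))
  have hfd : Continuous (fderiv ℝ φ) := hφ.continuous_fderiv (by simp)
  have hd : ∀ x, HasFDerivAt φ (fderiv ℝ φ x) x := fun x =>
    (hφ.differentiable (by simp) x).hasFDerivAt
  have hsq : ∀ x v : Plane, ‖v‖ = 1 → fderiv ℝ φ x v ^ 2 ≤ ‖gradient φ x‖ ^ 2 := by
    intro x v hv
    rw [← sq_abs, norm_gradient]
    have := (fderiv ℝ φ x).le_opNorm v
    rw [hv, mul_one] at this
    exact pow_le_pow_left₀ (abs_nonneg _) this 2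
  obtain ⟨s, hs, h⟩ := exists_setIntegral_square_le (f := fun x y => φ (Ψ (x, y)))
    (f₁ := fun x y => fderiv ℝ φ (Ψ (x, y)) e) (f₂ := fun x y => fderiv ℝ φ (Ψ (x, y)) e')
    (g := fun x y => ‖gradient φ (Ψ (x, y))‖ ^ 2) hℓ hℓL
    (hφ.continuous.comp hcΨ)
    (fun x y => by
      have h1 : HasDerivAt (fun x : ℝ => Ψ (x, y)) e x := by
        simp only [hΨeq]
        simpa using (((hasDerivAt_id x).smul_const e).const_add p).add_const (y • e')
      exact (hd _).comp_hasDerivAt x h1)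
    (fun x y => by
      have h1 : HasDerivAt (fun y : ℝ => Ψ (x, y)) e' y := by
        simp only [hΨeq]
        simpa using ((hasDerivAt_id y).smul_const e').const_add (p + x • e)
      exact (hd _).comp_hasDerivAt y h1)
    (fun y => (hfd.comp (hcΨ.comp (continuous_id.prodMk continuous_const))).clm_apply
      continuous_const)
    (fun x => (hfd.comp (hcΨ.comp (continuous_const.prodMk continuous_id))).clm_apply
      continuous_const)
    ((hgc.comp hcΨ).norm.pow 2) (fun x y => hsq _ _ he) (fun x y => hsq _ _ he')
  refine ⟨s, hs, ?_⟩
  have hs0 : Ψ (s, 0) = p + s • e := by rw [hΨeq]; simp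
  have hdist : ∀ z, dist (Ψ z) p ^ 2 = z.1 ^ 2 + z.2 ^ 2 := by
    intro z
    rw [dist_eq_norm, hΨeq, ← hnorm]
    congr 2; abel
  have hcomp : IsCompact (Icc (-L) L ×ˢ Icc (-L) L) := isCompact_Icc.prod isCompact_Icc
  have hF : Continuous fun z : ℝ × ℝ => (φ (Ψ z) - φ (p + s • e)) ^ 2 :=
    ((hφ.continuous.comp hcΨ).sub continuous_const).pow 2
  have hG : Continuous fun x => ‖gradient φ x‖ ^ 2 := hgc.norm.pow 2
  have hsub1 : Ψ ⁻¹' Metric.closedBall p L ⊆ Icc (-L) L ×ˢ Icc (-L) L := by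
    intro z hz
    have h1 : dist (Ψ z) p ≤ L := hz
    have h2 := hdist z
    have h3 : dist (Ψ z) p ^ 2 ≤ L ^ 2 := pow_le_pow_left₀ dist_nonneg h1 2
    exact ⟨abs_le.1 (abs_le_of_sq_le_sq (by nlinarith [sq_nonneg z.2]) hL.le),
      abs_le.1 (abs_le_of_sq_le_sq (by nlinarith [sq_nonneg z.1]) hL.le)⟩
  have hsub2 : Icc (-L) L ×ˢ Icc (-L) L ⊆ Ψ ⁻¹' Metric.closedBall p (2 * L) := by
    intro z hz
    have h1 : z.1 ^ 2 ≤ L ^ 2 := sq_le_sq' hz.1.1 hz.1.2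
    have h2 : z.2 ^ 2 ≤ L ^ 2 := sq_le_sq' hz.2.1 hz.2.2
    have h3 := hdist z
    refine abs_le_of_sq_le_sq (a := dist (Ψ z) p) (b := 2 * L) ?_ (by linarith) |> abs_le.1 |>.2
    nlinarith [sq_nonneg L]
  have t1 := hΨ.setIntegral_preimage_emb Ψ.measurableEmbedding
    (fun x => (φ x - φ (p + s • e)) ^ 2) (Metric.closedBall p L)
  have t2 := hΨ.setIntegral_preimage_emb Ψ.measurableEmbedding
    (fun x => ‖gradient φ x‖ ^ 2) (Metric.closedBall p (2 * L))
  simp only [hs0] at h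
  rw [← t1, ← t2]
  have u1 : ∫ z in Ψ ⁻¹' Metric.closedBall p L, (φ (Ψ z) - φ (p + s • e)) ^ 2
      ≤ ∫ z in Icc (-L) L ×ˢ Icc (-L) L, (φ (Ψ z) - φ (p + s • e)) ^ 2 :=
    setIntegral_mono_set (hF.continuousOn.integrableOn_compact hcomp)
      (Eventually.of_forall fun z => sq_nonneg _) (Eventually.of_forall hsub1)
  have u2 : ∫ z in Icc (-L) L ×ˢ Icc (-L) L, ‖gradient φ (Ψ z)‖ ^ 2
      ≤ ∫ z in Ψ ⁻¹' Metric.closedBall p (2 * L), ‖gradient φ (Ψ z)‖ ^ 2 := by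
    refine setIntegral_mono_set ?_ (Eventually.of_forall fun z => sq_nonneg _)
      (Eventually.of_forall hsub2)
    rw [← Function.comp_def (fun x => ‖gradient φ x‖ ^ 2) Ψ,
      hΨ.integrableOn_comp_preimage Ψ.measurableEmbedding]
    exact hG.continuousOn.integrableOn_compact (isCompact_closedBall _ _)
  refine u1.trans (h.trans ?_)
  exact mul_le_mul_of_nonneg_left u2 (by positivity)

/-! ### The boundary of a polygonal domain -/

lemma exists_pos_forall_le {ι : Type*} (s : Finset ι) (f : ι → ℝ) (hf : ∀ i ∈ s, 0 < f i) :
    ∃ c > 0, ∀ i ∈ s, c ≤ f i := by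
  rcases s.eq_empty_or_nonempty with rfl | hs
  · exact ⟨1, one_pos, by simp⟩
  · obtain ⟨i, hi, h⟩ := s.exists_min_image f hs
    exact ⟨f i, hf i hi, h⟩

lemma exists_direction_of_mem_segment {a b p : Plane} (hab : a ≠ b) (hp : p ∈ segment ℝ a b) :
    ∃ e : Plane, ‖e‖ = 1 ∧ ∀ s ∈ Icc 0 (‖b - a‖ / 2), p + s • e ∈ segment ℝ a b := by
  have hn : 0 < ‖b - a‖ := norm_pos_iff.2 (sub_ne_zero.2 hab.symm)
  rw [segment_eq_image'] at hp ⊢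
  obtain ⟨t, ht, rfl⟩ := hp
  rcases le_total t (1 / 2) with h | h
  · refine ⟨‖b - a‖⁻¹ • (b - a), by rw [norm_smul, norm_inv, norm_norm, inv_mul_cancel₀ hn.ne'],
      fun s hs => ⟨t + s * ‖b - a‖⁻¹, ⟨?_, ?_⟩, ?_⟩⟩
    · have := hs.1; have := ht.1; positivity
    · have : s * ‖b - a‖⁻¹ ≤ 1 / 2 := by
        rw [← div_eq_mul_inv, div_le_iff₀ hn]; linarith [hs.2]
      linarith
    · simp only [add_smul, smul_smul, add_assoc]
  · refine ⟨-(‖b - a‖⁻¹ • (b - a)), by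
      rw [norm_neg, norm_smul, norm_inv, norm_norm, inv_mul_cancel₀ hn.ne'],
      fun s hs => ⟨t - s * ‖b - a‖⁻¹, ⟨?_, ?_⟩, ?_⟩⟩
    · have : s * ‖b - a‖⁻¹ ≤ 1 / 2 := by
        rw [← div_eq_mul_inv, div_le_iff₀ hn]; linarith [hs.2]
      linarith
    · have : 0 ≤ s * ‖b - a‖⁻¹ := mul_nonneg hs.1 (by positivity)
      linarith [ht.2]
    · simp only [sub_smul, smul_neg, smul_smul]; abel

lemma exists_ne_zero_inner_eq_zero (v : Plane) : ∃ w : Plane, w ≠ 0 ∧ inner ℝ v w = 0 := by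
  by_cases hv : v = 0
  · exact ⟨EuclideanSpace.single 0 1, by simp, by simp [hv]⟩
  · refine ⟨!₂[-v 1, v 0], ?_, ?_⟩
    · intro h
      apply hv
      ext k
      have h0 := congrArg (fun z : Plane => z 0) h
      have h1 := congrArg (fun z : Plane => z 1) h
      fin_cases k
      · simpa using h1
      · simpa using h0
    · simp [PiLp.inner_apply, Fin.sum_univ_two]; ring

/-- The boundary of a polygonal domain has no isolated points: around an isolated boundary point a
punctured disc would lie in `Ω`, and the point would be interior to the closure of `Ω`, which is
`Ω` itself. -/
lemma IsPolygonalDomain.frontier_accumulation {Ω : Set Plane} (hΩ : IsPolygonalDomain Ω)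
    {p : Plane} (hp : p ∈ frontier Ω) {r : ℝ} (hr : 0 < r) :
    ∃ q ∈ frontier Ω, q ≠ p ∧ dist q p < r := by
  by_contra! hcon
  have hpΩ : p ∉ Ω := by
    rw [hΩ.isOpen.frontier_eq] at hp; exact hp.2
  have hball : ∀ q ∈ Metric.ball p r, q ∈ frontier Ω → q = p := fun q hq hqf => by
    by_contra h
    exact absurd (hcon q hqf h) (not_le.2 hq)
  have hseg : ∀ x ∈ Metric.ball p r, x ∈ Ω → ∀ y ∈ Metric.ball p r, p ∉ segment ℝ x y → y ∈ Ω := by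
    intro x hx hxΩ y hy hpxy
    by_contra hyΩ
    obtain ⟨q, hq, hqf⟩ : ∃ q ∈ segment ℝ x y, q ∈ frontier Ω := by
      by_contra! hno
      have hyc : y ∉ closure Ω := fun hyc =>
        hno y (right_mem_segment ℝ x y) (by rw [hΩ.isOpen.frontier_eq]; exact ⟨hyc, hyΩ⟩)
      obtain ⟨q, -, hq1, hq2⟩ := (convex_segment x y).isPreconnected Ω (closure Ω)ᶜ hΩ.isOpen
        isClosed_closure.isOpen_compl (fun q hq => by
          by_contra hq'
          rw [mem_union, not_or, mem_compl_iff, not_not] at hq'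
          exact hno q hq (by rw [hΩ.isOpen.frontier_eq]; exact ⟨hq'.2, hq'.1⟩))
        ⟨x, left_mem_segment ℝ x y, hxΩ⟩ ⟨y, right_mem_segment ℝ x y, hyc⟩
      exact hq2 (subset_closure hq1)
    have hqb : q ∈ Metric.ball p r := (convex_ball p r).segment_subset hx hy hq
    rw [hball q hqb hqf] at hq
    exact hpxy hq
  obtain ⟨x, hxΩ, hxp⟩ := Metric.mem_closure_iff.1 (frontier_subset_closure hp) r hr
  rw [dist_comm] at hxp
  -- a point of the disc is joined to `x`, or to a second point of `Ω` off the line through `x` and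
  -- `p`, by a segment that avoids `p`
  obtain ⟨w, hw0, hw⟩ := exists_ne_zero_inner_eq_zero (x - p)
  obtain ⟨ε, hε, hεb⟩ : ∃ ε : ℝ, 0 < ε ∧ x + ε • w ∈ Metric.ball p r ∩ Ω := by
    have hc : Tendsto (fun ε : ℝ => x + ε • w) (𝓝[>] 0) (𝓝 x) := by
      have : Continuous fun ε : ℝ => x + ε • w := by fun_prop
      simpa using (this.tendsto 0).mono_left nhdsWithin_le_nhds
    have hev := hc.eventually ((Metric.isOpen_ball.inter hΩ.isOpen).mem_nhds
      (⟨hxp, hxΩ⟩ : x ∈ Metric.ball p r ∩ Ω))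
    obtain ⟨ε, h1, h2⟩ := (hev.and self_mem_nhdsWithin).exists
    exact ⟨ε, h2, h1⟩
  have hsub : Metric.ball p r ⊆ closure Ω := by
    intro y hy
    by_cases hyp : y = p
    · rw [hyp]; exact frontier_subset_closure hp
    by_cases h1 : p ∈ segment ℝ x y
    · by_cases h2 : p ∈ segment ℝ (x + ε • w) y
      · exfalso
        obtain ⟨a, b, ha, hb, hab, h⟩ := h1
        obtain ⟨a', b', ha', hb', hab', h'⟩ := h2
        have e1 : b • (y - p) = -(a • (x - p)) := by
          have : a • (x - p) + b • (y - p) = 0 := by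
            rw [smul_sub, smul_sub, ← add_sub_add_comm, h, ← add_smul, hab, one_smul, sub_self]
          exact eq_neg_of_add_eq_zero_right this
        have e2 : a' • (x - p) + (a' * ε) • w + b' • (y - p) = 0 := by
          have : a' • (x + ε • w) + b' • y - (a' + b') • p = 0 := by
            rw [h', hab', one_smul, sub_self]
          rw [← this]; module
        have hyw : b * inner ℝ (y - p) w = 0 := by
          have := congrArg (fun z => inner ℝ z w) e1
          simp only [inner_smul_left, inner_neg_left, hw] at this
          simpa using this
        have e3 := congrArg (fun z => inner ℝ z w) e2
        simp only [inner_add_left, inner_smul_left, hw, inner_zero_left] at e3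
        have hww : inner ℝ w w ≠ 0 := inner_self_ne_zero.2 hw0
        have hb0 : b ≠ 0 := by
          rintro rfl
          have : a = 1 := by linarith
          rw [this, one_smul, zero_smul, add_zero] at h
          exact hpΩ (h ▸ hxΩ)
        have hyw' : inner ℝ (y - p) w = 0 := (mul_eq_zero.1 hyw).resolve_left hb0
        rw [hyw'] at e3
        have ha0 : a' = 0 := by
          have : a' * ε * inner ℝ w w = 0 := by simpa using e3
          rcases mul_eq_zero.1 this with h3 | h3
          · exact (mul_eq_zero.1 h3).resolve_right hε.ne'
          · exact absurd h3 hww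
        rw [ha0, zero_smul, zero_add] at h'
        have : b' = 1 := by linarith
        rw [this, one_smul] at h'
        exact hyp h'
      · exact subset_closure (hseg _ hεb.1 hεb.2 y hy h2)
    · exact subset_closure (hseg x hxp hxΩ y hy h1)
  apply hpΩ
  rw [← hΩ.interior_closure]
  exact mem_interior.2 ⟨_, hsub, Metric.isOpen_ball, Metric.mem_ball_self hr⟩

/-- Every boundary point is an end point of a boundary segment of length at least `ℓ`. -/
lemma IsPolygonalDomain.exists_boundary_segment {Ω : Set Plane} (hΩ : IsPolygonalDomain Ω) :
    ∃ ℓ : ℝ, 0 < ℓ ∧ ∀ p ∈ frontier Ω, ∃ e : Plane, ‖e‖ = 1 ∧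
      ∀ s ∈ Icc 0 ℓ, p + s • e ∈ frontier Ω := by
  classical
  obtain ⟨F, hF⟩ := hΩ.polygonal
  obtain ⟨ℓ, hℓ, hℓF⟩ := exists_pos_forall_le (F.filter fun e => e.1 ≠ e.2)
    (fun e => ‖e.2 - e.1‖ / 2) (fun e he => by
      have := (Finset.mem_filter.1 he).2
      have : 0 < ‖e.2 - e.1‖ := norm_pos_iff.2 (sub_ne_zero.2 this.symm)
      positivity)
  refine ⟨ℓ, hℓ, fun p hp => ?_⟩
  by_cases h : ∃ e ∈ F, e.1 ≠ e.2 ∧ p ∈ segment ℝ e.1 e.2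
  · obtain ⟨e, heF, hne, hpe⟩ := h
    obtain ⟨d, hd, hds⟩ := exists_direction_of_mem_segment hne hpe
    refine ⟨d, hd, fun s hs => ?_⟩
    rw [hF]
    exact mem_iUnion₂.2 ⟨e, heF, hds s ⟨hs.1, hs.2.trans
      (hℓF e (Finset.mem_filter.2 ⟨heF, hne⟩))⟩⟩
  · exfalso
    push Not at h
    set C : Set Plane := ⋃ e ∈ F.filter (fun e => p ∉ segment ℝ e.1 e.2), segment ℝ e.1 e.2
    have hC : IsClosed C := by
      refine isClosed_biUnion_finset fun e _ => ?_
      rw [segment_eq_image]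
      exact (isCompact_Icc.image (by fun_prop)).isClosed
    have hpC : p ∉ C := by
      intro hp'
      obtain ⟨e, he, hpe⟩ := mem_iUnion₂.1 hp'
      exact (Finset.mem_filter.1 he).2 hpe
    obtain ⟨r, hr, hrC⟩ := Metric.isOpen_iff.1 hC.isOpen_compl p hpC
    obtain ⟨q, hqf, hqp, hqr⟩ := hΩ.frontier_accumulation hp hr
    rw [hF] at hqf
    obtain ⟨e, he, hqe⟩ := mem_iUnion₂.1 hqf
    by_cases hpe : p ∈ segment ℝ e.1 e.2
    · have h12 : e.1 = e.2 := by
        by_contra hne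
        exact h e he hne hpe
      rw [h12, segment_same] at hpe hqe
      exact hqp (hqe.trans hpe.symm)
    · exact hrC hqr (mem_iUnion₂.2 ⟨e, Finset.mem_filter.2 ⟨he, hpe⟩, hqe⟩)

end PlateFEM

namespace PlateFEM

/-! ### Barycentric coordinates on a triangle -/

/-- `t` is the vertex set of a nondegenerate triangle. -/
structure IsTriangle (t : Finset Plane) : Prop where
  card_eq : t.card = 3
  indep : AffineIndependent ℝ ((↑) : t → Plane)

/-- The gradient of a barycentric coordinate, a constant vector. -/
noncomputable def baryGrad (t : Finset Plane) (p : Plane) : Plane := gradient (bary t p) 0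

/-- The cubic bubble function of a triangle. -/
noncomputable def bubble (t : Finset Plane) (x : Plane) : ℝ := ∏ p ∈ t, bary t p x

section Bary

variable {t : Finset Plane} {p : Plane}

lemma exists_affineMap_bary (t : Finset Plane) (p : Plane) :
    ∃ a : Plane →ᵃ[ℝ] ℝ, ∀ x, bary t p x = a x := by
  classical
  by_cases h : (AffineIndependent ℝ ((↑) : t → Plane) ∧
      affineSpan ℝ (range ((↑) : t → Plane)) = ⊤) ∧ p ∈ t
  · exact ⟨_, fun x => by rw [bary, dif_pos h]⟩
  · exact ⟨0, fun x => by rw [bary, dif_neg h]; rfl⟩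

lemma hasGradientAt_of_affineMap (a : Plane →ᵃ[ℝ] ℝ) :
    ∃ g : Plane, (∀ x, HasGradientAt a g x) ∧ ∀ x y, a x = a y + inner ℝ g (x - y) := by
  set A : Plane →L[ℝ] ℝ := LinearMap.toContinuousLinearMap a.linear
  have hxy : ∀ x y, a x = a y + A (x - y) := by
    intro x y
    have := a.linearMap_vsub x y
    change a.linear (x - y) = a x - a y at this
    change a x = a y + a.linear (x - y)
    rw [this]; ring
  refine ⟨(InnerProductSpace.toDual ℝ Plane).symm A, fun x => ?_, fun x y => ?_⟩
  · rw [hasGradientAt_iff_hasFDerivAt, LinearIsometryEquiv.apply_symm_apply]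
    have h : (a : Plane → ℝ) = fun y => a 0 + A y := by
      ext y
      simpa using hxy y 0
    rw [h]
    exact A.hasFDerivAt.const_add _
  · rw [InnerProductSpace.toDual_symm_apply]
    exact hxy x y

lemma bary_eq_add (t : Finset Plane) (p x y : Plane) :
    bary t p x = bary t p y + inner ℝ (baryGrad t p) (x - y) := by
  obtain ⟨a, ha⟩ := exists_affineMap_bary t p
  obtain ⟨g, hg, hxy⟩ := hasGradientAt_of_affineMap a
  have hfun : bary t p = a := funext ha
  rw [baryGrad, hfun, (hg 0).gradient]
  exact hxy x y

lemma hasGradientAt_bary (t : Finset Plane) (p x : Plane) :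
    HasGradientAt (bary t p) (baryGrad t p) x := by
  obtain ⟨a, ha⟩ := exists_affineMap_bary t p
  obtain ⟨g, hg, hxy⟩ := hasGradientAt_of_affineMap a
  have hfun : bary t p = a := funext ha
  rw [baryGrad, hfun, (hg 0).gradient]
  exact hg x

lemma continuous_bary (t : Finset Plane) (p : Plane) : Continuous (bary t p) :=
  continuous_iff_continuousAt.2 fun x => (hasGradientAt_bary t p x).hasFDerivAt.continuousAt

lemma continuous_bubble (t : Finset Plane) : Continuous (bubble t) :=
  continuous_finsetProd _ fun p _ => continuous_bary t p

lemma abs_bary_sub_le (t : Finset Plane) (p x y : Plane) :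
    |bary t p x - bary t p y| ≤ ‖baryGrad t p‖ * dist x y := by
  rw [bary_eq_add t p x y, add_sub_cancel_left, dist_eq_norm]
  exact abs_real_inner_le_norm _ _

namespace IsTriangle

lemma affineSpan_eq_top (ht : IsTriangle t) : affineSpan ℝ (range ((↑) : t → Plane)) = ⊤ := by
  rw [ht.indep.affineSpan_eq_top_iff_card_eq_finrank_add_one]
  simp [ht.card_eq]

lemma nonempty (ht : IsTriangle t) : t.Nonempty := by
  rw [← Finset.card_pos, ht.card_eq]; norm_num

lemma bary_eq (ht : IsTriangle t) (hp : p ∈ t) (x : Plane) : bary t p x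
    = (AffineBasis.mk ((↑) : t → Plane) ht.indep ht.affineSpan_eq_top).coord ⟨p, hp⟩ x := by
  rw [bary, dif_pos ⟨⟨ht.indep, ht.affineSpan_eq_top⟩, hp⟩]

lemma bary_self (ht : IsTriangle t) (hp : p ∈ t) : bary t p p = 1 := by
  rw [ht.bary_eq hp]
  exact AffineBasis.coord_apply_eq (AffineBasis.mk ((↑) : t → Plane) ht.indep
    ht.affineSpan_eq_top) ⟨p, hp⟩

lemma bary_of_ne (ht : IsTriangle t) (hp : p ∈ t) {q : Plane} (hq : q ∈ t) (hpq : p ≠ q) : bary t p q = 0 := by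
  rw [ht.bary_eq hp]
  exact AffineBasis.coord_apply_ne (AffineBasis.mk ((↑) : t → Plane) ht.indep
    ht.affineSpan_eq_top) (i := ⟨p, hp⟩) (j := ⟨q, hq⟩) (fun h => hpq (congrArg Subtype.val h))

lemma sum_bary (ht : IsTriangle t) (x : Plane) : ∑ p ∈ t, bary t p x = 1 := by
  rw [← Finset.sum_coe_sort, ← AffineBasis.sum_coord_apply_eq_one (AffineBasis.mk ((↑) : t → Plane)
    ht.indep ht.affineSpan_eq_top) x]
  exact Finset.sum_congr rfl fun i _ => ht.bary_eq i.2 x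

lemma affineMap_eq_sum (ht : IsTriangle t) (a : Plane →ᵃ[ℝ] ℝ) (x : Plane) :
    a x = ∑ p ∈ t, bary t p x * a p := by
  have h := AffineBasis.affineCombination_coord_eq_self (AffineBasis.mk ((↑) : t → Plane)
    ht.indep ht.affineSpan_eq_top) x
  have hs : ∑ i : t, (AffineBasis.mk ((↑) : t → Plane) ht.indep
    ht.affineSpan_eq_top).coord i x = 1 := AffineBasis.sum_coord_apply_eq_one _ x
  have h2 := Finset.map_affineCombination Finset.univ ((↑) : t → Plane) _ hs a
  have h3 := Finset.affineCombination_eq_linear_combination (Finset.univ : Finset t)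
    (a ∘ ((↑) : t → Plane)) _ hs
  refine (congrArg a h).symm.trans ((h2.trans h3).trans ?_)
  rw [← Finset.sum_coe_sort t]
  refine Finset.sum_congr rfl fun i _ => ?_
  rw [smul_eq_mul, ht.bary_eq i.2]
  rfl

/-- Barycentric coordinates are determined by the representation of the point. -/
lemma bary_eq_of_sum (ht : IsTriangle t) {w : Plane → ℝ} (hw : ∑ q ∈ t, w q = 1) {x : Plane}
    (hx : ∑ q ∈ t, w q • q = x) (hp : p ∈ t) : bary t p x = w p := by
  classical
  obtain ⟨a, ha⟩ := exists_affineMap_bary t p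
  have h : bary t p x = ∑ q ∈ t, w q * bary t p q := by
    have e : ∀ y, bary t p y = bary t p 0 + inner ℝ (baryGrad t p) y := fun y => by
      simpa using bary_eq_add t p y 0
    rw [e x, ← hx, inner_sum]
    calc bary t p 0 + ∑ q ∈ t, inner ℝ (baryGrad t p) (w q • q)
        = ∑ q ∈ t, (w q * bary t p 0 + w q * inner ℝ (baryGrad t p) q) := by
          rw [Finset.sum_add_distrib, ← Finset.sum_mul, hw, one_mul]
          simp only [inner_smul_right]
      _ = _ := Finset.sum_congr rfl fun q _ => by rw [e q]; ring
  rw [h, Finset.sum_eq_single p]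
  · rw [ht.bary_self hp, mul_one]
  · intro q hq hqp
    rw [ht.bary_of_ne hp hq hqp.symm, mul_zero]
  · exact fun h => absurd hp h

lemma mem_convexHull_iff (ht : IsTriangle t) {x : Plane} :
    x ∈ convexHull ℝ (t : Set Plane) ↔ ∀ p ∈ t, 0 ≤ bary t p x := by
  have h := AffineBasis.convexHull_eq_nonneg_coord (AffineBasis.mk ((↑) : t → Plane)
    ht.indep ht.affineSpan_eq_top)
  have hr : range (AffineBasis.mk ((↑) : t → Plane) ht.indep ht.affineSpan_eq_top)
      = (t : Set Plane) := Subtype.range_coe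
  rw [hr] at h
  rw [h]
  constructor
  · intro hx p hp
    rw [ht.bary_eq hp]; exact hx ⟨p, hp⟩
  · intro hx i
    have := hx i i.2
    rwa [ht.bary_eq i.2] at this

lemma mem_interior_iff (ht : IsTriangle t) {x : Plane} :
    x ∈ interior (convexHull ℝ (t : Set Plane)) ↔ ∀ p ∈ t, 0 < bary t p x := by
  have h := AffineBasis.interior_convexHull (AffineBasis.mk ((↑) : t → Plane)
    ht.indep ht.affineSpan_eq_top)
  have hr : range (AffineBasis.mk ((↑) : t → Plane) ht.indep ht.affineSpan_eq_top)
      = (t : Set Plane) := Subtype.range_coe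
  rw [hr] at h
  rw [h]
  constructor
  · intro hx p hp
    rw [ht.bary_eq hp]; exact hx ⟨p, hp⟩
  · intro hx i
    have := hx i i.2
    rwa [ht.bary_eq i.2] at this

lemma bary_le_one (ht : IsTriangle t) {x : Plane} (hx : x ∈ convexHull ℝ (t : Set Plane)) (hp : p ∈ t) :
    bary t p x ≤ 1 := by
  rw [← ht.sum_bary x]
  exact Finset.single_le_sum (f := fun q => bary t q x) (ht.mem_convexHull_iff.1 hx) hp

lemma sum_baryGrad (ht : IsTriangle t) : ∑ p ∈ t, baryGrad t p = 0 := by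
  refine ext_inner_right ℝ fun v => ?_
  rw [sum_inner, inner_zero_left]
  have h : ∑ p ∈ t, (bary t p v - bary t p 0) = 0 := by
    rw [Finset.sum_sub_distrib, ht.sum_bary, ht.sum_bary, sub_self]
  rw [← h]
  refine Finset.sum_congr rfl fun p _ => ?_
  rw [bary_eq_add t p v 0]; simp

lemma norm_baryGrad_le (ht : IsTriangle t) {c : Plane} {r : ℝ} (hr : 0 < r)
    (hc : Metric.closedBall c r ⊆ convexHull ℝ (t : Set Plane)) (hp : p ∈ t) :
    ‖baryGrad t p‖ ≤ 1 / r := by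
  by_cases h0 : baryGrad t p = 0
  · rw [h0, norm_zero]; positivity
  have hn : 0 < ‖baryGrad t p‖ := norm_pos_iff.2 h0
  set y := c + (r / ‖baryGrad t p‖) • baryGrad t p with hy
  have hyT : y ∈ convexHull ℝ (t : Set Plane) := hc (by
    rw [Metric.mem_closedBall, dist_eq_norm, hy, add_sub_cancel_left, norm_smul, Real.norm_eq_abs,
      abs_of_pos (by positivity), div_mul_cancel₀ _ hn.ne'])
  have h1 := ht.bary_le_one hyT hp
  have h2 := ht.mem_convexHull_iff.1 (hc (Metric.mem_closedBall_self hr.le)) p hp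
  rw [bary_eq_add t p y c, hy, add_sub_cancel_left, inner_smul_right, real_inner_self_eq_norm_sq]
    at h1
  rw [le_div_iff₀ hr]
  have : r / ‖baryGrad t p‖ * ‖baryGrad t p‖ ^ 2 = ‖baryGrad t p‖ * r := by
    field_simp
  linarith

lemma bubble_nonneg (ht : IsTriangle t) {x : Plane} (hx : x ∈ convexHull ℝ (t : Set Plane)) : 0 ≤ bubble t x :=
  Finset.prod_nonneg (ht.mem_convexHull_iff.1 hx)

lemma bubble_le_one (ht : IsTriangle t) {x : Plane} (hx : x ∈ convexHull ℝ (t : Set Plane)) : bubble t x ≤ 1 :=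
  Finset.prod_le_one (ht.mem_convexHull_iff.1 hx) fun _ hp => ht.bary_le_one hx hp

/-! ### Integrals of polynomials in the barycentric coordinates -/

lemma isCompact_convexHull (t : Finset Plane) : IsCompact (convexHull ℝ (t : Set Plane)) :=
  t.finite_toSet.isCompact_convexHull ℝ

lemma interior_ae_eq (t : Finset Plane) :
    interior (convexHull ℝ (t : Set Plane)) =ᵐ[volume] convexHull ℝ (t : Set Plane) :=
  interior_ae_eq_of_null_frontier ((convex_convexHull ℝ _).addHaar_frontier volume)

lemma exists_third (ht : IsTriangle t) {q : Plane} (hp : p ∈ t) (hq : q ∈ t) (hpq : p ≠ q) :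
    ∃ r, r ≠ p ∧ r ≠ q ∧ ∀ z, z ∈ t ↔ z = r ∨ z = p ∨ z = q := by
  classical
  have h1 : ((t.erase p).erase q).card = 1 := by
    rw [Finset.card_erase_of_mem (Finset.mem_erase.2 ⟨hpq.symm, hq⟩), Finset.card_erase_of_mem hp,
      ht.card_eq]
  obtain ⟨r, hr⟩ := Finset.card_eq_one.1 h1
  have hr' : ∀ z, (z ≠ q ∧ z ≠ p ∧ z ∈ t) ↔ z = r := fun z => by
    rw [← Finset.mem_singleton, ← hr, Finset.mem_erase, Finset.mem_erase]
  obtain ⟨h2, h3, h4⟩ := (hr' r).2 rfl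
  refine ⟨r, h3, h2, fun z => ?_⟩
  have := hr' z
  by_cases hzp : z = p
  · subst hzp; simp [hp]
  by_cases hzq : z = q
  · subst hzq; simp [hq]
  simp_all

lemma exists_other (ht : IsTriangle t) (p : Plane) : ∃ q ∈ t, p ≠ q := by
  have : 1 < t.card := by rw [ht.card_eq]; norm_num
  obtain ⟨q, hq, hqp⟩ := Finset.exists_mem_ne this p
  exact ⟨q, hq, hqp.symm⟩

/-- The reference triangle. -/
def ref : Set (ℝ × ℝ) := {z | 0 ≤ z.1 ∧ 0 ≤ z.2 ∧ z.1 + z.2 ≤ 1}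

lemma isCompact_ref : IsCompact ref := by
  refine Metric.isCompact_of_isClosed_isBounded ?_ ?_
  · exact (isClosed_le continuous_const continuous_fst).inter
      ((isClosed_le continuous_const continuous_snd).inter
        (isClosed_le (continuous_fst.add continuous_snd) continuous_const))
  · refine (Metric.isBounded_Icc (0 : ℝ) 1 |>.prod (Metric.isBounded_Icc (0 : ℝ) 1)).subset ?_
    rintro ⟨u, v⟩ ⟨h1, h2, h3⟩
    simp only at h1 h2 h3
    exact ⟨⟨h1, by linarith⟩, ⟨h2, by linarith⟩⟩

/-- Integration over the reference triangle by antiderivatives. -/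
lemma setIntegral_ref {f A : ℝ → ℝ → ℝ} {B : ℝ → ℝ} (hf : Continuous fun z : ℝ × ℝ => f z.1 z.2)
    (hA : ∀ u v, HasDerivAt (A u) (f u v) v)
    (hB : ∀ u, HasDerivAt B (A u (1 - u) - A u 0) u)
    (hc : Continuous fun u => A u (1 - u) - A u 0) :
    ∫ z in ref, f z.1 z.2 = B 1 - B 0 := by
  have hi : IntegrableOn (fun z : ℝ × ℝ => f z.1 z.2) ref :=
    hf.continuousOn.integrableOn_compact isCompact_ref
  have hm : MeasurableSet ref := isCompact_ref.measurableSet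
  rw [← integral_indicator hm, Measure.volume_eq_prod, integral_prod]
  swap
  · rw [← Measure.volume_eq_prod, integrable_indicator_iff hm]; exact hi
  have h1 : ∀ u, ∫ v, ref.indicator (fun z : ℝ × ℝ => f z.1 z.2) (u, v)
      = (Icc (0 : ℝ) 1).indicator (fun u => A u (1 - u) - A u 0) u := by
    intro u
    by_cases hu : u ∈ Icc (0 : ℝ) 1
    · rw [indicator_of_mem hu]
      have h2 : (fun v => ref.indicator (fun z : ℝ × ℝ => f z.1 z.2) (u, v))
          = (Icc 0 (1 - u)).indicator (f u) := by
        ext v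
        by_cases hv : v ∈ Icc 0 (1 - u)
        · rw [indicator_of_mem hv, indicator_of_mem]
          exact ⟨hu.1, hv.1, by linarith [hv.2]⟩
        · rw [indicator_of_notMem hv, indicator_of_notMem]
          rintro ⟨h3, h4, h5⟩
          exact hv ⟨h4, by simp only at h5; linarith⟩
      rw [h2, integral_indicator measurableSet_Icc, integral_Icc_eq_integral_Ioc,
        ← intervalIntegral.integral_of_le (by linarith [hu.2])]
      exact intervalIntegral.integral_eq_sub_of_hasDerivAt (fun v _ => hA u v)
        ((hf.comp (continuous_const.prodMk continuous_id)).intervalIntegrable _ _)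
    · rw [indicator_of_notMem hu]
      have h2 : (fun v => ref.indicator (fun z : ℝ × ℝ => f z.1 z.2) (u, v)) = fun _ => 0 := by
        ext v
        rw [indicator_of_notMem]
        rintro ⟨h3, h4, h5⟩
        exact hu ⟨h3, by simp only at h4 h5; linarith⟩
      rw [h2, integral_zero]
  simp only [h1]
  rw [integral_indicator measurableSet_Icc, integral_Icc_eq_integral_Ioc,
    ← intervalIntegral.integral_of_le zero_le_one]
  exact intervalIntegral.integral_eq_sub_of_hasDerivAt (fun u _ => hB u)
    (hc.intervalIntegrable _ _)

/-- Transformation to the reference triangle. -/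
lemma setIntegral_eq_ref (ht : IsTriangle t) {a b c : Plane} (hab : a ≠ b) (hac : a ≠ c)
    (hbc : b ≠ c) (hmem : ∀ z, z ∈ t ↔ z = a ∨ z = b ∨ z = c) (F : ℝ → ℝ → ℝ → ℝ) :
    ∫ x in convexHull ℝ (t : Set Plane), F (bary t a x) (bary t b x) (bary t c x)
      = 2 * volume.real (convexHull ℝ (t : Set Plane)) *
        ∫ z in ref, F (1 - z.1 - z.2) z.1 z.2 := by
  classical
  have ha : a ∈ t := (hmem a).2 (by simp)
  have hb : b ∈ t := (hmem b).2 (by simp)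
  have hc : c ∈ t := (hmem c).2 (by simp)
  have hteq : t = {a, b, c} := by ext z; simp [hmem]
  set l : ℝ × ℝ →ₗ[ℝ] Plane :=
    (LinearMap.fst ℝ ℝ ℝ).smulRight (b - a) + (LinearMap.snd ℝ ℝ ℝ).smulRight (c - a) with hl
  have hlapp : ∀ z, l z = z.1 • (b - a) + z.2 • (c - a) := fun z => by simp [hl]
  have hbary : ∀ z, bary t a (a + l z) = 1 - z.1 - z.2 ∧ bary t b (a + l z) = z.1 ∧
      bary t c (a + l z) = z.2 := by
    intro z
    set w : Plane → ℝ := fun p => if p = a then 1 - z.1 - z.2 else if p = b then z.1 else z.2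
    have hw : w a = 1 - z.1 - z.2 ∧ w b = z.1 ∧ w c = z.2 := by
      simp [w, hab.symm, hac.symm, hbc.symm]
    have hsum : ∑ q ∈ t, w q = 1 := by
      rw [hteq, Finset.sum_insert (by simp [hab, hac]), Finset.sum_insert (by simp [hbc]),
        Finset.sum_singleton, hw.1, hw.2.1, hw.2.2]; ring
    have hx : ∑ q ∈ t, w q • q = a + l z := by
      rw [hteq, Finset.sum_insert (by simp [hab, hac]), Finset.sum_insert (by simp [hbc]),
        Finset.sum_singleton, hw.1, hw.2.1, hw.2.2, hlapp]; module
    exact ⟨(ht.bary_eq_of_sum hsum hx ha).trans hw.1, (ht.bary_eq_of_sum hsum hx hb).trans hw.2.1,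
      (ht.bary_eq_of_sum hsum hx hc).trans hw.2.2⟩
  have hinj : Function.Injective l := by
    intro z z' h
    have h1 := hbary z
    have h2 := hbary z'
    rw [h] at h1
    exact Prod.ext (h1.2.1.symm.trans h2.2.1) (h1.2.2.symm.trans h2.2.2)
  set e : (ℝ × ℝ) ≃L[ℝ] Plane :=
    (LinearEquiv.ofInjectiveOfFinrankEq l hinj (by simp)).toContinuousLinearEquiv
  have he : ∀ z, e z = l z := fun z => rfl
  have := e.isAddHaarMeasure_map (volume : Measure (ℝ × ℝ))
  obtain ⟨κ, hκ⟩ : ∃ κ : NNReal, (volume : Measure (ℝ × ℝ)).map e = κ • (volume : Measure Plane) :=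
    ⟨_, Measure.isAddLeftInvariant_eq_smul _ _⟩
  set ψ : ℝ × ℝ ≃ᵐ Plane := e.toHomeomorph.toMeasurableEquiv.trans (MeasurableEquiv.addLeft a)
  have hψ : ∀ z, ψ z = a + l z := fun z => rfl
  have hmap : (volume : Measure (ℝ × ℝ)).map ψ = κ • (volume : Measure Plane) := by
    have : (ψ : ℝ × ℝ → Plane) = (fun x => a + x) ∘ e := rfl
    rw [this, ← Measure.map_map (measurable_const_add a) e.continuous.measurable, hκ,
      Measure.map_smul, map_add_left_eq_self]
  have hpre : ψ ⁻¹' (convexHull ℝ (t : Set Plane)) = ref := by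
    ext z
    rw [mem_preimage, ht.mem_convexHull_iff, hψ]
    obtain ⟨h1, h2, h3⟩ := hbary z
    constructor
    · intro h
      have h4 := h a ha
      have h5 := h b hb
      have h6 := h c hc
      rw [h1] at h4; rw [h2] at h5; rw [h3] at h6
      exact ⟨h5, h6, by linarith⟩
    · rintro ⟨h4, h5, h6⟩ p hp
      rcases (hmem p).1 hp with rfl | rfl | rfl
      · rw [h1]; linarith
      · rw [h2]; exact h4
      · rw [h3]; exact h5
  have key : ∀ G : Plane → ℝ, κ * ∫ x in convexHull ℝ (t : Set Plane), G x
      = ∫ z in ref, G (ψ z) := by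
    intro G
    rw [← hpre, ← setIntegral_map_equiv, hmap, Measure.restrict_smul, integral_smul_nnreal_measure]
    rfl
  have hone : κ * volume.real (convexHull ℝ (t : Set Plane)) = 1 / 2 := by
    have h1 := key fun _ => 1
    have h2 : ∫ z in ref, (1 : ℝ) = 1 / 2 := by
      have h3 : ∫ z in ref, (1 : ℝ) = (1 - 1 ^ 2 / 2) - (0 - 0 ^ 2 / 2) :=
        setIntegral_ref (f := fun _ _ => 1) (A := fun _ v => v) (B := fun u => u - u ^ 2 / 2)
          continuous_const (fun u v => hasDerivAt_id v)
          (fun u => by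
            have := (hasDerivAt_id u).sub (((hasDerivAt_id u).pow 2).div_const 2)
            refine this.congr_deriv ?_
            simp) (by fun_prop)
      rw [h3]; norm_num
    rw [h2] at h1
    simpa using h1
  have hfin := key fun x => F (bary t a x) (bary t b x) (bary t c x)
  simp only [hψ, (hbary _).1, (hbary _).2.1, (hbary _).2.2] at hfin
  rw [← hfin]
  have h0 : (2 : ℝ) * (κ * volume.real (convexHull ℝ (t : Set Plane))) = 1 := by rw [hone]; norm_num
  calc _ = (2 * (κ * volume.real (convexHull ℝ (t : Set Plane)))) * _ := by rw [h0, one_mul]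
    _ = _ := by ring

lemma setIntegral_ref_fst : ∫ z in ref, (z.1) = 1 / 6 := by
  have h := setIntegral_ref (f := fun u v => u)
    (A := fun u v => u * v) (B := fun u => u ^ 2 / 2 - u ^ 3 / 3)
    (by fun_prop) (fun u v => by
      refine (DifferentiableAt.hasDerivAt (by fun_prop)).congr_deriv ?_
      simp (disch := fun_prop)
      try ring) (fun u => by
      refine (DifferentiableAt.hasDerivAt (by fun_prop)).congr_deriv ?_
      simp (disch := fun_prop)
      try ring) (by fun_prop)
  rw [h]; norm_num

lemma setIntegral_ref_fst_sq : ∫ z in ref, (z.1 * z.1) = 1 / 12 := by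
  have h := setIntegral_ref (f := fun u v => u * u)
    (A := fun u v => u ^ 2 * v) (B := fun u => u ^ 3 / 3 - u ^ 4 / 4)
    (by fun_prop) (fun u v => by
      refine (DifferentiableAt.hasDerivAt (by fun_prop)).congr_deriv ?_
      simp (disch := fun_prop)
      try ring) (fun u => by
      refine (DifferentiableAt.hasDerivAt (by fun_prop)).congr_deriv ?_
      simp (disch := fun_prop)
      try ring) (by fun_prop)
  rw [h]; norm_num

lemma setIntegral_ref_fst_mul_snd : ∫ z in ref, (z.1 * z.2) = 1 / 24 := by
  have h := setIntegral_ref (f := fun u v => u * v)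
    (A := fun u v => u * v ^ 2 / 2) (B := fun u => (u ^ 2 / 2 - 2 * u ^ 3 / 3 + u ^ 4 / 4) / 2)
    (by fun_prop) (fun u v => by
      refine (DifferentiableAt.hasDerivAt (by fun_prop)).congr_deriv ?_
      simp (disch := fun_prop)
      try ring) (fun u => by
      refine (DifferentiableAt.hasDerivAt (by fun_prop)).congr_deriv ?_
      simp (disch := fun_prop)
      try ring) (by fun_prop)
  rw [h]; norm_num

lemma setIntegral_ref_bubble : ∫ z in ref, ((1 - z.1 - z.2) * z.1 * z.2) = 1 / 120 := by
  have h := setIntegral_ref (f := fun u v => (1 - u - v) * u * v)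
    (A := fun u v => u * ((1 - u) * v ^ 2 / 2 - v ^ 3 / 3)) (B := fun u => (u ^ 2 / 2 - u ^ 3 + 3 * u ^ 4 / 4 - u ^ 5 / 5) / 6)
    (by fun_prop) (fun u v => by
      refine (DifferentiableAt.hasDerivAt (by fun_prop)).congr_deriv ?_
      simp (disch := fun_prop)
      try ring) (fun u => by
      refine (DifferentiableAt.hasDerivAt (by fun_prop)).congr_deriv ?_
      simp (disch := fun_prop)
      try ring) (by fun_prop)
  rw [h]; norm_num

lemma setIntegral_ref_fst_mul_bubble : ∫ z in ref, (z.1 * ((1 - z.1 - z.2) * z.1 * z.2)) = 1 / 360 := by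
  have h := setIntegral_ref (f := fun u v => u * ((1 - u - v) * u * v))
    (A := fun u v => u ^ 2 * ((1 - u) * v ^ 2 / 2 - v ^ 3 / 3)) (B := fun u => (u ^ 3 / 3 - 3 * u ^ 4 / 4 + 3 * u ^ 5 / 5 - u ^ 6 / 6) / 6)
    (by fun_prop) (fun u v => by
      refine (DifferentiableAt.hasDerivAt (by fun_prop)).congr_deriv ?_
      simp (disch := fun_prop)
      try ring) (fun u => by
      refine (DifferentiableAt.hasDerivAt (by fun_prop)).congr_deriv ?_
      simp (disch := fun_prop)
      try ring) (by fun_prop)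
  rw [h]; norm_num

lemma setIntegral_ref_bubble_sq : ∫ z in ref, (((1 - z.1 - z.2) * z.1 * z.2) ^ 2) = 1 / 5040 := by
  have h := setIntegral_ref (f := fun u v => ((1 - u - v) * u * v) ^ 2)
    (A := fun u v => u ^ 2 * ((1 - u) ^ 2 * v ^ 3 / 3 - (1 - u) * v ^ 4 / 2 + v ^ 5 / 5)) (B := fun u => (u ^ 3 / 3 - 5 * u ^ 4 / 4 + 2 * u ^ 5 - 5 * u ^ 6 / 3 + 5 * u ^ 7 / 7 - u ^ 8 / 8) / 30)
    (by fun_prop) (fun u v => by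
      refine (DifferentiableAt.hasDerivAt (by fun_prop)).congr_deriv ?_
      simp (disch := fun_prop)
      try ring) (fun u => by
      refine (DifferentiableAt.hasDerivAt (by fun_prop)).congr_deriv ?_
      simp (disch := fun_prop)
      try ring) (by fun_prop)
  rw [h]; norm_num

lemma bubble_eq {a b c : Plane} (hab : a ≠ b) (hac : a ≠ c)
    (hbc : b ≠ c) (hmem : ∀ z, z ∈ t ↔ z = a ∨ z = b ∨ z = c) (x : Plane) :
    bubble t x = bary t a x * bary t b x * bary t c x := by
  classical
  have hteq : t = {a, b, c} := by ext z; simp [hmem]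
  rw [bubble, mul_assoc]
  nth_rewrite 1 [hteq]
  rw [Finset.prod_insert (by simp [hab, hac]), Finset.prod_insert (by simp [hbc]),
    Finset.prod_singleton]

lemma setIntegral_bary (ht : IsTriangle t) (hp : p ∈ t) :
    ∫ x in convexHull ℝ (t : Set Plane), bary t p x
      = volume.real (convexHull ℝ (t : Set Plane)) / 3 := by
  obtain ⟨q, hq, hpq⟩ := ht.exists_other p
  obtain ⟨r, hrp, hrq, hmem⟩ := ht.exists_third hp hq hpq
  rw [ht.setIntegral_eq_ref hrp hrq hpq hmem fun _ u _ => u, setIntegral_ref_fst]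
  ring

lemma setIntegral_bary_mul_self (ht : IsTriangle t) (hp : p ∈ t) :
    ∫ x in convexHull ℝ (t : Set Plane), bary t p x * bary t p x
      = volume.real (convexHull ℝ (t : Set Plane)) / 6 := by
  obtain ⟨q, hq, hpq⟩ := ht.exists_other p
  obtain ⟨r, hrp, hrq, hmem⟩ := ht.exists_third hp hq hpq
  rw [ht.setIntegral_eq_ref hrp hrq hpq hmem fun _ u _ => u * u, setIntegral_ref_fst_sq]
  ring

lemma setIntegral_bary_mul (ht : IsTriangle t) (hp : p ∈ t) {q : Plane} (hq : q ∈ t)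
    (hpq : p ≠ q) : ∫ x in convexHull ℝ (t : Set Plane), bary t p x * bary t q x
      = volume.real (convexHull ℝ (t : Set Plane)) / 12 := by
  obtain ⟨r, hrp, hrq, hmem⟩ := ht.exists_third hp hq hpq
  rw [ht.setIntegral_eq_ref hrp hrq hpq hmem fun _ u v => u * v, setIntegral_ref_fst_mul_snd]
  ring

lemma setIntegral_bubble (ht : IsTriangle t) :
    ∫ x in convexHull ℝ (t : Set Plane), bubble t x
      = volume.real (convexHull ℝ (t : Set Plane)) / 60 := by
  obtain ⟨p, hp⟩ := ht.nonempty
  obtain ⟨q, hq, hpq⟩ := ht.exists_other p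
  obtain ⟨r, hrp, hrq, hmem⟩ := ht.exists_third hp hq hpq
  simp only [bubble_eq hrp hrq hpq hmem]
  rw [ht.setIntegral_eq_ref hrp hrq hpq hmem fun a u v => a * u * v, setIntegral_ref_bubble]
  ring

lemma setIntegral_bary_mul_bubble (ht : IsTriangle t) (hp : p ∈ t) :
    ∫ x in convexHull ℝ (t : Set Plane), bary t p x * bubble t x
      = volume.real (convexHull ℝ (t : Set Plane)) / 180 := by
  obtain ⟨q, hq, hpq⟩ := ht.exists_other p
  obtain ⟨r, hrp, hrq, hmem⟩ := ht.exists_third hp hq hpq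
  simp only [bubble_eq hrp hrq hpq hmem]
  rw [ht.setIntegral_eq_ref hrp hrq hpq hmem fun a u v => u * (a * u * v),
    setIntegral_ref_fst_mul_bubble]
  ring

lemma setIntegral_bubble_sq (ht : IsTriangle t) :
    ∫ x in convexHull ℝ (t : Set Plane), bubble t x ^ 2
      = volume.real (convexHull ℝ (t : Set Plane)) / 2520 := by
  obtain ⟨p, hp⟩ := ht.nonempty
  obtain ⟨q, hq, hpq⟩ := ht.exists_other p
  obtain ⟨r, hrp, hrq, hmem⟩ := ht.exists_third hp hq hpq
  simp only [bubble_eq hrp hrq hpq hmem]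
  rw [ht.setIntegral_eq_ref hrp hrq hpq hmem fun a u v => (a * u * v) ^ 2,
    setIntegral_ref_bubble_sq]
  ring

end IsTriangle

end Bary

end PlateFEM

namespace PlateFEM

section TriangleBounds

variable {t : Finset Plane} {p : Plane}

/-- The dual function of the vertex `p`: integration against it over the triangle extracts the
nodal value at `p` of an affine function, and annihilates the bubble function. -/
noncomputable def dualFun (t : Finset Plane) (p x : Plane) : ℝ :=
  (12 * bary t p x - 2 / 3 - 140 * bubble t x) / volume.real (convexHull ℝ (t : Set Plane))

lemma continuous_dualFun (t : Finset Plane) (p : Plane) : Continuous (dualFun t p) :=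
  (((continuous_const.mul (continuous_bary t p)).sub continuous_const).sub
    (continuous_const.mul (continuous_bubble t))).div_const _

lemma IsTriangle.measureReal_pos (ht : IsTriangle t) :
    0 < volume.real (convexHull ℝ (t : Set Plane)) := by
  have h : 0 < volume (convexHull ℝ (t : Set Plane)) := by
    have hne : (interior (convexHull ℝ (t : Set Plane))).Nonempty := by
      rw [interior_convexHull_nonempty_iff_affineSpan_eq_top]
      simpa using ht.affineSpan_eq_top
    exact (isOpen_interior.measure_pos volume hne).trans_le (measure_mono interior_subset)
  exact ENNReal.toReal_pos h.ne' (IsTriangle.isCompact_convexHull t).measure_lt_top.ne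

lemma integrableOn_triangle {f : Plane → ℝ} (hf : Continuous f) :
    IntegrableOn f (convexHull ℝ (t : Set Plane)) :=
  hf.continuousOn.integrableOn_compact (IsTriangle.isCompact_convexHull t)

lemma setIntegral_mul_dualFun {f : Plane → ℝ} (hf : Continuous f) :
    ∫ x in convexHull ℝ (t : Set Plane), f x * dualFun t p x
      = (12 * (∫ x in convexHull ℝ (t : Set Plane), f x * bary t p x)
        - 2 / 3 * (∫ x in convexHull ℝ (t : Set Plane), f x)
        - 140 * ∫ x in convexHull ℝ (t : Set Plane), f x * bubble t x)
        / volume.real (convexHull ℝ (t : Set Plane)) := by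
  have i1 : IntegrableOn (fun x => f x * bary t p x) (convexHull ℝ (t : Set Plane)) :=
    integrableOn_triangle (hf.mul (continuous_bary t p))
  have i2 := integrableOn_triangle (t := t) hf
  have i3 : IntegrableOn (fun x => f x * bubble t x) (convexHull ℝ (t : Set Plane)) :=
    integrableOn_triangle (hf.mul (continuous_bubble t))
  have e : ∀ x, f x * dualFun t p x = (12 * (f x * bary t p x) - 2 / 3 * f x
      - 140 * (f x * bubble t x)) / volume.real (convexHull ℝ (t : Set Plane)) := fun x => by
    rw [dualFun]; ring
  simp only [e]
  have i12 : IntegrableOn (fun x => 12 * (f x * bary t p x) - 2 / 3 * f x)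
    (convexHull ℝ (t : Set Plane)) := (i1.const_mul 12).sub (i2.const_mul (2 / 3))
  rw [integral_div, integral_sub i12 (i3.const_mul 140),
    integral_sub (i1.const_mul 12) (i2.const_mul (2 / 3)), integral_const_mul, integral_const_mul,
    integral_const_mul]

lemma IsTriangle.setIntegral_bary_mul_dualFun (ht : IsTriangle t) (hp : p ∈ t) {q : Plane}
    (hq : q ∈ t) :
    ∫ x in convexHull ℝ (t : Set Plane), bary t q x * dualFun t p x = if q = p then 1 else 0 := by
  have h0 := ht.measureReal_pos.ne'
  rw [setIntegral_mul_dualFun (continuous_bary t q), ht.setIntegral_bary hq,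
    ht.setIntegral_bary_mul_bubble hq]
  split_ifs with h
  · subst h
    rw [ht.setIntegral_bary_mul_self hq]
    field_simp; norm_num
  · rw [ht.setIntegral_bary_mul hq hp h]
    field_simp; norm_num

lemma IsTriangle.setIntegral_bubble_mul_dualFun (ht : IsTriangle t) (hp : p ∈ t) :
    ∫ x in convexHull ℝ (t : Set Plane), bubble t x * dualFun t p x = 0 := by
  rw [setIntegral_mul_dualFun (continuous_bubble t), ht.setIntegral_bubble]
  have e1 : ∫ x in convexHull ℝ (t : Set Plane), bubble t x * bary t p x
      = volume.real (convexHull ℝ (t : Set Plane)) / 180 := by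
    rw [← ht.setIntegral_bary_mul_bubble hp]
    simp only [mul_comm]
  have e2 : ∫ x in convexHull ℝ (t : Set Plane), bubble t x * bubble t x
      = volume.real (convexHull ℝ (t : Set Plane)) / 2520 := by
    rw [← ht.setIntegral_bubble_sq]
    simp only [sq]
  rw [e1, e2]
  ring

lemma IsTriangle.abs_dualFun_le (ht : IsTriangle t) (hp : p ∈ t) {x : Plane}
    (hx : x ∈ convexHull ℝ (t : Set Plane)) :
    |dualFun t p x| ≤ 160 / volume.real (convexHull ℝ (t : Set Plane)) := by
  rw [dualFun, abs_div, abs_of_pos ht.measureReal_pos]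
  refine div_le_div_of_nonneg_right ?_ ht.measureReal_pos.le
  have h1 := ht.mem_convexHull_iff.1 hx p hp
  have h2 := ht.bary_le_one hx hp
  have h3 := ht.bubble_nonneg hx
  have h4 := ht.bubble_le_one hx
  rw [abs_le]
  constructor <;> linarith

lemma IsTriangle.abs_bubble_sub_le (ht : IsTriangle t) {G : ℝ}
    (hG : ∀ p ∈ t, ‖baryGrad t p‖ ≤ G) {x y : Plane} (hx : x ∈ convexHull ℝ (t : Set Plane))
    (hy : y ∈ convexHull ℝ (t : Set Plane)) :
    |bubble t x - bubble t y| ≤ 3 * G * dist x y := by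
  obtain ⟨p, hp⟩ := ht.nonempty
  obtain ⟨q, hq, hpq⟩ := ht.exists_other p
  obtain ⟨r, hrp, hrq, hmem⟩ := ht.exists_third hp hq hpq
  have hr : r ∈ t := (hmem r).2 (Or.inl rfl)
  rw [IsTriangle.bubble_eq hrp hrq hpq hmem, IsTriangle.bubble_eq hrp hrq hpq hmem]
  have hd : ∀ z ∈ t, |bary t z x - bary t z y| ≤ G * dist x y := fun z hz =>
    (abs_bary_sub_le t z x y).trans (mul_le_mul_of_nonneg_right (hG z hz) dist_nonneg)
  have hb : ∀ z ∈ t, ∀ w ∈ convexHull ℝ (t : Set Plane), |bary t z w| ≤ 1 := fun z hz w hw => by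
    rw [abs_of_nonneg (ht.mem_convexHull_iff.1 hw z hz)]; exact ht.bary_le_one hw hz
  have e : bary t r x * bary t p x * bary t q x - bary t r y * bary t p y * bary t q y
      = (bary t r x - bary t r y) * (bary t p x * bary t q x)
        + (bary t p x - bary t p y) * (bary t r y * bary t q x)
        + (bary t q x - bary t q y) * (bary t r y * bary t p y) := by ring
  have hG0 : 0 ≤ G * dist x y := (abs_nonneg _).trans (hd r hr)
  have hterm : ∀ a b c : ℝ, |a| ≤ G * dist x y → |b| ≤ 1 → |c| ≤ 1 →
      |a * (b * c)| ≤ G * dist x y := by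
    intro a b c ha hb hc
    rw [abs_mul, abs_mul]
    calc |a| * (|b| * |c|) ≤ (G * dist x y) * (1 * 1) := by gcongr
      _ = _ := by ring
  rw [e]
  refine (abs_add_le _ _).trans ?_
  refine (add_le_add_left (abs_add_le _ _) _).trans ?_
  have h1 := hterm _ _ _ (hd r hr) (hb p hp x hx) (hb q hq x hx)
  have h2 := hterm _ _ _ (hd p hp) (hb r hr y hy) (hb q hq x hx)
  have h3 := hterm _ _ _ (hd q hq) (hb r hr y hy) (hb p hp y hy)
  linarith

end TriangleBounds

/-! ### Piecewise Lipschitz functions -/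

lemma abs_sub_le_of_closed_cover {ι : Type*} {g : ℝ → ℝ} {K : ℝ} {C : ι → Set ℝ}
    (hC : ∀ i, IsClosed (C i)) (b : ℝ) (hg : ∀ i, ∀ u ∈ C i, ∀ v ∈ C i, |g u - g v| ≤ K * |u - v|)
    (s : Finset ι) : ∀ a ≤ b, Icc a b ⊆ ⋃ i ∈ s, C i → |g b - g a| ≤ K * (b - a) := by
  classical
  induction s using Finset.strongInduction with
  | H s ih =>
    intro a hab hcov
    obtain ⟨i, hi, hai⟩ := mem_iUnion₂.1 (hcov (left_mem_Icc.2 hab))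
    have hcomp : IsCompact (C i ∩ Icc a b) := isCompact_Icc.inter_left (hC i)
    have hne : (C i ∩ Icc a b).Nonempty := ⟨a, hai, left_mem_Icc.2 hab⟩
    set c := sSup (C i ∩ Icc a b) with hc
    obtain ⟨hci, hac, hcb⟩ : c ∈ C i ∩ Icc a b := hcomp.sSup_mem hne
    have h1 := hg i c hci a hai
    rw [abs_of_nonneg (sub_nonneg.2 hac)] at h1
    have h2 : |g b - g c| ≤ K * (b - c) := by
      rcases hcb.eq_or_lt with hcb' | hcb'
      · rw [← hcb']; simp
      refine ih (s.erase i) (Finset.erase_ssubset hi) c hcb ?_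
      have hcl : IsClosed (⋃ j ∈ s.erase i, C j) := isClosed_biUnion_finset fun j _ => hC j
      rw [← closure_Ioc hcb'.ne]
      refine closure_minimal (fun x hx => ?_) hcl
      obtain ⟨j, hj, hxj⟩ := mem_iUnion₂.1 (hcov ⟨hac.trans hx.1.le, hx.2⟩)
      refine mem_iUnion₂.2 ⟨j, Finset.mem_erase.2 ⟨?_, hj⟩, hxj⟩
      rintro rfl
      exact absurd (le_csSup hcomp.bddAbove ⟨hxj, hac.trans hx.1.le, hx.2⟩) (not_le.2 hx.1)
    calc |g b - g a| = |(g b - g c) + (g c - g a)| := by rw [sub_add_sub_cancel]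
      _ ≤ |g b - g c| + |g c - g a| := abs_add_le _ _
      _ ≤ K * (b - c) + K * (c - a) := add_le_add h2 h1
      _ = K * (b - a) := by ring

/-- A function that is Lipschitz on each set of a finite closed cover of a segment satisfies the
Lipschitz estimate for the end points. -/
lemma abs_sub_le_of_segment_subset {ι : Type*} {f : Plane → ℝ} {K : ℝ}
    {C : ι → Set Plane} (hC : ∀ i, IsClosed (C i))
    (hf : ∀ i, ∀ u ∈ C i, ∀ v ∈ C i, |f u - f v| ≤ K * dist u v) (s : Finset ι) {x y : Plane}
    (h : segment ℝ x y ⊆ ⋃ i ∈ s, C i) : |f y - f x| ≤ K * dist y x := by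
  have hline : Continuous fun τ : ℝ => x + τ • (y - x) := by fun_prop
  have := abs_sub_le_of_closed_cover (g := fun τ => f (x + τ • (y - x))) (K := K * dist y x) (C := fun i => (fun τ : ℝ => x + τ • (y - x)) ⁻¹' C i)
    (fun i => (hC i).preimage hline) 1 (fun i u hu v hv => by
      refine (hf i _ hu _ hv).trans_eq ?_
      rw [dist_eq_norm, add_sub_add_left_eq_sub, ← sub_smul, norm_smul, Real.norm_eq_abs,
        dist_eq_norm]
      ring) s 0 zero_le_one (fun τ hτ => by
      have hm : x + τ • (y - x) ∈ segment ℝ x y := by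
        rw [segment_eq_image']; exact ⟨τ, hτ, rfl⟩
      simpa using h hm)
  simpa using this

lemma lipschitzWith_of_closed_cover {ι : Type*} {f : Plane → ℝ} {K : NNReal}
    {C : ι → Set Plane} (hC : ∀ i, IsClosed (C i))
    (hf : ∀ i, ∀ u ∈ C i, ∀ v ∈ C i, |f u - f v| ≤ K * dist u v) (s : Finset ι)
    (h : ∀ x, ∃ i ∈ s, x ∈ C i) : LipschitzWith K f := by
  refine LipschitzWith.of_dist_le_mul fun x y => ?_
  rw [Real.dist_eq]
  refine abs_sub_le_of_segment_subset hC hf s fun z _ => ?_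
  obtain ⟨i, hi, hz⟩ := h z
  exact mem_iUnion₂.2 ⟨i, hi, hz⟩

end PlateFEM

namespace PlateFEM

/-! ### Nodal basis functions of a conforming triangulation -/

namespace Triangulation

variable {Ω : Set Plane} (𝒯 : Triangulation Ω)

lemma isTriangle {t : Finset Plane} (ht : t ∈ 𝒯.triangles) : IsTriangle t :=
  ⟨𝒯.card_eq t ht, 𝒯.indep t ht⟩

lemma mem_vertices {p : Plane} : p ∈ 𝒯.vertices ↔ ∃ t ∈ 𝒯.triangles, p ∈ t := by
  simp [vertices]

lemma mem_vertices_of_mem {t : Finset Plane} (ht : t ∈ 𝒯.triangles) {p : Plane} (hp : p ∈ t) :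
    p ∈ 𝒯.vertices := 𝒯.mem_vertices.2 ⟨t, ht, hp⟩

lemma convexHull_subset {t : Finset Plane} (ht : t ∈ 𝒯.triangles) :
    convexHull ℝ (t : Set Plane) ⊆ closure Ω := by
  rw [← 𝒯.cover]
  exact subset_biUnion_of_mem (u := fun t : Finset Plane => convexHull ℝ (t : Set Plane)) ht

lemma exists_triangle {x : Plane} (hx : x ∈ closure Ω) :
    ∃ t ∈ 𝒯.triangles, x ∈ convexHull ℝ (t : Set Plane) := by
  rw [← 𝒯.cover] at hx
  simpa using hx

lemma mem_interiorVertices {p : Plane} : p ∈ 𝒯.interiorVertices ↔ p ∈ 𝒯.vertices ∧ p ∈ Ω := by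
  simp [interiorVertices]

lemma mem_boundaryVertices {p : Plane} :
    p ∈ 𝒯.boundaryVertices ↔ p ∈ 𝒯.vertices ∧ p ∈ frontier Ω := by
  simp [boundaryVertices]

lemma vertex_cases (hΩ : IsOpen Ω) {p : Plane} (hp : p ∈ 𝒯.vertices) :
    p ∈ 𝒯.interiorVertices ∨ p ∈ 𝒯.boundaryVertices := by
  obtain ⟨t, ht, hpt⟩ := 𝒯.mem_vertices.1 hp
  have hcl : p ∈ closure Ω := 𝒯.convexHull_subset ht (subset_convexHull ℝ _ hpt)
  by_cases h : p ∈ Ω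
  · exact Or.inl (𝒯.mem_interiorVertices.2 ⟨hp, h⟩)
  · exact Or.inr (𝒯.mem_boundaryVertices.2 ⟨hp, by rw [hΩ.frontier_eq]; exact ⟨hcl, h⟩⟩)

/-- Conformity in terms of barycentric coordinates. -/
lemma bary_eq_of_mem {s t : Finset Plane} (hs : s ∈ 𝒯.triangles) (ht : t ∈ 𝒯.triangles)
    {x : Plane} (hxs : x ∈ convexHull ℝ (s : Set Plane)) (hxt : x ∈ convexHull ℝ (t : Set Plane))
    {p : Plane} (hp : p ∈ t) : bary t p x = if p ∈ s then bary s p x else 0 := by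
  classical
  have h := 𝒯.conforming s hs t ht ⟨hxs, hxt⟩
  rw [← Finset.coe_inter, Finset.mem_convexHull'] at h
  obtain ⟨w, -, hw1, hwx⟩ := h
  set w' : Plane → ℝ := fun q => if q ∈ s ∩ t then w q else 0 with hw'
  have hsum : ∀ u : Finset Plane, s ∩ t ⊆ u → ∑ q ∈ u, w' q = 1 ∧ ∑ q ∈ u, w' q • q = x := by
    intro u hu
    constructor
    · rw [← hw1, ← Finset.sum_subset hu]
      · exact Finset.sum_congr rfl fun q hq => by simp only [hw', if_pos hq]
      · intro q _ hq; simp only [hw', if_neg hq]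
    · rw [← hwx, ← Finset.sum_subset hu]
      · exact Finset.sum_congr rfl fun q hq => by simp only [hw', if_pos hq]
      · intro q _ hq; simp only [hw', if_neg hq, zero_smul]
  have h1 := hsum s Finset.inter_subset_left
  have h2 := hsum t Finset.inter_subset_right
  rw [(𝒯.isTriangle ht).bary_eq_of_sum h2.1 h2.2 hp]
  split_ifs with hps
  · rw [(𝒯.isTriangle hs).bary_eq_of_sum h1.1 h1.2 hps]
  · simp [hw', hps]

lemma hat_of_mem {t : Finset Plane} (ht : t ∈ 𝒯.triangles) {x : Plane}
    (hx : x ∈ convexHull ℝ (t : Set Plane)) (p : Plane) :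
    𝒯.hat p x = if p ∈ t then bary t p x else 0 := by
  classical
  rw [hat]
  split_ifs with h1 h2 h2
  · rw [𝒯.bary_eq_of_mem ht h1.choose_spec.1 hx h1.choose_spec.2.2 h1.choose_spec.2.1, if_pos h2]
  · rw [𝒯.bary_eq_of_mem ht h1.choose_spec.1 hx h1.choose_spec.2.2 h1.choose_spec.2.1, if_neg h2]
  · exact absurd ⟨t, ht, h2, hx⟩ h1
  · rfl

lemma hat_of_notMem_closure {x : Plane} (hx : x ∉ closure Ω) (p : Plane) : 𝒯.hat p x = 0 := by
  rw [hat, dif_neg]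
  rintro ⟨t, ht, -, h⟩
  exact hx (𝒯.convexHull_subset ht h)

lemma hat_nonneg (p x : Plane) : 0 ≤ 𝒯.hat p x := by
  by_cases hx : x ∈ closure Ω
  · obtain ⟨t, ht, hxt⟩ := 𝒯.exists_triangle hx
    rw [𝒯.hat_of_mem ht hxt]
    split_ifs with h
    · exact (𝒯.isTriangle ht).mem_convexHull_iff.1 hxt p h
    · exact le_rfl
  · rw [𝒯.hat_of_notMem_closure hx]

/-- A finite element function on a triangle. -/
lemma sum_mul_hat {t : Finset Plane} (ht : t ∈ 𝒯.triangles) {x : Plane}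
    (hx : x ∈ convexHull ℝ (t : Set Plane)) (y : Plane → ℝ) :
    ∑ p ∈ 𝒯.vertices, y p * 𝒯.hat p x = ∑ p ∈ t, y p * bary t p x := by
  classical
  rw [← Finset.sum_subset (s₁ := t) (fun p hp => 𝒯.mem_vertices_of_mem ht hp)]
  · exact Finset.sum_congr rfl fun p hp => by rw [𝒯.hat_of_mem ht hx, if_pos hp]
  · intro p _ hp
    rw [𝒯.hat_of_mem ht hx, if_neg hp, mul_zero]

lemma sum_hat_le_one (x : Plane) : ∑ p ∈ 𝒯.vertices, 𝒯.hat p x ≤ 1 := by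
  by_cases hx : x ∈ closure Ω
  · obtain ⟨t, ht, hxt⟩ := 𝒯.exists_triangle hx
    have := 𝒯.sum_mul_hat ht hxt fun _ => 1
    simp only [one_mul] at this
    rw [this, (𝒯.isTriangle ht).sum_bary]
  · simp [𝒯.hat_of_notMem_closure hx]

lemma hat_le_one (p x : Plane) : 𝒯.hat p x ≤ 1 := by
  by_cases hx : x ∈ closure Ω
  · obtain ⟨t, ht, hxt⟩ := 𝒯.exists_triangle hx
    rw [𝒯.hat_of_mem ht hxt]
    split_ifs with h
    · exact (𝒯.isTriangle ht).bary_le_one hxt h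
    · exact zero_le_one
  · rw [𝒯.hat_of_notMem_closure hx]; exact zero_le_one

lemma exists_lipschitz_const : ∃ K : NNReal, ∀ t ∈ 𝒯.triangles, ∀ p ∈ t, ‖baryGrad t p‖ ≤ K := by
  classical
  refine ⟨∑ t ∈ 𝒯.triangles, ∑ p ∈ t, ‖baryGrad t p‖₊, fun t ht p hp => ?_⟩
  have h1 : ‖baryGrad t p‖₊ ≤ ∑ p ∈ t, ‖baryGrad t p‖₊ :=
    Finset.single_le_sum (f := fun p => ‖baryGrad t p‖₊) (fun _ _ => zero_le) hp
  have h2 : ∑ p ∈ t, ‖baryGrad t p‖₊ ≤ ∑ t ∈ 𝒯.triangles, ∑ p ∈ t, ‖baryGrad t p‖₊ :=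
    Finset.single_le_sum (f := fun t => ∑ p ∈ t, ‖baryGrad t p‖₊) (fun _ _ => zero_le) ht
  exact_mod_cast h1.trans h2

lemma abs_hat_sub_le {K : NNReal} (hK : ∀ t ∈ 𝒯.triangles, ∀ p ∈ t, ‖baryGrad t p‖ ≤ K)
    {t : Finset Plane} (ht : t ∈ 𝒯.triangles) (p : Plane) {x y : Plane}
    (hx : x ∈ convexHull ℝ (t : Set Plane)) (hy : y ∈ convexHull ℝ (t : Set Plane)) :
    |𝒯.hat p x - 𝒯.hat p y| ≤ K * dist x y := by
  rw [𝒯.hat_of_mem ht hx, 𝒯.hat_of_mem ht hy]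
  split_ifs with h
  · exact (abs_bary_sub_le t p x y).trans
      (mul_le_mul_of_nonneg_right (hK t ht p h) dist_nonneg)
  · simp; positivity

/-- The set of points of the star of an interior vertex at which its basis function is positive
lies in `Ω`. -/
lemma mem_of_bary_pos (hΩ : IsPolygonalDomain Ω) {p : Plane} (hp : p ∈ Ω) {t : Finset Plane}
    (ht : t ∈ 𝒯.triangles) (hpt : p ∈ t) {x : Plane} (hx : x ∈ convexHull ℝ (t : Set Plane))
    (hpos : 0 < bary t p x) : x ∈ Ω := by
  classical
  obtain ⟨K, hK⟩ := 𝒯.exists_lipschitz_const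
  obtain ⟨r, hr, hrΩ⟩ := Metric.isOpen_iff.1 hΩ.isOpen p hp
  -- the dilation with factor `τ` and centre `p` maps `x` into a disc contained in `Ω`
  obtain ⟨τ, hτ0, hτ1, hτ⟩ : ∃ τ : ℝ, 0 < τ ∧ τ ≤ 1 ∧ p + τ • (x - p) ∈ Metric.ball p r := by
    have hc : Continuous fun τ : ℝ => p + τ • (x - p) := by fun_prop
    have h1 : ∀ᶠ τ in 𝓝[>] (0 : ℝ), p + τ • (x - p) ∈ Metric.ball p r := by
      refine ((hc.tendsto 0).mono_left nhdsWithin_le_nhds).eventually ?_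
      exact Metric.isOpen_ball.mem_nhds (by simpa using hr)
    have h2 : ∀ᶠ τ in 𝓝[>] (0 : ℝ), τ ≤ 1 :=
      (eventually_le_nhds zero_lt_one).filter_mono nhdsWithin_le_nhds
    obtain ⟨τ, ⟨h3, h4⟩, h5⟩ := ((h1.and h2).and self_mem_nhdsWithin).exists
    exact ⟨τ, h5, h4, h3⟩
  have hbary : ∀ s ∈ 𝒯.triangles, ∀ q ∈ s, p ∈ s → ∀ z, bary s q (p + τ • (z - p))
      = (1 - τ) * bary s q p + τ * bary s q z := by
    intro s _ q _ _ z
    rw [bary_eq_add s q _ p, bary_eq_add s q z p, add_sub_cancel_left, inner_smul_right]; ring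
  have hT := 𝒯.isTriangle ht
  have hxτ : p + τ • (x - p) ∈ convexHull ℝ (t : Set Plane) :=
    (convex_convexHull ℝ (t : Set Plane)).add_smul_sub_mem (subset_convexHull ℝ _ hpt) hx
      ⟨hτ0.le, hτ1⟩
  have hval : 1 - τ < 𝒯.hat p (p + τ • (x - p)) := by
    rw [𝒯.hat_of_mem ht hxτ, if_pos hpt, hbary t ht p hpt hpt, hT.bary_self hpt]
    nlinarith
  have hsub : ∀ᶠ y in 𝓝 x, y ∈ closure Ω := by
    have hc : Continuous fun y : Plane => p + τ • (y - p) := by fun_prop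
    have h1 : ∀ᶠ y in 𝓝 x, p + τ • (y - p) ∈ Metric.ball p r :=
      (hc.tendsto x).eventually (Metric.isOpen_ball.mem_nhds hτ)
    have h2 : ∀ᶠ y in 𝓝 x, K * dist (p + τ • (y - p)) (p + τ • (x - p))
        < 𝒯.hat p (p + τ • (x - p)) - (1 - τ) := by
      have hc2 : Continuous fun y : Plane => (K : ℝ) * dist (p + τ • (y - p)) (p + τ • (x - p)) := by
        fun_prop
      refine (hc2.tendsto x).eventually (gt_mem_nhds ?_)
      simp only [dist_self, mul_zero]; linarith
    filter_upwards [h1, h2] with y hy1 hy2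
    have hlip := abs_sub_le_of_segment_subset (f := 𝒯.hat p) (K := K)
      (C := fun s : 𝒯.triangles => convexHull ℝ ((s : Finset Plane) : Set Plane))
      (fun s => (IsTriangle.isCompact_convexHull _).isClosed)
      (fun s u hu v hv => 𝒯.abs_hat_sub_le hK s.2 p hu hv) Finset.univ
      (x := p + τ • (x - p)) (y := p + τ • (y - p)) (by
        refine ((convex_ball p r).segment_subset hτ hy1).trans (hrΩ.trans ?_)
        intro z hz
        obtain ⟨s, hs, hzs⟩ := 𝒯.exists_triangle (subset_closure hz)
        exact mem_iUnion₂.2 ⟨⟨s, hs⟩, Finset.mem_univ _, hzs⟩)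
    have hy3 : 1 - τ < 𝒯.hat p (p + τ • (y - p)) := by
      have := (abs_le.1 (hlip.trans hy2.le)).1
      have h3 := (abs_le.1 hlip).1
      linarith
    obtain ⟨s, hs, hys⟩ := 𝒯.exists_triangle (subset_closure (hrΩ hy1))
    have hS := 𝒯.isTriangle hs
    rw [𝒯.hat_of_mem hs hys] at hy3
    split_ifs at hy3 with hps
    · refine 𝒯.convexHull_subset hs (hS.mem_convexHull_iff.2 fun q hq => ?_)
      by_cases hqp : q = p
      · subst hqp
        rw [hbary s hs q hq hps, hS.bary_self hq] at hy3
        by_contra hneg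
        nlinarith [not_le.1 hneg]
      · have h4 := hS.mem_convexHull_iff.1 hys q hq
        rw [hbary s hs q hq hps, hS.bary_of_ne hq hps hqp, mul_zero, zero_add] at h4
        exact nonneg_of_mul_nonneg_right h4 hτ0
    · linarith
  rw [← hΩ.interior_closure]
  exact mem_interior_iff_mem_nhds.2 hsub

lemma hat_of_notMem (hΩ : IsPolygonalDomain Ω) {p : Plane} (hp : p ∈ Ω) {x : Plane} (hx : x ∉ Ω) :
    𝒯.hat p x = 0 := by
  by_cases hxc : x ∈ closure Ω
  · obtain ⟨t, ht, hxt⟩ := 𝒯.exists_triangle hxc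
    rw [𝒯.hat_of_mem ht hxt]
    split_ifs with hpt
    · by_contra h0
      have h1 := (𝒯.isTriangle ht).mem_convexHull_iff.1 hxt p hpt
      exact hx (𝒯.mem_of_bary_pos hΩ hp ht hpt hxt (lt_of_le_of_ne h1 (Ne.symm h0)))
    · rfl
  · exact 𝒯.hat_of_notMem_closure hxc p

/-- A function that is Lipschitz on each triangle and vanishes outside `Ω` is Lipschitz. -/
lemma lipschitzWith_of_triangles (hΩ : IsOpen Ω) {f : Plane → ℝ} {K : NNReal}
    (hf : ∀ t ∈ 𝒯.triangles, ∀ x ∈ convexHull ℝ (t : Set Plane),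
      ∀ y ∈ convexHull ℝ (t : Set Plane), |f x - f y| ≤ K * dist x y)
    (h0 : ∀ x ∉ Ω, f x = 0) : LipschitzWith K f := by
  refine lipschitzWith_of_closed_cover
    (C := fun o : Option 𝒯.triangles => o.elim Ωᶜ
      fun s => convexHull ℝ ((s : Finset Plane) : Set Plane)) (fun o => ?_) (fun o => ?_)
    Finset.univ (fun x => ?_)
  · cases o with
    | none => exact hΩ.isClosed_compl
    | some s => exact (IsTriangle.isCompact_convexHull _).isClosed
  · cases o with
    | none =>
      intro u hu v hv
      rw [h0 u hu, h0 v hv, sub_self, abs_zero]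
      positivity
    | some s => exact fun u hu v hv => hf s s.2 u hu v hv
  · by_cases hx : x ∈ Ω
    · obtain ⟨t, ht, hxt⟩ := 𝒯.exists_triangle (subset_closure hx)
      exact ⟨some ⟨t, ht⟩, Finset.mem_univ _, hxt⟩
    · exact ⟨none, Finset.mem_univ _, hx⟩

lemma lipschitzWith_hat (hΩ : IsPolygonalDomain Ω) {p : Plane} (hp : p ∈ Ω) :
    ∃ K, LipschitzWith K (𝒯.hat p) := by
  obtain ⟨K, hK⟩ := 𝒯.exists_lipschitz_const
  exact ⟨K, 𝒯.lipschitzWith_of_triangles hΩ.isOpen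
    (fun t ht x hx y hy => 𝒯.abs_hat_sub_le hK ht p hx hy)
    (fun x hx => 𝒯.hat_of_notMem hΩ hp hx)⟩

/-! ### Decomposition of integrals -/

lemma ae_mem_interior (hΩ : IsOpen Ω) : ∀ᵐ x ∂(volume.restrict Ω),
    ∃ t ∈ 𝒯.triangles, x ∈ interior (convexHull ℝ (t : Set Plane)) := by
  have h : ∀ᵐ x ∂(volume : Measure Plane), ∀ t ∈ 𝒯.triangles,
      x ∈ convexHull ℝ (t : Set Plane) → x ∈ interior (convexHull ℝ (t : Set Plane)) := by
    rw [Filter.eventually_all_finset]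
    intro t _
    filter_upwards [(IsTriangle.interior_ae_eq t).mem_iff] with x hx
    exact hx.2
  filter_upwards [ae_restrict_of_ae h, ae_restrict_mem hΩ.measurableSet] with x hx hxΩ
  obtain ⟨t, ht, hxt⟩ := 𝒯.exists_triangle (subset_closure hxΩ)
  exact ⟨t, ht, hx t ht hxt⟩

lemma interior_subset (hΩ : IsPolygonalDomain Ω) {t : Finset Plane} (ht : t ∈ 𝒯.triangles) :
    interior (convexHull ℝ (t : Set Plane)) ⊆ Ω := by
  conv_rhs => rw [← hΩ.interior_closure]
  exact interior_mono (𝒯.convexHull_subset ht)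

/-- The open triangles of a triangulation are disjoint. -/
lemma disjoint_interior {s t : Finset Plane} (hs : s ∈ 𝒯.triangles) (ht : t ∈ 𝒯.triangles)
    (hst : s ≠ t) : Disjoint (interior (convexHull ℝ (s : Set Plane)))
      (interior (convexHull ℝ (t : Set Plane))) := by
  rw [Set.disjoint_left]
  intro x hxs hxt
  have hne : ∃ p ∈ t, p ∉ s := by
    by_contra! h
    exact hst (Finset.eq_of_subset_of_card_le h
      (by rw [𝒯.card_eq s hs, 𝒯.card_eq t ht])).symm
  obtain ⟨p, hpt, hps⟩ := hne
  have h1 := (𝒯.isTriangle ht).mem_interior_iff.1 hxt p hpt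
  rw [𝒯.bary_eq_of_mem hs ht (_root_.interior_subset hxs) (_root_.interior_subset hxt) hpt,
    if_neg hps] at h1
  exact lt_irrefl _ h1

lemma ae_eq_iUnion (hΩ : IsPolygonalDomain Ω) :
    (⋃ t ∈ 𝒯.triangles, interior (convexHull ℝ (t : Set Plane))) =ᵐ[volume] Ω := by
  have h := 𝒯.ae_mem_interior hΩ.isOpen
  rw [ae_restrict_iff' hΩ.isOpen.measurableSet] at h
  filter_upwards [h] with x hx
  refine propext ⟨fun h' => ?_, fun h' => ?_⟩
  · obtain ⟨t, ht, hxt⟩ := mem_iUnion₂.1 h'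
    exact 𝒯.interior_subset hΩ ht hxt
  · obtain ⟨t, ht, hxt⟩ := hx h'
    exact mem_iUnion₂.2 ⟨t, ht, hxt⟩

lemma restrict_triangle_le (hΩ : IsPolygonalDomain Ω) {t : Finset Plane} (ht : t ∈ 𝒯.triangles) :
    volume.restrict (convexHull ℝ (t : Set Plane)) ≤ volume.restrict Ω := by
  rw [← Measure.restrict_congr_set (IsTriangle.interior_ae_eq t)]
  exact Measure.restrict_mono (𝒯.interior_subset hΩ ht) le_rfl

lemma ae_triangle {P : Plane → Prop} (hΩ : IsPolygonalDomain Ω) {t : Finset Plane}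
    (ht : t ∈ 𝒯.triangles) (h : ∀ᵐ x ∂(volume.restrict Ω), P x) :
    ∀ᵐ x ∂(volume.restrict (convexHull ℝ (t : Set Plane))), P x :=
  ae_mono (𝒯.restrict_triangle_le hΩ ht) h

lemma integrableOn_triangle (hΩ : IsPolygonalDomain Ω) {t : Finset Plane} (ht : t ∈ 𝒯.triangles)
    {E : Type*} [NormedAddCommGroup E] {f : Plane → E} (hf : IntegrableOn f Ω) :
    IntegrableOn f (convexHull ℝ (t : Set Plane)) :=
  Integrable.mono_measure hf (𝒯.restrict_triangle_le hΩ ht)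

/-- The integral over the domain is the sum of the integrals over the triangles. -/
lemma setIntegral_eq_sum (hΩ : IsPolygonalDomain Ω) {f : Plane → ℝ} (hf : IntegrableOn f Ω) :
    ∫ x in Ω, f x = ∑ t ∈ 𝒯.triangles, ∫ x in convexHull ℝ (t : Set Plane), f x := by
  rw [← setIntegral_congr_set (𝒯.ae_eq_iUnion hΩ), integral_biUnion_finset]
  · exact Finset.sum_congr rfl fun t _ => setIntegral_congr_set (IsTriangle.interior_ae_eq t)
  · exact fun t _ => isOpen_interior.measurableSet
  · exact fun s hs t ht hst => 𝒯.disjoint_interior hs ht hst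
  · exact fun t ht => hf.mono_set (𝒯.interior_subset hΩ ht)

lemma setIntegral_inter (hΩ : IsPolygonalDomain Ω) {t : Finset Plane} (ht : t ∈ 𝒯.triangles)
    (f : Plane → ℝ) : ∫ x in Ω ∩ convexHull ℝ (t : Set Plane), f x
      = ∫ x in convexHull ℝ (t : Set Plane), f x := by
  refine setIntegral_congr_set ?_
  filter_upwards [(IsTriangle.interior_ae_eq t).mem_iff] with x hx
  refine propext ⟨fun h => h.2, fun h => ⟨𝒯.interior_subset hΩ ht (hx.2 h), h⟩⟩

/-! ### The nodal basis functions and the bubble functions as elements of `H¹₀(Ω)` -/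

lemma hat_eventuallyEq {t : Finset Plane} (ht : t ∈ 𝒯.triangles) (p : Plane) {x : Plane}
    (hx : x ∈ interior (convexHull ℝ (t : Set Plane))) :
    𝒯.hat p =ᶠ[𝓝 x] if p ∈ t then bary t p else 0 := by
  filter_upwards [mem_interior_iff_mem_nhds.1 hx] with y hy
  rw [𝒯.hat_of_mem ht hy]
  split_ifs <;> rfl

lemma gradient_hat {t : Finset Plane} (ht : t ∈ 𝒯.triangles) (p : Plane) {x : Plane}
    (hx : x ∈ interior (convexHull ℝ (t : Set Plane))) :
    gradient (𝒯.hat p) x = if p ∈ t then baryGrad t p else 0 := by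
  have h := 𝒯.hat_eventuallyEq ht p hx
  rw [gradient, h.fderiv_eq, ← gradient]
  split_ifs
  · exact (hasGradientAt_bary t p x).gradient
  · simp [gradient]

lemma hat_ne_zero_or (hΩ : IsPolygonalDomain Ω) (p : Plane) :
    ∀ᵐ x ∂(volume.restrict Ω), 𝒯.hat p x ≠ 0 ∨ 𝒯.hat p =ᶠ[𝓝 x] 0 := by
  filter_upwards [𝒯.ae_mem_interior hΩ.isOpen] with x hx
  obtain ⟨t, ht, hxt⟩ := hx
  by_cases hp : p ∈ t
  · left
    rw [𝒯.hat_of_mem ht (_root_.interior_subset hxt), if_pos hp]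
    exact ((𝒯.isTriangle ht).mem_interior_iff.1 hxt p hp).ne'
  · right
    have := 𝒯.hat_eventuallyEq ht p hxt
    rwa [if_neg hp] at this

lemma exists_hat (hΩ : IsPolygonalDomain Ω) (p : Plane) : ∃ w : H10 Ω, p ∈ Ω →
    (H1.val (w : H1 Ω) =ᵐ[volume.restrict Ω] 𝒯.hat p ∧
      H1.grad (w : H1 Ω) =ᵐ[volume.restrict Ω] gradient (𝒯.hat p)) := by
  by_cases hp : p ∈ Ω
  · obtain ⟨K, hK⟩ := 𝒯.lipschitzWith_hat hΩ hp
    exact ⟨⟨_, ofLipschitz_mem_H10 hΩ.isOpen hΩ.isBounded hK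
      (fun x hx => 𝒯.hat_of_notMem hΩ hp hx) (𝒯.hat_ne_zero_or hΩ p)⟩,
      fun _ => ⟨H1.val_ofLipschitz hΩ.isOpen hΩ.isBounded hK,
        H1.grad_ofLipschitz hΩ.isOpen hΩ.isBounded hK⟩⟩
  · exact ⟨0, fun h => absurd h hp⟩

/-- The nodal basis function of an interior vertex as an element of `H¹₀(Ω)`. -/
noncomputable def hatElt (hΩ : IsPolygonalDomain Ω) (p : Plane) : H10 Ω :=
  (𝒯.exists_hat hΩ p).choose

lemma val_hatElt (hΩ : IsPolygonalDomain Ω) {p : Plane} (hp : p ∈ Ω) :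
    H1.val (𝒯.hatElt hΩ p : H1 Ω) =ᵐ[volume.restrict Ω] 𝒯.hat p :=
  ((𝒯.exists_hat hΩ p).choose_spec hp).1

lemma grad_hatElt (hΩ : IsPolygonalDomain Ω) {p : Plane} (hp : p ∈ Ω) :
    H1.grad (𝒯.hatElt hΩ p : H1 Ω) =ᵐ[volume.restrict Ω] gradient (𝒯.hat p) :=
  ((𝒯.exists_hat hΩ p).choose_spec hp).2

lemma lipschitzWith_bubble {t : Finset Plane} (ht : t ∈ 𝒯.triangles) {K : NNReal}
    (hK : ∀ p ∈ t, ‖baryGrad t p‖ ≤ K) :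
    LipschitzWith (3 * K) ((convexHull ℝ (t : Set Plane)).indicator (bubble t)) := by
  have hT := 𝒯.isTriangle ht
  refine lipschitzWith_of_closed_cover
    (C := fun o : Bool => if o then convexHull ℝ (t : Set Plane)
      else (interior (convexHull ℝ (t : Set Plane)))ᶜ) (fun o => ?_) (fun o => ?_)
    Finset.univ (fun x => ?_)
  · cases o
    · exact isOpen_interior.isClosed_compl
    · exact (IsTriangle.isCompact_convexHull t).isClosed
  · cases o
    · have h0 : ∀ u ∈ (interior (convexHull ℝ (t : Set Plane)))ᶜ,
          (convexHull ℝ (t : Set Plane)).indicator (bubble t) u = 0 := by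
        intro u hu
        by_cases hut : u ∈ convexHull ℝ (t : Set Plane)
        · rw [indicator_of_mem hut]
          rw [mem_compl_iff, hT.mem_interior_iff] at hu
          push Not at hu
          obtain ⟨p, hp, hp0⟩ := hu
          exact Finset.prod_eq_zero hp (le_antisymm hp0 (hT.mem_convexHull_iff.1 hut p hp))
        · rw [indicator_of_notMem hut]
      intro u hu v hv
      rw [h0 u hu, h0 v hv, sub_self, abs_zero]
      positivity
    · intro u hu v hv
      replace hu : u ∈ convexHull ℝ (t : Set Plane) := hu
      replace hv : v ∈ convexHull ℝ (t : Set Plane) := hv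
      rw [indicator_of_mem hu, indicator_of_mem hv]
      simpa using hT.abs_bubble_sub_le hK hu hv
  · by_cases hx : x ∈ convexHull ℝ (t : Set Plane)
    · exact ⟨true, Finset.mem_univ _, hx⟩
    · exact ⟨false, Finset.mem_univ _, fun h => hx (_root_.interior_subset h)⟩

lemma indicator_bubble_eventuallyEq {s t : Finset Plane} (hs : s ∈ 𝒯.triangles)
    (ht : t ∈ 𝒯.triangles) {x : Plane} (hx : x ∈ interior (convexHull ℝ (s : Set Plane))) :
    (convexHull ℝ (t : Set Plane)).indicator (bubble t) =ᶠ[𝓝 x] if s = t then bubble t else 0 := by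
  split_ifs with h
  · subst h
    filter_upwards [mem_interior_iff_mem_nhds.1 hx] with y hy
    rw [indicator_of_mem hy]
  · filter_upwards [isOpen_interior.mem_nhds hx] with y hy
    by_cases hyt : y ∈ convexHull ℝ (t : Set Plane)
    · rw [indicator_of_mem hyt]
      have hne : ∃ p ∈ t, p ∉ s := by
        by_contra! h'
        exact h (Finset.eq_of_subset_of_card_le h'
          (by rw [𝒯.card_eq s hs, 𝒯.card_eq t ht])).symm
      obtain ⟨p, hpt, hps⟩ := hne
      refine Finset.prod_eq_zero hpt ?_
      rw [𝒯.bary_eq_of_mem hs ht (_root_.interior_subset hy) hyt hpt, if_neg hps]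
    · rw [indicator_of_notMem hyt]; rfl

lemma exists_bubble (hΩ : IsPolygonalDomain Ω) (t : Finset Plane) :
    ∃ w : H10 Ω, t ∈ 𝒯.triangles →
    (H1.val (w : H1 Ω) =ᵐ[volume.restrict Ω] (convexHull ℝ (t : Set Plane)).indicator (bubble t) ∧
      H1.grad (w : H1 Ω) =ᵐ[volume.restrict Ω]
        gradient ((convexHull ℝ (t : Set Plane)).indicator (bubble t))) := by
  by_cases ht : t ∈ 𝒯.triangles
  · obtain ⟨K, hK'⟩ := 𝒯.exists_lipschitz_const
    have hK := 𝒯.lipschitzWith_bubble ht (hK' t ht)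
    have hT := 𝒯.isTriangle ht
    refine ⟨⟨_, ofLipschitz_mem_H10 hΩ.isOpen hΩ.isBounded hK (fun x hx => ?_) ?_⟩,
      fun _ => ⟨H1.val_ofLipschitz hΩ.isOpen hΩ.isBounded hK,
        H1.grad_ofLipschitz hΩ.isOpen hΩ.isBounded hK⟩⟩
    · by_cases hxt : x ∈ convexHull ℝ (t : Set Plane)
      · rw [indicator_of_mem hxt]
        have h1 : x ∉ interior (convexHull ℝ (t : Set Plane)) :=
          fun h => hx (𝒯.interior_subset hΩ ht h)
        rw [hT.mem_interior_iff] at h1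
        push Not at h1
        obtain ⟨p, hp, hp0⟩ := h1
        exact Finset.prod_eq_zero hp (le_antisymm hp0 (hT.mem_convexHull_iff.1 hxt p hp))
      · rw [indicator_of_notMem hxt]
    · filter_upwards [𝒯.ae_mem_interior hΩ.isOpen] with x hx
      obtain ⟨s, hs, hxs⟩ := hx
      have h := 𝒯.indicator_bubble_eventuallyEq hs ht hxs
      by_cases hst : s = t
      · left
        subst hst
        rw [indicator_of_mem (_root_.interior_subset hxs)]
        exact (Finset.prod_pos (hT.mem_interior_iff.1 hxs)).ne'
      · right
        rwa [if_neg hst] at h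
  · exact ⟨0, fun h => absurd h ht⟩

/-- The bubble function of a triangle, extended by zero, as an element of `H¹₀(Ω)`. -/
noncomputable def bubbleElt (hΩ : IsPolygonalDomain Ω) (t : Finset Plane) : H10 Ω :=
  (𝒯.exists_bubble hΩ t).choose

lemma val_bubbleElt (hΩ : IsPolygonalDomain Ω) {t : Finset Plane} (ht : t ∈ 𝒯.triangles) :
    H1.val (𝒯.bubbleElt hΩ t : H1 Ω)
      =ᵐ[volume.restrict Ω] (convexHull ℝ (t : Set Plane)).indicator (bubble t) :=
  ((𝒯.exists_bubble hΩ t).choose_spec ht).1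

lemma grad_bubbleElt (hΩ : IsPolygonalDomain Ω) {t : Finset Plane} (ht : t ∈ 𝒯.triangles) :
    H1.grad (𝒯.bubbleElt hΩ t : H1 Ω)
      =ᵐ[volume.restrict Ω] gradient ((convexHull ℝ (t : Set Plane)).indicator (bubble t)) :=
  ((𝒯.exists_bubble hΩ t).choose_spec ht).2

end Triangulation

end PlateFEM

namespace PlateFEM

/-! ### The finite element space `S_h` -/

/-- `L²` closeness of an `H¹₀` function to a constant on a small disc; the constant is zero if the
disc is centred at the end point of a segment of comparable length outside `Ω`. -/
lemma H10.exists_const {Ω : Set Plane} (hΩ : IsOpen Ω) (w : H10 Ω) (p : Plane) {e : Plane}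
    (he : ‖e‖ = 1) {L : ℝ} (hL : 0 < L) {ε : ℝ} (hε : 0 < ε) :
    ∃ m : ℝ, ((∀ s ∈ Icc 0 L, p + s • e ∉ Ω) → m = 0) ∧
      ∫ x in Ω ∩ Metric.closedBall p L, (H1.val (w : H1 Ω) x - m) ^ 2
        ≤ 96 * L ^ 2 * (∫ x in Ω ∩ Metric.closedBall p (2 * L), ‖H1.grad (w : H1 Ω) x‖ ^ 2) + ε := by
  set η : ℝ := ε / (2 + 96 * L ^ 2) with hη
  have hη0 : 0 < η := by positivity
  have hw : (w : H1 Ω) ∈ closure (testSubspace Ω : Set (H1 Ω)) := by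
    rw [← Submodule.topologicalClosure_coe]; exact w.2
  obtain ⟨u, hu, hdist⟩ := Metric.mem_closure_iff.1 hw (Real.sqrt η) (Real.sqrt_pos.2 hη0)
  obtain ⟨φ, hφ, hval, hgrad⟩ : ∃ φ, IsTestFunction Ω φ ∧ H1.val u =ᵐ[volume.restrict Ω] φ ∧
      H1.grad u =ᵐ[volume.restrict Ω] gradient φ := by
    obtain ⟨φ, hφ, hval⟩ := hu
    exact ⟨φ, hφ, hval, H1.grad_of_isTestFunction hΩ hφ hval⟩
  have hnorm : ‖(w : H1 Ω) - u‖ ^ 2 ≤ η := by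
    rw [dist_eq_norm] at hdist
    calc _ ≤ Real.sqrt η ^ 2 := pow_le_pow_left₀ (norm_nonneg _) hdist.le 2
      _ = η := Real.sq_sqrt hη0.le
  rw [H1.norm_sq] at hnorm
  have hn1 : 0 ≤ ∫ x in Ω, H1.val ((w : H1 Ω) - u) x ^ 2 := integral_nonneg fun x => sq_nonneg _
  have hn2 : 0 ≤ ∫ x in Ω, ‖H1.grad ((w : H1 Ω) - u) x‖ ^ 2 :=
    integral_nonneg fun x => sq_nonneg _
  obtain ⟨s, hs, hP⟩ := exists_setIntegral_sub_sq_le (hφ.smooth.of_le (by simp)) p he hL le_rfl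
  have hconst : 8 * L ^ 2 + 16 * L ^ 3 / L = 24 * L ^ 2 := by field_simp; ring
  rw [hconst] at hP
  set m := φ (p + s • e) with hm
  refine ⟨m, fun h => image_eq_zero_of_notMem_tsupport fun h' => h s hs (hφ.supp h'), ?_⟩
  set B := Metric.closedBall p L
  set B2 := Metric.closedBall p (2 * L)
  have hB : MeasurableSet B := Metric.isClosed_closedBall.measurableSet
  have hB2 : MeasurableSet B2 := Metric.isClosed_closedBall.measurableSet
  have hgc : Continuous (gradient φ) :=
    (LinearIsometryEquiv.continuous _).comp (hφ.smooth.continuous_fderiv (by simp))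
  have hfin : volume (Ω ∩ B) ≠ ⊤ :=
    ((measure_mono inter_subset_right).trans_lt (isCompact_closedBall p L).measure_lt_top).ne
  -- the gradient of `φ` on the large disc
  have hG : ∫ x in B2, ‖gradient φ x‖ ^ 2
      ≤ 2 * (∫ x in Ω ∩ B2, ‖H1.grad (w : H1 Ω) x‖ ^ 2) + 2 * η := by
    have e1 : ∫ x in B2, ‖gradient φ x‖ ^ 2 = ∫ x in Ω ∩ B2, ‖gradient φ x‖ ^ 2 := by
      rw [inter_comm]
      refine setIntegral_eq_of_subset_of_forall_sdiff_eq_zero hB2 inter_subset_left fun x hx => ?_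
      have hxΩ : x ∉ Ω := fun h => hx.2 ⟨hx.1, h⟩
      have : fderiv ℝ φ x = 0 := image_eq_zero_of_notMem_tsupport
        (fun hx' => hxΩ (hφ.supp (tsupport_fderiv_subset ℝ hx')))
      rw [norm_gradient, this]; simp
    have i1 : IntegrableOn (fun x => ‖H1.grad (w : H1 Ω) x‖ ^ 2) Ω := H1.integrable_grad_sq _
    have i2 : IntegrableOn (fun x => ‖H1.grad ((w : H1 Ω) - u) x‖ ^ 2) Ω :=
      H1.integrable_grad_sq _
    have hpt : ∀ᵐ x ∂(volume.restrict Ω), ‖gradient φ x‖ ^ 2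
        ≤ 2 * ‖H1.grad (w : H1 Ω) x‖ ^ 2 + 2 * ‖H1.grad ((w : H1 Ω) - u) x‖ ^ 2 := by
      filter_upwards [hgrad, H1.grad_sub (w : H1 Ω) u] with x h1 h2
      rw [h2, Pi.sub_apply, h1]
      have h3 : ‖gradient φ x‖ ≤ ‖H1.grad (w : H1 Ω) x‖
          + ‖H1.grad (w : H1 Ω) x - gradient φ x‖ := by
        have := norm_sub_le (H1.grad (w : H1 Ω) x) (H1.grad (w : H1 Ω) x - gradient φ x)
        simpa using this
      nlinarith [norm_nonneg (gradient φ x), sq_nonneg (‖H1.grad (w : H1 Ω) x‖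
          - ‖H1.grad (w : H1 Ω) x - gradient φ x‖)]
    have i3 : IntegrableOn (fun x => 2 * ‖H1.grad (w : H1 Ω) x‖ ^ 2
        + 2 * ‖H1.grad ((w : H1 Ω) - u) x‖ ^ 2) (Ω ∩ B2) :=
      ((i1.mono_set inter_subset_left).const_mul 2).add
        ((i2.mono_set inter_subset_left).const_mul 2)
    rw [e1]
    calc _ ≤ ∫ x in Ω ∩ B2, (2 * ‖H1.grad (w : H1 Ω) x‖ ^ 2
          + 2 * ‖H1.grad ((w : H1 Ω) - u) x‖ ^ 2) :=
        integral_mono_of_nonneg (Eventually.of_forall fun x => sq_nonneg _) i3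
          (ae_restrict_of_ae_restrict_of_subset inter_subset_left hpt)
      _ = 2 * (∫ x in Ω ∩ B2, ‖H1.grad (w : H1 Ω) x‖ ^ 2)
          + 2 * ∫ x in Ω ∩ B2, ‖H1.grad ((w : H1 Ω) - u) x‖ ^ 2 := by
        rw [integral_add ((i1.mono_set inter_subset_left).const_mul 2)
          ((i2.mono_set inter_subset_left).const_mul 2), integral_const_mul, integral_const_mul]
      _ ≤ _ := by
        have : ∫ x in Ω ∩ B2, ‖H1.grad ((w : H1 Ω) - u) x‖ ^ 2
            ≤ ∫ x in Ω, ‖H1.grad ((w : H1 Ω) - u) x‖ ^ 2 :=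
          setIntegral_mono_set i2 (Eventually.of_forall fun x => sq_nonneg _)
            (Eventually.of_forall inter_subset_left)
        linarith
  have hcφ : Continuous fun x => (φ x - m) ^ 2 := (hφ.smooth.continuous.sub continuous_const).pow 2
  have j1 : IntegrableOn (fun x => (φ x - m) ^ 2) B :=
    hcφ.continuousOn.integrableOn_compact (isCompact_closedBall p L)
  have j2 : IntegrableOn (fun x => H1.val ((w : H1 Ω) - u) x ^ 2) Ω := H1.integrable_val_sq _
  have hpt : ∀ᵐ x ∂(volume.restrict Ω), (H1.val (w : H1 Ω) x - m) ^ 2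
      ≤ 2 * (φ x - m) ^ 2 + 2 * H1.val ((w : H1 Ω) - u) x ^ 2 := by
    filter_upwards [hval, H1.val_sub (w : H1 Ω) u] with x h1 h2
    rw [h2, Pi.sub_apply, h1]
    nlinarith [sq_nonneg ((φ x - m) - (H1.val (w : H1 Ω) x - φ x))]
  have j3 : IntegrableOn (fun x => 2 * (φ x - m) ^ 2 + 2 * H1.val ((w : H1 Ω) - u) x ^ 2)
      (Ω ∩ B) :=
    ((j1.mono_set inter_subset_right).const_mul 2).add
      ((j2.mono_set inter_subset_left).const_mul 2)
  calc ∫ x in Ω ∩ B, (H1.val (w : H1 Ω) x - m) ^ 2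
      ≤ ∫ x in Ω ∩ B, (2 * (φ x - m) ^ 2 + 2 * H1.val ((w : H1 Ω) - u) x ^ 2) :=
        integral_mono_of_nonneg (Eventually.of_forall fun x => sq_nonneg _) j3
          (ae_restrict_of_ae_restrict_of_subset inter_subset_left hpt)
    _ = 2 * (∫ x in Ω ∩ B, (φ x - m) ^ 2)
        + 2 * ∫ x in Ω ∩ B, H1.val ((w : H1 Ω) - u) x ^ 2 := by
        rw [integral_add ((j1.mono_set inter_subset_right).const_mul 2)
          ((j2.mono_set inter_subset_left).const_mul 2), integral_const_mul, integral_const_mul]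
    _ ≤ 2 * (24 * L ^ 2 * (2 * (∫ x in Ω ∩ B2, ‖H1.grad (w : H1 Ω) x‖ ^ 2) + 2 * η))
        + 2 * η := by
        have k1 : ∫ x in Ω ∩ B, (φ x - m) ^ 2 ≤ ∫ x in B, (φ x - m) ^ 2 :=
          setIntegral_mono_set j1 (Eventually.of_forall fun x => sq_nonneg _)
            (Eventually.of_forall inter_subset_right)
        have k2 : ∫ x in Ω ∩ B, H1.val ((w : H1 Ω) - u) x ^ 2
            ≤ ∫ x in Ω, H1.val ((w : H1 Ω) - u) x ^ 2 :=
          setIntegral_mono_set j2 (Eventually.of_forall fun x => sq_nonneg _)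
            (Eventually.of_forall inter_subset_left)
        have k3 := k1.trans (hP.trans (mul_le_mul_of_nonneg_left hG (by positivity)))
        linarith
    _ = _ := by
        have : ε = η * (2 + 96 * L ^ 2) := by rw [hη]; field_simp
        rw [this]; ring

namespace Triangulation

variable {Ω : Set Plane} (𝒯 : Triangulation Ω)

/-- If a function coincides with an affine function on a triangle with vertex `p`, then its `L²`
distance to a constant on small discs around `p` controls the distance of the constant to the value
of the affine function at `p`. -/
lemma exists_tendsto_zero_vertex (hΩ : IsPolygonalDomain Ω) (w : H10 Ω) {t : Finset Plane}
    (ht : t ∈ 𝒯.triangles) {p : Plane} (hp : p ∈ t) (a : Plane →ᵃ[ℝ] ℝ)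
    (ha : ∀ᵐ x ∂(volume.restrict Ω), x ∈ convexHull ℝ (t : Set Plane) →
      H1.val (w : H1 Ω) x = a x) :
    ∃ R : ℝ → ℝ, Tendsto R (𝓝[>] 0) (𝓝 0) ∧ ∀ᶠ L in 𝓝[>] (0 : ℝ), ∀ m : ℝ,
      ∫ x in Ω ∩ Metric.closedBall p L, (H1.val (w : H1 Ω) x - m) ^ 2
        ≤ 96 * L ^ 2 * (∫ x in Ω ∩ Metric.closedBall p (2 * L), ‖H1.grad (w : H1 Ω) x‖ ^ 2)
          + L ^ 4 → (a p - m) ^ 2 ≤ R L := by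
  have hT := 𝒯.isTriangle ht
  set T := convexHull ℝ (t : Set Plane) with hTdef
  have hpT : p ∈ T := subset_convexHull ℝ _ hp
  have hTc : IsCompact T := IsTriangle.isCompact_convexHull t
  obtain ⟨g, -, hg⟩ := hasGradientAt_of_affineMap a
  set d : ℝ := Metric.diam T + 1 with hd
  have hd0 : 0 < d := by have := Metric.diam_nonneg (s := T); linarith
  have hμ : 0 < volume.real T := hT.measureReal_pos
  set E : ℝ → ℝ := fun L => ∫ x in Ω ∩ Metric.closedBall p (2 * L), ‖H1.grad (w : H1 Ω) x‖ ^ 2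
  have hE : Tendsto E (𝓝[>] 0) (𝓝 0) := by
    have h1 : E = fun L => ∫ x in Metric.closedBall p (2 * L), ‖H1.grad (w : H1 Ω) x‖ ^ 2
        ∂(volume.restrict Ω) := by
      ext L
      rw [Measure.restrict_restrict Metric.isClosed_closedBall.measurableSet, inter_comm]
    rw [h1]
    refine Integrable.tendsto_setIntegral_nhds_zero (H1.integrable_grad_sq (w : H1 Ω)) ?_
    have h2 : Tendsto (fun L : ℝ => volume (Metric.closedBall p (2 * L))) (𝓝[>] 0) (𝓝 0) := by
      have h3 : Tendsto (fun L : ℝ => ENNReal.ofReal ((2 * L) ^ Module.finrank ℝ Plane)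
          * volume (Metric.ball (0 : Plane) 1)) (𝓝[>] 0) (𝓝 0) := by
        have h4 : Tendsto (fun L : ℝ => ENNReal.ofReal ((2 * L) ^ Module.finrank ℝ Plane))
            (𝓝[>] 0) (𝓝 0) := by
          have hc : Continuous fun L : ℝ => ENNReal.ofReal ((2 * L) ^ Module.finrank ℝ Plane) :=
            ENNReal.continuous_ofReal.comp (by fun_prop)
          have := (hc.tendsto 0).mono_left (nhdsWithin_le_nhds (s := Ioi 0))
          simpa using this
        have := ENNReal.Tendsto.mul_const h4 (b := volume (Metric.ball (0 : Plane) 1))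
          (Or.inr Metric.isBounded_ball.measure_lt_top.ne)
        simpa using this
      refine h3.congr' ?_
      filter_upwards [self_mem_nhdsWithin] with L hL
      rw [Measure.addHaar_closedBall _ _ (by have : (0 : ℝ) < L := hL
                                             linarith)]
    refine tendsto_of_tendsto_of_tendsto_of_le_of_le tendsto_const_nhds h2 (fun _ => zero_le)
      (fun L => ?_)
    exact Measure.restrict_apply_le _ _
  refine ⟨fun L => (192 * d ^ 2 * E L + 2 * d ^ 2 * L ^ 2 + 2 * ‖g‖ ^ 2 * volume.real T * L ^ 2)
    / volume.real T, ?_, ?_⟩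
  · have hL2 : Tendsto (fun L : ℝ => L ^ 2) (𝓝[>] 0) (𝓝 0) := by
      have := ((continuous_pow (M := ℝ) 2).tendsto 0).mono_left (nhdsWithin_le_nhds (s := Ioi 0))
      simpa using this
    have := (((hE.const_mul (192 * d ^ 2)).add (hL2.const_mul (2 * d ^ 2))).add
      (hL2.const_mul (2 * ‖g‖ ^ 2 * volume.real T))).div_const (volume.real T)
    simpa using this
  · have hsmall : ∀ᶠ L in 𝓝[>] (0 : ℝ), L ≤ d :=
      (eventually_le_nhds hd0).filter_mono nhdsWithin_le_nhds
    filter_upwards [hsmall, self_mem_nhdsWithin] with L hLd hL0 m hm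
    replace hL0 : 0 < L := hL0
    set τ := L / d with hτ
    have hτ0 : 0 < τ := by positivity
    have hτ1 : τ ≤ 1 := by rw [hτ, div_le_one hd0]; exact hLd
    have hτd : τ * d = L := by rw [hτ]; field_simp
    -- the triangle shrunk towards `p` fits into the disc of radius `L`, and its area is of the same
    -- order `L ^ 2`
    set T' := AffineMap.homothety p τ '' T with hT'
    have hT'T : T' ⊆ T := by
      rintro _ ⟨x, hx, rfl⟩
      rw [AffineMap.homothety_apply, vsub_eq_sub, vadd_eq_add, add_comm]
      exact (convex_convexHull ℝ (t : Set Plane)).add_smul_sub_mem hpT hx ⟨hτ0.le, hτ1⟩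
    have hT'B : T' ⊆ Metric.closedBall p L := by
      rintro _ ⟨x, hx, rfl⟩
      rw [AffineMap.homothety_apply, vsub_eq_sub, vadd_eq_add, Metric.mem_closedBall, dist_eq_norm,
        add_sub_cancel_right, norm_smul, Real.norm_eq_abs, abs_of_pos hτ0, ← hτd, ← dist_eq_norm]
      refine mul_le_mul_of_nonneg_left ?_ hτ0.le
      have := Metric.dist_le_diam_of_mem hTc.isBounded hx hpT
      linarith
    have hμ' : volume.real T' = τ ^ 2 * volume.real T := by
      rw [measureReal_def, Measure.addHaar_image_homothety, ENNReal.toReal_mul,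
        ENNReal.toReal_ofReal (abs_nonneg _), measureReal_def]
      simp
    have hT'c : IsCompact T' := by
      refine hTc.image ?_
      exact AffineMap.homothety_continuous p τ
    have hT'm : MeasurableSet T' := hT'c.measurableSet
    have hfin : volume T' ≠ ⊤ := hT'c.measure_lt_top.ne
    have haeT : ∀ᵐ x ∂(volume.restrict T'), x ∈ Ω ∧ H1.val (w : H1 Ω) x = a x := by
      have h1 : ∀ᵐ x ∂(volume.restrict T'), x ∈ interior T := by
        refine ae_restrict_of_ae_restrict_of_subset hT'T ?_
        rw [← Measure.restrict_congr_set (IsTriangle.interior_ae_eq t)]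
        exact ae_restrict_mem isOpen_interior.measurableSet
      have h2 := ae_restrict_of_ae_restrict_of_subset hT'T (𝒯.ae_triangle hΩ ht ha)
      filter_upwards [h1, h2] with x hx1 hx2
      exact ⟨𝒯.interior_subset hΩ ht hx1, hx2 (_root_.interior_subset hx1)⟩
    have hint : IntegrableOn (fun x => (H1.val (w : H1 Ω) x - m) ^ 2)
        (Ω ∩ Metric.closedBall p L) := by
      have hfinΩ := isFiniteMeasure_restrict hΩ.isBounded
      have : MemLp (fun x => H1.val (w : H1 Ω) x - m) 2 (volume.restrict Ω) :=
        (H1.memLp_val (w : H1 Ω)).sub (memLp_const m)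
      exact (IntegrableOn.mono_set this.integrable_sq inter_subset_left :)
    have hT'sub : T' ≤ᵐ[volume] (Ω ∩ Metric.closedBall p L : Set Plane) := by
      have := (ae_restrict_iff' hT'm).1 haeT
      filter_upwards [this] with x hx hxT
      exact ⟨(hx hxT).1, hT'B hxT⟩
    have k1 : ∫ x in T', (H1.val (w : H1 Ω) x - m) ^ 2
        ≤ ∫ x in Ω ∩ Metric.closedBall p L, (H1.val (w : H1 Ω) x - m) ^ 2 :=
      setIntegral_mono_set hint (Eventually.of_forall fun x => sq_nonneg _) hT'sub
    have k2 : ∫ x in T', (a p - m) ^ 2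
        ≤ ∫ x in T', (2 * (H1.val (w : H1 Ω) x - m) ^ 2 + 2 * (‖g‖ * L) ^ 2) := by
      refine integral_mono_of_nonneg (Eventually.of_forall fun x => sq_nonneg _) ?_ ?_
      · exact ((hint.mono_set_ae hT'sub).const_mul 2).add (integrableOn_const hfin)
      · filter_upwards [haeT, ae_restrict_mem hT'm] with x hx hxT
        have h1 : |a p - a x| ≤ ‖g‖ * L := by
          rw [hg p x, add_sub_cancel_left]
          refine (abs_real_inner_le_norm _ _).trans ?_
          refine mul_le_mul_of_nonneg_left ?_ (norm_nonneg _)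
          rw [← dist_eq_norm, dist_comm]; exact hT'B hxT
        have h2 : (a p - a x) ^ 2 ≤ (‖g‖ * L) ^ 2 := by
          rw [← sq_abs]; exact pow_le_pow_left₀ (abs_nonneg _) h1 2
        rw [hx.2]
        nlinarith [sq_nonneg ((a p - a x) - (a x - m))]
    rw [integral_add ((hint.mono_set_ae hT'sub).const_mul 2) (integrableOn_const hfin),
      integral_const_mul, setIntegral_const, setIntegral_const, hμ', smul_eq_mul, smul_eq_mul] at k2
    have k3 : τ ^ 2 * volume.real T * (a p - m) ^ 2
        ≤ 2 * (96 * L ^ 2 * E L + L ^ 4) + τ ^ 2 * volume.real T * (2 * (‖g‖ * L) ^ 2) := by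
      linarith [k1.trans hm]
    rw [le_div_iff₀ hμ]
    have hτ2 : 0 < τ ^ 2 := by positivity
    refine le_of_mul_le_mul_left ?_ hτ2
    calc τ ^ 2 * ((a p - m) ^ 2 * volume.real T) = τ ^ 2 * volume.real T * (a p - m) ^ 2 := by ring
      _ ≤ _ := k3
      _ = _ := by rw [← hτd]; ring

/-- The finite element function with given nodal values at the interior vertices. -/
noncomputable def fe (hΩ : IsPolygonalDomain Ω) : (Plane → ℝ) →ₗ[ℝ] H10 Ω where
  toFun y := ∑ p ∈ 𝒯.interiorVertices, y p • 𝒯.hatElt hΩ p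
  map_add' y z := by simp only [Pi.add_apply, add_smul, Finset.sum_add_distrib]
  map_smul' c y := by
    simp only [Pi.smul_apply, smul_eq_mul, mul_smul, Finset.smul_sum, RingHom.id_apply]

lemma fe_apply (hΩ : IsPolygonalDomain Ω) (y : Plane → ℝ) :
    𝒯.fe hΩ y = ∑ p ∈ 𝒯.interiorVertices, y p • 𝒯.hatElt hΩ p := rfl

lemma coe_fe (hΩ : IsPolygonalDomain Ω) (y : Plane → ℝ) :
    (𝒯.fe hΩ y : H1 Ω) = ∑ p ∈ 𝒯.interiorVertices, y p • (𝒯.hatElt hΩ p : H1 Ω) := by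
  rw [fe_apply, AddSubmonoidClass.coe_finsetSum]
  rfl

lemma val_fe (hΩ : IsPolygonalDomain Ω) (y : Plane → ℝ) :
    H1.val (𝒯.fe hΩ y : H1 Ω)
      =ᵐ[volume.restrict Ω] fun x => ∑ p ∈ 𝒯.vertices, Ω.indicator y p * 𝒯.hat p x := by
  classical
  have h : ∀ᵐ x ∂(volume.restrict Ω), ∀ p ∈ 𝒯.interiorVertices,
      H1.val (𝒯.hatElt hΩ p : H1 Ω) x = 𝒯.hat p x := by
    rw [Filter.eventually_all_finset]
    exact fun p hp => 𝒯.val_hatElt hΩ (𝒯.mem_interiorVertices.1 hp).2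
  rw [coe_fe]
  filter_upwards [H1.val_sum 𝒯.interiorVertices y fun p => (𝒯.hatElt hΩ p : H1 Ω), h] with x h1 h2
  rw [h1, ← Finset.sum_subset (s₁ := 𝒯.interiorVertices)
    (fun p hp => (𝒯.mem_interiorVertices.1 hp).1)]
  · refine Finset.sum_congr rfl fun p hp => ?_
    rw [h2 p hp, indicator_of_mem (𝒯.mem_interiorVertices.1 hp).2]
  · intro p hp hp'
    rw [indicator_of_notMem, zero_mul]
    exact fun h => hp' (𝒯.mem_interiorVertices.2 ⟨hp, h⟩)

lemma val_fe_triangle (hΩ : IsPolygonalDomain Ω) (y : Plane → ℝ) :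
    ∀ᵐ x ∂(volume.restrict Ω), ∀ t ∈ 𝒯.triangles, x ∈ convexHull ℝ (t : Set Plane) →
      H1.val (𝒯.fe hΩ y : H1 Ω) x = ∑ p ∈ t, Ω.indicator y p * bary t p x := by
  filter_upwards [𝒯.val_fe hΩ y] with x hx t ht hxt
  rw [hx, 𝒯.sum_mul_hat ht hxt]

lemma grad_fe_triangle (hΩ : IsPolygonalDomain Ω) (y : Plane → ℝ) :
    ∀ᵐ x ∂(volume.restrict Ω), ∀ t ∈ 𝒯.triangles, x ∈ interior (convexHull ℝ (t : Set Plane)) →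
      H1.grad (𝒯.fe hΩ y : H1 Ω) x = ∑ p ∈ t, Ω.indicator y p • baryGrad t p := by
  classical
  have h : ∀ᵐ x ∂(volume.restrict Ω), ∀ p ∈ 𝒯.interiorVertices,
      H1.grad (𝒯.hatElt hΩ p : H1 Ω) x = gradient (𝒯.hat p) x := by
    rw [Filter.eventually_all_finset]
    exact fun p hp => 𝒯.grad_hatElt hΩ (𝒯.mem_interiorVertices.1 hp).2
  rw [coe_fe]
  filter_upwards [H1.grad_sum 𝒯.interiorVertices y fun p => (𝒯.hatElt hΩ p : H1 Ω), h]
    with x h1 h2 t ht hxt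
  have h3 : ∑ p ∈ t, Ω.indicator y p • baryGrad t p
      = ∑ p ∈ 𝒯.vertices, Ω.indicator y p • (if p ∈ t then baryGrad t p else 0) := by
    rw [← Finset.sum_subset (s₁ := t) (s₂ := 𝒯.vertices)
      (fun p hp => 𝒯.mem_vertices_of_mem ht hp)]
    · exact Finset.sum_congr rfl fun p hp => by rw [if_pos hp]
    · exact fun p _ hp => by rw [if_neg hp, smul_zero]
  rw [h1, h3, ← Finset.sum_subset (s₁ := 𝒯.interiorVertices)
    (fun p hp => (𝒯.mem_interiorVertices.1 hp).1)]
  · refine Finset.sum_congr rfl fun p hp => ?_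
    rw [h2 p hp, indicator_of_mem (𝒯.mem_interiorVertices.1 hp).2, 𝒯.gradient_hat ht p hxt]
  · intro p hp hp'
    rw [indicator_of_notMem, zero_smul]
    exact fun h => hp' (𝒯.mem_interiorVertices.2 ⟨hp, h⟩)

lemma fe_mem_S (hΩ : IsPolygonalDomain Ω) (y : Plane → ℝ) : 𝒯.fe hΩ y ∈ 𝒯.S := by
  intro t ht
  choose a ha using exists_affineMap_bary t
  refine ⟨∑ p ∈ t, Ω.indicator y p • a p, ?_⟩
  filter_upwards [𝒯.val_fe_triangle hΩ y] with x hx hxt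
  refine (hx t ht hxt).trans ?_
  have : ∀ s : Finset Plane, (∑ p ∈ s, Ω.indicator y p • a p) x
      = ∑ p ∈ s, Ω.indicator y p * a p x := by
    classical
    intro s
    induction s using Finset.induction_on with
    | empty => simp
    | insert q s hq ih => rw [Finset.sum_insert hq, Finset.sum_insert hq, AffineMap.coe_add,
        Pi.add_apply, ih]; rfl
  rw [this]
  exact Finset.sum_congr rfl fun p _ => by rw [ha]

/-- Every function in `S_h` is determined by nodal values at the interior vertices: the affine
pieces agree at the vertices, and vanish at vertices on the boundary. -/
lemma exists_fe_eq (hΩ : IsPolygonalDomain Ω) {v : H10 Ω} (hv : v ∈ 𝒯.S) :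
    ∃ y, v = 𝒯.fe hΩ y := by
  classical
  have hv' : ∀ t : Finset Plane, ∃ a : Plane →ᵃ[ℝ] ℝ, t ∈ 𝒯.triangles →
      ∀ᵐ x ∂(volume.restrict Ω), x ∈ convexHull ℝ (t : Set Plane) →
        H1.val (v : H1 Ω) x = a x := by
    intro t
    by_cases ht : t ∈ 𝒯.triangles
    · obtain ⟨a, ha⟩ := hv t ht
      exact ⟨a, fun _ => ha⟩
    · exact ⟨0, fun h => absurd h ht⟩
  choose a ha using hv'
  have hle : ∀ (R : ℝ → ℝ) (c : ℝ), Tendsto R (𝓝[>] 0) (𝓝 0) →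
      (∀ᶠ L in 𝓝[>] (0 : ℝ), c ^ 2 ≤ R L) → c = 0 := by
    intro R c hR hc
    have := ge_of_tendsto hR hc
    exact pow_eq_zero_iff two_ne_zero |>.1 (le_antisymm this (sq_nonneg c))
  have hbd : ∀ t ∈ 𝒯.triangles, ∀ p ∈ t, p ∈ frontier Ω → a t p = 0 := by
    intro t ht p hp hpf
    obtain ⟨ℓ, hℓ, hseg⟩ := hΩ.exists_boundary_segment
    obtain ⟨e, he, hes⟩ := hseg p hpf
    obtain ⟨R, hR, hRL⟩ := 𝒯.exists_tendsto_zero_vertex hΩ v ht hp (a t) (ha t ht)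
    refine hle R _ hR ?_
    have hsmall : ∀ᶠ L in 𝓝[>] (0 : ℝ), L ≤ ℓ :=
      (eventually_le_nhds hℓ).filter_mono nhdsWithin_le_nhds
    filter_upwards [hRL, hsmall, self_mem_nhdsWithin] with L h1 h2 h3
    replace h3 : 0 < L := h3
    obtain ⟨m, hm0, hm⟩ := H10.exists_const hΩ.isOpen v p he h3 (ε := L ^ 4) (by positivity)
    have hm00 : m = 0 := hm0 fun s hs => by
      have := hes s ⟨hs.1, hs.2.trans h2⟩
      rw [hΩ.isOpen.frontier_eq] at this
      exact this.2
    have := h1 m hm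
    rwa [hm00, sub_zero] at this
  have hint : ∀ t ∈ 𝒯.triangles, ∀ s ∈ 𝒯.triangles, ∀ p ∈ t, p ∈ s → a t p = a s p := by
    intro t ht s hs p hpt hps
    obtain ⟨R, hR, hRL⟩ := 𝒯.exists_tendsto_zero_vertex hΩ v ht hpt (a t) (ha t ht)
    obtain ⟨R', hR', hRL'⟩ := 𝒯.exists_tendsto_zero_vertex hΩ v hs hps (a s) (ha s hs)
    have hsum : Tendsto (fun L => 2 * R L + 2 * R' L) (𝓝[>] 0) (𝓝 0) := by
      simpa using (hR.const_mul 2).add (hR'.const_mul 2)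
    refine sub_eq_zero.1 (hle _ _ hsum ?_)
    filter_upwards [hRL, hRL', self_mem_nhdsWithin] with L h1 h2 h3
    replace h3 : 0 < L := h3
    obtain ⟨m, -, hm⟩ := H10.exists_const hΩ.isOpen v p (e := EuclideanSpace.single 0 1) (by simp)
      h3 (ε := L ^ 4) (by positivity)
    have h4 := h1 m hm
    have h5 := h2 m hm
    nlinarith [sq_nonneg ((a t p - m) + (a s p - m))]
  set y : Plane → ℝ := fun p =>
    if h : ∃ t ∈ 𝒯.triangles, p ∈ t then a h.choose p else 0 with hy
  have hyt : ∀ t ∈ 𝒯.triangles, ∀ p ∈ t, Ω.indicator y p = a t p := by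
    intro t ht p hp
    by_cases hpΩ : p ∈ Ω
    · rw [indicator_of_mem hpΩ]
      have hex : ∃ t ∈ 𝒯.triangles, p ∈ t := ⟨t, ht, hp⟩
      simp only [hy]
      rw [dif_pos hex]
      exact hint _ hex.choose_spec.1 t ht p hex.choose_spec.2 hp
    · rw [indicator_of_notMem hpΩ, hbd t ht p hp]
      rw [hΩ.isOpen.frontier_eq]
      exact ⟨𝒯.convexHull_subset ht (subset_convexHull ℝ _ hp), hpΩ⟩
  refine ⟨y, H10.ext_val hΩ.isOpen ?_⟩
  have hall : ∀ᵐ x ∂(volume.restrict Ω), ∀ t ∈ 𝒯.triangles, x ∈ convexHull ℝ (t : Set Plane) →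
      H1.val (v : H1 Ω) x = a t x := by
    rw [Filter.eventually_all_finset]
    exact ha
  filter_upwards [hall, 𝒯.val_fe_triangle hΩ y, 𝒯.ae_mem_interior hΩ.isOpen] with x h1 h2 h3
  obtain ⟨t, ht, hxt⟩ := h3
  have hxt' := _root_.interior_subset hxt
  rw [h1 t ht hxt', h2 t ht hxt', (𝒯.isTriangle ht).affineMap_eq_sum (a t) x]
  exact Finset.sum_congr rfl fun p hp => by rw [hyt t ht p hp, mul_comm]

end Triangulation

end PlateFEM

namespace PlateFEM

/-! ### Quasi-uniform triangulations -/

lemma volumeReal_closedBall (x : Plane) {r : ℝ} (hr : 0 ≤ r) :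
    volume.real (Metric.closedBall x r) = r ^ 2 * Real.pi := by
  rw [measureReal_def, EuclideanSpace.volume_closedBall_fin_two, ENNReal.toReal_mul,
    ENNReal.toReal_pow, ENNReal.toReal_ofReal hr, ENNReal.toReal_ofReal Real.pi_pos.le]

/-- Each triangle has diameter at most `h` and contains a disc of radius `σ * h`. -/
structure Triangulation.IsRegular {Ω : Set Plane} (𝒯 : Triangulation Ω) (σ h : ℝ) : Prop where
  sigma_pos : 0 < σ
  h_pos : 0 < h
  dist_le : ∀ t ∈ 𝒯.triangles, ∀ x ∈ convexHull ℝ (t : Set Plane),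
    ∀ y ∈ convexHull ℝ (t : Set Plane), dist x y ≤ h
  exists_ball : ∀ t ∈ 𝒯.triangles, ∃ c, Metric.closedBall c (σ * h) ⊆ convexHull ℝ (t : Set Plane)

namespace Triangulation

variable {Ω : Set Plane} (𝒯 : Triangulation Ω)

lemma exists_isRegular (hΩ : IsPolygonalDomain Ω) {σ : ℝ} (hσ : 0 < σ) (h𝒯 : 𝒯.QuasiUniform σ) :
    ∃ h ≤ Metric.diam (closure Ω), 𝒯.IsRegular σ h := by
  obtain ⟨x, hx⟩ := hΩ.isConnected.nonempty
  obtain ⟨t₀, ht₀, -⟩ := 𝒯.exists_triangle (subset_closure hx)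
  obtain ⟨s, hs, hmax⟩ := 𝒯.triangles.exists_max_image
    (fun t => Metric.diam (convexHull ℝ (t : Set Plane))) ⟨t₀, ht₀⟩
  have hb : ∀ t : Finset Plane, Bornology.IsBounded (convexHull ℝ (t : Set Plane)) :=
    fun t => (IsTriangle.isCompact_convexHull t).isBounded
  refine ⟨Metric.diam (convexHull ℝ (s : Set Plane)),
    Metric.diam_mono (𝒯.convexHull_subset hs) hΩ.isBounded.closure, hσ, ?_, ?_,
    fun t ht => h𝒯 s hs t ht⟩
  · obtain ⟨p, hp⟩ := (𝒯.isTriangle hs).nonempty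
    obtain ⟨q, hq, hpq⟩ := (𝒯.isTriangle hs).exists_other p
    exact (dist_pos.2 hpq).trans_le (Metric.dist_le_diam_of_mem (hb s)
      (subset_convexHull ℝ _ hp) (subset_convexHull ℝ _ hq))
  · exact fun t ht x hx y hy => (Metric.dist_le_diam_of_mem (hb t) hx hy).trans (hmax t ht)

/-- Distinct triangles do not overlap, so integrals over them add up to at most the integral over
a set that contains them. -/
lemma sum_setIntegral_le {s : Finset (Finset Plane)} (hs : s ⊆ 𝒯.triangles) {U : Set Plane}
    {f : Plane → ℝ} (hf : IntegrableOn f U)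
    (hf0 : ∀ x, 0 ≤ f x) (hsU : ∀ t ∈ s, interior (convexHull ℝ (t : Set Plane)) ⊆ U) :
    ∑ t ∈ s, ∫ x in convexHull ℝ (t : Set Plane), f x ≤ ∫ x in U, f x := by
  have h1 : ∑ t ∈ s, ∫ x in convexHull ℝ (t : Set Plane), f x
      = ∫ x in ⋃ t ∈ s, interior (convexHull ℝ (t : Set Plane)), f x := by
    rw [integral_biUnion_finset]
    · exact Finset.sum_congr rfl fun t _ =>
        setIntegral_congr_set (IsTriangle.interior_ae_eq t).symm
    · exact fun t _ => isOpen_interior.measurableSet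
    · exact fun s' hs' t ht hst => 𝒯.disjoint_interior (hs hs') (hs ht) hst
    · exact fun t ht => hf.mono_set (hsU t ht)
  rw [h1]
  exact setIntegral_mono_set hf (Eventually.of_forall hf0)
    (Eventually.of_forall (iUnion₂_subset hsU))

/-- The three vertices of the triangles are counted at most three times. -/
lemma sum_vertices_le {f : Plane → ℝ} (hf : ∀ p, 0 ≤ f p) :
    ∑ p ∈ 𝒯.vertices, f p ≤ ∑ t ∈ 𝒯.triangles, ∑ p ∈ t, f p := by
  classical
  rw [show (∑ t ∈ 𝒯.triangles, ∑ p ∈ t, f p)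
    = ∑ t ∈ 𝒯.triangles, ∑ p ∈ 𝒯.vertices, if p ∈ t then f p else 0 from ?_, Finset.sum_comm]
  · refine Finset.sum_le_sum fun p hp => ?_
    obtain ⟨t, ht, hpt⟩ := 𝒯.mem_vertices.1 hp
    refine le_trans ?_ (Finset.single_le_sum (f := fun t => if p ∈ t then f p else 0)
      (fun t _ => ?_) ht)
    · simp [hpt]
    · split_ifs
      exacts [hf p, le_rfl]
  · refine Finset.sum_congr rfl fun t ht => ?_
    rw [← Finset.sum_filter]
    refine Finset.sum_congr ?_ fun _ _ => rfl
    ext p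
    rw [Finset.mem_filter]
    exact ⟨fun h => ⟨𝒯.mem_vertices_of_mem ht h, h⟩, fun h => h.2⟩

namespace IsRegular

variable {𝒯} {σ h : ℝ}

lemma volume_ge (hr : 𝒯.IsRegular σ h) {t : Finset Plane} (ht : t ∈ 𝒯.triangles) :
    Real.pi * σ ^ 2 * h ^ 2 ≤ volume.real (convexHull ℝ (t : Set Plane)) := by
  obtain ⟨c, hc⟩ := hr.exists_ball t ht
  have h1 := measureReal_mono (μ := volume) hc (IsTriangle.isCompact_convexHull t).measure_lt_top.ne
  rw [volumeReal_closedBall c (mul_pos hr.sigma_pos hr.h_pos).le] at h1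
  linarith

lemma subset_closedBall (hr : 𝒯.IsRegular σ h) {t : Finset Plane} (ht : t ∈ 𝒯.triangles) {x : Plane}
    (hx : x ∈ convexHull ℝ (t : Set Plane)) :
    convexHull ℝ (t : Set Plane) ⊆ Metric.closedBall x h :=
  fun y hy => hr.dist_le t ht y hy x hx

lemma dist_vertex_le (hr : 𝒯.IsRegular σ h) {t : Finset Plane} (ht : t ∈ 𝒯.triangles) {p q : Plane} (hp : p ∈ t)
    (hq : q ∈ t) : dist p q ≤ h :=
  hr.dist_le t ht p (subset_convexHull ℝ _ hp) q (subset_convexHull ℝ _ hq)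

lemma sum_volume_le (hr : 𝒯.IsRegular σ h) {s : Finset (Finset Plane)} (hs : s ⊆ 𝒯.triangles) {x : Plane} {R : ℝ}
    (hR : 0 ≤ R)
    (hsx : ∀ t ∈ s, convexHull ℝ (t : Set Plane) ⊆ Metric.closedBall x (R * h)) :
    ∑ t ∈ s, volume.real (convexHull ℝ (t : Set Plane)) ≤ Real.pi * R ^ 2 * h ^ 2 := by
  have h1 := 𝒯.sum_setIntegral_le hs (U := Metric.closedBall x (R * h)) (f := fun _ => 1)
    (integrableOn_const (isCompact_closedBall _ _).measure_lt_top.ne) (fun _ => zero_le_one)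
    (fun t ht => _root_.interior_subset.trans (hsx t ht))
  simp only [setIntegral_const, smul_eq_mul, mul_one] at h1
  rw [volumeReal_closedBall x (mul_nonneg hR hr.h_pos.le)] at h1
  linarith

/-- The number of triangles in a disc of radius `R * h` is bounded. -/
lemma card_le (hr : 𝒯.IsRegular σ h) {s : Finset (Finset Plane)} (hs : s ⊆ 𝒯.triangles) {x : Plane} {R : ℝ} (hR : 0 ≤ R)
    (hsx : ∀ t ∈ s, convexHull ℝ (t : Set Plane) ⊆ Metric.closedBall x (R * h)) :
    (s.card : ℝ) ≤ R ^ 2 / σ ^ 2 := by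
  have h1 := hr.sum_volume_le hs hR hsx
  have h2 : (s.card : ℝ) * (Real.pi * σ ^ 2 * h ^ 2)
      ≤ ∑ t ∈ s, volume.real (convexHull ℝ (t : Set Plane)) := by
    rw [← nsmul_eq_mul]
    exact Finset.card_nsmul_le_sum _ _ _ fun t ht => hr.volume_ge (hs ht)
  rw [le_div_iff₀ (pow_pos hr.sigma_pos 2)]
  have h3 : 0 < Real.pi * h ^ 2 := mul_pos Real.pi_pos (pow_pos hr.h_pos 2)
  refine le_of_mul_le_mul_left ?_ h3
  linarith

lemma volume_le (hr : 𝒯.IsRegular σ h) {t : Finset Plane} (ht : t ∈ 𝒯.triangles) :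
    volume.real (convexHull ℝ (t : Set Plane)) ≤ Real.pi * h ^ 2 := by
  obtain ⟨p, hp⟩ := (𝒯.isTriangle ht).nonempty
  have := hr.sum_volume_le (s := {t}) (Finset.singleton_subset_iff.2 ht) zero_le_one
    (x := p) (fun s hs => by
      rw [Finset.mem_singleton.1 hs, one_mul]
      exact hr.subset_closedBall ht (subset_convexHull ℝ _ hp))
  simpa using this

lemma sigma_le_one (hr : 𝒯.IsRegular σ h) (hΩ : IsPolygonalDomain Ω) : σ ≤ 1 := by
  obtain ⟨x, hx⟩ := hΩ.isConnected.nonempty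
  obtain ⟨t, ht, -⟩ := 𝒯.exists_triangle (subset_closure hx)
  have h1 := (hr.volume_ge ht).trans (hr.volume_le ht)
  have h3 : 0 < Real.pi * h ^ 2 := mul_pos Real.pi_pos (pow_pos hr.h_pos 2)
  have h4 : σ ^ 2 ≤ 1 := by
    refine le_of_mul_le_mul_left ?_ h3
    linarith
  nlinarith [hr.sigma_pos]

lemma norm_baryGrad_le (hr : 𝒯.IsRegular σ h) {t : Finset Plane} (ht : t ∈ 𝒯.triangles) {p : Plane} (hp : p ∈ t) :
    ‖baryGrad t p‖ ≤ 1 / (σ * h) := by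
  obtain ⟨c, hc⟩ := hr.exists_ball t ht
  exact (𝒯.isTriangle ht).norm_baryGrad_le (mul_pos hr.sigma_pos hr.h_pos) hc hp

end IsRegular

end Triangulation

/-- The decaying weight `(1 + γ |x - z| / h)⁻²`. -/
noncomputable def decay (γ h : ℝ) (z x : Plane) : ℝ := ((1 + γ * dist x z / h) ^ 2)⁻¹

lemma decay_pos {γ h : ℝ} (hγ : 0 ≤ γ) (hh : 0 < h) (z x : Plane) : 0 < decay γ h z x := by
  unfold decay; positivity

lemma decay_self (γ h : ℝ) (z : Plane) : decay γ h z z = 1 := by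
  simp [decay]

lemma decay_comm (γ h : ℝ) (z x : Plane) : decay γ h z x = decay γ h x z := by
  simp [decay, dist_comm]

/-- The weight varies slowly on the scale `h`. -/
lemma decay_le {γ h R : ℝ} (hγ : 0 ≤ γ) (hh : 0 < h) (hR : 0 ≤ R) {z x y : Plane}
    (hxy : dist x y ≤ R * h) : decay γ h z x ≤ (1 + R * γ) ^ 2 * decay γ h z y := by
  have hx : 0 ≤ γ * dist x z / h := by positivity
  have hy : 0 ≤ γ * dist y z / h := by positivity
  have h1 : γ * dist y z / h ≤ γ * dist x z / h + γ * R := by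
    have h2 : dist y z ≤ dist x z + R * h := by
      have := dist_triangle y x z
      rw [dist_comm y x] at this
      linarith
    calc γ * dist y z / h ≤ γ * (dist x z + R * h) / h := by gcongr
      _ = _ := by field_simp
  have h3 : 1 + γ * dist y z / h ≤ (1 + R * γ) * (1 + γ * dist x z / h) := by
    nlinarith [mul_nonneg (mul_nonneg hR hγ) hx]
  unfold decay
  rw [← div_eq_mul_inv, le_div_iff₀ (by positivity), inv_mul_le_iff₀ (by positivity), ← mul_pow,
    mul_comm (1 + γ * dist x z / h)]
  exact pow_le_pow_left₀ (by positivity) h3 2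

namespace Triangulation.IsRegular

variable {Ω : Set Plane} {𝒯 : Triangulation Ω} {σ h : ℝ}

/-- The squares of the weights are summable over the vertices, uniformly in the mesh: the sum is
comparable with the integral of `(1 + |x|)⁻⁴`. -/
lemma sum_decay_sq_le (hr : 𝒯.IsRegular σ h) {γ : ℝ} (hγ : 0 < γ) (z : Plane) :
    ∑ p ∈ 𝒯.vertices, decay γ h z p ^ 2
      ≤ 3 * (1 + γ) ^ 4 / (Real.pi * σ ^ 2 * γ ^ 2) * ∫ x : Plane, (1 + ‖x‖) ^ (-4 : ℝ) := by
  have hh := hr.h_pos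
  have hσ := hr.sigma_pos
  have hpi := Real.pi_pos
  have hint : Integrable (fun x : Plane => (1 + ‖x‖) ^ (-4 : ℝ)) :=
    integrable_one_add_norm (by simp; norm_num)
  have heq : (fun x : Plane => decay γ h z x ^ 2)
      = fun x => (fun y : Plane => (1 + ‖y‖) ^ (-4 : ℝ)) ((γ / h) • (x - z)) := by
    ext x
    have h0 : 1 + ‖(γ / h) • (x - z)‖ = 1 + γ * dist x z / h := by
      rw [norm_smul, Real.norm_eq_abs, abs_of_pos (by positivity), dist_eq_norm]
      ring
    simp only [decay]
    rw [h0, show (-4 : ℝ) = -((4 : ℕ) : ℝ) by norm_num, Real.rpow_neg (by positivity),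
      Real.rpow_natCast, inv_pow, ← pow_mul]
  have hI : Integrable (fun x : Plane => decay γ h z x ^ 2) := by
    rw [heq]
    exact (hint.comp_smul (by positivity : γ / h ≠ 0)).comp_sub_right z
  have hJ : ∫ x : Plane, decay γ h z x ^ 2
      = h ^ 2 / γ ^ 2 * ∫ x : Plane, (1 + ‖x‖) ^ (-4 : ℝ) := by
    rw [heq, integral_sub_right_eq_self
      (fun x : Plane => (fun y : Plane => (1 + ‖y‖) ^ (-4 : ℝ)) ((γ / h) • x)) z,
      Measure.integral_comp_smul volume (fun y : Plane => (1 + ‖y‖) ^ (-4 : ℝ)), smul_eq_mul]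
    congr 1
    rw [finrank_euclideanSpace, Fintype.card_fin, abs_of_pos (by positivity)]
    field_simp
  have hT : ∀ t ∈ 𝒯.triangles, ∑ p ∈ t, decay γ h z p ^ 2
      ≤ 3 * (1 + γ) ^ 4 / (Real.pi * σ ^ 2 * h ^ 2)
        * ∫ x in convexHull ℝ (t : Set Plane), decay γ h z x ^ 2 := by
    intro t ht
    have h1 : ∀ p ∈ t, decay γ h z p ^ 2 ≤ (1 + γ) ^ 4 / (Real.pi * σ ^ 2 * h ^ 2)
        * ∫ x in convexHull ℝ (t : Set Plane), decay γ h z x ^ 2 := by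
      intro p hp
      have h2 : ∫ x in convexHull ℝ (t : Set Plane), decay γ h z p ^ 2
          ≤ ∫ x in convexHull ℝ (t : Set Plane), (1 + γ) ^ 4 * decay γ h z x ^ 2 := by
        refine setIntegral_mono_on (integrableOn_const
          (IsTriangle.isCompact_convexHull t).measure_lt_top.ne) (hI.integrableOn.const_mul _)
          (IsTriangle.isCompact_convexHull t).measurableSet fun x hx => ?_
        have h3 := decay_le hγ.le hh zero_le_one (z := z) (x := p) (y := x)
          (by rw [one_mul]; exact hr.dist_le t ht p (subset_convexHull ℝ _ hp) x hx)
        rw [one_mul] at h3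
        calc decay γ h z p ^ 2 ≤ ((1 + γ) ^ 2 * decay γ h z x) ^ 2 :=
              pow_le_pow_left₀ (decay_pos hγ.le hh z p).le h3 2
          _ = _ := by ring
      rw [setIntegral_const, integral_const_mul, smul_eq_mul] at h2
      have h4 : Real.pi * σ ^ 2 * h ^ 2 * decay γ h z p ^ 2
          ≤ volume.real (convexHull ℝ (t : Set Plane)) * decay γ h z p ^ 2 :=
        mul_le_mul_of_nonneg_right (hr.volume_ge ht) (sq_nonneg _)
      rw [div_mul_eq_mul_div, le_div_iff₀ (by positivity)]
      linarith
    calc _ ≤ t.card • ((1 + γ) ^ 4 / (Real.pi * σ ^ 2 * h ^ 2)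
          * ∫ x in convexHull ℝ (t : Set Plane), decay γ h z x ^ 2) :=
        Finset.sum_le_card_nsmul _ _ _ h1
      _ = _ := by
        rw [(𝒯.isTriangle ht).card_eq, nsmul_eq_mul]
        push_cast
        ring
  calc _ ≤ ∑ t ∈ 𝒯.triangles, ∑ p ∈ t, decay γ h z p ^ 2 :=
        𝒯.sum_vertices_le fun p => sq_nonneg _
    _ ≤ ∑ t ∈ 𝒯.triangles, 3 * (1 + γ) ^ 4 / (Real.pi * σ ^ 2 * h ^ 2)
        * ∫ x in convexHull ℝ (t : Set Plane), decay γ h z x ^ 2 := Finset.sum_le_sum hT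
    _ ≤ 3 * (1 + γ) ^ 4 / (Real.pi * σ ^ 2 * h ^ 2) * ∫ x in univ, decay γ h z x ^ 2 := by
        rw [← Finset.mul_sum]
        refine mul_le_mul_of_nonneg_left ?_ (by positivity)
        exact 𝒯.sum_setIntegral_le subset_rfl hI.integrableOn (fun x => sq_nonneg _)
          (fun t _ => subset_univ _)
    _ = _ := by
        rw [setIntegral_univ, hJ]
        field_simp

end Triangulation.IsRegular

end PlateFEM

namespace PlateFEM

/-! ### A discrete maximum principle and the stability of the mixed mass matrix -/

namespace Triangulation

variable {Ω : Set Plane} (𝒯 : Triangulation Ω)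

open scoped Classical in
/-- Nonnegative boundary coefficients that add up to at most one. Besides the admissible
coefficients this covers `A = 0`, for which the multiplier space is `S_h` itself. -/
structure IsSubstochastic (A : Plane → Plane → ℝ) : Prop where
  nonneg : ∀ j ∈ 𝒯.boundaryVertices, ∀ i ∈ 𝒯.interiorVertices, 𝒯.Adj i j → 0 ≤ A j i
  sum_le_one : ∀ j ∈ 𝒯.boundaryVertices, ∑ i ∈ 𝒯.interiorVertices with 𝒯.Adj i j, A j i ≤ 1

open scoped Classical in
/-- The nodal values of `∑ i, v i * φ_i`, where `φ_i` is the basis of the multiplier space: the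
values at boundary vertices are averages of the values at neighbouring interior vertices. -/
noncomputable def extend (A : Plane → Plane → ℝ) (v : Plane → ℝ) (p : Plane) : ℝ :=
  if p ∈ Ω then v p else ∑ i ∈ 𝒯.interiorVertices with 𝒯.Adj i p, A p i * v i

open scoped Classical in
/-- The rows of twelve times the mass matrix, applied to a vector of nodal values. -/
noncomputable def massSum (y : Plane → ℝ) (k : Plane) : ℝ :=
  ∑ t ∈ 𝒯.triangles with k ∈ t,
    volume.real (convexHull ℝ (t : Set Plane)) * (y k + ∑ p ∈ t, y p)

lemma extend_of_mem (A : Plane → Plane → ℝ) (v : Plane → ℝ) {p : Plane} (hp : p ∈ Ω) :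
    𝒯.extend A v p = v p := if_pos hp

lemma extend_neg (A : Plane → Plane → ℝ) (v : Plane → ℝ) :
    𝒯.extend A (-v) = -𝒯.extend A v := by
  ext p
  simp only [extend, Pi.neg_apply]
  split_ifs
  · rfl
  · simp only [mul_neg, Finset.sum_neg_distrib]

lemma massSum_neg (y : Plane → ℝ) : 𝒯.massSum (-y) = -𝒯.massSum y := by
  ext k
  simp only [massSum, Pi.neg_apply, Finset.sum_neg_distrib]
  rw [← Finset.sum_neg_distrib]
  exact Finset.sum_congr rfl fun t _ => by ring

lemma notMem_of_boundary (hΩ : IsOpen Ω) {p : Plane} (hp : p ∈ 𝒯.boundaryVertices) : p ∉ Ω := by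
  have := (𝒯.mem_boundaryVertices.1 hp).2
  rw [hΩ.frontier_eq] at this
  exact this.2

variable {𝒯} {σ h : ℝ}

lemma IsRegular.dist_le_of_adj (hr : 𝒯.IsRegular σ h) {i j : Plane} (hij : 𝒯.Adj i j) :
    dist i j ≤ h := by
  obtain ⟨-, t, ht, hi, hj⟩ := hij
  exact hr.dist_vertex_le ht hi hj

lemma IsRegular.abs_extend_le (hr : 𝒯.IsRegular σ h) (hΩ : IsOpen Ω) {A : Plane → Plane → ℝ}
    (hA : 𝒯.IsSubstochastic A) {v : Plane → ℝ} {p : Plane} (hp : p ∈ 𝒯.vertices) {m : ℝ}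
    (hm : 0 ≤ m) (hv : ∀ k ∈ 𝒯.interiorVertices, dist k p ≤ h → |v k| ≤ m) :
    |𝒯.extend A v p| ≤ m := by
  classical
  rcases 𝒯.vertex_cases hΩ hp with hp' | hp'
  · rw [𝒯.extend_of_mem A v (𝒯.mem_interiorVertices.1 hp').2]
    exact hv p hp' (by rw [dist_self]; exact hr.h_pos.le)
  · rw [extend, if_neg (𝒯.notMem_of_boundary hΩ hp')]
    calc _ ≤ ∑ i ∈ 𝒯.interiorVertices with 𝒯.Adj i p, |A p i * v i| :=
          Finset.abs_sum_le_sum_abs _ _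
      _ ≤ ∑ i ∈ 𝒯.interiorVertices with 𝒯.Adj i p, A p i * m := by
          refine Finset.sum_le_sum fun i hi => ?_
          obtain ⟨hi, hadj⟩ := Finset.mem_filter.1 hi
          rw [abs_mul, abs_of_nonneg (hA.nonneg p hp' i hi hadj)]
          exact mul_le_mul_of_nonneg_left (hv i hi (hr.dist_le_of_adj hadj))
            (hA.nonneg p hp' i hi hadj)
      _ ≤ 1 * m := by
          rw [← Finset.sum_mul]
          exact mul_le_mul_of_nonneg_right (hA.sum_le_one p hp') hm
      _ = m := one_mul m

/-- If `y` is nearly maximal at `k` and the row `k` of the mass matrix nearly annihilates `y`, then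
the values at the neighbours of `k` are nearly minimal. -/
lemma IsRegular.le_neg_of_massSum_le (hr : 𝒯.IsRegular σ h) (hσ1 : σ ≤ 1) {y : Plane → ℝ}
    {k : Plane} {m ε δ η : ℝ} (hm : 0 ≤ m) (hε : 0 ≤ ε) (hδ : 0 ≤ δ) (hη : 0 ≤ η)
    (hy : ∀ t ∈ 𝒯.triangles, k ∈ t → ∀ p ∈ t, |y p| ≤ (1 + δ) * m)
    (hk : (1 - η) * m ≤ y k) (hF : 𝒯.massSum y k ≤ ε * (Real.pi * σ ^ 2 * h ^ 2) * m)
    {t : Finset Plane} (ht : t ∈ 𝒯.triangles) (hkt : k ∈ t) {a : Plane} (ha : a ∈ t)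
    (hak : a ≠ k) : y a ≤ -(1 - (ε + 5 * (η + δ) / σ ^ 2)) * m := by
  classical
  have hσ := hr.sigma_pos
  have hh := hr.h_pos
  have hpi := Real.pi_pos
  have hsum : ∀ t ∈ 𝒯.triangles, k ∈ t → ∀ a ∈ t, a ≠ k →
      ∃ r ∈ t, y k + ∑ p ∈ t, y p = 2 * y k + y a + y r := by
    intro t ht hkt a ha hak
    obtain ⟨r, hrk, hra, hmem⟩ := (𝒯.isTriangle ht).exists_third hkt ha hak.symm
    refine ⟨r, (hmem r).2 (Or.inl rfl), ?_⟩
    have : t = {r, k, a} := by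
      ext z
      rw [hmem]
      simp
    rw [this, Finset.sum_insert (by simp [hrk, hra]), Finset.sum_insert (by simp [hak.symm]),
      Finset.sum_singleton]
    ring
  have hlow : ∀ t ∈ 𝒯.triangles, k ∈ t → -(2 * (η + δ) * m) ≤ y k + ∑ p ∈ t, y p := by
    intro t ht hkt
    obtain ⟨a, ha, hka⟩ := (𝒯.isTriangle ht).exists_other k
    obtain ⟨r, hrt, hs⟩ := hsum t ht hkt a ha hka.symm
    have h1 := (abs_le.1 (hy t ht hkt a ha)).1
    have h2 := (abs_le.1 (hy t ht hkt r hrt)).1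
    rw [hs]
    linarith
  obtain ⟨r, hrt, hs⟩ := hsum t ht hkt a ha hak
  set X := y k + ∑ p ∈ t, y p with hX
  set μ : Finset Plane → ℝ := fun t => volume.real (convexHull ℝ (t : Set Plane)) with hμ
  have hstar : ∑ t ∈ 𝒯.triangles with k ∈ t, μ t ≤ Real.pi * h ^ 2 := by
    have := hr.sum_volume_le (Finset.filter_subset (fun t => k ∈ t) 𝒯.triangles) zero_le_one
      (x := k) (fun s hs => by
        obtain ⟨hs, hks⟩ := Finset.mem_filter.1 hs
        rw [one_mul]
        exact hr.subset_closedBall hs (subset_convexHull ℝ _ hks))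
    simpa using this
  have h1 : μ t * X + μ t * (2 * (η + δ) * m)
      ≤ 𝒯.massSum y k + ∑ t ∈ 𝒯.triangles with k ∈ t, μ t * (2 * (η + δ) * m) := by
    rw [massSum, ← Finset.sum_add_distrib]
    refine Finset.single_le_sum (f := fun t => μ t * (y k + ∑ p ∈ t, y p)
      + μ t * (2 * (η + δ) * m)) (fun s hs => ?_) (Finset.mem_filter.2 ⟨ht, hkt⟩)
    obtain ⟨hs, hks⟩ := Finset.mem_filter.1 hs
    rw [← mul_add]
    exact mul_nonneg measureReal_nonneg (by linarith [hlow s hs hks])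
  rw [← Finset.sum_mul] at h1
  have hc : 0 ≤ 2 * (η + δ) * m := by positivity
  have h2 : μ t * X ≤ Real.pi * σ ^ 2 * h ^ 2 * (ε + 2 * (η + δ) / σ ^ 2) * m := by
    have h3 : 0 ≤ μ t * (2 * (η + δ) * m) := mul_nonneg measureReal_nonneg hc
    have h4 := mul_le_mul_of_nonneg_right hstar hc
    have h5 : Real.pi * σ ^ 2 * h ^ 2 * (ε + 2 * (η + δ) / σ ^ 2) * m
        = ε * (Real.pi * σ ^ 2 * h ^ 2) * m + Real.pi * h ^ 2 * (2 * (η + δ) * m) := by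
      field_simp
    rw [h5]
    linarith
  have hXle : X ≤ (ε + 2 * (η + δ) / σ ^ 2) * m := by
    by_cases h0 : 0 ≤ X
    · have h3 := mul_le_mul_of_nonneg_right (hr.volume_ge ht) h0
      have h4 : 0 < Real.pi * σ ^ 2 * h ^ 2 := by positivity
      refine le_of_mul_le_mul_left ?_ h4
      calc _ ≤ μ t * X := h3
        _ ≤ _ := h2
        _ = _ := by ring
    · exact (not_le.1 h0).le.trans (by positivity)
  have hr1 := (abs_le.1 (hy t ht hkt r hrt)).1
  have hσ2 : η + δ ≤ (η + δ) / σ ^ 2 := by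
    rw [le_div_iff₀ (by positivity)]
    have : σ ^ 2 ≤ 1 := pow_le_one₀ hσ.le hσ1
    nlinarith
  have hd : 2 * (η + δ) / σ ^ 2 = 2 * ((η + δ) / σ ^ 2) := by ring
  have hd' : 5 * (η + δ) / σ ^ 2 = 5 * ((η + δ) / σ ^ 2) := by ring
  rw [hd] at hXle
  rw [hd']
  have hσm := mul_le_mul_of_nonneg_right hσ2 hm
  nlinarith [mul_nonneg hη hm, mul_nonneg hδ hm]

/-- A discrete maximum principle: at a local near-maximum of `|v|`, some nearby row of the mass
matrix does not annihilate `v`. Otherwise the neighbours of a maximum are near-minima; but two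
neighbours of the maximum are neighbours of each other, or, if one of them lies on the boundary, it
is the neighbour of an interior near-minimum. -/
lemma IsRegular.exists_lt_abs_massSum (hr : 𝒯.IsRegular σ h) (hΩ : IsOpen Ω) (hσ1 : σ ≤ 1)
    {A : Plane → Plane → ℝ} (hA : 𝒯.IsSubstochastic A) {v : Plane → ℝ} {i : Plane}
    (hi : i ∈ 𝒯.interiorVertices) {m ε δ : ℝ} (hε : ε = σ ^ 2 / 26) (hδ : δ = ε * σ ^ 2 / 5)
    (hm : 0 < m) (hvi : |v i| = m)
    (hv : ∀ k ∈ 𝒯.interiorVertices, dist k i ≤ 4 * h → |v k| ≤ (1 + δ) * m) :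
    ∃ k ∈ 𝒯.interiorVertices, dist k i ≤ 2 * h ∧
      ε * (Real.pi * σ ^ 2 * h ^ 2) * m < |𝒯.massSum (𝒯.extend A v) k| := by
  classical
  have hσ := hr.sigma_pos
  have hh := hr.h_pos
  have hε0 : 0 < ε := by rw [hε]; positivity
  have hδ0 : 0 < δ := by rw [hδ]; positivity
  have hσ2 : σ ^ 2 ≤ 1 := pow_le_one₀ hσ.le hσ1
  -- the sign of `v i` may be chosen
  wlog hpos : 0 ≤ v i generalizing v
  · obtain ⟨k, hk, hki, hlt⟩ := this (v := -v) (by simpa using hvi) (by simpa using hv)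
      (by simpa using (not_le.1 hpos).le)
    refine ⟨k, hk, hki, ?_⟩
    rwa [extend_neg, massSum_neg, Pi.neg_apply, abs_neg] at hlt
  rw [abs_of_nonneg hpos] at hvi
  by_contra! hcon
  set y := 𝒯.extend A v with hy
  have hyle : ∀ p ∈ 𝒯.vertices, dist p i ≤ 3 * h → |y p| ≤ (1 + δ) * m := by
    intro p hp hpi
    refine hr.abs_extend_le hΩ hA hp (by positivity) fun k hk hkp => hv k hk ?_
    linarith [dist_triangle k p i]
  have hε1 : ε ≤ 1 / 26 := by rw [hε]; linarith
  have hδσ : 5 * δ / σ ^ 2 = ε := by rw [hδ]; field_simp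
  have hεσ : 5 * (4 * ε) / σ ^ 2 = 20 / 26 := by rw [hε]; field_simp; norm_num
  have hη : 5 * (4 * ε + δ) / σ ^ 2 = 20 / 26 + ε := by
    rw [mul_add, add_div, hεσ, hδσ]
  -- the neighbours of `i` are near-minima
  have hnb : ∀ t ∈ 𝒯.triangles, i ∈ t → ∀ a ∈ t, a ≠ i → y a ≤ -(1 - 2 * ε) * m := by
    intro t ht hit a ha hai
    have := hr.le_neg_of_massSum_le hσ1 (y := y) (k := i) (m := m) (ε := ε) (δ := δ) (η := 0) hm.le
      hε0.le hδ0.le le_rfl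
      (fun s hs his p hp => hyle p (𝒯.mem_vertices_of_mem hs hp)
        ((hr.dist_vertex_le hs hp his).trans (by linarith)))
      (by rw [hy, 𝒯.extend_of_mem A v (𝒯.mem_interiorVertices.1 hi).2, hvi]; linarith)
      (le_of_abs_le (hcon i hi (by rw [dist_self]; positivity))) ht hit ha hai
    rw [zero_add, hδσ] at this
    linarith
  -- an interior near-minimum close to `i` has neighbours that are nearly maximal
  have hnb' : ∀ k ∈ 𝒯.interiorVertices, dist k i ≤ 2 * h → v k ≤ -(1 - 4 * ε) * m →
      ∀ t ∈ 𝒯.triangles, k ∈ t → ∀ a ∈ t, a ≠ k → (1 - 20 / 26 - 2 * ε) * m ≤ y a := by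
    intro k hk hki hvk t ht hkt a ha hak
    have := hr.le_neg_of_massSum_le hσ1 (y := -y) (k := k) (m := m) (ε := ε) (δ := δ)
      (η := 4 * ε) hm.le hε0.le hδ0.le (by positivity)
      (fun s hs his p hp => by
        rw [Pi.neg_apply, abs_neg]
        refine hyle p (𝒯.mem_vertices_of_mem hs hp) ?_
        linarith [hr.dist_vertex_le hs hp his, dist_triangle p k i])
      (by rw [Pi.neg_apply, hy, 𝒯.extend_of_mem A v (𝒯.mem_interiorVertices.1 hk).2]; linarith)
      (by rw [massSum_neg]; exact (neg_le_abs _).trans (hcon k hk hki)) ht hkt ha hak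
    rw [hη, Pi.neg_apply] at this
    linarith
  obtain ⟨t, ht, hit⟩ := 𝒯.mem_vertices.1 (𝒯.mem_interiorVertices.1 hi).1
  obtain ⟨a, ha, hia⟩ := (𝒯.isTriangle ht).exists_other i
  obtain ⟨r, hri, hra, hmem⟩ := (𝒯.isTriangle ht).exists_third hit ha hia
  have hrt : r ∈ t := (hmem r).2 (Or.inl rfl)
  have hya := hnb t ht hit a ha hia.symm
  have hyr := hnb t ht hit r hrt hri
  have hai : dist a i ≤ h := hr.dist_vertex_le ht ha hit
  have hεm := mul_pos hε0 hm
  rcases 𝒯.vertex_cases hΩ (𝒯.mem_vertices_of_mem ht ha) with ha' | ha'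
  · have hva : v a = y a := (𝒯.extend_of_mem A v (𝒯.mem_interiorVertices.1 ha').2).symm
    have := hnb' a ha' (by linarith) (by rw [hva]; nlinarith) t ht ha r hrt hra
    nlinarith
  · obtain ⟨j, hj, hja, hvj⟩ : ∃ j ∈ 𝒯.interiorVertices, 𝒯.Adj j a ∧ v j ≤ -(1 - 4 * ε) * m := by
      by_contra! hj
      have h1 : -(1 - 4 * ε) * m ≤ y a := by
        rw [hy, extend, if_neg (𝒯.notMem_of_boundary hΩ ha')]
        have h2 : ∑ i ∈ 𝒯.interiorVertices with 𝒯.Adj i a, A a i * (-(1 - 4 * ε) * m)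
            ≤ ∑ i ∈ 𝒯.interiorVertices with 𝒯.Adj i a, A a i * v i := by
          refine Finset.sum_le_sum fun j hj' => ?_
          obtain ⟨hj', hadj⟩ := Finset.mem_filter.1 hj'
          exact mul_le_mul_of_nonneg_left (hj j hj' hadj).le (hA.nonneg a ha' j hj' hadj)
        rw [← Finset.sum_mul] at h2
        have h3 := hA.sum_le_one a ha'
        have h4 : 0 ≤ (1 - 4 * ε) * m := mul_nonneg (by linarith) hm.le
        nlinarith
      nlinarith
    obtain ⟨hja', s, hs, hjs, has⟩ := hja
    have := hnb' j hj (by linarith [hr.dist_vertex_le hs hjs has, dist_triangle j a i]) hvj s hs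
      hjs a has hja'.symm
    nlinarith

/-- Stability of the mixed mass matrix in `ℓ²`, by the maximum principle for decaying weights. -/
lemma exists_sum_sq_le_massSum {σ : ℝ} (hσ : 0 < σ) (hσ1 : σ ≤ 1) : ∃ C, 0 ≤ C ∧
    ∀ {Ω : Set Plane} {𝒯 : Triangulation Ω} {h : ℝ}, IsOpen Ω → 𝒯.IsRegular σ h →
      ∀ {A : Plane → Plane → ℝ}, 𝒯.IsSubstochastic A → ∀ v : Plane → ℝ,
        ∑ z ∈ 𝒯.interiorVertices, v z ^ 2
          ≤ C / h ^ 4 * ∑ k ∈ 𝒯.interiorVertices, 𝒯.massSum (𝒯.extend A v) k ^ 2 := by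
  classical
  set ε := σ ^ 2 / 26 with hε
  set δ := ε * σ ^ 2 / 5 with hδ
  set γ := δ / 24 with hγ
  have hpi := Real.pi_pos
  have hε0 : 0 < ε := by positivity
  have hδ0 : 0 < δ := by positivity
  have hγ0 : 0 < γ := by positivity
  have hσ2 : σ ^ 2 ≤ 1 := pow_le_one₀ hσ.le hσ1
  have hδ1 : δ ≤ 1 := by
    have : ε ≤ 1 := by rw [hε]; linarith
    rw [hδ]
    have := mul_le_one₀ this (sq_nonneg σ) hσ2
    linarith
  have hγδ : (1 + 4 * γ) ^ 2 ≤ 1 + δ := by rw [hγ]; nlinarith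
  set J := ∫ x : Plane, (1 + ‖x‖) ^ (-4 : ℝ) with hJ
  have hJ0 : 0 ≤ J := integral_nonneg fun x => by positivity
  set D := 3 * (1 + γ) ^ 4 / (Real.pi * σ ^ 2 * γ ^ 2) * J with hD
  have hD0 : 0 ≤ D := by positivity
  refine ⟨(2 / (ε * (Real.pi * σ ^ 2))) ^ 2 * D, by positivity, ?_⟩
  intro Ω 𝒯 h hΩ hr A hA v
  have hh := hr.h_pos
  set F := 𝒯.massSum (𝒯.extend A v) with hF
  set c := ε * (Real.pi * σ ^ 2 * h ^ 2) with hc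
  have hc0 : 0 < c := by positivity
  have hpt : ∀ z ∈ 𝒯.interiorVertices,
      v z ^ 2 ≤ (2 / c) ^ 2 * ∑ k ∈ 𝒯.interiorVertices, decay γ h z k ^ 2 * F k ^ 2 := by
    intro z hz
    -- where `|v|` times the weight centred at `z` is largest, `|v|` is almost a local maximum, since
    -- the weights of neighbours differ by a factor close to one
    obtain ⟨i, hi, hmax⟩ := 𝒯.interiorVertices.exists_max_image
      (fun k => decay γ h z k * |v k|) ⟨z, hz⟩
    have hzi := hmax z hz
    rw [decay_self, one_mul] at hzi
    rcases (abs_nonneg (v i)).eq_or_lt with h0 | hm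
    · rw [← h0, mul_zero] at hzi
      rw [← sq_abs, le_antisymm hzi (abs_nonneg _)]
      simp only [ne_eq, OfNat.ofNat_ne_zero, not_false_eq_true, zero_pow]
      exact mul_nonneg (sq_nonneg _) (Finset.sum_nonneg fun k _ => by positivity)
    · obtain ⟨k, hk, hki, hlt⟩ := hr.exists_lt_abs_massSum hΩ hσ1 hA hi hε hδ hm rfl
        (fun k hk hki => by
          have h1 := decay_le hγ0.le hh (by norm_num : (0 : ℝ) ≤ 4) (z := z) (x := i) (y := k)
            (by rwa [dist_comm])
          have h2 := decay_pos hγ0.le hh z k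
          have h3 : decay γ h z k * |v k| ≤ decay γ h z k * ((1 + δ) * |v i|) :=
            calc _ ≤ decay γ h z i * |v i| := hmax k hk
              _ ≤ ((1 + 4 * γ) ^ 2 * decay γ h z k) * |v i| :=
                mul_le_mul_of_nonneg_right h1 hm.le
              _ ≤ ((1 + δ) * decay γ h z k) * |v i| := by gcongr
              _ = _ := by ring
          exact le_of_mul_le_mul_left h3 h2)
      have h1 := decay_le hγ0.le hh (by norm_num : (0 : ℝ) ≤ 4) (z := z) (x := i) (y := k)
        (by rw [dist_comm]; linarith)
      have h2 := decay_pos hγ0.le hh z k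
      have h3 : |v z| ≤ 2 / c * (decay γ h z k * |F k|) :=
        calc |v z| ≤ decay γ h z i * |v i| := hzi
          _ ≤ ((1 + δ) * decay γ h z k) * |v i| := by gcongr; exact h1.trans (by gcongr)
          _ ≤ (2 * decay γ h z k) * |v i| := by gcongr; linarith
          _ ≤ (2 * decay γ h z k) * (|F k| / c) := by
            gcongr
            rw [le_div_iff₀ hc0, mul_comm]
            exact hlt.le
          _ = _ := by ring
      calc v z ^ 2 = |v z| ^ 2 := (sq_abs _).symm
        _ ≤ (2 / c * (decay γ h z k * |F k|)) ^ 2 := pow_le_pow_left₀ (abs_nonneg _) h3 2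
        _ = (2 / c) ^ 2 * (decay γ h z k ^ 2 * F k ^ 2) := by
          rw [mul_pow, mul_pow (decay γ h z k), sq_abs]
        _ ≤ _ := by
          gcongr
          exact Finset.single_le_sum (f := fun k => decay γ h z k ^ 2 * F k ^ 2)
            (fun k _ => by positivity) hk
  calc _ ≤ ∑ z ∈ 𝒯.interiorVertices,
        (2 / c) ^ 2 * ∑ k ∈ 𝒯.interiorVertices, decay γ h z k ^ 2 * F k ^ 2 :=
      Finset.sum_le_sum hpt
    _ = (2 / c) ^ 2 * ∑ k ∈ 𝒯.interiorVertices,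
        (∑ z ∈ 𝒯.interiorVertices, decay γ h k z ^ 2) * F k ^ 2 := by
      rw [← Finset.mul_sum, Finset.sum_comm]
      congr 1
      refine Finset.sum_congr rfl fun k _ => ?_
      rw [Finset.sum_mul]
      exact Finset.sum_congr rfl fun z _ => by rw [decay_comm]
    _ ≤ (2 / c) ^ 2 * ∑ k ∈ 𝒯.interiorVertices, D * F k ^ 2 := by
      gcongr with k hk
      refine (Finset.sum_le_sum_of_subset_of_nonneg (t := 𝒯.vertices)
        (fun p hp => (𝒯.mem_interiorVertices.1 hp).1) fun p _ _ => sq_nonneg _).trans ?_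
      exact hr.sum_decay_sq_le hγ0 k
    _ = _ := by
      rw [← Finset.mul_sum, hc]
      field_simp

end Triangulation

end PlateFEM

namespace PlateFEM

/-! ### Continuous functionals on `H¹₀(Ω)` and the mass matrix -/

section Functionals

variable {Ω : Set Plane}

/-- The functional `w ↦ ∫ w g` on `H¹₀(Ω)`. -/
noncomputable def H10.pairing {g : Plane → ℝ} (hg : MemLp g 2 (volume.restrict Ω)) :
    H10 Ω →L[ℝ] ℝ :=
  (innerSL ℝ (hg.toLp g)) ∘L (WithLp.fstL 2 ℝ (L2 Ω) (L2Vec Ω)) ∘L (H1 Ω).subtypeL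
    ∘L (H10 Ω).subtypeL

lemma H10.pairing_apply {g : Plane → ℝ} (hg : MemLp g 2 (volume.restrict Ω)) (w : H10 Ω) :
    H10.pairing hg w = ∫ x in Ω, H1.val (w : H1 Ω) x * g x := by
  change inner ℝ (hg.toLp g) (w : H1 Ω).1.fst = _
  rw [L2.inner_def]
  refine integral_congr_ae ?_
  filter_upwards [hg.coeFn_toLp] with x hx
  rw [hx]
  rfl

/-- The functional `w ↦ ∫ ∇w · g` on `H¹₀(Ω)`. -/
noncomputable def H10.gradPairing {g : Plane → Plane} (hg : MemLp g 2 (volume.restrict Ω)) :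
    H10 Ω →L[ℝ] ℝ :=
  (innerSL ℝ (hg.toLp g)) ∘L (WithLp.sndL 2 ℝ (L2 Ω) (L2Vec Ω)) ∘L (H1 Ω).subtypeL
    ∘L (H10 Ω).subtypeL

lemma H10.gradPairing_apply {g : Plane → Plane} (hg : MemLp g 2 (volume.restrict Ω)) (w : H10 Ω) :
    H10.gradPairing hg w = ∫ x in Ω, inner ℝ (g x) (H1.grad (w : H1 Ω) x) := by
  change inner ℝ (hg.toLp g) (w : H1 Ω).1.snd = _
  rw [L2.inner_def]
  refine integral_congr_ae ?_
  filter_upwards [hg.coeFn_toLp] with x hx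
  rw [hx]
  rfl

end Functionals

namespace Triangulation

variable {Ω : Set Plane} (𝒯 : Triangulation Ω)

lemma integrableOn_of_triangles (hΩ : IsPolygonalDomain Ω) {f : Plane → ℝ}
    (hf : ∀ t ∈ 𝒯.triangles, IntegrableOn f (convexHull ℝ (t : Set Plane))) :
    IntegrableOn f Ω := by
  refine (integrableOn_congr_set_ae (𝒯.ae_eq_iUnion hΩ)).1 ?_
  rw [integrableOn_finset_iUnion]
  exact fun t ht => (hf t ht).mono_set _root_.interior_subset

lemma sum_mul_hat_integrableOn (hΩ : IsPolygonalDomain Ω) (y : Plane → ℝ) :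
    IntegrableOn (fun x => ∑ p ∈ 𝒯.vertices, y p * 𝒯.hat p x) Ω := by
  refine 𝒯.integrableOn_of_triangles hΩ fun t ht => ?_
  refine (PlateFEM.integrableOn_triangle (t := t) (f := fun x => ∑ p ∈ t, y p * bary t p x)
    (continuous_finsetSum _ fun p _ => continuous_const.mul (continuous_bary t p))).congr_fun
    (fun x hx => (𝒯.sum_mul_hat ht hx y).symm)
    (IsTriangle.isCompact_convexHull t).measurableSet

/-- A combination of hat functions is bounded by the largest nodal value. -/
lemma abs_sum_mul_hat_le {y : Plane → ℝ} {m : ℝ} (hm : 0 ≤ m) (hy : ∀ p ∈ 𝒯.vertices, |y p| ≤ m)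
    (x : Plane) : |∑ p ∈ 𝒯.vertices, y p * 𝒯.hat p x| ≤ m :=
  calc _ ≤ ∑ p ∈ 𝒯.vertices, |y p * 𝒯.hat p x| := Finset.abs_sum_le_sum_abs _ _
    _ ≤ ∑ p ∈ 𝒯.vertices, m * 𝒯.hat p x := by
      refine Finset.sum_le_sum fun p hp => ?_
      rw [abs_mul, abs_of_nonneg (𝒯.hat_nonneg p x)]
      exact mul_le_mul_of_nonneg_right (hy p hp) (𝒯.hat_nonneg p x)
    _ ≤ m := by
      rw [← Finset.mul_sum]
      exact mul_le_of_le_one_right hm (𝒯.sum_hat_le_one x)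

lemma memLp_sum_mul_hat (hΩ : IsPolygonalDomain Ω) (y : Plane → ℝ) :
    MemLp (fun x => ∑ p ∈ 𝒯.vertices, y p * 𝒯.hat p x) 2 (volume.restrict Ω) := by
  have := isFiniteMeasure_restrict hΩ.isBounded
  refine MemLp.of_bound (𝒯.sum_mul_hat_integrableOn hΩ y).aestronglyMeasurable
    (∑ p ∈ 𝒯.vertices, |y p|) (Eventually.of_forall fun x => ?_)
  exact 𝒯.abs_sum_mul_hat_le (Finset.sum_nonneg fun p _ => abs_nonneg _)
    (fun p hp => Finset.single_le_sum (f := fun p => |y p|) (fun p _ => abs_nonneg _) hp) x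

lemma sum_single_mul_hat {k : Plane} (hk : k ∈ 𝒯.vertices) (x : Plane) :
    ∑ p ∈ 𝒯.vertices, (Pi.single k 1 : Plane → ℝ) p * 𝒯.hat p x = 𝒯.hat k x := by
  rw [Finset.sum_eq_single k]
  · simp
  · intro p _ hp
    rw [Pi.single_eq_of_ne hp, zero_mul]
  · exact fun h => absurd hk h

lemma memLp_hat (hΩ : IsPolygonalDomain Ω) {k : Plane} (hk : k ∈ 𝒯.vertices) :
    MemLp (𝒯.hat k) 2 (volume.restrict Ω) := by
  convert 𝒯.memLp_sum_mul_hat hΩ (Pi.single k 1) using 2 with x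
  exact (𝒯.sum_single_mul_hat hk x).symm

/-- The rows of the mass matrix. -/
lemma setIntegral_hat_mul_sum (hΩ : IsPolygonalDomain Ω) {k : Plane} (hk : k ∈ 𝒯.vertices)
    (y : Plane → ℝ) :
    ∫ x in Ω, 𝒯.hat k x * ∑ p ∈ 𝒯.vertices, y p * 𝒯.hat p x = 𝒯.massSum y k / 12 := by
  classical
  have hint : IntegrableOn (fun x => 𝒯.hat k x * ∑ p ∈ 𝒯.vertices, y p * 𝒯.hat p x) Ω :=
    (𝒯.memLp_hat hΩ hk).integrable_mul (𝒯.memLp_sum_mul_hat hΩ y)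
  rw [𝒯.setIntegral_eq_sum hΩ hint, massSum, Finset.sum_div, Finset.sum_filter]
  refine Finset.sum_congr rfl fun t ht => ?_
  have hT := 𝒯.isTriangle ht
  have hm : MeasurableSet (convexHull ℝ (t : Set Plane)) :=
    (IsTriangle.isCompact_convexHull t).measurableSet
  rw [setIntegral_congr_fun hm (g := fun x =>
    (if k ∈ t then bary t k x else 0) * ∑ p ∈ t, y p * bary t p x) (fun x hx => by
      simp only [𝒯.hat_of_mem ht hx k, 𝒯.sum_mul_hat ht hx y])]
  split_ifs with hkt
  · have hI : ∀ p ∈ t, IntegrableOn (fun x => y p * (bary t k x * bary t p x))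
        (convexHull ℝ (t : Set Plane)) := fun p _ =>
      PlateFEM.integrableOn_triangle
        (continuous_const.mul ((continuous_bary t k).mul (continuous_bary t p)))
    have h1 : ∫ x in convexHull ℝ (t : Set Plane), bary t k x * ∑ p ∈ t, y p * bary t p x
        = ∑ p ∈ t, ∫ x in convexHull ℝ (t : Set Plane), y p * (bary t k x * bary t p x) := by
      rw [← integral_finsetSum _ hI]
      congr 1
      ext x
      rw [Finset.mul_sum]
      exact Finset.sum_congr rfl fun p _ => by ring
    have h2 : ∀ p ∈ t, ∫ x in convexHull ℝ (t : Set Plane), y p * (bary t k x * bary t p x)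
        = volume.real (convexHull ℝ (t : Set Plane)) / 12 * y p
          + if p = k then volume.real (convexHull ℝ (t : Set Plane)) / 12 * y p else 0 := by
      intro p hp
      rw [integral_const_mul]
      split_ifs with hpk
      · rw [hpk, hT.setIntegral_bary_mul_self hkt]
        ring
      · rw [hT.setIntegral_bary_mul hkt hp (Ne.symm hpk)]
        ring
    rw [h1, Finset.sum_congr rfl h2, Finset.sum_add_distrib, ← Finset.mul_sum,
      Finset.sum_ite_eq' t k, if_pos hkt]
    ring
  · simp

variable {𝒯}

lemma sum_mul_multiplierBasis (hΩ : IsOpen Ω) (A : Plane → Plane → ℝ) (v : Plane → ℝ)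
    (x : Plane) : ∑ i ∈ 𝒯.interiorVertices, v i * 𝒯.multiplierBasis A i x
      = ∑ p ∈ 𝒯.vertices, 𝒯.extend A v p * 𝒯.hat p x := by
  classical
  have hdisj : Disjoint 𝒯.interiorVertices 𝒯.boundaryVertices :=
    Finset.disjoint_left.2 fun p hp hp' =>
      𝒯.notMem_of_boundary hΩ hp' (𝒯.mem_interiorVertices.1 hp).2
  have hun : 𝒯.vertices = 𝒯.interiorVertices ∪ 𝒯.boundaryVertices := by
    ext p
    rw [Finset.mem_union]
    exact ⟨fun hp => 𝒯.vertex_cases hΩ hp, fun hp => hp.elim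
      (fun hp => (𝒯.mem_interiorVertices.1 hp).1) (fun hp => (𝒯.mem_boundaryVertices.1 hp).1)⟩
  rw [hun, Finset.sum_union hdisj]
  simp only [multiplierBasis, mul_add, Finset.sum_add_distrib]
  congr 1
  · exact Finset.sum_congr rfl fun p hp => by
      rw [𝒯.extend_of_mem A v (𝒯.mem_interiorVertices.1 hp).2]
  · simp only [Finset.sum_filter, Finset.mul_sum]
    rw [Finset.sum_comm]
    refine Finset.sum_congr rfl fun j hj => ?_
    rw [extend, if_neg (𝒯.notMem_of_boundary hΩ hj), Finset.sum_filter, Finset.sum_mul]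
    refine Finset.sum_congr rfl fun i _ => ?_
    split_ifs
    · ring
    · simp

lemma multiplierBasis_eq (hΩ : IsOpen Ω) (A : Plane → Plane → ℝ) {i : Plane}
    (hi : i ∈ 𝒯.interiorVertices) (x : Plane) : 𝒯.multiplierBasis A i x
      = ∑ p ∈ 𝒯.vertices, 𝒯.extend A (Pi.single i 1) p * 𝒯.hat p x := by
  rw [← sum_mul_multiplierBasis hΩ, Finset.sum_eq_single i]
  · simp
  · intro p _ hp
    rw [Pi.single_eq_of_ne hp, zero_mul]
  · exact fun h => absurd hi h

lemma memLp_multiplierBasis (hΩ : IsPolygonalDomain Ω) (A : Plane → Plane → ℝ) {i : Plane}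
    (hi : i ∈ 𝒯.interiorVertices) :
    MemLp (𝒯.multiplierBasis A i) 2 (volume.restrict Ω) := by
  convert 𝒯.memLp_sum_mul_hat hΩ (𝒯.extend A (Pi.single i 1)) using 2 with x
  exact multiplierBasis_eq hΩ.isOpen A hi x

variable {σ h : ℝ} {A : Plane → Plane → ℝ}

lemma IsSubstochastic.multiplierBasis_nonneg (hA : 𝒯.IsSubstochastic A) {i : Plane}
    (hi : i ∈ 𝒯.interiorVertices) (x : Plane) : 0 ≤ 𝒯.multiplierBasis A i x := by
  classical
  refine add_nonneg (𝒯.hat_nonneg i x) (Finset.sum_nonneg fun j hj => ?_)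
  obtain ⟨hj, hij⟩ := Finset.mem_filter.1 hj
  exact mul_nonneg (hA.nonneg j hj i hi hij) (𝒯.hat_nonneg j x)

lemma IsSubstochastic.sum_multiplierBasis_le_one (hA : 𝒯.IsSubstochastic A)
    (hΩ : IsOpen Ω) (x : Plane) : ∑ i ∈ 𝒯.interiorVertices, 𝒯.multiplierBasis A i x ≤ 1 := by
  classical
  have h1 := sum_mul_multiplierBasis (𝒯 := 𝒯) hΩ A 1 x
  simp only [Pi.one_apply, one_mul] at h1
  rw [h1]
  refine (le_abs_self _).trans (𝒯.abs_sum_mul_hat_le zero_le_one (fun p hp => ?_) x)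
  rcases 𝒯.vertex_cases hΩ hp with hp' | hp'
  · rw [𝒯.extend_of_mem A _ (𝒯.mem_interiorVertices.1 hp').2]
    simp
  · rw [extend, if_neg (𝒯.notMem_of_boundary hΩ hp'), abs_of_nonneg]
    · simpa using hA.sum_le_one p hp'
    · refine Finset.sum_nonneg fun i hi => ?_
      obtain ⟨hi, hij⟩ := Finset.mem_filter.1 hi
      simpa using hA.nonneg p hp' i hi hij

lemma IsSubstochastic.multiplierBasis_le_one (hA : 𝒯.IsSubstochastic A)
    (hΩ : IsOpen Ω) {i : Plane} (hi : i ∈ 𝒯.interiorVertices) (x : Plane) :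
    𝒯.multiplierBasis A i x ≤ 1 :=
  (Finset.single_le_sum (f := fun i => 𝒯.multiplierBasis A i x)
    (fun _ hj => hA.multiplierBasis_nonneg hj x) hi).trans (hA.sum_multiplierBasis_le_one hΩ x)

lemma IsRegular.hat_eq_zero (hr : 𝒯.IsRegular σ h) {p x : Plane} (hx : h < dist x p) :
    𝒯.hat p x = 0 := by
  by_cases hxΩ : x ∈ closure Ω
  · obtain ⟨t, ht, hxt⟩ := 𝒯.exists_triangle hxΩ
    rw [𝒯.hat_of_mem ht hxt, if_neg]
    intro hpt
    exact hx.not_ge (hr.dist_le t ht x hxt p (subset_convexHull ℝ _ hpt))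
  · exact 𝒯.hat_of_notMem_closure hxΩ p

lemma IsRegular.multiplierBasis_eq_zero (hr : 𝒯.IsRegular σ h) {i x : Plane}
    (hx : 2 * h < dist x i) : 𝒯.multiplierBasis A i x = 0 := by
  classical
  have hh := hr.h_pos
  rw [multiplierBasis, hr.hat_eq_zero (by linarith), zero_add]
  refine Finset.sum_eq_zero fun j hj => ?_
  have hij := hr.dist_le_of_adj (Finset.mem_filter.1 hj).2
  rw [hr.hat_eq_zero, mul_zero]
  rw [dist_comm] at hij
  linarith [dist_triangle x j i]

lemma IsRegular.setIntegral_multiplierBasis_le (hr : 𝒯.IsRegular σ h) (hΩ : IsPolygonalDomain Ω)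
    (hA : 𝒯.IsSubstochastic A) {i : Plane} (hi : i ∈ 𝒯.interiorVertices) :
    ∫ x in Ω, 𝒯.multiplierBasis A i x ≤ 4 * Real.pi * h ^ 2 := by
  have hh := hr.h_pos
  have hfin := isFiniteMeasure_restrict hΩ.isBounded
  have hB : MeasurableSet (Metric.closedBall i (2 * h)) :=
    Metric.isClosed_closedBall.measurableSet
  have hI : Integrable ((Metric.closedBall i (2 * h)).indicator fun _ => (1 : ℝ))
      volume :=
    (integrableOn_const (isCompact_closedBall _ _).measure_lt_top.ne).integrable_indicator hB
  have hle : ∀ x, 𝒯.multiplierBasis A i x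
      ≤ (Metric.closedBall i (2 * h)).indicator (fun _ => (1 : ℝ)) x := by
    intro x
    by_cases hx : x ∈ Metric.closedBall i (2 * h)
    · rw [indicator_of_mem hx]
      exact hA.multiplierBasis_le_one hΩ.isOpen hi x
    · rw [indicator_of_notMem hx, hr.multiplierBasis_eq_zero (not_le.1 hx)]
  calc _ ≤ ∫ x in Ω, (Metric.closedBall i (2 * h)).indicator (fun _ => (1 : ℝ)) x :=
        integral_mono ((memLp_multiplierBasis hΩ A hi).integrable (by norm_num)) hI.integrableOn hle
    _ ≤ ∫ x, (Metric.closedBall i (2 * h)).indicator (fun _ => (1 : ℝ)) x :=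
        setIntegral_le_integral hI (Eventually.of_forall fun x =>
          indicator_nonneg (fun _ _ => zero_le_one) x)
    _ = _ := by
        rw [integral_indicator hB, setIntegral_const, smul_eq_mul, mul_one,
          volumeReal_closedBall i (by positivity)]
        ring

/-- The moments against the multiplier basis are controlled by the `L²` norm. -/
lemma IsRegular.sum_sq_setIntegral_multiplierBasis_le (hr : 𝒯.IsRegular σ h)
    (hΩ : IsPolygonalDomain Ω) (hA : 𝒯.IsSubstochastic A) (w : H10 Ω) :
    ∑ i ∈ 𝒯.interiorVertices, (∫ x in Ω, H1.val (w : H1 Ω) x * 𝒯.multiplierBasis A i x) ^ 2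
      ≤ 4 * Real.pi * h ^ 2 * ∫ x in Ω, H1.val (w : H1 Ω) x ^ 2 := by
  have hpi := Real.pi_pos
  have hfin := isFiniteMeasure_restrict hΩ.isBounded
  have hsq := H1.integrable_val_sq (w : H1 Ω)
  set φ := 𝒯.multiplierBasis A with hφ
  have h0 : ∀ i ∈ 𝒯.interiorVertices, ∀ x, 0 ≤ φ i x :=
    fun i hi x => hA.multiplierBasis_nonneg hi x
  have hbd : ∀ i ∈ 𝒯.interiorVertices,
      Integrable (fun x => H1.val (w : H1 Ω) x ^ 2 * φ i x) (volume.restrict Ω) := by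
    intro i hi
    refine hsq.mul_bdd (c := 1) (memLp_multiplierBasis hΩ A hi).aestronglyMeasurable
      (Eventually.of_forall fun x => ?_)
    rw [Real.norm_eq_abs, abs_of_nonneg (h0 i hi x)]
    exact hA.multiplierBasis_le_one hΩ.isOpen hi x
  have hone : ∀ i ∈ 𝒯.interiorVertices,
      (∫ x in Ω, H1.val (w : H1 Ω) x * φ i x) ^ 2
        ≤ 4 * Real.pi * h ^ 2 * ∫ x in Ω, H1.val (w : H1 Ω) x ^ 2 * φ i x := by
    intro i hi
    have hs : ∀ x, Real.sqrt (φ i x) ^ 2 = φ i x := fun x => Real.sq_sqrt (h0 i hi x)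
    have e1 : ∀ x, (H1.val (w : H1 Ω) x * Real.sqrt (φ i x)) * Real.sqrt (φ i x)
        = H1.val (w : H1 Ω) x * φ i x := fun x => by rw [mul_assoc, ← sq, hs]
    have e2 : ∀ x, (H1.val (w : H1 Ω) x * Real.sqrt (φ i x)) ^ 2
        = H1.val (w : H1 Ω) x ^ 2 * φ i x := fun x => by rw [mul_pow, hs]
    have hcs := sq_integral_mul_le (μ := volume.restrict Ω)
      (f := fun x => H1.val (w : H1 Ω) x * Real.sqrt (φ i x)) (g := fun x => Real.sqrt (φ i x))
      (by simpa only [e2] using hbd i hi)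
      (by simpa only [hs] using (memLp_multiplierBasis hΩ A hi).integrable (by norm_num))
      (by
        simp only [e1]
        exact (H1.memLp_val (w : H1 Ω)).integrable_mul (memLp_multiplierBasis hΩ A hi))
    simp only [e1, e2, hs] at hcs
    rw [mul_comm]
    refine hcs.trans (mul_le_mul_of_nonneg_left (hr.setIntegral_multiplierBasis_le hΩ hA hi)
      (integral_nonneg fun x => mul_nonneg (sq_nonneg _) (h0 i hi x)))
  calc _ ≤ ∑ i ∈ 𝒯.interiorVertices,
        4 * Real.pi * h ^ 2 * ∫ x in Ω, H1.val (w : H1 Ω) x ^ 2 * φ i x := Finset.sum_le_sum hone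
    _ = 4 * Real.pi * h ^ 2 *
        ∫ x in Ω, ∑ i ∈ 𝒯.interiorVertices, H1.val (w : H1 Ω) x ^ 2 * φ i x := by
      rw [integral_finsetSum _ hbd, Finset.mul_sum]
    _ ≤ _ := by
      refine mul_le_mul_of_nonneg_left (integral_mono (integrable_finsetSum _ hbd) hsq fun x => ?_)
        (by positivity)
      simp only [← Finset.mul_sum]
      exact mul_le_of_le_one_right (sq_nonneg _) (hA.sum_multiplierBasis_le_one hΩ.isOpen x)

end Triangulation

end PlateFEM

namespace PlateFEM

/-! ### Nodal coefficients of the oblique projection -/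

/-- A lower bound for a square matrix in `ℓ²` is also one for its transpose. -/
lemma sum_sq_le_transpose {ι : Type*} [Fintype ι] [DecidableEq ι] {G : Matrix ι ι ℝ} {K : ℝ}
    (hG : ∀ v : ι → ℝ, ∑ i, v i ^ 2 ≤ K * ∑ i, (G.mulVec v) i ^ 2) :
    IsUnit G ∧ ∀ q : ι → ℝ, ∑ i, q i ^ 2 ≤ K * ∑ i, (G.transpose.mulVec q) i ^ 2 := by
  have hu : IsUnit G := by
    rw [← Matrix.mulVec_injective_iff_isUnit]
    intro v w hvw
    have h1 := hG (v - w)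
    rw [Matrix.mulVec_sub, hvw, sub_self] at h1
    simp only [Pi.zero_apply, ne_eq, OfNat.ofNat_ne_zero, not_false_eq_true, zero_pow,
      Finset.sum_const_zero, mul_zero] at h1
    have h2 := (Finset.sum_eq_zero_iff_of_nonneg fun i _ => sq_nonneg ((v - w) i)).1
      (le_antisymm h1 (Finset.sum_nonneg fun i _ => sq_nonneg _))
    ext i
    exact sub_eq_zero.1 (pow_eq_zero_iff two_ne_zero |>.1 (h2 i (Finset.mem_univ i)))
  refine ⟨hu, fun q => ?_⟩
  set v := G⁻¹.mulVec q with hv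
  have hGv : G.mulVec v = q := by
    rw [hv, Matrix.mulVec_mulVec, Matrix.mul_nonsing_inv _ ((Matrix.isUnit_iff_isUnit_det G).1 hu),
      Matrix.one_mulVec]
  have h1 : ∑ i, q i ^ 2 = ∑ i, (G.transpose.mulVec q) i * v i := by
    have h2 : dotProduct q (G.mulVec v) = dotProduct (G.transpose.mulVec q) v := by
      rw [Matrix.dotProduct_mulVec, Matrix.mulVec_transpose]
    rw [hGv] at h2
    simpa only [dotProduct, sq] using h2
  have h2 := Finset.sum_mul_sq_le_sq_mul_sq Finset.univ (G.transpose.mulVec q) v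
  rw [← h1] at h2
  have h3 := hG v
  rw [hGv] at h3
  have hq : 0 ≤ ∑ i, q i ^ 2 := Finset.sum_nonneg fun i _ => sq_nonneg _
  have hf : 0 ≤ ∑ i, (G.transpose.mulVec q) i ^ 2 := Finset.sum_nonneg fun i _ => sq_nonneg _
  rcases hq.eq_or_lt with h0 | h0
  · have h5 : q = 0 := by
      ext i
      have := (Finset.sum_eq_zero_iff_of_nonneg fun i _ => sq_nonneg (q i)).1 h0.symm i
        (Finset.mem_univ i)
      exact pow_eq_zero_iff two_ne_zero |>.1 this
    simp [h5]
  · refine le_of_mul_le_mul_left ?_ h0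
    calc (∑ i, q i ^ 2) * ∑ i, q i ^ 2 = (∑ i, q i ^ 2) ^ 2 := (sq _).symm
      _ ≤ _ := h2
      _ ≤ (∑ i, (G.transpose.mulVec q) i ^ 2) * (K * ∑ i, q i ^ 2) :=
        mul_le_mul_of_nonneg_left h3 hf
      _ = _ := by ring

namespace Triangulation

variable {Ω : Set Plane} {𝒯 : Triangulation Ω} {σ h : ℝ} {A : Plane → Plane → ℝ}

/-- The nodal values of the projection onto `S_h` along the multiplier space. -/
lemma IsRegular.exists_coefficients (hr : 𝒯.IsRegular σ h) (hΩ : IsPolygonalDomain Ω)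
    (hA : 𝒯.IsSubstochastic A) {C : ℝ} (hC0 : 0 ≤ C)
    (hC : ∀ v : Plane → ℝ, ∑ z ∈ 𝒯.interiorVertices, v z ^ 2
      ≤ C / h ^ 4 * ∑ k ∈ 𝒯.interiorVertices, 𝒯.massSum (𝒯.extend A v) k ^ 2) :
    ∃ q : H10 Ω →ₗ[ℝ] (Plane → ℝ),
      (∀ w, ∀ i ∈ 𝒯.interiorVertices, ∑ k ∈ 𝒯.interiorVertices,
        q w k * ∫ x in Ω, 𝒯.hat k x * 𝒯.multiplierBasis A i x
          = ∫ x in Ω, H1.val (w : H1 Ω) x * 𝒯.multiplierBasis A i x) ∧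
      (∀ y : Plane → ℝ, (∀ i ∈ 𝒯.interiorVertices, ∑ k ∈ 𝒯.interiorVertices,
        y k * ∫ x in Ω, 𝒯.hat k x * 𝒯.multiplierBasis A i x = 0) →
          ∀ k ∈ 𝒯.interiorVertices, y k = 0) ∧
      ∀ w, ∑ k ∈ 𝒯.interiorVertices, q w k ^ 2
        ≤ 576 * Real.pi * C / h ^ 2 * ∫ x in Ω, H1.val (w : H1 Ω) x ^ 2 := by
  classical
  have hh := hr.h_pos
  set ι := {p // p ∈ 𝒯.interiorVertices} with hι
  set G : Matrix ι ι ℝ :=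
    Matrix.of fun k i => ∫ x in Ω, 𝒯.hat k x * 𝒯.multiplierBasis A i x with hG
  have hGv : ∀ (v : Plane → ℝ) (k : ι), (G.mulVec fun i => v i) k
      = 𝒯.massSum (𝒯.extend A v) k / 12 := by
    intro v k
    have hk := (𝒯.mem_interiorVertices.1 k.2).1
    rw [← 𝒯.setIntegral_hat_mul_sum hΩ hk]
    simp only [← sum_mul_multiplierBasis hΩ.isOpen, Finset.mul_sum]
    rw [integral_finsetSum]
    · rw [Matrix.mulVec, dotProduct, ← Finset.sum_coe_sort 𝒯.interiorVertices]
      refine Finset.sum_congr rfl fun i _ => ?_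
      rw [hG, Matrix.of_apply, mul_comm, ← integral_const_mul]
      congr 1
      ext x
      ring
    · intro i hi
      have := ((𝒯.memLp_hat hΩ hk).integrable_mul (memLp_multiplierBasis hΩ A hi)).const_mul (v i)
      refine this.congr (Eventually.of_forall fun x => ?_)
      simp only [Pi.mul_apply]
      ring
  have hstab : ∀ v : ι → ℝ, ∑ i, v i ^ 2 ≤ 144 * C / h ^ 4 * ∑ i, (G.mulVec v) i ^ 2 := by
    intro v
    set v' : Plane → ℝ := fun p => if hp : p ∈ 𝒯.interiorVertices then v ⟨p, hp⟩ else 0 with hv'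
    have hvv : v = fun i : ι => v' i := by
      ext i
      simp only [hv', i.2, dite_true]
      rfl
    have h1 := hC v'
    rw [← Finset.sum_coe_sort 𝒯.interiorVertices (fun z => v' z ^ 2),
      ← Finset.sum_coe_sort 𝒯.interiorVertices
      (fun k => 𝒯.massSum (𝒯.extend A v') k ^ 2)] at h1
    rw [hvv]
    refine h1.trans (le_of_eq ?_)
    simp only [hGv, div_pow, ← Finset.sum_div]
    ring
  obtain ⟨hu, htr⟩ := sum_sq_le_transpose hstab
  set f : H10 Ω →ₗ[ℝ] (ι → ℝ) := LinearMap.pi fun i : ι =>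
    (H10.pairing (memLp_multiplierBasis hΩ A i.2)).toLinearMap with hf
  have hfi : ∀ w i, f w i = ∫ x in Ω, H1.val (w : H1 Ω) x * 𝒯.multiplierBasis A i x :=
    fun w i => H10.pairing_apply _ w
  set q : H10 Ω →ₗ[ℝ] (Plane → ℝ) := (Function.ExtendByZero.linearMap ℝ (Subtype.val : ι → Plane))
    ∘ₗ (Matrix.toLin' (G.transpose)⁻¹) ∘ₗ f with hq
  have hqk : ∀ w, (fun k : ι => q w k) = (G.transpose)⁻¹.mulVec (f w) := by
    intro w
    ext k
    rw [hq, LinearMap.comp_apply, LinearMap.comp_apply, Function.ExtendByZero.linearMap_apply,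
      Subtype.val_injective.extend_apply, Matrix.toLin'_apply]
  have hut : IsUnit G.transpose.det := by
    rw [Matrix.det_transpose]
    exact (Matrix.isUnit_iff_isUnit_det G).1 hu
  have hGq : ∀ w, G.transpose.mulVec (fun k : ι => q w k) = f w := by
    intro w
    rw [hqk, Matrix.mulVec_mulVec, Matrix.mul_nonsing_inv _ hut, Matrix.one_mulVec]
  have hGt : ∀ (y : Plane → ℝ) (i : ι), (G.transpose.mulVec fun k : ι => y k) i
      = ∑ k ∈ 𝒯.interiorVertices, y k * ∫ x in Ω, 𝒯.hat k x * 𝒯.multiplierBasis A i x := by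
    intro y i
    rw [Matrix.mulVec, dotProduct, ← Finset.sum_coe_sort 𝒯.interiorVertices]
    exact Finset.sum_congr rfl fun k _ => by rw [Matrix.transpose_apply, mul_comm]; rfl
  refine ⟨q, fun w i hi => ?_, fun y hy k hk => ?_, fun w => ?_⟩
  · rw [← hGt (q w) ⟨i, hi⟩, hGq, hfi]
  · have h1 := htr fun k : ι => y k
    have h2 : (G.transpose.mulVec fun k : ι => y k) = 0 := by
      ext i
      rw [hGt]
      exact hy i i.2
    simp only [h2, Pi.zero_apply, ne_eq, OfNat.ofNat_ne_zero, not_false_eq_true, zero_pow,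
      Finset.sum_const_zero, mul_zero] at h1
    have h3 := (Finset.sum_eq_zero_iff_of_nonneg fun (i : ι) _ => sq_nonneg (y i)).1
      (le_antisymm h1 (Finset.sum_nonneg fun i _ => sq_nonneg _)) ⟨k, hk⟩ (Finset.mem_univ _)
    exact pow_eq_zero_iff two_ne_zero |>.1 h3
  · have h1 := htr fun k : ι => q w k
    rw [hGq] at h1
    simp only [hfi] at h1
    rw [Finset.sum_coe_sort 𝒯.interiorVertices (fun k => q w k ^ 2),
      Finset.sum_coe_sort 𝒯.interiorVertices
        (fun i => (∫ x in Ω, H1.val (w : H1 Ω) x * 𝒯.multiplierBasis A i x) ^ 2)] at h1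
    refine h1.trans ?_
    refine (mul_le_mul_of_nonneg_left (hr.sum_sq_setIntegral_multiplierBasis_le hΩ hA w)
      (by positivity)).trans (le_of_eq ?_)
    field_simp
    ring

/-! ### Norms of finite element functions -/

/-- The number of triangles at a vertex is bounded. -/
lemma IsRegular.sum_triangles_le (hr : 𝒯.IsRegular σ h) {f : Plane → ℝ} (hf : ∀ p, 0 ≤ f p) :
    ∑ t ∈ 𝒯.triangles, ∑ p ∈ t, f p ≤ 1 / σ ^ 2 * ∑ p ∈ 𝒯.vertices, f p := by
  classical
  rw [show (∑ t ∈ 𝒯.triangles, ∑ p ∈ t, f p)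
    = ∑ t ∈ 𝒯.triangles, ∑ p ∈ 𝒯.vertices, if p ∈ t then f p else 0 from ?_, Finset.sum_comm,
    Finset.mul_sum]
  · refine Finset.sum_le_sum fun p hp => ?_
    rw [← Finset.sum_filter, Finset.sum_const, nsmul_eq_mul]
    refine mul_le_mul_of_nonneg_right ?_ (hf p)
    have := hr.card_le (Finset.filter_subset (fun t => p ∈ t) 𝒯.triangles) zero_le_one
      (x := p) (fun s hs => by
        obtain ⟨hs, hks⟩ := Finset.mem_filter.1 hs
        rw [one_mul]
        exact hr.subset_closedBall hs (subset_convexHull ℝ _ hks))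
    simpa using this
  · refine Finset.sum_congr rfl fun t ht => ?_
    rw [← Finset.sum_filter]
    refine Finset.sum_congr ?_ fun _ _ => rfl
    ext p
    rw [Finset.mem_filter]
    exact ⟨fun h => ⟨𝒯.mem_vertices_of_mem ht h, h⟩, fun h => h.2⟩

lemma sum_sq_indicator (y : Plane → ℝ) :
    ∑ p ∈ 𝒯.vertices, Ω.indicator y p ^ 2 = ∑ p ∈ 𝒯.interiorVertices, y p ^ 2 := by
  classical
  rw [← Finset.sum_subset (s₁ := 𝒯.interiorVertices)
    (fun p hp => (𝒯.mem_interiorVertices.1 hp).1)]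
  · exact Finset.sum_congr rfl fun p hp => by
      rw [indicator_of_mem (𝒯.mem_interiorVertices.1 hp).2]
  · intro p hp hp'
    rw [indicator_of_notMem (fun h => hp' (𝒯.mem_interiorVertices.2 ⟨hp, h⟩))]
    simp

/-- An estimate on each triangle by nodal values gives an estimate on the domain. -/
lemma IsRegular.setIntegral_le_of_triangles (hr : 𝒯.IsRegular σ h) (hΩ : IsPolygonalDomain Ω)
    {f : Plane → ℝ} (hf : IntegrableOn f Ω) {y : Plane → ℝ} {a : ℝ} (ha : 0 ≤ a)
    (hfy : ∀ᵐ x ∂(volume.restrict Ω), ∀ t ∈ 𝒯.triangles,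
      x ∈ interior (convexHull ℝ (t : Set Plane)) → f x ≤ a * ∑ p ∈ t, Ω.indicator y p ^ 2) :
    ∫ x in Ω, f x
      ≤ Real.pi * h ^ 2 * a / σ ^ 2 * ∑ p ∈ 𝒯.interiorVertices, y p ^ 2 := by
  have hpi := Real.pi_pos
  rw [𝒯.setIntegral_eq_sum hΩ hf]
  calc _ ≤ ∑ t ∈ 𝒯.triangles, Real.pi * h ^ 2 * a * ∑ p ∈ t, Ω.indicator y p ^ 2 := by
        refine Finset.sum_le_sum fun t ht => ?_
        have hfin : volume (convexHull ℝ (t : Set Plane)) ≠ ⊤ :=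
          (IsTriangle.isCompact_convexHull t).measure_lt_top.ne
        have hint : ∀ᵐ x ∂(volume.restrict (convexHull ℝ (t : Set Plane))),
            x ∈ interior (convexHull ℝ (t : Set Plane)) := by
          rw [← Measure.restrict_congr_set (IsTriangle.interior_ae_eq t)]
          exact ae_restrict_mem isOpen_interior.measurableSet
        have hs : 0 ≤ ∑ p ∈ t, Ω.indicator y p ^ 2 := Finset.sum_nonneg fun p _ => sq_nonneg _
        calc _ ≤ ∫ x in convexHull ℝ (t : Set Plane), a * ∑ p ∈ t, Ω.indicator y p ^ 2 := by
              refine integral_mono_ae (𝒯.integrableOn_triangle hΩ ht hf) (integrableOn_const hfin) ?_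
              filter_upwards [hint, 𝒯.ae_triangle hΩ ht hfy] with x h1 h2
              exact h2 t ht h1
          _ = volume.real (convexHull ℝ (t : Set Plane)) *
              (a * ∑ p ∈ t, Ω.indicator y p ^ 2) := by rw [setIntegral_const, smul_eq_mul]
          _ ≤ Real.pi * h ^ 2 * (a * ∑ p ∈ t, Ω.indicator y p ^ 2) :=
              mul_le_mul_of_nonneg_right (hr.volume_le ht) (mul_nonneg ha hs)
          _ = _ := by ring
    _ = Real.pi * h ^ 2 * a * ∑ t ∈ 𝒯.triangles, ∑ p ∈ t, Ω.indicator y p ^ 2 := by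
        rw [Finset.mul_sum]
    _ ≤ Real.pi * h ^ 2 * a * (1 / σ ^ 2 * ∑ p ∈ 𝒯.vertices, Ω.indicator y p ^ 2) :=
        mul_le_mul_of_nonneg_left (hr.sum_triangles_le fun p => sq_nonneg _) (by positivity)
    _ = _ := by rw [sum_sq_indicator]; ring

lemma IsRegular.setIntegral_val_fe_sq_le (hr : 𝒯.IsRegular σ h) (hΩ : IsPolygonalDomain Ω)
    (y : Plane → ℝ) :
    ∫ x in Ω, H1.val (𝒯.fe hΩ y : H1 Ω) x ^ 2
      ≤ Real.pi * h ^ 2 * 3 / σ ^ 2 * ∑ p ∈ 𝒯.interiorVertices, y p ^ 2 := by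
  refine hr.setIntegral_le_of_triangles hΩ (H1.integrable_val_sq _) (by norm_num) ?_
  filter_upwards [𝒯.val_fe_triangle hΩ y] with x hx t ht hxt
  have hxt' := _root_.interior_subset hxt
  have hT := 𝒯.isTriangle ht
  rw [hx t ht hxt']
  calc _ ≤ (t.card : ℝ) * ∑ p ∈ t, (Ω.indicator y p * bary t p x) ^ 2 := sq_sum_le_card_mul_sum_sq
    _ ≤ _ := by
      rw [hT.card_eq]
      push_cast
      refine mul_le_mul_of_nonneg_left (Finset.sum_le_sum fun p hp => ?_) (by norm_num)
      rw [mul_pow]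
      refine mul_le_of_le_one_right (sq_nonneg _) (pow_le_one₀ ?_ (hT.bary_le_one hxt' hp))
      exact hT.mem_convexHull_iff.1 hxt' p hp

lemma norm_sum_smul_sq_le {t : Finset Plane} (ht : t.card = 3) (y : Plane → ℝ) {g : Plane → Plane}
    {a : ℝ} (hg : ∀ p ∈ t, ‖g p‖ ≤ a) :
    ‖∑ p ∈ t, y p • g p‖ ^ 2 ≤ 3 * a ^ 2 * ∑ p ∈ t, y p ^ 2 :=
  calc _ ≤ (∑ p ∈ t, ‖y p • g p‖) ^ 2 :=
        pow_le_pow_left₀ (norm_nonneg _) (norm_sum_le _ _) 2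
    _ ≤ (t.card : ℝ) * ∑ p ∈ t, ‖y p • g p‖ ^ 2 := sq_sum_le_card_mul_sum_sq
    _ ≤ (t.card : ℝ) * ∑ p ∈ t, a ^ 2 * y p ^ 2 := by
      refine mul_le_mul_of_nonneg_left (Finset.sum_le_sum fun p hp => ?_) (Nat.cast_nonneg _)
      rw [norm_smul, mul_pow, Real.norm_eq_abs, sq_abs, mul_comm]
      exact mul_le_mul_of_nonneg_right (pow_le_pow_left₀ (norm_nonneg _) (hg p hp) 2)
        (sq_nonneg _)
    _ = _ := by
      rw [ht, ← Finset.mul_sum]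
      push_cast
      ring

lemma IsRegular.setIntegral_grad_fe_sq_le (hr : 𝒯.IsRegular σ h) (hΩ : IsPolygonalDomain Ω)
    (y : Plane → ℝ) :
    ∫ x in Ω, ‖H1.grad (𝒯.fe hΩ y : H1 Ω) x‖ ^ 2
      ≤ Real.pi * 3 / σ ^ 4 * ∑ p ∈ 𝒯.interiorVertices, y p ^ 2 := by
  have hσ := hr.sigma_pos
  have hh := hr.h_pos
  refine (hr.setIntegral_le_of_triangles hΩ (H1.integrable_grad_sq _)
    (a := 3 * (1 / (σ * h)) ^ 2) (y := y) (by positivity) ?_).trans (le_of_eq ?_)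
  · filter_upwards [𝒯.grad_fe_triangle hΩ y] with x hx t ht hxt
    rw [hx t ht hxt]
    exact norm_sum_smul_sq_le (𝒯.isTriangle ht).card_eq _ fun p hp => hr.norm_baryGrad_le ht hp
  · field_simp

end Triangulation

end PlateFEM

namespace PlateFEM

/-! ### Quasi-interpolation and stability of projections in `H¹` -/

section

variable {Ω : Set Plane}

lemma H1.setIntegral_val_add_sq_le (u v : H1 Ω) : ∫ x in Ω, H1.val (u + v) x ^ 2
    ≤ 2 * (∫ x in Ω, H1.val u x ^ 2) + 2 * ∫ x in Ω, H1.val v x ^ 2 := by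
  rw [← integral_const_mul, ← integral_const_mul,
    ← integral_add ((H1.integrable_val_sq u).const_mul 2) ((H1.integrable_val_sq v).const_mul 2)]
  refine integral_mono_ae (H1.integrable_val_sq _)
    (((H1.integrable_val_sq u).const_mul 2).add ((H1.integrable_val_sq v).const_mul 2)) ?_
  filter_upwards [H1.val_add u v] with x hx
  rw [hx, Pi.add_apply]
  nlinarith [sq_nonneg (H1.val u x - H1.val v x)]

lemma H1.setIntegral_grad_add_sq_le (u v : H1 Ω) : ∫ x in Ω, ‖H1.grad (u + v) x‖ ^ 2
    ≤ 2 * (∫ x in Ω, ‖H1.grad u x‖ ^ 2) + 2 * ∫ x in Ω, ‖H1.grad v x‖ ^ 2 := by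
  rw [← integral_const_mul, ← integral_const_mul,
    ← integral_add ((H1.integrable_grad_sq u).const_mul 2) ((H1.integrable_grad_sq v).const_mul 2)]
  refine integral_mono_ae (H1.integrable_grad_sq _)
    (((H1.integrable_grad_sq u).const_mul 2).add ((H1.integrable_grad_sq v).const_mul 2)) ?_
  filter_upwards [H1.grad_add u v] with x hx
  rw [hx, Pi.add_apply]
  nlinarith [norm_add_le (H1.grad u x) (H1.grad v x), norm_nonneg (H1.grad u x + H1.grad v x),
    sq_nonneg (‖H1.grad u x‖ - ‖H1.grad v x‖)]

lemma H1.continuous_setIntegral_val_sq : Continuous fun u : H1 Ω => ∫ x in Ω, H1.val u x ^ 2 := by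
  have h : (fun u : H1 Ω => ∫ x in Ω, H1.val u x ^ 2)
      = fun u => ‖((WithLp.fstL 2 ℝ (L2 Ω) (L2Vec Ω)) ∘L (H1 Ω).subtypeL) u‖ ^ 2 := by
    ext u
    refine Eq.trans ?_ (norm_sq_Lp u.1.fst).symm
    simp only [Real.norm_eq_abs, sq_abs]
    rfl
  rw [h]
  exact (ContinuousLinearMap.continuous _).norm.pow 2

/-- The square of the `L²` norm. -/
noncomputable def H10.l2Sq (w : H10 Ω) : ℝ := ∫ x in Ω, H1.val (w : H1 Ω) x ^ 2

/-- The square of the `L²` norm of the gradient. -/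
noncomputable def H10.gradSq (w : H10 Ω) : ℝ := ∫ x in Ω, ‖H1.grad (w : H1 Ω) x‖ ^ 2

lemma H10.l2Sq_nonneg (w : H10 Ω) : 0 ≤ H10.l2Sq w := integral_nonneg fun _ => sq_nonneg _

lemma H10.gradSq_nonneg (w : H10 Ω) : 0 ≤ H10.gradSq w := integral_nonneg fun _ => sq_nonneg _

lemma H10.norm_sq (w : H10 Ω) : ‖w‖ ^ 2 = H10.l2Sq w + H10.gradSq w := H1.norm_sq (w : H1 Ω)

lemma H10.l2Sq_le (w : H10 Ω) : H10.l2Sq w ≤ ‖w‖ ^ 2 := by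
  rw [H10.norm_sq]
  exact le_add_of_nonneg_right (H10.gradSq_nonneg w)

lemma H10.gradSq_le (w : H10 Ω) : H10.gradSq w ≤ ‖w‖ ^ 2 := by
  rw [H10.norm_sq]
  exact le_add_of_nonneg_left (H10.l2Sq_nonneg w)

lemma H10.l2Sq_add_le (u v : H10 Ω) : H10.l2Sq (u + v) ≤ 2 * H10.l2Sq u + 2 * H10.l2Sq v :=
  H1.setIntegral_val_add_sq_le (u : H1 Ω) (v : H1 Ω)

lemma H10.gradSq_add_le (u v : H10 Ω) :
    H10.gradSq (u + v) ≤ 2 * H10.gradSq u + 2 * H10.gradSq v :=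
  H1.setIntegral_grad_add_sq_le (u : H1 Ω) (v : H1 Ω)

lemma H10.l2Sq_neg (u : H10 Ω) : H10.l2Sq (-u) = H10.l2Sq u := by
  refine integral_congr_ae ?_
  filter_upwards [H1.val_smul (-1) (u : H1 Ω)] with x hx
  rw [show ((-u : H10 Ω) : H1 Ω) = (-1 : ℝ) • (u : H1 Ω) by simp, hx]
  simp

lemma H10.continuous_l2Sq : Continuous (H10.l2Sq (Ω := Ω)) :=
  H1.continuous_setIntegral_val_sq.comp continuous_subtype_val

/-- A value that approximates a test function on a disc around `p`; it is zero on the boundary. -/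
lemma IsTestFunction.exists_nodal_value {φ : Plane → ℝ} (hφ : IsTestFunction Ω φ) (hΩ : IsOpen Ω)
    {ℓ : ℝ} (hℓ : 0 < ℓ) (hseg : ∀ p ∈ frontier Ω, ∃ e : Plane, ‖e‖ = 1 ∧
      ∀ s ∈ Icc 0 ℓ, p + s • e ∈ frontier Ω) {h D : ℝ} (hh : 0 < h) (hD : h ≤ D) {p : Plane}
    (hp : p ∈ closure Ω) : ∃ m : ℝ, (p ∉ Ω → m = 0) ∧
      ∫ x in Metric.closedBall p h, (φ x - m) ^ 2
        ≤ (24 + 16 * D / ℓ) * h ^ 2 * ∫ x in Metric.closedBall p (2 * h), ‖gradient φ x‖ ^ 2 := by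
  have hI : 0 ≤ ∫ x in Metric.closedBall p (2 * h), ‖gradient φ x‖ ^ 2 :=
    integral_nonneg fun x => sq_nonneg _
  have hD0 : 0 < D := hh.trans_le hD
  by_cases hpΩ : p ∈ Ω
  · obtain ⟨s, -, hs⟩ := exists_setIntegral_sub_sq_le (hφ.smooth.of_le (by simp)) p
      (e := EuclideanSpace.single 0 1) (by simp) hh le_rfl
    refine ⟨_, fun h => absurd hpΩ h, hs.trans (mul_le_mul_of_nonneg_right ?_ hI)⟩
    have h1 : 8 * h ^ 2 + 16 * h ^ 3 / h = 24 * h ^ 2 := by field_simp; norm_num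
    rw [h1]
    have : 0 ≤ 16 * D / ℓ := by positivity
    nlinarith [sq_nonneg h]
  · obtain ⟨e, he, hes⟩ := hseg p (by rw [hΩ.frontier_eq]; exact ⟨hp, hpΩ⟩)
    obtain ⟨s, hs, hP⟩ := exists_setIntegral_sub_sq_le (hφ.smooth.of_le (by simp)) p he
      (lt_min hh hℓ) (min_le_left h ℓ)
    have h0 : φ (p + s • e) = 0 := by
      have h1 := hes s ⟨hs.1, hs.2.trans (min_le_right _ _)⟩
      rw [hΩ.frontier_eq] at h1
      exact image_eq_zero_of_notMem_tsupport fun h' => h1.2 (hφ.supp h')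
    rw [h0] at hP
    refine ⟨0, fun _ => rfl, hP.trans (mul_le_mul_of_nonneg_right ?_ hI)⟩
    have h1 : h / min h ℓ ≤ 1 + D / ℓ := by
      rcases min_cases h ℓ with ⟨h2, -⟩ | ⟨h2, -⟩
      · rw [h2, div_self hh.ne']
        have : 0 ≤ D / ℓ := by positivity
        linarith
      · rw [h2]
        have : h / ℓ ≤ D / ℓ := by gcongr
        linarith
    calc 8 * h ^ 2 + 16 * h ^ 3 / min h ℓ = (8 + 16 * (h / min h ℓ)) * h ^ 2 := by ring
      _ ≤ (8 + 16 * (1 + D / ℓ)) * h ^ 2 := by gcongr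
      _ = _ := by ring

end

namespace Triangulation

variable {Ω : Set Plane} {𝒯 : Triangulation Ω} {σ h : ℝ}

/-- The discs of radius `2 h` around the vertices of the triangles have bounded overlap. -/
lemma IsRegular.sum_setIntegral_closedBall_le (hr : 𝒯.IsRegular σ h) {g : Plane → ℝ}
    (hg : Integrable g) (hg0 : ∀ x, 0 ≤ g x) :
    ∑ t ∈ 𝒯.triangles, ∑ p ∈ t, ∫ x in Metric.closedBall p (2 * h), g x
      ≤ 27 / σ ^ 2 * ∫ x, g x := by
  classical
  have hB : ∀ p : Plane, MeasurableSet (Metric.closedBall p (2 * h)) :=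
    fun p => Metric.isClosed_closedBall.measurableSet
  have hI : ∀ p, Integrable ((Metric.closedBall p (2 * h)).indicator g) :=
    fun p => hg.indicator (hB p)
  have e1 : ∑ t ∈ 𝒯.triangles, ∑ p ∈ t, ∫ x in Metric.closedBall p (2 * h), g x
      = ∫ x, ∑ t ∈ 𝒯.triangles, ∑ p ∈ t, (Metric.closedBall p (2 * h)).indicator g x := by
    rw [integral_finsetSum _ fun t _ => integrable_finsetSum _ fun p _ => hI p]
    refine Finset.sum_congr rfl fun t _ => ?_
    rw [integral_finsetSum _ fun p _ => hI p]
    exact Finset.sum_congr rfl fun p _ => (integral_indicator (hB p)).symm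
  rw [e1, ← integral_const_mul]
  refine integral_mono (integrable_finsetSum _ fun t _ => integrable_finsetSum _ fun p _ => hI p)
    (hg.const_mul _) fun x => ?_
  set s := 𝒯.triangles.filter fun t : Finset Plane => convexHull ℝ (t : Set Plane) ⊆ Metric.closedBall x (3 * h)
    with hs
  have hcard : (s.card : ℝ) ≤ 3 ^ 2 / σ ^ 2 :=
    hr.card_le (Finset.filter_subset _ _) (by norm_num) fun t ht => (Finset.mem_filter.1 ht).2
  have hle : ∀ t ∈ 𝒯.triangles, ∑ p ∈ t, (Metric.closedBall p (2 * h)).indicator g x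
      ≤ if t ∈ s then 3 * g x else 0 := by
    intro t ht
    split_ifs with hts
    · calc _ ≤ t.card • g x := Finset.sum_le_card_nsmul _ _ _ fun p _ =>
            indicator_le_self' (fun _ _ => hg0 _) x
        _ = _ := by rw [(𝒯.isTriangle ht).card_eq, nsmul_eq_mul]; norm_num
    · refine Finset.sum_nonpos fun p hp => ?_
      rw [indicator_of_notMem]
      intro hxp
      refine hts (Finset.mem_filter.2 ⟨ht, fun y hy => ?_⟩)
      have h1 := hr.dist_le t ht y hy p (subset_convexHull ℝ _ hp)
      rw [Metric.mem_closedBall, dist_comm] at hxp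
      rw [Metric.mem_closedBall]
      linarith [dist_triangle y p x]
  calc _ ≤ ∑ t ∈ 𝒯.triangles, if t ∈ s then 3 * g x else 0 := Finset.sum_le_sum hle
    _ = s.card * (3 * g x) := by
      rw [← Finset.sum_filter, Finset.sum_const, nsmul_eq_mul]
      congr 3
      ext t
      rw [Finset.mem_filter]
      exact ⟨fun ht => ht.2, fun ht => ⟨Finset.filter_subset _ _ ht, ht⟩⟩
    _ ≤ 3 ^ 2 / σ ^ 2 * (3 * g x) :=
      mul_le_mul_of_nonneg_right hcard (mul_nonneg (by norm_num) (hg0 x))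
    _ = _ := by ring

/-- Quasi-interpolation of a test function with optimal approximation order. -/
lemma IsRegular.exists_quasi_interpolant (hr : 𝒯.IsRegular σ h) (hΩ : IsPolygonalDomain Ω)
    {ℓ : ℝ} (hℓ : 0 < ℓ) (hseg : ∀ p ∈ frontier Ω, ∃ e : Plane, ‖e‖ = 1 ∧
      ∀ s ∈ Icc 0 ℓ, p + s • e ∈ frontier Ω) {D : ℝ} (hD : h ≤ D) {w : H10 Ω} {φ : Plane → ℝ}
    (hφ : IsTestFunction Ω φ) (hval : H1.val (w : H1 Ω) =ᵐ[volume.restrict Ω] φ)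
    (hgrad : H1.grad (w : H1 Ω) =ᵐ[volume.restrict Ω] gradient φ) :
    ∃ m : Plane → ℝ,
      H10.l2Sq (w - 𝒯.fe hΩ m)
        ≤ 27 * (24 + 16 * D / ℓ) / σ ^ 2 * h ^ 2 * H10.gradSq w ∧
      H10.gradSq (𝒯.fe hΩ m) ≤ 81 * (24 + 16 * D / ℓ) / σ ^ 4 * H10.gradSq w := by
  have hh := hr.h_pos
  have hσ := hr.sigma_pos
  have hD0 : 0 < D := hh.trans_le hD
  obtain ⟨K, hK⟩ : ∃ K, 24 + 16 * D / ℓ = K := ⟨_, rfl⟩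
  rw [hK]
  have hK0 : 0 ≤ K := by rw [← hK]; positivity
  have hex : ∀ p : Plane, ∃ m : ℝ, p ∈ closure Ω → (p ∉ Ω → m = 0) ∧
      ∫ x in Metric.closedBall p h, (φ x - m) ^ 2
        ≤ K * h ^ 2 * ∫ x in Metric.closedBall p (2 * h), ‖gradient φ x‖ ^ 2 := by
    intro p
    by_cases hp : p ∈ closure Ω
    · obtain ⟨m, hm⟩ := hφ.exists_nodal_value hΩ.isOpen hℓ hseg hh hD hp
      rw [hK] at hm
      exact ⟨m, fun _ => hm⟩
    · exact ⟨0, fun h => absurd h hp⟩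
  choose m hm using hex
  have hpcl : ∀ t ∈ 𝒯.triangles, ∀ p ∈ t, p ∈ closure Ω :=
    fun t ht p hp => 𝒯.convexHull_subset ht (subset_convexHull ℝ _ hp)
  have hind : ∀ t ∈ 𝒯.triangles, ∀ p ∈ t, Ω.indicator m p = m p := by
    intro t ht p hp
    by_cases hpΩ : p ∈ Ω
    · rw [indicator_of_mem hpΩ]
    · rw [indicator_of_notMem hpΩ, (hm p (hpcl t ht p hp)).1 hpΩ]
  have hcφ : ∀ c : ℝ, Continuous fun x => (φ x - c) ^ 2 :=
    fun c => (hφ.smooth.continuous.sub continuous_const).pow 2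
  have hgc : Continuous (gradient φ) :=
    (LinearIsometryEquiv.continuous _).comp (hφ.smooth.continuous_fderiv (by simp))
  have hc2 : Continuous fun x => ‖gradient φ x‖ ^ 2 := hgc.norm.pow 2
  have hs2 : HasCompactSupport fun x => ‖gradient φ x‖ ^ 2 := by
    refine hφ.compact.mono' fun x hx => ?_
    by_contra hxs
    have h0 : fderiv ℝ φ x = 0 := image_eq_zero_of_notMem_tsupport
      fun hx' => hxs (tsupport_fderiv_subset ℝ hx')
    exact hx (by simp only [norm_gradient, h0, norm_zero, zero_pow two_ne_zero])
  have hgI : Integrable (fun x => ‖gradient φ x‖ ^ 2) := hc2.integrable_of_hasCompactSupport hs2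
  have hgΩ : ∫ x, ‖gradient φ x‖ ^ 2 = H10.gradSq w := by
    have h1 : ∫ x in Ω, ‖gradient φ x‖ ^ 2 = ∫ x, ‖gradient φ x‖ ^ 2 := by
      have h2 : ∀ x, x ∉ Ω → ‖gradient φ x‖ ^ 2 = 0 := by
        intro x hx
        have : fderiv ℝ φ x = 0 := image_eq_zero_of_notMem_tsupport
          (fun hx' => hx (hφ.supp (tsupport_fderiv_subset ℝ hx')))
        rw [norm_gradient, this]; simp
      exact setIntegral_eq_integral_of_forall_compl_eq_zero h2
    rw [← h1, H10.gradSq]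
    have h2 : ∀ᵐ x ∂(volume.restrict Ω), ‖gradient φ x‖ ^ 2 = ‖H1.grad (w : H1 Ω) x‖ ^ 2 := by
      filter_upwards [hgrad] with x hx
      rw [hx]
    exact integral_congr_ae h2
  set E : Finset Plane → ℝ := fun t =>
    ∑ p ∈ t, ∫ x in Metric.closedBall p (2 * h), ‖gradient φ x‖ ^ 2 with hE
  have hEsum : ∑ t ∈ 𝒯.triangles, E t ≤ 27 / σ ^ 2 * H10.gradSq w := by
    rw [← hgΩ]
    exact hr.sum_setIntegral_closedBall_le hgI fun x => sq_nonneg _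
  have hIT : ∀ t : Finset Plane, ∀ p ∈ t, IntegrableOn (fun x => (φ x - m p) ^ 2)
      (convexHull ℝ (t : Set Plane)) := fun t p _ => PlateFEM.integrableOn_triangle (hcφ _)
  have hET : ∀ t ∈ 𝒯.triangles,
      ∫ x in convexHull ℝ (t : Set Plane), ∑ p ∈ t, (φ x - m p) ^ 2 ≤ K * h ^ 2 * E t := by
    intro t ht
    rw [integral_finsetSum _ (hIT t), hE, Finset.mul_sum]
    refine Finset.sum_le_sum fun p hp => le_trans ?_ (hm p (hpcl t ht p hp)).2
    refine setIntegral_mono_set ((hcφ _).continuousOn.integrableOn_compact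
      (isCompact_closedBall _ _)) (Eventually.of_forall fun x => sq_nonneg _)
      (Eventually.of_forall (hr.subset_closedBall ht (subset_convexHull ℝ _ hp)))
  have haeint : ∀ t : Finset Plane, ∀ᵐ x ∂(volume.restrict (convexHull ℝ (t : Set Plane))),
      x ∈ interior (convexHull ℝ (t : Set Plane)) := by
    intro t
    rw [← Measure.restrict_congr_set (IsTriangle.interior_ae_eq t)]
    exact ae_restrict_mem isOpen_interior.measurableSet
  -- estimates on the triangles are added up
  have hadd : ∀ (f : Plane → ℝ) (a : ℝ), 0 ≤ a → IntegrableOn f Ω →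
      (∀ᵐ x ∂(volume.restrict Ω), ∀ t ∈ 𝒯.triangles,
        x ∈ interior (convexHull ℝ (t : Set Plane)) → f x ≤ a * ∑ p ∈ t, (φ x - m p) ^ 2) →
      ∫ x in Ω, f x
        ≤ a * (K * h ^ 2) * (27 / σ ^ 2 * H10.gradSq w) := by
    intro f a ha hf hfa
    rw [𝒯.setIntegral_eq_sum hΩ hf]
    calc _ ≤ ∑ t ∈ 𝒯.triangles, a * (K * h ^ 2) * E t := by
          refine Finset.sum_le_sum fun t ht => ?_
          calc _ ≤ ∫ x in convexHull ℝ (t : Set Plane), a * ∑ p ∈ t, (φ x - m p) ^ 2 := by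
                refine integral_mono_ae (𝒯.integrableOn_triangle hΩ ht hf)
                  ((integrable_finsetSum _ (hIT t)).const_mul a) ?_
                filter_upwards [haeint t, 𝒯.ae_triangle hΩ ht hfa] with x h1 h2
                exact h2 t ht h1
            _ ≤ a * (K * h ^ 2 * E t) := by
                rw [integral_const_mul]
                exact mul_le_mul_of_nonneg_left (hET t ht) ha
            _ = _ := by ring
      _ ≤ _ := by
          rw [← Finset.mul_sum]
          exact mul_le_mul_of_nonneg_left hEsum (by positivity)
  refine ⟨m, ?_, ?_⟩
  · have h0 := hadd (fun x => H1.val ((w - 𝒯.fe hΩ m : H10 Ω) : H1 Ω) x ^ 2) 1 zero_le_one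
      (H1.integrable_val_sq _) ?_
    · refine h0.trans (le_of_eq ?_)
      ring
    filter_upwards [hval, H1.val_sub (w : H1 Ω) (𝒯.fe hΩ m : H1 Ω), 𝒯.val_fe_triangle hΩ m]
      with x h1 h2 h3 t ht hxt
    have hxt' := _root_.interior_subset hxt
    have hT := 𝒯.isTriangle ht
    have h4 : H1.val ((w - 𝒯.fe hΩ m : H10 Ω) : H1 Ω) x
        = ∑ p ∈ t, bary t p x * (φ x - m p) := by
      rw [AddSubgroupClass.coe_sub, h2, Pi.sub_apply, h1, h3 t ht hxt']
      simp only [mul_sub, Finset.sum_sub_distrib, ← Finset.sum_mul]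
      rw [hT.sum_bary, one_mul]
      congr 1
      exact Finset.sum_congr rfl fun p hp => by rw [hind t ht p hp, mul_comm]
    have h0 := hT.mem_convexHull_iff.1 hxt'
    rw [h4, one_mul]
    -- the square is convex
    calc _ ≤ ∑ p ∈ t, bary t p x * (φ x - m p) ^ 2 := by
          have := (Even.convexOn_pow (𝕜 := ℝ) (n := 2) even_two).map_sum_le (t := t)
            (w := fun p => bary t p x) (p := fun p => φ x - m p) h0 (hT.sum_bary x)
            (fun _ _ => mem_univ _)
          simpa only [smul_eq_mul] using this
      _ ≤ _ := Finset.sum_le_sum fun p hp =>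
          mul_le_of_le_one_left (sq_nonneg _) (hT.bary_le_one hxt' hp)
  · have h0 := hadd (fun x => ‖H1.grad (𝒯.fe hΩ m : H1 Ω) x‖ ^ 2) (3 * (1 / (σ * h)) ^ 2)
      (by positivity) (H1.integrable_grad_sq _) ?_
    · refine h0.trans (le_of_eq ?_)
      field_simp
      ring
    filter_upwards [𝒯.grad_fe_triangle hΩ m] with x h3 t ht hxt
    have hT := 𝒯.isTriangle ht
    -- the gradients of the barycentric coordinates add up to zero
    have h4 : H1.grad (𝒯.fe hΩ m : H1 Ω) x = -∑ p ∈ t, (φ x - m p) • baryGrad t p := by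
      rw [h3 t ht hxt]
      simp only [sub_smul, Finset.sum_sub_distrib, ← Finset.smul_sum]
      rw [hT.sum_baryGrad, smul_zero, zero_sub, neg_neg]
      exact Finset.sum_congr rfl fun p hp => by rw [hind t ht p hp]
    rw [h4, norm_neg]
    exact norm_sum_smul_sq_le hT.card_eq _ fun p hp => hr.norm_baryGrad_le ht hp

lemma fe_congr (hΩ : IsPolygonalDomain Ω) {y z : Plane → ℝ}
    (hyz : ∀ p ∈ 𝒯.interiorVertices, y p = z p) : 𝒯.fe hΩ y = 𝒯.fe hΩ z := by
  rw [fe_apply, fe_apply]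
  exact Finset.sum_congr rfl fun p hp => by rw [hyz p hp]

set_option maxHeartbeats 1000000 in
/-- A projection onto `S_h` with nodal values that are stable in `L²` is stable in `H¹` and
approximates to first order. -/
lemma exists_projection (hΩ : IsPolygonalDomain Ω) {σ c : ℝ} (hσ : 0 < σ) (hc : 0 ≤ c) :
    ∃ C, 0 ≤ C ∧ ∀ {𝒯 : Triangulation Ω} {h : ℝ}, 𝒯.IsRegular σ h →
      h ≤ Metric.diam (closure Ω) → ∀ q : H10 Ω →ₗ[ℝ] (Plane → ℝ),
      (∀ y, ∀ p ∈ 𝒯.interiorVertices, q (𝒯.fe hΩ y) p = y p) →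
      (∀ w : H10 Ω, ∑ p ∈ 𝒯.interiorVertices, q w p ^ 2
        ≤ c / h ^ 2 * H10.l2Sq w) →
      ∃ Pr : H10 Ω →L[ℝ] H10 Ω, (∀ w, Pr w = 𝒯.fe hΩ (q w)) ∧ (∀ w, ‖Pr w‖ ^ 2 ≤ C * ‖w‖ ^ 2) ∧
        ∀ w, H10.l2Sq (w - Pr w) ≤ C * h ^ 2 * ‖w‖ ^ 2 := by
  obtain ⟨ℓ, hℓ, hseg⟩ := hΩ.exists_boundary_segment
  set D := Metric.diam (closure Ω) with hD
  have hpi := Real.pi_pos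
  have hD0 : 0 ≤ D := Metric.diam_nonneg
  obtain ⟨α, hα⟩ : ∃ r, r = 27 * (24 + 16 * D / ℓ) / σ ^ 2 := ⟨_, rfl⟩
  obtain ⟨β, hβ⟩ : ∃ r, r = 81 * (24 + 16 * D / ℓ) / σ ^ 4 := ⟨_, rfl⟩
  obtain ⟨κ₀, hκ₀⟩ : ∃ r, r = Real.pi * 3 / σ ^ 2 * c := ⟨_, rfl⟩
  obtain ⟨κ₁, hκ₁⟩ : ∃ r, r = Real.pi * 3 / σ ^ 4 * c := ⟨_, rfl⟩
  have hα0 : 0 ≤ α := by rw [hα]; positivity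
  have hβ0 : 0 ≤ β := by rw [hβ]; positivity
  have hκ₀0 : 0 ≤ κ₀ := by rw [hκ₀]; positivity
  have hκ₁0 : 0 ≤ κ₁ := by rw [hκ₁]; positivity
  refine ⟨κ₀ + 2 * β + 2 * κ₁ * α + 2 * (1 + κ₀) * α, by positivity, ?_⟩
  obtain ⟨C, hC⟩ : ∃ C, C = κ₀ + 2 * β + 2 * κ₁ * α + 2 * (1 + κ₀) * α := ⟨_, rfl⟩
  rw [← hC]
  intro 𝒯 h hr hhD q hq hqc
  have hh := hr.h_pos
  set L : H10 Ω →ₗ[ℝ] H10 Ω := 𝒯.fe hΩ ∘ₗ q with hL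
  have hLw : ∀ w, L w = 𝒯.fe hΩ (q w) := fun w => rfl
  have h0 : ∀ w, H10.l2Sq (L w) ≤ κ₀ * H10.l2Sq w := fun w =>
    calc _ ≤ Real.pi * h ^ 2 * 3 / σ ^ 2 * ∑ p ∈ 𝒯.interiorVertices, q w p ^ 2 :=
          hr.setIntegral_val_fe_sq_le hΩ (q w)
      _ ≤ Real.pi * h ^ 2 * 3 / σ ^ 2 * (c / h ^ 2 * H10.l2Sq w) :=
          mul_le_mul_of_nonneg_left (hqc w) (by positivity)
      _ = _ := by rw [hκ₀]; field_simp
  have h1 : ∀ w, H10.gradSq (L w) ≤ κ₁ / h ^ 2 * H10.l2Sq w := fun w =>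
    calc _ ≤ Real.pi * 3 / σ ^ 4 * ∑ p ∈ 𝒯.interiorVertices, q w p ^ 2 :=
          hr.setIntegral_grad_fe_sq_le hΩ (q w)
      _ ≤ Real.pi * 3 / σ ^ 4 * (c / h ^ 2 * H10.l2Sq w) :=
          mul_le_mul_of_nonneg_left (hqc w) (by positivity)
      _ = _ := by rw [hκ₁]; field_simp
  have hnorm : ∀ w : H10 Ω, ‖w‖ ^ 2 = H10.l2Sq w + H10.gradSq w := H10.norm_sq
  -- a bound that depends on `h` gives continuity
  have hcont : ∀ w, ‖L w‖ ≤ Real.sqrt (κ₀ + κ₁ / h ^ 2) * ‖w‖ := by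
    intro w
    refine abs_le_of_sq_le_sq' ?_ (by positivity) |>.2
    rw [mul_pow, Real.sq_sqrt (by positivity), hnorm (L w)]
    have := H10.l2Sq_le w
    have h2 : (κ₀ + κ₁ / h ^ 2) * H10.l2Sq w ≤ (κ₀ + κ₁ / h ^ 2) * ‖w‖ ^ 2 :=
      mul_le_mul_of_nonneg_left this (by positivity)
    linarith [h0 w, h1 w]
  set Pr : H10 Ω →L[ℝ] H10 Ω := L.mkContinuous _ hcont with hPr
  have hPrw : ∀ w, Pr w = L w := fun w => rfl
  -- `L` reproduces the quasi-interpolant of `φ`, so that `w - L w` is the error of the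
  -- quasi-interpolant minus its image under `L`
  have hkey : ∀ (w : H10 Ω) (φ : Plane → ℝ), IsTestFunction Ω φ →
      H1.val (w : H1 Ω) =ᵐ[volume.restrict Ω] φ →
      H1.grad (w : H1 Ω) =ᵐ[volume.restrict Ω] gradient φ →
      H10.gradSq (L w) ≤ (2 * β + 2 * κ₁ * α) * H10.gradSq w ∧
        H10.l2Sq (w - L w) ≤ 2 * (1 + κ₀) * α * h ^ 2 * H10.gradSq w := by
    intro w φ hφ hval hgrad
    obtain ⟨m, hm0, hm1⟩ := hr.exists_quasi_interpolant hΩ hℓ hseg hhD hφ hval hgrad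
    set e := w - 𝒯.fe hΩ m with he
    rw [← hα] at hm0
    rw [← hβ] at hm1
    have hfix : L (𝒯.fe hΩ m) = 𝒯.fe hΩ m := fe_congr hΩ (hq m)
    have hLe : L w = 𝒯.fe hΩ m + L e := by rw [he, map_sub, hfix]; abel
    constructor
    · rw [hLe]
      refine (H10.gradSq_add_le _ _).trans ?_
      have h2 := h1 e
      have h3 : κ₁ / h ^ 2 * H10.l2Sq e ≤ κ₁ / h ^ 2 * (α * h ^ 2 * H10.gradSq w) :=
        mul_le_mul_of_nonneg_left hm0 (by positivity)
      have h4 : κ₁ / h ^ 2 * (α * h ^ 2 * H10.gradSq w) = κ₁ * α * H10.gradSq w := by field_simp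
      linarith
    · have h2 : w - L w = e + -L e := by rw [hLe, he]; abel
      rw [h2]
      refine (H10.l2Sq_add_le _ _).trans ?_
      rw [H10.l2Sq_neg]
      have h3 := h0 e
      have h4 : (1 + κ₀) * H10.l2Sq e ≤ (1 + κ₀) * (α * h ^ 2 * H10.gradSq w) :=
        mul_le_mul_of_nonneg_left hm0 (by positivity)
      linarith
  refine ⟨Pr, hLw, fun w => ?_, fun w => ?_⟩
  · refine H10.induction hΩ.isOpen (p := fun w => ‖Pr w‖ ^ 2 ≤ C * ‖w‖ ^ 2) ?_ ?_ w
    · exact isClosed_le (Pr.continuous.norm.pow 2) (continuous_const.mul (continuous_norm.pow 2))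
    · intro w φ hφ hval hgrad
      obtain ⟨hk, -⟩ := hkey w φ hφ hval hgrad
      rw [hPrw, hnorm, hnorm w]
      have h2 := h0 w
      have h3 : κ₀ * H10.l2Sq w ≤ C * H10.l2Sq w := by
        refine mul_le_mul_of_nonneg_right ?_ (H10.l2Sq_nonneg w)
        rw [hC]
        have := mul_nonneg hκ₁0 hα0
        have : 0 ≤ 2 * (1 + κ₀) * α := by positivity
        linarith
      have h4 : (2 * β + 2 * κ₁ * α) * H10.gradSq w ≤ C * H10.gradSq w := by
        refine mul_le_mul_of_nonneg_right ?_ (H10.gradSq_nonneg w)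
        rw [hC]
        have : 0 ≤ 2 * (1 + κ₀) * α := by positivity
        linarith
      linarith
  · refine H10.induction hΩ.isOpen
      (p := fun w => H10.l2Sq (w - Pr w) ≤ C * h ^ 2 * ‖w‖ ^ 2) ?_ ?_ w
    · exact isClosed_le (H10.continuous_l2Sq.comp (continuous_id.sub Pr.continuous))
        (continuous_const.mul (continuous_norm.pow 2))
    · intro w φ hφ hval hgrad
      obtain ⟨-, hk⟩ := hkey w φ hφ hval hgrad
      rw [hPrw]
      refine hk.trans ?_
      have h2 := H10.gradSq_le w
      have h3 : 2 * (1 + κ₀) * α ≤ C := by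
        rw [hC]
        have : 0 ≤ 2 * κ₁ * α := by positivity
        linarith
      have h4 : 0 ≤ C := by rw [hC]; positivity
      have h5 := H10.gradSq_nonneg w
      gcongr

end Triangulation

end PlateFEM

namespace PlateFEM

/-! ### The projections onto `S_h` -/

lemma H10.setIntegral_sub_mul {Ω : Set Plane} {g : Plane → ℝ}
    (hg : MemLp g 2 (volume.restrict Ω)) (u v : H10 Ω) :
    ∫ x in Ω, (H1.val (u : H1 Ω) x - H1.val (v : H1 Ω) x) * g x
      = (∫ x in Ω, H1.val (u : H1 Ω) x * g x) - ∫ x in Ω, H1.val (v : H1 Ω) x * g x := by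
  have h : ∀ w : H10 Ω, Integrable (fun x => H1.val (w : H1 Ω) x * g x) (volume.restrict Ω) :=
    fun w => (H1.memLp_val (w : H1 Ω)).integrable_mul hg
  rw [← integral_sub (h u) (h v)]
  simp only [sub_mul]

namespace Triangulation

variable {Ω : Set Plane}

set_option maxHeartbeats 1000000 in
/-- The projection onto `S_h` orthogonal to the multiplier space is bounded in `H¹` and
approximates to first order. -/
lemma exists_oblique_projection (hΩ : IsPolygonalDomain Ω) {σ : ℝ} (hσ : 0 < σ) :
    ∃ C, 0 ≤ C ∧ ∀ {𝒯 : Triangulation Ω} {h : ℝ}, 𝒯.IsRegular σ h →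
      h ≤ Metric.diam (closure Ω) → ∀ {A : Plane → Plane → ℝ}, 𝒯.IsSubstochastic A →
      ∃ P : H10 Ω →L[ℝ] H10 Ω, (∀ w, P w ∈ 𝒯.S) ∧ (∀ w ∈ 𝒯.S, P w = w) ∧
        (∀ w : H10 Ω, ∀ i ∈ 𝒯.interiorVertices, ∫ x in Ω, (H1.val (w : H1 Ω) x
          - H1.val (P w : H1 Ω) x) * 𝒯.multiplierBasis A i x = 0) ∧
        (∀ w, ‖P w‖ ^ 2 ≤ C * ‖w‖ ^ 2) ∧ ∀ w, H10.l2Sq (w - P w) ≤ C * h ^ 2 * ‖w‖ ^ 2 := by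
  by_cases hσ1 : σ ≤ 1
  swap
  · exact ⟨0, le_rfl, fun hr => absurd (hr.sigma_le_one hΩ) hσ1⟩
  obtain ⟨C₀, hC₀, hstab⟩ := exists_sum_sq_le_massSum hσ hσ1
  obtain ⟨C, hC, hproj⟩ := exists_projection hΩ (c := 576 * Real.pi * C₀) hσ
    (by have := Real.pi_pos; positivity)
  refine ⟨C, hC, ?_⟩
  intro 𝒯 h hr hhD A hA
  obtain ⟨q, hq, huniq, hqb⟩ := hr.exists_coefficients hΩ hA hC₀ fun v => hstab hΩ.isOpen hr hA v
  have hfe : ∀ (y : Plane → ℝ), ∀ i ∈ 𝒯.interiorVertices,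
      ∫ x in Ω, H1.val (𝒯.fe hΩ y : H1 Ω) x * 𝒯.multiplierBasis A i x
        = ∑ k ∈ 𝒯.interiorVertices,
          y k * ∫ x in Ω, 𝒯.hat k x * 𝒯.multiplierBasis A i x := by
    intro y i hi
    have hb := memLp_multiplierBasis hΩ A hi
    rw [← H10.pairing_apply hb, fe_apply, map_sum]
    refine Finset.sum_congr rfl fun k hk => ?_
    rw [map_smul, smul_eq_mul, H10.pairing_apply hb]
    congr 1
    refine integral_congr_ae ?_
    filter_upwards [𝒯.val_hatElt hΩ (𝒯.mem_interiorVertices.1 hk).2] with x hx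
    rw [hx]
  have hqfe : ∀ y, ∀ p ∈ 𝒯.interiorVertices, q (𝒯.fe hΩ y) p = y p := by
    intro y p hp
    refine sub_eq_zero.1 (huniq (q (𝒯.fe hΩ y) - y) (fun i hi => ?_) p hp)
    simp only [Pi.sub_apply, sub_mul, Finset.sum_sub_distrib]
    rw [hq _ i hi, hfe y i hi, sub_self]
  obtain ⟨P, hP, hPn, hPa⟩ := hproj hr hhD q hqfe hqb
  refine ⟨P, fun w => ?_, fun w hw => ?_, fun w i hi => ?_, hPn, hPa⟩
  · rw [hP]
    exact 𝒯.fe_mem_S hΩ _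
  · obtain ⟨y, rfl⟩ := 𝒯.exists_fe_eq hΩ hw
    rw [hP]
    exact fe_congr hΩ (hqfe y)
  · have hb := memLp_multiplierBasis hΩ A hi
    rw [H10.setIntegral_sub_mul hb, hP, hfe _ i hi, hq w i hi, sub_self]

variable {𝒯 : Triangulation Ω}

lemma isSubstochastic_zero : 𝒯.IsSubstochastic 0 :=
  ⟨fun _ _ _ _ _ => le_rfl, fun _ _ => by simp⟩

lemma IsAdmissible.isSubstochastic {A : Plane → Plane → ℝ} (hA : 𝒯.IsAdmissible A) :
    𝒯.IsSubstochastic A := ⟨hA.nonneg, fun j hj => (hA.sum_eq_one j hj).le⟩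

lemma multiplierBasis_zero (i : Plane) : 𝒯.multiplierBasis 0 i = 𝒯.hat i := by
  ext x
  simp [multiplierBasis]

/-- Orthogonality to the nodal basis is orthogonality to `S_h`. -/
lemma setIntegral_mul_eq_zero_of_mem_S (hΩ : IsPolygonalDomain Ω) {u : H10 Ω}
    (hu : ∀ i ∈ 𝒯.interiorVertices, ∫ x in Ω, H1.val (u : H1 Ω) x * 𝒯.hat i x = 0) {s : H10 Ω}
    (hs : s ∈ 𝒯.S) : ∫ x in Ω, H1.val (u : H1 Ω) x * H1.val (s : H1 Ω) x = 0 := by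
  obtain ⟨y, rfl⟩ := 𝒯.exists_fe_eq hΩ hs
  have hm := H1.memLp_val (u : H1 Ω)
  have h1 : ∫ x in Ω, H1.val (u : H1 Ω) x * H1.val (𝒯.fe hΩ y : H1 Ω) x
      = H10.pairing hm (𝒯.fe hΩ y) := by
    rw [H10.pairing_apply]
    simp only [mul_comm]
  rw [h1, fe_apply, map_sum]
  refine Finset.sum_eq_zero fun k hk => ?_
  rw [map_smul, smul_eq_mul, H10.pairing_apply, ← mul_zero (y k), ← hu k hk]
  congr 1
  refine integral_congr_ae ?_
  filter_upwards [𝒯.val_hatElt hΩ (𝒯.mem_interiorVertices.1 hk).2] with x hx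
  rw [hx, mul_comm]

/-- Functionals given by integration over a triangle against a continuous function. -/
lemma memLp_indicator_triangle (hΩ : IsPolygonalDomain Ω) (t : Finset Plane) {f : Plane → ℝ}
    (hf : Continuous f) :
    MemLp ((convexHull ℝ (t : Set Plane)).indicator f) 2 (volume.restrict Ω) :=
  (memLp_of_continuous hΩ.isOpen hΩ.isBounded hf).indicator
    (IsTriangle.isCompact_convexHull t).measurableSet

lemma pairing_indicator (hΩ : IsPolygonalDomain Ω) {t : Finset Plane} (ht : t ∈ 𝒯.triangles)
    {f : Plane → ℝ} (hf : Continuous f) (w : H10 Ω) :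
    H10.pairing (memLp_indicator_triangle hΩ t hf) w
      = ∫ x in convexHull ℝ (t : Set Plane), H1.val (w : H1 Ω) x * f x := by
  rw [H10.pairing_apply, ← 𝒯.setIntegral_inter hΩ ht]
  have h : (fun x => H1.val (w : H1 Ω) x * (convexHull ℝ (t : Set Plane)).indicator f x)
      = (convexHull ℝ (t : Set Plane)).indicator fun x => H1.val (w : H1 Ω) x * f x := by
    ext x
    rw [indicator_mul_right]
  rw [h, setIntegral_indicator (IsTriangle.isCompact_convexHull t).measurableSet]

lemma integrableOn_val_sq (hΩ : IsPolygonalDomain Ω) {t : Finset Plane} (ht : t ∈ 𝒯.triangles)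
    (w : H10 Ω) :
    IntegrableOn (fun x => H1.val (w : H1 Ω) x ^ 2) (convexHull ℝ (t : Set Plane)) :=
  𝒯.integrableOn_triangle hΩ ht (H1.integrable_val_sq (w : H1 Ω))

lemma l2Sq_eq_sum (hΩ : IsPolygonalDomain Ω) (w : H10 Ω) : H10.l2Sq w
    = ∑ t ∈ 𝒯.triangles, ∫ x in convexHull ℝ (t : Set Plane), H1.val (w : H1 Ω) x ^ 2 :=
  𝒯.setIntegral_eq_sum hΩ (H1.integrable_val_sq (w : H1 Ω))

lemma sq_setIntegral_val_mul_le (hΩ : IsPolygonalDomain Ω) {t : Finset Plane}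
    (ht : t ∈ 𝒯.triangles) {f : Plane → ℝ} (hf : Continuous f) {a : ℝ}
    (hfa : ∀ x ∈ convexHull ℝ (t : Set Plane), |f x| ≤ a) (w : H10 Ω) :
    (∫ x in convexHull ℝ (t : Set Plane), H1.val (w : H1 Ω) x * f x) ^ 2
      ≤ volume.real (convexHull ℝ (t : Set Plane)) * a ^ 2
        * ∫ x in convexHull ℝ (t : Set Plane), H1.val (w : H1 Ω) x ^ 2 := by
  have hm := IsTriangle.isCompact_convexHull t
  have hf2 : IntegrableOn (fun x => f x ^ 2) (convexHull ℝ (t : Set Plane)) :=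
    PlateFEM.integrableOn_triangle (hf.pow 2)
  have hvf : IntegrableOn (fun x => H1.val (w : H1 Ω) x * f x) (convexHull ℝ (t : Set Plane)) :=
    𝒯.integrableOn_triangle hΩ ht ((H1.memLp_val (w : H1 Ω)).integrable_mul
      (memLp_of_continuous hΩ.isOpen hΩ.isBounded hf))
  have h1 := sq_integral_mul_le (integrableOn_val_sq hΩ ht w) hf2 hvf
  have h2 : ∫ x in convexHull ℝ (t : Set Plane), f x ^ 2
      ≤ volume.real (convexHull ℝ (t : Set Plane)) * a ^ 2 := by
    rw [← smul_eq_mul, ← setIntegral_const]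
    refine setIntegral_mono_on hf2 (integrableOn_const hm.measure_lt_top.ne) hm.measurableSet
      fun x hx => ?_
    rw [← sq_abs]
    exact pow_le_pow_left₀ (abs_nonneg _) (hfa x hx) 2
  rw [mul_comm (volume.real _ * a ^ 2)]
  exact h1.trans (mul_le_mul_of_nonneg_left h2 (integral_nonneg fun x => sq_nonneg _))

set_option maxHeartbeats 1000000 in
/-- There is a projection onto `S_h` that annihilates the bubble functions, is bounded in `H¹` and
approximates to first order: its nodal values are moments against functions dual to the barycentric
coordinates and orthogonal to the bubble function. -/
lemma exists_projection_bubble (hΩ : IsPolygonalDomain Ω) {σ : ℝ} (hσ : 0 < σ) :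
    ∃ C, 0 ≤ C ∧ ∀ {𝒯 : Triangulation Ω} {h : ℝ}, 𝒯.IsRegular σ h →
      h ≤ Metric.diam (closure Ω) →
      ∃ P : H10 Ω →L[ℝ] H10 Ω, (∀ w, P w ∈ 𝒯.S) ∧ (∀ w ∈ 𝒯.S, P w = w) ∧ (∀ w ∈ 𝒯.B, P w = 0) ∧
        (∀ w, ‖P w‖ ^ 2 ≤ C * ‖w‖ ^ 2) ∧ ∀ w, H10.l2Sq (w - P w) ≤ C * h ^ 2 * ‖w‖ ^ 2 := by
  classical
  have hpi := Real.pi_pos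
  obtain ⟨C, hC, hproj⟩ := exists_projection hΩ (c := 3 * 160 ^ 2 / (Real.pi * σ ^ 2)) hσ
    (by positivity)
  refine ⟨C, hC, ?_⟩
  intro 𝒯 h hr hhD
  have hh := hr.h_pos
  have hex : ∀ p : Plane, ∃ t : Finset Plane, p ∈ 𝒯.vertices → t ∈ 𝒯.triangles ∧ p ∈ t := by
    intro p
    by_cases hp : p ∈ 𝒯.vertices
    · obtain ⟨t, ht⟩ := 𝒯.mem_vertices.1 hp
      exact ⟨t, fun _ => ht⟩
    · exact ⟨∅, fun h => absurd h hp⟩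
  choose T hT using hex
  have hTi : ∀ p ∈ 𝒯.interiorVertices, T p ∈ 𝒯.triangles ∧ p ∈ T p :=
    fun p hp => hT p (𝒯.mem_interiorVertices.1 hp).1
  set q : H10 Ω →ₗ[ℝ] (Plane → ℝ) := LinearMap.pi fun p : Plane =>
    (H10.pairing (memLp_indicator_triangle hΩ (T p) (continuous_dualFun (T p) p))).toLinearMap
    with hq
  have hqp : ∀ w, ∀ p ∈ 𝒯.interiorVertices, q w p
      = ∫ x in convexHull ℝ (T p : Set Plane), H1.val (w : H1 Ω) x * dualFun (T p) p x :=
    fun w p hp => pairing_indicator hΩ (hTi p hp).1 (continuous_dualFun (T p) p) w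
  have hqfe : ∀ y, ∀ p ∈ 𝒯.interiorVertices, q (𝒯.fe hΩ y) p = y p := by
    intro y p hp
    obtain ⟨ht, hpt⟩ := hTi p hp
    have hI : ∀ r ∈ T p, IntegrableOn (fun x => Ω.indicator y r
        * (bary (T p) r x * dualFun (T p) p x)) (convexHull ℝ (T p : Set Plane)) := fun r _ =>
      PlateFEM.integrableOn_triangle
        (continuous_const.mul ((continuous_bary _ r).mul (continuous_dualFun _ p)))
    have h1 : ∫ x in convexHull ℝ (T p : Set Plane),
        H1.val (𝒯.fe hΩ y : H1 Ω) x * dualFun (T p) p x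
        = ∫ x in convexHull ℝ (T p : Set Plane), ∑ r ∈ T p, Ω.indicator y r
          * (bary (T p) r x * dualFun (T p) p x) := by
      refine integral_congr_ae ?_
      filter_upwards [𝒯.ae_triangle hΩ ht (𝒯.val_fe_triangle hΩ y),
        ae_restrict_mem (IsTriangle.isCompact_convexHull (T p)).measurableSet] with x hx hxt
      rw [hx _ ht hxt, Finset.sum_mul]
      exact Finset.sum_congr rfl fun r _ => by ring
    rw [hqp _ p hp, h1, integral_finsetSum _ hI, Finset.sum_eq_single p]
    · rw [integral_const_mul, (𝒯.isTriangle ht).setIntegral_bary_mul_dualFun hpt hpt, if_pos rfl,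
        mul_one, indicator_of_mem (𝒯.mem_interiorVertices.1 hp).2]
    · intro r hr hrp
      rw [integral_const_mul, (𝒯.isTriangle ht).setIntegral_bary_mul_dualFun hpt hr, if_neg hrp,
        mul_zero]
    · exact fun h => absurd hpt h
  have hqb : ∀ w : H10 Ω, ∑ p ∈ 𝒯.interiorVertices, q w p ^ 2
      ≤ 3 * 160 ^ 2 / (Real.pi * σ ^ 2) / h ^ 2 * H10.l2Sq w := by
    intro w
    set I : Finset Plane → ℝ :=
      fun t => ∫ x in convexHull ℝ (t : Set Plane), H1.val (w : H1 Ω) x ^ 2 with hI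
    have hI0 : ∀ t, 0 ≤ I t := fun t => integral_nonneg fun x => sq_nonneg _
    have h1 : ∀ p ∈ 𝒯.interiorVertices,
        q w p ^ 2 ≤ 160 ^ 2 / (Real.pi * σ ^ 2 * h ^ 2) * I (T p) := by
      intro p hp
      obtain ⟨ht, hpt⟩ := hTi p hp
      have hv := hr.volume_ge ht
      have hv0 : 0 < Real.pi * σ ^ 2 * h ^ 2 := by positivity
      rw [hqp w p hp]
      refine (sq_setIntegral_val_mul_le hΩ ht (continuous_dualFun _ p)
        (fun x hx => (𝒯.isTriangle ht).abs_dualFun_le hpt hx) w).trans ?_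
      refine mul_le_mul_of_nonneg_right ?_ (hI0 _)
      have hv1 := hv0.trans_le hv
      calc _ = 160 ^ 2 / volume.real (convexHull ℝ (T p : Set Plane)) := by field_simp
        _ ≤ _ := by gcongr
    calc _ ≤ ∑ p ∈ 𝒯.interiorVertices, 160 ^ 2 / (Real.pi * σ ^ 2 * h ^ 2) * I (T p) :=
          Finset.sum_le_sum h1
      _ ≤ ∑ p ∈ 𝒯.interiorVertices, 160 ^ 2 / (Real.pi * σ ^ 2 * h ^ 2) *
          ∑ t ∈ 𝒯.triangles, if p ∈ t then I t else 0 := by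
        gcongr with p hp
        obtain ⟨ht, hpt⟩ := hTi p hp
        have := Finset.single_le_sum (f := fun t => if p ∈ t then I t else 0)
          (fun t _ => by split_ifs; exacts [hI0 t, le_rfl]) ht
        simpa [hpt] using this
      _ = 160 ^ 2 / (Real.pi * σ ^ 2 * h ^ 2) *
          ∑ t ∈ 𝒯.triangles, ∑ p ∈ 𝒯.interiorVertices, if p ∈ t then I t else 0 := by
        rw [← Finset.mul_sum, Finset.sum_comm]
      _ ≤ 160 ^ 2 / (Real.pi * σ ^ 2 * h ^ 2) * ∑ t ∈ 𝒯.triangles, 3 * I t := by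
        gcongr with t ht
        rw [← Finset.sum_filter, Finset.sum_const, nsmul_eq_mul]
        refine mul_le_mul_of_nonneg_right ?_ (hI0 t)
        have : (𝒯.interiorVertices.filter (· ∈ t)).card ≤ t.card :=
          Finset.card_le_card fun p hp => (Finset.mem_filter.1 hp).2
        rw [(𝒯.isTriangle ht).card_eq] at this
        exact_mod_cast this
      _ = _ := by
        rw [← Finset.mul_sum, 𝒯.l2Sq_eq_sum hΩ w, hI]
        field_simp
  obtain ⟨P, hP, hPn, hPa⟩ := hproj hr hhD q hqfe hqb
  refine ⟨P, fun w => ?_, fun w hw => ?_, fun w hw => ?_, hPn, hPa⟩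
  · rw [hP]
    exact 𝒯.fe_mem_S hΩ _
  · obtain ⟨y, rfl⟩ := 𝒯.exists_fe_eq hΩ hw
    rw [hP]
    exact fe_congr hΩ (hqfe y)
  · have h0 : ∀ p ∈ 𝒯.interiorVertices, q w p = (0 : Plane → ℝ) p := by
      intro p hp
      obtain ⟨ht, hpt⟩ := hTi p hp
      obtain ⟨c, hc⟩ := hw _ ht
      have h1 : ∫ x in convexHull ℝ (T p : Set Plane), H1.val (w : H1 Ω) x * dualFun (T p) p x
          = ∫ x in convexHull ℝ (T p : Set Plane), c * (bubble (T p) x * dualFun (T p) p x) := by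
        refine integral_congr_ae ?_
        filter_upwards [𝒯.ae_triangle hΩ ht hc,
          ae_restrict_mem (IsTriangle.isCompact_convexHull (T p)).measurableSet] with x hx hxt
        rw [hx hxt, mul_assoc]
        rfl
      rw [hqp w p hp, h1, integral_const_mul,
        (𝒯.isTriangle ht).setIntegral_bubble_mul_dualFun hpt, mul_zero, Pi.zero_apply]
    rw [hP, fe_congr hΩ h0, map_zero]

end Triangulation

end PlateFEM

namespace PlateFEM

/-! ### The bubble map -/

namespace Triangulation

variable {Ω : Set Plane} {𝒯 : Triangulation Ω} {σ h : ℝ}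

/-- The coefficient of the bubble function of `t` that has the same integral over the triangle
as `w`; the bubble function itself has the integral `|T| / 60`. -/
noncomputable def bubbleCoeff (t : Finset Plane) (w : H10 Ω) : ℝ :=
  60 / volume.real (convexHull ℝ (t : Set Plane))
    * ∫ x in convexHull ℝ (t : Set Plane), H1.val (w : H1 Ω) x

/-- The map onto `B_h` that preserves the integral over each triangle. -/
noncomputable def bubbleMap (𝒯 : Triangulation Ω) (hΩ : IsPolygonalDomain Ω) :
    H10 Ω →L[ℝ] H10 Ω :=
  ∑ t ∈ 𝒯.triangles, (60 / volume.real (convexHull ℝ (t : Set Plane))) •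
    (H10.pairing (memLp_indicator_triangle hΩ t (f := fun _ => 1) continuous_const)).smulRight
      (𝒯.bubbleElt hΩ t)

lemma bubbleMap_apply (hΩ : IsPolygonalDomain Ω) (w : H10 Ω) :
    𝒯.bubbleMap hΩ w = ∑ t ∈ 𝒯.triangles, bubbleCoeff t w • 𝒯.bubbleElt hΩ t := by
  rw [bubbleMap, sum_apply]
  refine Finset.sum_congr rfl fun t ht => ?_
  have h1 := pairing_indicator (𝒯 := 𝒯) hΩ ht (f := fun _ => 1) continuous_const w
  simp only [mul_one] at h1
  rw [smul_apply, ContinuousLinearMap.smulRight_apply, h1, smul_smul,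
    bubbleCoeff]

lemma val_bubbleMap (hΩ : IsPolygonalDomain Ω) (w : H10 Ω) :
    ∀ᵐ x ∂(volume.restrict Ω), ∀ t ∈ 𝒯.triangles, x ∈ interior (convexHull ℝ (t : Set Plane)) →
      H1.val (𝒯.bubbleMap hΩ w : H1 Ω) x = bubbleCoeff t w * bubble t x := by
  have h1 : ∀ᵐ x ∂(volume.restrict Ω), ∀ t ∈ 𝒯.triangles, H1.val (𝒯.bubbleElt hΩ t : H1 Ω) x
      = (convexHull ℝ (t : Set Plane)).indicator (bubble t) x :=
    (ae_ball_iff 𝒯.triangles.countable_toSet).2 fun t ht => 𝒯.val_bubbleElt hΩ ht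
  have h2 : ((𝒯.bubbleMap hΩ w : H10 Ω) : H1 Ω)
      = ∑ t ∈ 𝒯.triangles, bubbleCoeff t w • (𝒯.bubbleElt hΩ t : H1 Ω) := by
    rw [bubbleMap_apply, AddSubmonoidClass.coe_finsetSum]
    rfl
  rw [h2]
  filter_upwards [h1, H1.val_sum 𝒯.triangles (fun t => bubbleCoeff t w)
    fun t => (𝒯.bubbleElt hΩ t : H1 Ω)] with x hx hs t ht hxt
  rw [hs, Finset.sum_eq_single t]
  · rw [hx t ht, indicator_of_mem (_root_.interior_subset hxt)]
  · intro s hs hst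
    have := (𝒯.indicator_bubble_eventuallyEq ht hs hxt).eq_of_nhds
    rw [if_neg hst.symm] at this
    rw [hx s hs, this, Pi.zero_apply, mul_zero]
  · exact fun h => absurd ht h

lemma grad_bubbleMap (hr : 𝒯.IsRegular σ h) (hΩ : IsPolygonalDomain Ω) (w : H10 Ω) :
    ∀ᵐ x ∂(volume.restrict Ω), ∀ t ∈ 𝒯.triangles, x ∈ interior (convexHull ℝ (t : Set Plane)) →
      ‖H1.grad (𝒯.bubbleMap hΩ w : H1 Ω) x‖ ≤ |bubbleCoeff t w| * (3 / (σ * h)) := by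
  have h1 : ∀ᵐ x ∂(volume.restrict Ω), ∀ t ∈ 𝒯.triangles, H1.grad (𝒯.bubbleElt hΩ t : H1 Ω) x
      = gradient ((convexHull ℝ (t : Set Plane)).indicator (bubble t)) x :=
    (ae_ball_iff 𝒯.triangles.countable_toSet).2 fun t ht => 𝒯.grad_bubbleElt hΩ ht
  have h2 : ((𝒯.bubbleMap hΩ w : H10 Ω) : H1 Ω)
      = ∑ t ∈ 𝒯.triangles, bubbleCoeff t w • (𝒯.bubbleElt hΩ t : H1 Ω) := by
    rw [bubbleMap_apply, AddSubmonoidClass.coe_finsetSum]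
    rfl
  have hK0 : 0 ≤ 1 / (σ * h) := by
    have := hr.sigma_pos
    have := hr.h_pos
    positivity
  rw [h2]
  filter_upwards [h1, H1.grad_sum 𝒯.triangles (fun t => bubbleCoeff t w)
    fun t => (𝒯.bubbleElt hΩ t : H1 Ω)] with x hx hs t ht hxt
  rw [hs, Finset.sum_eq_single t]
  · rw [hx t ht, norm_smul, Real.norm_eq_abs]
    have h3 := norm_gradient_le (𝒯.lipschitzWith_bubble ht (K := ⟨1 / (σ * h), hK0⟩)
      fun p hp => hr.norm_baryGrad_le ht hp) x
    refine mul_le_mul_of_nonneg_left (h3.trans_eq ?_) (abs_nonneg _)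
    change 3 * (1 / (σ * h)) = 3 / (σ * h)
    ring
  · intro s hs hst
    have h3 := 𝒯.indicator_bubble_eventuallyEq ht hs hxt
    rw [if_neg hst.symm] at h3
    rw [hx s hs, gradient, h3.fderiv_eq]
    simp
  · exact fun h => absurd ht h

/-- The bubble map takes values in `B_h`. -/
lemma bubbleMap_mem_B (hΩ : IsPolygonalDomain Ω) (w : H10 Ω) : 𝒯.bubbleMap hΩ w ∈ 𝒯.B := by
  intro t ht
  refine ⟨bubbleCoeff t w, ?_⟩
  have hfr : ∀ᵐ x ∂(volume.restrict Ω), x ∈ convexHull ℝ (t : Set Plane) →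
      x ∈ interior (convexHull ℝ (t : Set Plane)) :=
    ae_restrict_of_ae ((IsTriangle.interior_ae_eq t).mono fun x hx => hx.mpr)
  filter_upwards [𝒯.val_bubbleMap hΩ w, hfr] with x hx hi hxt
  exact hx t ht (hi hxt)

lemma ae_val_bubbleMap (hΩ : IsPolygonalDomain Ω) (w : H10 Ω) {t : Finset Plane}
    (ht : t ∈ 𝒯.triangles) : ∀ᵐ x ∂(volume.restrict (convexHull ℝ (t : Set Plane))),
      H1.val (𝒯.bubbleMap hΩ w : H1 Ω) x = bubbleCoeff t w * bubble t x := by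
  rw [← Measure.restrict_congr_set (IsTriangle.interior_ae_eq t)]
  have h := 𝒯.ae_triangle hΩ ht (𝒯.val_bubbleMap hΩ w)
  rw [← Measure.restrict_congr_set (IsTriangle.interior_ae_eq t)] at h
  filter_upwards [h, ae_restrict_mem isOpen_interior.measurableSet] with x hx hxt
  exact hx t ht hxt

lemma setIntegral_bubbleMap (hΩ : IsPolygonalDomain Ω) (w : H10 Ω) {t : Finset Plane}
    (ht : t ∈ 𝒯.triangles) :
    ∫ x in convexHull ℝ (t : Set Plane), H1.val (𝒯.bubbleMap hΩ w : H1 Ω) x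
      = ∫ x in convexHull ℝ (t : Set Plane), H1.val (w : H1 Ω) x := by
  have hv := (𝒯.isTriangle ht).measureReal_pos
  rw [integral_congr_ae (𝒯.ae_val_bubbleMap hΩ w ht), integral_const_mul,
    (𝒯.isTriangle ht).setIntegral_bubble, bubbleCoeff]
  field_simp

lemma integrableOn_val (hΩ : IsPolygonalDomain Ω) {t : Finset Plane} (ht : t ∈ 𝒯.triangles)
    (w : H10 Ω) : IntegrableOn (H1.val (w : H1 Ω)) (convexHull ℝ (t : Set Plane)) := by
  have := isFiniteMeasure_restrict hΩ.isBounded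
  exact 𝒯.integrableOn_triangle hΩ ht ((H1.memLp_val (w : H1 Ω)).integrable (by norm_num))

lemma isBubbleMap_bubbleMap (hΩ : IsPolygonalDomain Ω) : 𝒯.IsBubbleMap (𝒯.bubbleMap hΩ) := by
  refine fun v => ⟨𝒯.bubbleMap_mem_B hΩ v, fun t ht => ?_⟩
  rw [𝒯.setIntegral_inter hΩ ht, integral_sub (𝒯.integrableOn_val hΩ ht v)
    (𝒯.integrableOn_val hΩ ht _), 𝒯.setIntegral_bubbleMap hΩ v ht, sub_self]

lemma bubbleMap_of_mem_B (hΩ : IsPolygonalDomain Ω) {w : H10 Ω} (hw : w ∈ 𝒯.B) :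
    𝒯.bubbleMap hΩ w = w := by
  refine H10.ext_val hΩ.isOpen ?_
  choose! c hc using hw
  have hcc : ∀ t ∈ 𝒯.triangles, bubbleCoeff t w = c t := by
    intro t ht
    have hv := (𝒯.isTriangle ht).measureReal_pos
    have h1 : ∫ x in convexHull ℝ (t : Set Plane), H1.val (w : H1 Ω) x
        = ∫ x in convexHull ℝ (t : Set Plane), c t * bubble t x := by
      refine integral_congr_ae ?_
      filter_upwards [𝒯.ae_triangle hΩ ht (hc t ht),
        ae_restrict_mem (IsTriangle.isCompact_convexHull t).measurableSet] with x hx hxt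
      exact hx hxt
    rw [bubbleCoeff, h1, integral_const_mul, (𝒯.isTriangle ht).setIntegral_bubble]
    field_simp
  filter_upwards [(ae_ball_iff 𝒯.triangles.countable_toSet).2 hc, 𝒯.val_bubbleMap hΩ w,
    𝒯.ae_mem_interior hΩ.isOpen] with x hx hb hxi
  obtain ⟨t, ht, hxt⟩ := hxi
  rw [hb t ht hxt, hcc t ht, hx t ht (_root_.interior_subset hxt)]
  rfl

lemma sq_bubbleCoeff_mul_le (hΩ : IsPolygonalDomain Ω) {t : Finset Plane} (ht : t ∈ 𝒯.triangles)
    (w : H10 Ω) : bubbleCoeff t w ^ 2 * volume.real (convexHull ℝ (t : Set Plane))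
      ≤ 3600 * ∫ x in convexHull ℝ (t : Set Plane), H1.val (w : H1 Ω) x ^ 2 := by
  have hv := (𝒯.isTriangle ht).measureReal_pos
  have h1 := sq_setIntegral_val_mul_le hΩ ht (f := fun _ => 1) continuous_const (a := 1)
    (fun _ _ => by simp) w
  simp only [mul_one, one_pow] at h1
  rw [bubbleCoeff, mul_pow]
  set V := volume.real (convexHull ℝ (t : Set Plane))
  calc _ = 3600 / V * (∫ x in convexHull ℝ (t : Set Plane), H1.val (w : H1 Ω) x) ^ 2 := by
        field_simp
        ring
    _ ≤ 3600 / V * (V * ∫ x in convexHull ℝ (t : Set Plane), H1.val (w : H1 Ω) x ^ 2) := by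
        gcongr
    _ = _ := by field_simp

set_option maxHeartbeats 1000000 in
/-- The inverse estimate for bubble functions turns an `L²` bound into an `H¹` bound, at the price
of a factor `h⁻¹`. -/
lemma norm_bubbleMap_sq_le (hΩ : IsPolygonalDomain Ω) {𝒯 : Triangulation Ω}
    (hr : 𝒯.IsRegular σ h) (w : H10 Ω) :
    ‖𝒯.bubbleMap hΩ w‖ ^ 2 ≤ 3600 * (1 + 9 / (σ * h) ^ 2) * H10.l2Sq w := by
  have hs := hr.sigma_pos
  have hh := hr.h_pos
  have hkey : ∀ (f : Plane → ℝ) (a : ℝ), 0 ≤ a → Integrable f (volume.restrict Ω) →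
      (∀ᵐ x ∂(volume.restrict Ω), ∀ t ∈ 𝒯.triangles,
        x ∈ interior (convexHull ℝ (t : Set Plane)) → f x ≤ bubbleCoeff t w ^ 2 * a) →
      ∫ x in Ω, f x ≤ 3600 * a * H10.l2Sq w := by
    intro f a ha hf hfa
    rw [𝒯.setIntegral_eq_sum hΩ hf, 𝒯.l2Sq_eq_sum hΩ w, Finset.mul_sum]
    refine Finset.sum_le_sum fun t ht => ?_
    have hm := IsTriangle.isCompact_convexHull t
    have h1 : ∀ᵐ x ∂(volume.restrict (convexHull ℝ (t : Set Plane))),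
        f x ≤ bubbleCoeff t w ^ 2 * a := by
      have h := 𝒯.ae_triangle hΩ ht hfa
      rw [← Measure.restrict_congr_set (IsTriangle.interior_ae_eq t)] at h ⊢
      filter_upwards [h, ae_restrict_mem isOpen_interior.measurableSet] with x hx hxt
      exact hx t ht hxt
    calc _ ≤ ∫ x in convexHull ℝ (t : Set Plane), bubbleCoeff t w ^ 2 * a :=
          integral_mono_ae (𝒯.integrableOn_triangle hΩ ht hf)
            (integrableOn_const hm.measure_lt_top.ne) h1
      _ = a * (bubbleCoeff t w ^ 2 * volume.real (convexHull ℝ (t : Set Plane))) := by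
        rw [setIntegral_const, smul_eq_mul]
        ring
      _ ≤ a * (3600 * ∫ x in convexHull ℝ (t : Set Plane), H1.val (w : H1 Ω) x ^ 2) :=
        mul_le_mul_of_nonneg_left (sq_bubbleCoeff_mul_le hΩ ht w) ha
      _ = _ := by ring
  have h1 : H10.l2Sq (𝒯.bubbleMap hΩ w) ≤ 3600 * 1 * H10.l2Sq w := by
    refine hkey _ 1 zero_le_one (H1.integrable_val_sq _) ?_
    filter_upwards [𝒯.val_bubbleMap hΩ w] with x hx t ht hxt
    have hT := 𝒯.isTriangle ht
    have hxt' := _root_.interior_subset hxt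
    rw [hx t ht hxt, mul_pow]
    exact mul_le_mul_of_nonneg_left
      (pow_le_one₀ (hT.bubble_nonneg hxt') (hT.bubble_le_one hxt')) (sq_nonneg _)
  have h2 : H10.gradSq (𝒯.bubbleMap hΩ w) ≤ 3600 * (9 / (σ * h) ^ 2) * H10.l2Sq w := by
    refine hkey _ _ (by positivity) (H1.integrable_grad_sq _) ?_
    filter_upwards [grad_bubbleMap hr hΩ w] with x hx t ht hxt
    calc _ ≤ (|bubbleCoeff t w| * (3 / (σ * h))) ^ 2 :=
          pow_le_pow_left₀ (norm_nonneg _) (hx t ht hxt) 2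
      _ = _ := by
        rw [mul_pow, sq_abs, div_pow]
        norm_num
  rw [H10.norm_sq]
  linarith

end Triangulation

end PlateFEM

namespace PlateFEM

/-! ### Gradients and the multiplier space -/

lemma integral_inner_gradient_eq_zero {ψ : Plane → ℝ} {K : NNReal} (hψ : LipschitzWith K ψ)
    (hc : HasCompactSupport ψ) (e : Plane) : ∫ x, inner ℝ e (gradient ψ x) = 0 := by
  have h := (LipschitzWith.const (1 : ℝ)).integral_lineDeriv_mul_eq (μ := volume) hψ hc (-e)
  have h0 : ∀ x, lineDeriv ℝ (fun _ : Plane => (1 : ℝ)) x (-e) = 0 := fun x => by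
    rw [(differentiableAt_const _).lineDeriv_eq_fderiv]
    simp
  simp only [mul_one, neg_neg, h0, zero_mul, integral_zero] at h
  rw [h]
  refine integral_congr_ae ?_
  filter_upwards [hψ.ae_differentiableAt] with x hx
  rw [inner_gradient, hx.lineDeriv_eq_fderiv]

lemma setIntegral_inner_gradient_eq_zero {Ω : Set Plane} {ψ : Plane → ℝ} {K : NNReal}
    (hψ : LipschitzWith K ψ) (hc : HasCompactSupport ψ) (hs : tsupport ψ ⊆ Ω) (e : Plane) :
    ∫ x in Ω, inner ℝ e (gradient ψ x) = 0 := by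
  rw [setIntegral_eq_integral_of_forall_compl_eq_zero, integral_inner_gradient_eq_zero hψ hc]
  intro x hx
  have : fderiv ℝ ψ x = 0 := image_eq_zero_of_notMem_tsupport
    (fun hx' => hx (hs (tsupport_fderiv_subset ℝ hx')))
  rw [inner_gradient, this]
  simp

namespace Triangulation

variable {Ω : Set Plane} {𝒯 : Triangulation Ω}

open scoped Classical in
/-- Integration by parts against a nodal basis function. The vertex may lie on the boundary, since
`w` vanishes there. The integrals of `w` over the triangles determine the result, because the
gradient of the nodal basis function is constant on each triangle. -/
lemma setIntegral_inner_grad_mul_hat (hΩ : IsPolygonalDomain Ω) {p : Plane} (hp : p ∈ 𝒯.vertices)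
    (e : Plane) (w : H10 Ω) :
    ∫ x in Ω, inner ℝ e (H1.grad (w : H1 Ω) x) * 𝒯.hat p x
      = - ∑ t ∈ 𝒯.triangles, inner ℝ e (if p ∈ t then baryGrad t p else 0)
          * ∫ x in convexHull ℝ (t : Set Plane), H1.val (w : H1 Ω) x := by
  have hmem : MemLp (fun x => 𝒯.hat p x • e) 2 (volume.restrict Ω) := by
    have := isFiniteMeasure_restrict hΩ.isBounded
    exact (memLp_const e).smul (p := ⊤) (q := 2) (r := 2) (MemLp.of_bound
      (𝒯.memLp_hat hΩ hp).aestronglyMeasurable 1 (Eventually.of_forall fun x => by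
        rw [Real.norm_eq_abs, abs_of_nonneg (𝒯.hat_nonneg p x)]
        exact 𝒯.hat_le_one p x))
  have hL : ∀ w : H10 Ω, ∫ x in Ω, inner ℝ e (H1.grad (w : H1 Ω) x) * 𝒯.hat p x
      = H10.gradPairing hmem w := by
    intro w
    rw [H10.gradPairing_apply]
    refine integral_congr_ae (Eventually.of_forall fun x => ?_)
    simp only [real_inner_smul_left, mul_comm]
  have hR : ∀ w : H10 Ω, ∑ t ∈ 𝒯.triangles, inner ℝ e (if p ∈ t then baryGrad t p else 0)
        * ∫ x in convexHull ℝ (t : Set Plane), H1.val (w : H1 Ω) x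
      = ∑ t ∈ 𝒯.triangles, inner ℝ e (if p ∈ t then baryGrad t p else 0)
        * H10.pairing (memLp_indicator_triangle hΩ t (f := fun _ => 1) continuous_const) w := by
    refine fun w => Finset.sum_congr rfl fun t ht => ?_
    rw [pairing_indicator hΩ ht continuous_const]
    simp only [mul_one]
  refine H10.induction hΩ.isOpen (p := fun w : H10 Ω =>
    ∫ x in Ω, inner ℝ e (H1.grad (w : H1 Ω) x) * 𝒯.hat p x
      = - ∑ t ∈ 𝒯.triangles, inner ℝ e (if p ∈ t then baryGrad t p else 0)
          * ∫ x in convexHull ℝ (t : Set Plane), H1.val (w : H1 Ω) x) ?_ ?_ w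
  · simp only [hL, hR]
    exact isClosed_eq (ContinuousLinearMap.continuous _) (continuous_finsetSum _ fun t _ =>
      continuous_const.mul (ContinuousLinearMap.continuous _)).neg
  intro w φ hφ hval hgrad
  set ψ : Plane → ℝ := fun x => φ x * 𝒯.hat p x with hψ
  have hsub : tsupport ψ ⊆ tsupport φ := closure_mono (Function.support_mul_subset_left _ _)
  obtain ⟨D, hD⟩ := hφ.lipschitz
  obtain ⟨K, hK⟩ := 𝒯.exists_lipschitz_const
  obtain ⟨b, hb⟩ := hφ.compact.exists_bound_of_continuous hφ.smooth.continuous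
  have hb0 : 0 ≤ b := (norm_nonneg _).trans (hb 0)
  have hψL : LipschitzWith (⟨b, hb0⟩ * K + D) ψ := by
    refine 𝒯.lipschitzWith_of_triangles hΩ.isOpen (fun t ht x hx y hy => ?_) fun x hx => ?_
    · have h1 := 𝒯.abs_hat_sub_le hK ht p hx hy
      have h2 : |φ x - φ y| ≤ D * dist x y := hD.dist_le_mul x y
      have h3 : |φ x| ≤ b := hb x
      have h4 : |𝒯.hat p y| ≤ 1 := by
        rw [abs_of_nonneg (𝒯.hat_nonneg p y)]
        exact 𝒯.hat_le_one p y
      calc |ψ x - ψ y| = |φ x * (𝒯.hat p x - 𝒯.hat p y) + (φ x - φ y) * 𝒯.hat p y| := by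
            rw [hψ]
            ring_nf
        _ ≤ |φ x| * |𝒯.hat p x - 𝒯.hat p y| + |φ x - φ y| * |𝒯.hat p y| := by
            rw [← abs_mul, ← abs_mul]
            exact abs_add_le _ _
        _ ≤ b * (K * dist x y) + D * dist x y * 1 := by gcongr
        _ = _ := by
            push_cast
            change _ = (b * K + D) * dist x y
            ring
    · change φ x * _ = 0
      rw [image_eq_zero_of_notMem_tsupport fun h => hx (hφ.supp h), zero_mul]
  have h0 := setIntegral_inner_gradient_eq_zero hψL (hφ.compact.mono' (subset_closure.trans hsub))
    (hsub.trans hφ.supp) e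
  have hint : IntegrableOn (fun x => inner ℝ e (gradient ψ x)) Ω := by
    have := isFiniteMeasure_restrict hΩ.isBounded
    exact ((memLp_gradient hΩ.isBounded hψL).const_inner e).integrable (by norm_num)
  have hint' : IntegrableOn (fun x => inner ℝ e (H1.grad (w : H1 Ω) x) * 𝒯.hat p x) Ω :=
    ((H1.memLp_grad (w : H1 Ω)).const_inner e).integrable_mul (𝒯.memLp_hat hΩ hp)
  have hcell : ∀ t ∈ 𝒯.triangles,
      ∫ x in convexHull ℝ (t : Set Plane), inner ℝ e (gradient ψ x)
        = (∫ x in convexHull ℝ (t : Set Plane), inner ℝ e (H1.grad (w : H1 Ω) x) * 𝒯.hat p x)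
          + inner ℝ e (if p ∈ t then baryGrad t p else 0)
            * ∫ x in convexHull ℝ (t : Set Plane), H1.val (w : H1 Ω) x := by
    intro t ht
    rw [← integral_const_mul, ← integral_add (𝒯.integrableOn_triangle hΩ ht hint')
      ((𝒯.integrableOn_val hΩ ht w).const_mul _)]
    refine integral_congr_ae ?_
    have hv := 𝒯.ae_triangle hΩ ht hval
    have hg := 𝒯.ae_triangle hΩ ht hgrad
    rw [← Measure.restrict_congr_set (IsTriangle.interior_ae_eq t)] at hv hg ⊢
    filter_upwards [hv, hg, ae_restrict_mem isOpen_interior.measurableSet] with x hx hgx hxt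
    have hd : DifferentiableAt ℝ (𝒯.hat p) x := by
      refine DifferentiableAt.congr_of_eventuallyEq ?_ (𝒯.hat_eventuallyEq ht p hxt)
      split_ifs
      · exact (hasGradientAt_bary t p x).hasFDerivAt.differentiableAt
      · exact differentiableAt_const _
    rw [hx, hgx, ← 𝒯.gradient_hat ht p hxt, inner_gradient, inner_gradient, inner_gradient, hψ,
      fderiv_fun_mul ((hφ.smooth.differentiable (by simp)) x) hd]
    simp only [add_apply, smul_apply, smul_eq_mul]
    ring
  rw [𝒯.setIntegral_eq_sum hΩ hint, Finset.sum_congr rfl hcell, Finset.sum_add_distrib,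
    ← 𝒯.setIntegral_eq_sum hΩ hint'] at h0
  linarith

lemma memLp_of_mem_M (hΩ : IsPolygonalDomain Ω) {A : Plane → Plane → ℝ} {η : Plane → ℝ}
    (hη : η ∈ 𝒯.M A) : MemLp η 2 (volume.restrict Ω) := by
  refine Submodule.span_induction (p := fun η _ => MemLp η 2 (volume.restrict Ω)) ?_ ?_ ?_ ?_ hη
  · rintro _ ⟨i, hi, rfl⟩
    exact memLp_multiplierBasis hΩ A hi
  · exact MemLp.zero
  · exact fun _ _ _ _ h1 h2 => h1.add h2
  · exact fun c _ _ h => h.const_smul c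

lemma setIntegral_mul_eq_zero_of_mem_M (hΩ : IsPolygonalDomain Ω) {A : Plane → Plane → ℝ}
    {g : Plane → ℝ} (hg : MemLp g 2 (volume.restrict Ω))
    (h : ∀ i ∈ 𝒯.interiorVertices, ∫ x in Ω, g x * 𝒯.multiplierBasis A i x = 0) {η : Plane → ℝ}
    (hη : η ∈ 𝒯.M A) : ∫ x in Ω, g x * η x = 0 := by
  refine Submodule.span_induction (p := fun η _ => ∫ x in Ω, g x * η x = 0) ?_ ?_ ?_ ?_ hη
  · rintro _ ⟨i, hi, rfl⟩
    exact h i hi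
  · simp
  · intro η ζ hη hζ h1 h2
    have hi : ∀ {f : Plane → ℝ}, f ∈ 𝒯.M A → Integrable (fun x => g x * f x) (volume.restrict Ω) :=
      fun hf => hg.integrable_mul (memLp_of_mem_M hΩ hf)
    simp only [Pi.add_apply, mul_add]
    rw [integral_add (hi hη) (hi hζ), h1, h2, add_zero]
  · intro c η _ h1
    simp only [Pi.smul_apply, smul_eq_mul, mul_left_comm]
    rw [integral_const_mul, h1, mul_zero]

/-- If the integral of `u` over each triangle vanishes, then `∇u` is orthogonal to the multiplier
space. -/
lemma setIntegral_inner_grad_mul_eq_zero (hΩ : IsPolygonalDomain Ω) {A : Plane → Plane → ℝ}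
    {u : H10 Ω}
    (hu : ∀ t ∈ 𝒯.triangles, ∫ x in convexHull ℝ (t : Set Plane), H1.val (u : H1 Ω) x = 0)
    (e : Plane) {η : Plane → ℝ} (hη : η ∈ 𝒯.M A) :
    ∫ x in Ω, inner ℝ e (H1.grad (u : H1 Ω) x) * η x = 0 := by
  classical
  have hg : MemLp (fun x => inner ℝ e (H1.grad (u : H1 Ω) x)) 2 (volume.restrict Ω) :=
    (H1.memLp_grad (u : H1 Ω)).const_inner e
  refine setIntegral_mul_eq_zero_of_mem_M hΩ hg (fun i hi => ?_) hη
  simp only [multiplierBasis_eq hΩ.isOpen A hi, Finset.mul_sum]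
  have hi : ∀ p ∈ 𝒯.vertices, Integrable (fun x => inner ℝ e (H1.grad (u : H1 Ω) x)
      * (𝒯.extend A (Pi.single i 1) p * 𝒯.hat p x)) (volume.restrict Ω) :=
    fun p hp => hg.integrable_mul ((𝒯.memLp_hat hΩ hp).const_mul _)
  rw [integral_finsetSum _ hi]
  refine Finset.sum_eq_zero fun p hp => ?_
  simp only [mul_left_comm (inner ℝ e _)]
  rw [integral_const_mul, setIntegral_inner_grad_mul_hat hΩ hp, Finset.sum_eq_zero, neg_zero,
    mul_zero]
  exact fun t ht => by rw [hu t ht, mul_zero]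

end Triangulation

/-- The form `b` only depends on the `L²` pairings of `ψ` and `∇v` with the multipliers. -/
lemma bForm_eq {Ω : Set Plane} (ψ : H10Vec Ω) (v : H10 Ω) {η : Fin 2 → Plane → ℝ}
    (hη : ∀ k, MemLp (η k) 2 (volume.restrict Ω)) :
    bForm ψ v η = ∑ k : Fin 2, ((∫ x in Ω, H1.val (ψ k : H1 Ω) x * η k x)
      - ∫ x in Ω, inner ℝ (EuclideanSpace.single k (1 : ℝ)) (H1.grad (v : H1 Ω) x) * η k x) := by
  have h1 : ∀ k : Fin 2, Integrable (fun x => H1.val (ψ k : H1 Ω) x * η k x) (volume.restrict Ω) :=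
    fun k => (H1.memLp_val (ψ k : H1 Ω)).integrable_mul (hη k)
  have h2 : ∀ k : Fin 2, Integrable (fun x => inner ℝ (EuclideanSpace.single k (1 : ℝ))
      (H1.grad (v : H1 Ω) x) * η k x) (volume.restrict Ω) :=
    fun k => ((H1.memLp_grad (v : H1 Ω)).const_inner _).integrable_mul (hη k)
  have h3 : ∀ k : Fin 2, Integrable (fun x => H1.val (ψ k : H1 Ω) x * η k x
      - inner ℝ (EuclideanSpace.single k (1 : ℝ)) (H1.grad (v : H1 Ω) x) * η k x)
      (volume.restrict Ω) := fun k => (h1 k).sub (h2 k)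
  simp only [← fun k => integral_sub (h1 k) (h2 k)]
  rw [← integral_finsetSum _ fun k _ => h3 k, bForm]
  refine integral_congr_ae (Eventually.of_forall fun x => Finset.sum_congr rfl fun k _ => ?_)
  rw [EuclideanSpace.inner_single_left]
  simp [sub_mul]

namespace Triangulation

variable {Ω : Set Plane} {𝒯 : Triangulation Ω}

lemma bForm_eq_bForm (hΩ : IsPolygonalDomain Ω) {A : Plane → Plane → ℝ} {ψ χ : H10Vec Ω}
    {v w : H10 Ω} {η : Fin 2 → Plane → ℝ} (hη : ∀ k, η k ∈ 𝒯.M A)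
    (hψ : ∀ k, ∫ x in Ω, (H1.val (ψ k : H1 Ω) x - H1.val (χ k : H1 Ω) x) * η k x = 0)
    (hv : ∀ t ∈ 𝒯.triangles, ∫ x in convexHull ℝ (t : Set Plane), H1.val (w : H1 Ω) x
      = ∫ x in convexHull ℝ (t : Set Plane), H1.val (v : H1 Ω) x) :
    bForm χ w η = bForm ψ v η := by
  have hm := fun k => memLp_of_mem_M hΩ (hη k)
  rw [bForm_eq χ w hm, bForm_eq ψ v hm]
  refine Finset.sum_congr rfl fun k _ => ?_
  have h1 := hψ k
  rw [H10.setIntegral_sub_mul (hm k)] at h1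
  have hu : ∀ t ∈ 𝒯.triangles,
      ∫ x in convexHull ℝ (t : Set Plane), H1.val ((v - w : H10 Ω) : H1 Ω) x = 0 := by
    intro t ht
    have h2 := 𝒯.ae_triangle hΩ ht (H1.val_sub (v : H1 Ω) (w : H1 Ω))
    rw [AddSubgroupClass.coe_sub, integral_congr_ae h2]
    simp only [Pi.sub_apply]
    rw [integral_sub (𝒯.integrableOn_val hΩ ht v) (𝒯.integrableOn_val hΩ ht w), hv t ht, sub_self]
  have h3 := setIntegral_inner_grad_mul_eq_zero hΩ hu (EuclideanSpace.single k 1) (hη k)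
  have h4 : ∀ u : H10 Ω, Integrable (fun x => inner ℝ (EuclideanSpace.single k (1 : ℝ))
      (H1.grad (u : H1 Ω) x) * η k x) (volume.restrict Ω) :=
    fun u => ((H1.memLp_grad (u : H1 Ω)).const_inner _).integrable_mul (hm k)
  have h5 : ∫ x in Ω, inner ℝ (EuclideanSpace.single k (1 : ℝ))
        (H1.grad ((v - w : H10 Ω) : H1 Ω) x) * η k x
      = (∫ x in Ω, inner ℝ (EuclideanSpace.single k (1 : ℝ)) (H1.grad (v : H1 Ω) x) * η k x)
        - ∫ x in Ω, inner ℝ (EuclideanSpace.single k (1 : ℝ)) (H1.grad (w : H1 Ω) x) * η k x := by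
    rw [← integral_sub (h4 v) (h4 w)]
    refine integral_congr_ae ?_
    rw [AddSubgroupClass.coe_sub]
    filter_upwards [H1.grad_sub (v : H1 Ω) (w : H1 Ω)] with x hx
    rw [hx, Pi.sub_apply, inner_sub_right, sub_mul]
  rw [h5] at h3
  linarith

end Triangulation

end PlateFEM

namespace PlateFEM

/-! ### Bubble corrections and vector fields -/

namespace Triangulation

variable {Ω : Set Plane} {𝒯 : Triangulation Ω} {σ h : ℝ}

/-- After correction by bubble functions, any operator preserves the integrals over the triangles. -/
lemma setIntegral_add_bubbleMap (hΩ : IsPolygonalDomain Ω) (u w : H10 Ω) {t : Finset Plane}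
    (ht : t ∈ 𝒯.triangles) :
    ∫ x in convexHull ℝ (t : Set Plane), H1.val ((u + 𝒯.bubbleMap hΩ (w - u) : H10 Ω) : H1 Ω) x
      = ∫ x in convexHull ℝ (t : Set Plane), H1.val (w : H1 Ω) x := by
  have h1 := 𝒯.ae_triangle hΩ ht (H1.val_add (u : H1 Ω) (𝒯.bubbleMap hΩ (w - u) : H1 Ω))
  have h2 := 𝒯.ae_triangle hΩ ht (H1.val_sub (w : H1 Ω) (u : H1 Ω))
  have h3 := 𝒯.setIntegral_bubbleMap hΩ (w - u) ht
  rw [AddSubgroupClass.coe_sub, integral_congr_ae h2] at h3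
  simp only [Pi.sub_apply] at h3
  rw [integral_sub (𝒯.integrableOn_val hΩ ht w) (𝒯.integrableOn_val hΩ ht u)] at h3
  rw [AddMemClass.coe_add, integral_congr_ae h1]
  simp only [Pi.add_apply]
  rw [integral_add (𝒯.integrableOn_val hΩ ht u) (𝒯.integrableOn_val hΩ ht _), h3]
  ring

/-- The factor `h⁻¹` of the inverse estimate for bubble functions is absorbed by the approximation
property of `u`. -/
lemma norm_add_bubbleMap_le (hΩ : IsPolygonalDomain Ω) {𝒯 : Triangulation Ω}
    (hr : 𝒯.IsRegular σ h) {D C : ℝ} (hD : h ≤ D) (hC : 0 ≤ C) {u w : H10 Ω}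
    (hu : ‖u‖ ^ 2 ≤ C * ‖w‖ ^ 2) (hwu : H10.l2Sq (w - u) ≤ C * h ^ 2 * ‖w‖ ^ 2) :
    ‖u + 𝒯.bubbleMap hΩ (w - u)‖ ≤ √(2 * C + 7200 * (D ^ 2 + 9 / σ ^ 2) * C) * ‖w‖ := by
  refine le_of_sq_le_sq ?_ (by positivity)
  rw [mul_pow, Real.sq_sqrt (by positivity)]
  have hs := hr.sigma_pos
  have hh := hr.h_pos
  have h1 := norm_bubbleMap_sq_le hΩ hr (w - u)
  have h2 : 3600 * (1 + 9 / (σ * h) ^ 2) * H10.l2Sq (w - u)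
      ≤ 3600 * (D ^ 2 + 9 / σ ^ 2) * C * ‖w‖ ^ 2 := by
    calc _ ≤ 3600 * (1 + 9 / (σ * h) ^ 2) * (C * h ^ 2 * ‖w‖ ^ 2) := by gcongr
      _ = 3600 * (h ^ 2 + 9 / σ ^ 2) * C * ‖w‖ ^ 2 := by field_simp
      _ ≤ _ := by gcongr
  have h3 : ‖u + 𝒯.bubbleMap hΩ (w - u)‖ ^ 2
      ≤ 2 * ‖u‖ ^ 2 + 2 * ‖𝒯.bubbleMap hΩ (w - u)‖ ^ 2 := by
    have h4 := pow_le_pow_left₀ (norm_nonneg _) (norm_add_le u (𝒯.bubbleMap hΩ (w - u))) 2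
    exact h4.trans (by nlinarith only [sq_nonneg (‖u‖ - ‖𝒯.bubbleMap hΩ (w - u)‖)])
  linarith

lemma add_bubbleMap_mem_W (hΩ : IsPolygonalDomain Ω) {u : H10 Ω} (hu : u ∈ 𝒯.S) (w : H10 Ω) :
    u + 𝒯.bubbleMap hΩ (w - u) ∈ 𝒯.W :=
  Submodule.add_mem_sup hu (𝒯.bubbleMap_mem_B hΩ _)

end Triangulation

lemma exists_piLp_map {E : Type*} [SeminormedAddCommGroup E] [NormedSpace ℝ E] {P : E →L[ℝ] E} {C : ℝ}
    (hC : 0 ≤ C) (hP : ∀ w, ‖P w‖ ^ 2 ≤ C * ‖w‖ ^ 2) :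
    ∃ Q : PiLp 2 (fun _ : Fin 2 => E) →L[ℝ] PiLp 2 (fun _ : Fin 2 => E),
      (∀ ψ k, Q ψ k = P (ψ k)) ∧ ‖Q‖ ≤ √C := by
  let L : PiLp 2 (fun _ : Fin 2 => E) →ₗ[ℝ] PiLp 2 (fun _ : Fin 2 => E) :=
    { toFun := fun ψ => WithLp.toLp 2 fun k => P (ψ k)
      map_add' := fun ψ χ => by
        ext1 k
        simp only [PiLp.add_apply, map_add]
      map_smul' := fun c ψ => by
        ext1 k
        simp only [PiLp.smul_apply, map_smul, RingHom.id_apply] }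
  have hL : ∀ ψ, ‖L ψ‖ ≤ √C * ‖ψ‖ := by
    intro ψ
    refine le_of_sq_le_sq ?_ (by positivity)
    rw [mul_pow, Real.sq_sqrt hC, PiLp.norm_sq_eq_of_L2, PiLp.norm_sq_eq_of_L2, Finset.mul_sum]
    exact Finset.sum_le_sum fun k _ => hP (ψ k)
  exact ⟨L.mkContinuous √C hL, fun ψ k => rfl,
    ContinuousLinearMap.opNorm_le_bound _ (Real.sqrt_nonneg C) hL⟩

namespace Triangulation

variable {Ω : Set Plane}

set_option maxHeartbeats 1000000 in
/-- The `M¹_h`-orthogonal projection of vector fields. -/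
lemma exists_multiplier_projection (hΩ : IsPolygonalDomain Ω) {σ : ℝ} (hσ : 0 < σ) :
    ∃ C : ℝ, ∀ {𝒯 : Triangulation Ω} {h : ℝ}, 𝒯.IsRegular σ h →
      h ≤ Metric.diam (closure Ω) → ∀ {A : Plane → Plane → ℝ}, 𝒯.IsSubstochastic A →
      ∃ Q : H10Vec Ω →L[ℝ] H10Vec Ω, LinearMap.IsProj 𝒯.V (Q : H10Vec Ω →ₗ[ℝ] H10Vec Ω) ∧
        ‖Q‖ ≤ C ∧ ∀ (ψ : H10Vec Ω) (k : Fin 2), ∀ η ∈ 𝒯.M A,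
          ∫ x in Ω, (H1.val (ψ k : H1 Ω) x - H1.val (Q ψ k : H1 Ω) x) * η x = 0 := by
  obtain ⟨C, hC, hobl⟩ := exists_oblique_projection hΩ hσ
  refine ⟨√C, ?_⟩
  intro 𝒯 h hr hD A hA
  obtain ⟨P, hS, hid, horth, hb, -⟩ := hobl hr hD hA
  obtain ⟨Q, hQ, hQn⟩ : ∃ Q : H10Vec Ω →L[ℝ] H10Vec Ω, (∀ ψ k, Q ψ k = P (ψ k)) ∧ ‖Q‖ ≤ √C :=
    @exists_piLp_map (H10 Ω) (Submodule.seminormedAddCommGroup _) (Submodule.normedSpace _) P C hC hb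
  refine ⟨Q, ⟨fun ψ k => ?_, fun ψ hψ => ?_⟩, hQn, fun ψ k η hη => ?_⟩
  · exact Set.mem_of_eq_of_mem (hQ ψ k) (hS _)
  · ext1 k
    exact (hQ ψ k).trans (hid _ (hψ k))
  · rw [hQ]
    exact setIntegral_mul_eq_zero_of_mem_M hΩ
      ((H1.memLp_val _).sub (H1.memLp_val _)) (horth (ψ k)) hη

set_option maxHeartbeats 1000000 in
/-- A bounded projector onto `W_h` that preserves the integrals over the triangles. The first
summand annihilates `B_h`, which makes the bubble correction of it idempotent. -/
lemma exists_projector_W (hΩ : IsPolygonalDomain Ω) {σ : ℝ} (hσ : 0 < σ) :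
    ∃ C : ℝ, ∀ {𝒯 : Triangulation Ω} {h : ℝ}, 𝒯.IsRegular σ h →
      h ≤ Metric.diam (closure Ω) →
      ∃ R : H10 Ω →L[ℝ] H10 Ω, LinearMap.IsProj 𝒯.W (R : H10 Ω →ₗ[ℝ] H10 Ω) ∧ ‖R‖ ≤ C ∧
        ∀ v : H10 Ω, ∀ t ∈ 𝒯.triangles, ∫ x in convexHull ℝ (t : Set Plane), H1.val (R v : H1 Ω) x
          = ∫ x in convexHull ℝ (t : Set Plane), H1.val (v : H1 Ω) x := by
  obtain ⟨C, hC, hbub⟩ := exists_projection_bubble hΩ hσ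
  refine ⟨√(2 * C + 7200 * (Metric.diam (closure Ω) ^ 2 + 9 / σ ^ 2) * C), ?_⟩
  intro 𝒯 h hr hD
  obtain ⟨P, hS, hid, hB, hb, ha⟩ := hbub hr hD
  obtain ⟨R, hR⟩ : ∃ R : H10 Ω →L[ℝ] H10 Ω, ∀ v, R v = P v + 𝒯.bubbleMap hΩ (v - P v) :=
    ⟨P + 𝒯.bubbleMap hΩ ∘L (ContinuousLinearMap.id ℝ _ - P), fun v => rfl⟩
  refine ⟨R, ⟨fun v => ?_, fun v hv => ?_⟩,
    ContinuousLinearMap.opNorm_le_bound (E := H10 Ω) (F := H10 Ω) _ (Real.sqrt_nonneg _) fun v => ?_, fun v t ht => ?_⟩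
  · rw [ContinuousLinearMap.coe_coe, hR]
    exact add_bubbleMap_mem_W hΩ (hS v) v
  · obtain ⟨s, hs, b, hb, rfl⟩ := Submodule.mem_sup.1 hv
    rw [ContinuousLinearMap.coe_coe, hR, map_add, hid s hs, hB b hb, add_zero,
      add_sub_cancel_left, bubbleMap_of_mem_B hΩ hb]
  · rw [hR]
    exact norm_add_bubbleMap_le hΩ hr hD hC (hb v) (ha v)
  · rw [hR]
    exact setIntegral_add_bubbleMap hΩ _ v ht

set_option maxHeartbeats 1000000 in
/-- The `L²` projection onto `S_h`, with its bubble correction. -/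
lemma exists_isL2Projection (hΩ : IsPolygonalDomain Ω) {σ : ℝ} (hσ : 0 < σ) :
    ∃ C : ℝ, ∀ {𝒯 : Triangulation Ω} {h : ℝ}, 𝒯.IsRegular σ h →
      h ≤ Metric.diam (closure Ω) →
      ∃ P : H10 Ω →L[ℝ] H10 Ω, 𝒯.IsL2Projection P ∧
        ∀ v, ‖P v + 𝒯.bubbleMap hΩ (v - P v)‖ ≤ C * ‖v‖ := by
  obtain ⟨C, hC, hobl⟩ := exists_oblique_projection hΩ hσ
  refine ⟨√(2 * C + 7200 * (Metric.diam (closure Ω) ^ 2 + 9 / σ ^ 2) * C), ?_⟩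
  intro 𝒯 h hr hD
  obtain ⟨P, hS, -, horth, hb, ha⟩ := hobl hr hD isSubstochastic_zero
  refine ⟨P, fun v => ⟨hS v, fun s hs => ?_⟩,
    fun v => norm_add_bubbleMap_le hΩ hr hD hC (hb v) (ha v)⟩
  have hsub : ∀ g : Plane → ℝ, ∫ x in Ω, H1.val ((v - P v : H10 Ω) : H1 Ω) x * g x
      = ∫ x in Ω, (H1.val (v : H1 Ω) x - H1.val (P v : H1 Ω) x) * g x := by
    intro g
    rw [AddSubgroupClass.coe_sub]
    refine integral_congr_ae ?_
    filter_upwards [H1.val_sub (v : H1 Ω) (P v : H1 Ω)] with x hx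
    rw [hx, Pi.sub_apply]
  rw [← hsub]
  refine setIntegral_mul_eq_zero_of_mem_S hΩ (fun i hi => ?_) hs
  rw [hsub, ← multiplierBasis_zero, horth v i hi]

end Triangulation

end PlateFEM

theorem lemma3p1 (Ω : Set PlateFEM.Plane) (hΩ : PlateFEM.IsPolygonalDomain Ω)
    (σ : ℝ) (hσ : 0 < σ) :
    ∃ C : ℝ, ∀ 𝒯 : PlateFEM.Triangulation Ω, 𝒯.QuasiUniform σ → 𝒯.EachHasInteriorVertex →
      ∀ A : PlateFEM.Plane → PlateFEM.Plane → ℝ, 𝒯.IsAdmissible A →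
      ∃ Q : PlateFEM.H10Vec Ω →L[ℝ] PlateFEM.H10Vec Ω,
        -- `Q` is a projector onto `V_h`, bounded uniformly, and `M¹_h`-orthogonal
        LinearMap.IsProj 𝒯.V (Q : PlateFEM.H10Vec Ω →ₗ[ℝ] PlateFEM.H10Vec Ω) ∧ ‖Q‖ ≤ C ∧
        (∀ (ψ : PlateFEM.H10Vec Ω) (k : Fin 2), ∀ η ∈ 𝒯.M A,
          ∫ x in Ω, (PlateFEM.H1.val (ψ k : PlateFEM.H1 Ω) x
            - PlateFEM.H1.val (Q ψ k : PlateFEM.H1 Ω) x) * η x = 0) ∧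
        -- a projector `R` onto `W_h`, bounded uniformly, with the commuting property
        (∃ R : PlateFEM.H10 Ω →L[ℝ] PlateFEM.H10 Ω,
          LinearMap.IsProj 𝒯.W (R : PlateFEM.H10 Ω →ₗ[ℝ] PlateFEM.H10 Ω) ∧ ‖R‖ ≤ C ∧
          ∀ (ψ : PlateFEM.H10Vec Ω) (v : PlateFEM.H10 Ω) (η : Fin 2 → PlateFEM.Plane → ℝ),
            (∀ k, η k ∈ 𝒯.M A) →
              PlateFEM.bForm (Q ψ) (R v) η = PlateFEM.bForm ψ v η) ∧
        -- the operator `P_h + Z_h (I - P_h)` has these properties too, except for idempotence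
        (∃ P Z : PlateFEM.H10 Ω →L[ℝ] PlateFEM.H10 Ω, 𝒯.IsL2Projection P ∧ 𝒯.IsBubbleMap Z ∧
          (∀ v, P v + Z (v - P v) ∈ 𝒯.W) ∧ (∀ v, ‖P v + Z (v - P v)‖ ≤ C * ‖v‖) ∧
          ∀ (ψ : PlateFEM.H10Vec Ω) (v : PlateFEM.H10 Ω) (η : Fin 2 → PlateFEM.Plane → ℝ),
            (∀ k, η k ∈ 𝒯.M A) →
              PlateFEM.bForm (Q ψ) (P v + Z (v - P v)) η = PlateFEM.bForm ψ v η) := by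
  refine (PlateFEM.Triangulation.exists_multiplier_projection hΩ hσ).elim fun C₁ hQ => ?_
  refine (PlateFEM.Triangulation.exists_projector_W hΩ hσ).elim fun C₂ hR => ?_
  refine (PlateFEM.Triangulation.exists_isL2Projection hΩ hσ).elim fun C₃ hP => ?_
  refine ⟨max C₁ (max C₂ C₃), fun 𝒯 hq _ A hA => ?_⟩
  refine (PlateFEM.Triangulation.exists_isRegular 𝒯 hΩ hσ hq).elim fun h hh => ?_
  refine (hQ hh.2 hh.1 hA.isSubstochastic).elim fun Q hQ => ?_
  refine (hR hh.2 hh.1).elim fun R hR => ?_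
  refine (hP hh.2 hh.1).elim fun P hP => ?_
  refine ⟨Q, hQ.1, hQ.2.1.trans (le_max_left _ _), hQ.2.2,
    ⟨R, hR.1, hR.2.1.trans ((le_max_left _ _).trans (le_max_right _ _)), fun ψ v η hη => ?_⟩,
    ⟨P, 𝒯.bubbleMap hΩ, hP.1, PlateFEM.Triangulation.isBubbleMap_bubbleMap hΩ, fun v => ?_,
      fun v => (hP.2 v).trans (mul_le_mul_of_nonneg_right
        ((le_max_right _ _).trans (le_max_right _ _)) (norm_nonneg _)), fun ψ v η hη => ?_⟩⟩
  · exact PlateFEM.Triangulation.bForm_eq_bForm hΩ hη (fun k => hQ.2.2 ψ k (η k) (hη k)) (hR.2.2 v)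
  · exact PlateFEM.Triangulation.add_bubbleMap_mem_W hΩ (hP.1 v).1 v
  · exact PlateFEM.Triangulation.bForm_eq_bForm hΩ hη (fun k => hQ.2.2 ψ k (η k) (hη k))
      fun t ht => PlateFEM.Triangulation.setIntegral_add_bubbleMap hΩ _ v ht
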